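/- Let $\mathbb K$ be a field with algebraic closure $\bar{\mathbb K}$ and separable closure $\mathbb K^{sep}\subset\bar{\mathbb K}$. **Notation.** Let $S\subset\mathbb P^4$ be a del Pezzo surface of degree $4$ over $\mathbb K$ in its anticanonical embedding, i.e. a smooth intersection of two quadrics. Let $\mathcal P(S)\cong\mathbb P^1$ be the pencil of quadrics containing $S$, and let $\Delta(S)\subset\mathcal P(S)$ be the closed subscheme, finite étale of length $5$ over $\mathbb K$, that parameterizes the singular quadrics. Put $G(S)=R_{\mathbb K[\Delta(S)]/\mathbb K}(\mathbb Z/2\mathbb Z)/(\mathbb Z/2\mathbb Z)$, where $R$ is Weil restriction and $\mathbb Z/2\mathbb Z$ is embedded as the constants. Let $\Lambda(S)$ be the (finite étale) Hilbert scheme of lines on $S$. It is a torsor over $G(S)$: the generator of $G(S)_{\mathbb K^{sep}}$ corresponding to a singular quadric $R$ acts on the lines by the involution $\iota_R$ of the double cover of $S$ given by the projection from the vertex of $R$. A marking of $S$ is an ordered quintuple $L_1,\dots,L_5$ of the lines on $S_{\mathbb K^{sep}}$ different from and meeting some line $Q$. It fixes an action of the Weyl group $W(D_5)=(\mathbb Z/2\mathbb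 Z)^4\rtimes\mathfrak S_5$ on the configuration of the $16$ lines, in which $\sigma\in\mathfrak S_5$ fixes $Q$ and sends $L_i$ to $L_{\sigma(i)}$, and the sign change $\iota_{klmn}$ sends $Q$ to $L_i$ whenever $\{i,k,l,m,n\}=\{1,\dots,5\}$. **Setting.** Let $S$ and $S'$ be del Pezzo surfaces of degree $4$ over $\mathbb K$. Let $X$ and $X'$ be smooth cubic surfaces over $\mathbb K$ obtained as blow ups $f\colon X\to S$ and $f'\colon X'\to S'$ at $\mathbb K$-points $p\in S$ and $p'\in S'$. Let $\phi\colon X\to\mathbb P^1$ and $\phi'\colon X'\to\mathbb P^1$ be the conic bundles given by the linear projections from the $f$-exceptional line and from the $f'$-exceptional line, respectively. Let $\theta\colon X\dashrightarrow X'$ be a transformation of $\phi$ into $\phi'$, i.e. a birational map over $\mathbb K$ with $\phi'\circ\theta=\alpha\circ\phi$ for an automorphism $\alpha$ of $\mathbb P^1$, which induces an isomorphism between neighborhoods of the degenerate fibers of $\phi$ and of $\phi'$. A marking $L_1,\dots,L_5$ of $S$ corresponds to the marking $E_1\cup F_1,\dots,E_5\cup F_5$ of the degenerate fibers of $\phi$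 (with a chosen component $E_i$ in each of them) if either, for all $i$, the third line in the plane spanned by the proper transforms of $Q$ and $L_i$ on $X\subset\mathbb P^3$ is $E_i$, or, for all $i$, this third line is $F_i$; similarly for $S'$ and $\phi'$. **Claim.** (i) The maps $\delta\colon\mathcal P(S)\to\mathbb P^1$ and $\delta'\colon\mathcal P(S')\to\mathbb P^1$ that send a quadric $R$ to the fiber of $\phi$ (of $\phi'$) which is the proper transform of the section of the surface by the tangent hyperplane to $R$ at the blown up point are isomorphisms, and $g=\delta'^{-1}\circ\alpha\circ\delta\colon\mathcal P(S)\to\mathcal P(S')$ maps $\Delta(S)$ isomorphically onto $\Delta(S')$. So $\Delta(S)$ and $\Delta(S')$ are naturally isomorphic as closed subschemes of $\mathbb P^1$. (ii) The isomorphism $\Delta(S)\cong\Delta(S')$ of (i) induces an isomorphism $G(S)\cong G(S')$ of group schemes over $\mathbb K$. (iii) There is an isomorphism $\nu\colon\Lambda(S)\to\Lambda(S')$ over $\mathbb K$ with the following property. Markings of $S$ exist, and for every marking $L_1,\dots,L_5$ of $S$, with associated line $Q$, there is a marking $E_i\cup F_i$ of $\phi$ corresponding to it and a marking $L_1',\dots,L_5'$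 of $S'$, with associated line $Q'$, corresponding to the marking $\theta(E_i)\cup\theta(F_i)$ of $\phi'$, such that $\nu(Q)=Q'$, $\nu(L_i)=L'_i$ for all $i$, and $\nu$ is equivariant for the actions of $W(D_5)$ fixed by $L_1,\dots,L_5$ and by $L'_1,\dots,L'_5$. This $\nu$ is an isomorphism of torsors with respect to the isomorphism $G(S)\cong G(S')$ of (ii). (iv) There is an isomorphism $\psi\colon S\to S'$ over $\mathbb K$ such that the induced map $\Lambda(S)\to\Lambda(S')$ coincides with $\nu$. -/

import Mathlib

/-
Conventions.  `K` is the base field and `L` is an algebraic closure of `K`.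
A projective variety over `K` (all varieties here are smooth, hence geometrically reduced) is given by
homogeneous equations over `K` and is handled through its set of `L`-points; morphisms and rational maps
over `K` are those given locally by homogeneous polynomials with coefficients in `K`.
The group `L ≃ₐ[K] L` is the absolute Galois group of `K` (restriction to the separable closure is an
isomorphism).  A finite etale `K`-scheme (group scheme, torsor) is handled through its set of geometric
points with the Galois action.
-/

open MvPolynomial

namespace DelPezzo

section Basics

variable (K : Type*) {L : Type*} [Field K] [Field L] [Algebra K L] {k m : ℕ}

/-- Points over `L` of the projective space with `k` homogeneous coordinates,
so that `PSpace L (n + 1)` is the space of `L`-points of the `n`-dimensional projective space. -/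
abbrev PSpace (L : Type*) [Field L] (k : ℕ) := Projectivization L (Fin k → L)

variable {K} in
/-- The common zeros in projective space of a family of (homogeneous) polynomials over `K`. -/
def zeros (L : Type*) [Field L] [Algebra K L] {ι : Type*}
    (F : ι → MvPolynomial (Fin k) K) : Set (PSpace L k) :=
  {x | ∀ i, aeval x.rep (F i) = 0}

/-- `g` is a morphism over `K` on the locally closed set `U`: near every point of `U` it is given by
homogeneous polynomials over `K` of the same degree. -/
def RegularOn (U : Set (PSpace L k)) (g : PSpace L k → PSpace L m) : Prop :=
  ∀ x ∈ U, ∃ (d : ℕ) (F : Fin m → MvPolynomial (Fin k) K),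
    (∀ i, (F i).IsHomogeneous d) ∧ (fun i => aeval x.rep (F i)) ≠ 0 ∧
      ∀ y ∈ U, ∀ h : (fun i => aeval y.rep (F i)) ≠ 0,
        g y = Projectivization.mk L (fun i => aeval y.rep (F i)) h

/-- The bijection `e` from `e.source` onto `e.target` is an isomorphism over `K`. -/
def IsIsoOver (e : PartialEquiv (PSpace L k) (PSpace L m)) : Prop :=
  RegularOn K e.source e ∧ RegularOn K e.target e.symm

/-- `W` is a Zariski open subset, defined over `K`, of the closed set `V`. -/
def OpenIn (V W : Set (PSpace L k)) : Prop :=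
  ∃ T : Set (MvPolynomial (Fin k) K), (∀ F ∈ T, ∃ d, F.IsHomogeneous d) ∧
    W = {x ∈ V | ∃ F ∈ T, aeval x.rep F ≠ 0}

/-- The points of the linear subspace of projective space defined by a vector subspace. -/
def ptsOf (M : Submodule L (Fin k → L)) : Set (PSpace L k) := {x | x.rep ∈ M}

/-- The lines (defined over `L`) contained in the set `V`. -/
def linesOn (V : Set (PSpace L k)) : Set (Submodule L (Fin k → L)) :=
  {M | Module.finrank L M = 2 ∧ ptsOf M ⊆ V}

variable {K}

/-- The Galois conjugate of a linear subspace. -/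
def galSub (σ : L ≃ₐ[K] L) (M : Submodule L (Fin k → L)) : Submodule L (Fin k → L) where
  carrier := {v | (fun i => σ.symm (v i)) ∈ M}
  add_mem' {a b} ha hb := by
    have := M.add_mem ha hb
    simpa [Pi.add_def] using this
  zero_mem' := by
    have h : (fun i => σ.symm ((0 : Fin k → L) i)) = 0 := by
      funext i
      simp
    change (fun i => σ.symm ((0 : Fin k → L) i)) ∈ M
    rw [h]
    exact M.zero_mem
  smul_mem' c v hv := by
    have := M.smul_mem (σ.symm c) hv
    simpa [Pi.smul_def] using this

theorem gal_ne_zero (σ : L ≃ₐ[K] L) {v : Fin k → L} (hv : v ≠ 0) : (fun i => σ (v i)) ≠ 0 := by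
  intro h
  apply hv
  funext i
  have := congrFun h i
  simpa using this

/-- The Galois conjugate of a point of projective space. -/
noncomputable def galPt (σ : L ≃ₐ[K] L) (x : PSpace L k) : PSpace L k :=
  Projectivization.mk L (fun i => σ (x.rep i)) (gal_ne_zero σ x.rep_nonzero)

end Basics

/-- A del Pezzo surface of degree `4` over `K` in its anticanonical embedding:
a smooth intersection of two quadrics in four-dimensional projective space. -/
structure QuarticDelPezzo (K L : Type*) [Field K] [Field L] [Algebra K L] where
  q : Fin 2 → MvPolynomial (Fin 5) K
  homogeneous : ∀ i, (q i).IsHomogeneous 2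
  smooth : ∀ x ∈ zeros L q, LinearIndependent L (fun i j => aeval x.rep (pderiv j (q i)))

/-- A smooth cubic surface over `K` in three-dimensional projective space. -/
structure CubicSurface (K L : Type*) [Field K] [Field L] [Algebra K L] where
  c : MvPolynomial (Fin 4) K
  homogeneous : c.IsHomogeneous 3
  smooth : ∀ x : PSpace L 4, aeval x.rep c = 0 → ∃ j, aeval x.rep (pderiv j c) ≠ 0

section Surfaces

variable {K L : Type*} [Field K] [Field L] [Algebra K L]

namespace CubicSurface

/-- The points of the cubic surface. -/
def pts (X : CubicSurface K L) : Set (PSpace L 4) := {x | aeval x.rep X.c = 0}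

end CubicSurface

namespace QuarticDelPezzo

variable (S : QuarticDelPezzo K L)

/-- The points of the del Pezzo surface. -/
def pts : Set (PSpace L 5) := zeros L S.q

/-- The geometric lines on the surface, i.e. the geometric points of its Hilbert scheme of lines. -/
abbrev Line := ↥(linesOn S.pts)

/-- The quadratic form of the member with coordinates `R` of the pencil of quadrics
passing through the surface. -/
noncomputable def form (R : Fin 2 → L) (v : Fin 5 → L) : L := ∑ i, R i * aeval v (S.q i)

/-- `v` represents a singular point (a vertex) of the quadric `R`. -/
def IsVertex (R : Fin 2 → L) (v : Fin 5 → L) : Prop :=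
  v ≠ 0 ∧ S.form R v = 0 ∧ ∀ u, QuadraticMap.polar (S.form R) v u = 0

/-- The subscheme of the pencil (which is a projective line) that parameterizes the singular quadrics. -/
def Delta : Set (PSpace L 2) := {R | ∃ v, S.IsVertex R.rep v}

theorem form_gal (σ : L ≃ₐ[K] L) (R : Fin 2 → L) (v : Fin 5 → L) :
    S.form (fun i => σ (R i)) (fun i => σ (v i)) = σ (S.form R v) := by
  have h : ∀ F : MvPolynomial (Fin 5) K, aeval (fun i => σ (v i)) F = σ (aeval v F) := by
    intro F
    have := comp_aeval_apply (R := K) v (σ : L →ₐ[K] L) F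
    simpa using this.symm
  simp [form, h]

theorem isVertex_smul {R : Fin 2 → L} {v : Fin 5 → L} (c : L) (h : S.IsVertex R v) :
    S.IsVertex (c • R) v := by
  have hf : ∀ u, S.form (c • R) u = c * S.form R u := by
    intro u
    simp only [form, Pi.smul_apply, smul_eq_mul, Finset.mul_sum, mul_assoc]
  refine ⟨h.1, by rw [hf, h.2.1, mul_zero], fun u => ?_⟩
  have := h.2.2 u
  simp only [QuadraticMap.polar, hf] at this ⊢
  linear_combination c * this

theorem isVertex_gal (σ : L ≃ₐ[K] L) {R : Fin 2 → L} {v : Fin 5 → L} (h : S.IsVertex R v) :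
    S.IsVertex (fun i => σ (R i)) (fun i => σ (v i)) := by
  refine ⟨gal_ne_zero σ h.1, by rw [form_gal, h.2.1, map_zero], fun u => ?_⟩
  have hu : u = fun i => σ (σ.symm (u i)) := by funext i; simp
  have h2 := congrArg σ (h.2.2 (fun i => σ.symm (u i)))
  have hadd : ((fun i => σ (v i)) + fun i => σ (σ.symm (u i))) =
      fun i => σ ((v + fun i => σ.symm (u i)) i) := by
    funext i; simp
  rw [hu]
  simp only [QuadraticMap.polar, map_sub, map_zero] at h2 ⊢
  rw [hadd, form_gal, form_gal, form_gal]
  exact h2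

theorem galPt_mem_Delta (σ : L ≃ₐ[K] L) {R : PSpace L 2} (h : R ∈ S.Delta) :
    galPt σ R ∈ S.Delta := by
  obtain ⟨v, hv⟩ := h
  obtain ⟨a, ha⟩ := Projectivization.exists_smul_eq_mk_rep L (fun i => σ (R.rep i))
    (gal_ne_zero σ R.rep_nonzero)
  refine ⟨fun i => σ (v i), ?_⟩
  have := S.isVertex_smul (a : L) (S.isVertex_gal σ hv)
  rw [galPt, ← ha]
  exact this

/-- The Galois action on the geometric points of `Delta`. -/
noncomputable def galDelta (σ : L ≃ₐ[K] L) (R : S.Delta) : S.Delta := ⟨galPt σ R, S.galPt_mem_Delta σ R.2⟩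

/-- The (geometric points of the) Weil restriction of `ℤ/2ℤ` from the coordinate algebra
of `Delta` to `K`. -/
abbrev GTilde := S.Delta → ZMod 2

/-- The subgroup `ℤ/2ℤ` of constant functions. -/
def constants : AddSubgroup S.GTilde where
  carrier := {a | ∃ c, a = fun _ => c}
  add_mem' := by
    rintro _ _ ⟨c, rfl⟩ ⟨d, rfl⟩
    exact ⟨c + d, rfl⟩
  zero_mem' := ⟨0, rfl⟩
  neg_mem' := by
    rintro _ ⟨c, rfl⟩
    exact ⟨-c, rfl⟩

/-- The group scheme `G(S)`: the quotient of the Weil restriction of `ℤ/2ℤ` by `ℤ/2ℤ`. -/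
abbrev G := S.GTilde ⧸ S.constants

/-- The Galois action on functions on `Delta`. -/
noncomputable def galGTilde (σ : L ≃ₐ[K] L) : S.GTilde →+ S.GTilde where
  toFun a R := a (S.galDelta σ.symm R)
  map_zero' := rfl
  map_add' _ _ := rfl

/-- The Galois action on `G(S)`. -/
noncomputable def galG (σ : L ≃ₐ[K] L) : S.G →+ S.G :=
  QuotientAddGroup.map _ _ (S.galGTilde σ) (by
    rintro _ ⟨c, rfl⟩
    exact ⟨c, rfl⟩)

/-- The lift to vectors of the involution of the double cover given by the projection from a vertex `v`
of a singular quadric; here `R'` is any other quadric of the pencil.  The point `x` is sent to the second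
point of the line through `x` and `v` at which `R'` (equivalently, the surface) is met. -/
noncomputable def involution (R' : Fin 2 → L) (v x : Fin 5 → L) : Fin 5 → L :=
  x - (QuadraticMap.polar (S.form R') x v / S.form R' v) • v

/-- The involution of the surface defined by the singular quadric `R` sends the line `M` to `M'`. -/
def InvolutionMaps (R : S.Delta) (M M' : S.Line) : Prop :=
  ∃ (v : Fin 5 → L) (R' : PSpace L 2), S.IsVertex R.1.rep v ∧ R' ≠ R.1 ∧
    (M'.1 : Set (Fin 5 → L)) = S.involution R'.rep v '' (M.1 : Set (Fin 5 → L))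

open scoped Classical in
/-- `ρ` is the action of `G(S)` on the lines, in which the generator corresponding to a singular
quadric acts by the involution of that quadric, and it makes the scheme of lines a torsor over `G(S)`. -/
structure IsTorsorAction (ρ : Multiplicative S.G →* Equiv.Perm S.Line) : Prop where
  generator : ∀ (R : S.Delta) (M : S.Line),
    S.InvolutionMaps R M
      (ρ (Multiplicative.ofAdd (QuotientAddGroup.mk (Pi.single R (1 : ZMod 2)))) M)
  simply_transitive : ∀ M M' : S.Line, ∃! a : S.G, ρ (Multiplicative.ofAdd a) M = M'
  galois : ∀ (σ : L ≃ₐ[K] L) (a : S.G) (M N : S.Line), N.1 = galSub σ M.1 →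
    (ρ (Multiplicative.ofAdd (S.galG σ a)) N).1 = galSub σ (ρ (Multiplicative.ofAdd a) M).1

/-- Two lines have a common point. -/
def Meet (M N : S.Line) : Prop := M.1 ⊓ N.1 ≠ ⊥

/-- A marking: an ordered quintuple of lines that meet a line `Q`. -/
structure Marking where
  Q : S.Line
  line : Fin 5 → S.Line
  injective : Function.Injective line
  ne : ∀ i, line i ≠ Q
  meet : ∀ i, S.Meet (line i) Q

end QuarticDelPezzo

end Surfaces

section Weyl

/-- The normal subgroup of the Weyl group of type `D₅`: sign changes at an even number of places. -/
def evenSigns : Subgroup (Fin 5 → ℤˣ) where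
  carrier := {a | ∏ i, a i = 1}
  mul_mem' {a b} ha hb := by
    simp only [Set.mem_ofPred_eq, Pi.mul_apply, Finset.prod_mul_distrib] at *
    rw [ha, hb, one_mul]
  one_mem' := by simp
  inv_mem' {a} ha := by
    simp only [Set.mem_ofPred_eq, Pi.inv_apply, Finset.prod_inv_distrib] at *
    rw [ha, inv_one]

/-- Permutations act on even sign changes by permuting the places. -/
def permSigns : Equiv.Perm (Fin 5) →* MulAut evenSigns where
  toFun σ :=
    { toFun := fun a => ⟨fun i => a.1 (σ⁻¹ i), by
        have h : ∏ i, a.1 i = 1 := a.2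
        change ∏ i, a.1 (σ⁻¹ i) = 1
        rw [← h]
        exact Equiv.prod_comp σ⁻¹ a.1⟩
      invFun := fun a => ⟨fun i => a.1 (σ i), by
        have h : ∏ i, a.1 i = 1 := a.2
        change ∏ i, a.1 (σ i) = 1
        rw [← h]
        exact Equiv.prod_comp σ a.1⟩
      left_inv := fun a => by ext i; simp
      right_inv := fun a => by ext i; simp
      map_mul' := fun a b => rfl }
  map_one' := by ext a i; simp
  map_mul' σ τ := by ext a i; simp [Equiv.Perm.mul_apply]

/-- The Weyl group of type `D₅`. -/
abbrev WeylD5 := SemidirectProduct evenSigns (Equiv.Perm (Fin 5)) permSigns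

/-- The sign change at the four places different from `i`. -/
def signsExcept (i : Fin 5) : evenSigns :=
  ⟨fun j => if j = i then 1 else -1, by
    change ∏ j, (if j = i then (1 : ℤˣ) else -1) = 1
    revert i
    decide⟩

variable {K L : Type*} [Field K] [Field L] [Algebra K L]

/-- `act` is the action of the Weyl group on the configuration of lines that is fixed by the marking. -/
structure QuarticDelPezzo.IsMarkingAction (S : QuarticDelPezzo K L) (μ : S.Marking)
    (act : WeylD5 →* Equiv.Perm S.Line) : Prop where
  meet_iff : ∀ (w : WeylD5) (M N : S.Line), S.Meet (act w M) (act w N) ↔ S.Meet M N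
  perm_Q : ∀ σ : Equiv.Perm (Fin 5), act (SemidirectProduct.inr σ) μ.Q = μ.Q
  perm_line : ∀ (σ : Equiv.Perm (Fin 5)) (i : Fin 5),
    act (SemidirectProduct.inr σ) (μ.line i) = μ.line (σ i)
  signs_Q : ∀ i : Fin 5, act (SemidirectProduct.inl (signsExcept i)) μ.Q = μ.line i

end Weyl

section BlowUps

variable {K L : Type*} [Field K] [Field L] [Algebra K L]

/-- A presentation of the cubic surface `X` as the blow up `f : X → S` at a `K`-point:
`f` contracts the line `E = {e 0 = e 1 = 0}` on `X` to the `K`-point `center` of `S`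
and is an isomorphism over the complement of this point. -/
structure BlowUp (S : QuarticDelPezzo K L) (X : CubicSurface K L) where
  center : PSpace L 5
  rational : ∃ (v : Fin 5 → K) (h : (fun i => algebraMap K L (v i)) ≠ 0),
    center = Projectivization.mk L (fun i => algebraMap K L (v i)) h
  center_mem : center ∈ S.pts
  f : PSpace L 4 → PSpace L 5
  mapsTo : Set.MapsTo f X.pts S.pts
  regular : RegularOn K X.pts f
  e : Fin 2 → MvPolynomial (Fin 4) K
  e_homogeneous : ∀ i, (e i).IsHomogeneous 1
  e_independent : LinearIndependent K e
  exceptional : zeros L e = {x ∈ X.pts | f x = center}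
  iso : ∃ u : PartialEquiv (PSpace L 4) (PSpace L 5), u.source = {x ∈ X.pts | f x ≠ center} ∧
    u.target = S.pts \ {center} ∧ Set.EqOn u f u.source ∧ IsIsoOver K u

/-- `φ` is the conic bundle on `X` given by the linear projection from the exceptional line of `B`
(extended to a morphism on the whole of `X`). -/
structure BlowUp.IsConicBundle {S : QuarticDelPezzo K L} {X : CubicSurface K L} (B : BlowUp S X)
    (φ : PSpace L 4 → PSpace L 2) : Prop where
  regular : RegularOn K X.pts φ
  projection : ∀ x ∈ X.pts, ∀ h : (fun i => aeval x.rep (B.e i)) ≠ 0,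
    φ x = Projectivization.mk L (fun i => aeval x.rep (B.e i)) h

/-- The fiber over `t` of a conic bundle `φ` on a cubic surface is degenerate, i.e. this plane conic
contains a line. -/
def CubicSurface.IsDegenerate (X : CubicSurface K L) (φ : PSpace L 4 → PSpace L 2)
    (t : PSpace L 2) : Prop :=
  ∃ C ∈ linesOn X.pts, ∀ x ∈ ptsOf C, φ x = t

/-- A transformation of conic bundles: a birational map `X ⇢ X'` over `K`, commuting with the
projections up to an automorphism of the base, that restricts to an isomorphism of a neighborhood
`θ.source` of the degenerate fibers of `φ` with a neighborhood `θ.target` of the degenerate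
fibers of `φ'`. -/
structure Transformation (X X' : CubicSurface K L) (φ φ' : PSpace L 4 → PSpace L 2) where
  θ : PartialEquiv (PSpace L 4) (PSpace L 4)
  iso : IsIsoOver K θ
  source_open : OpenIn K X.pts θ.source
  target_open : OpenIn K X'.pts θ.target
  base : PSpace L 2 ≃ PSpace L 2
  base_iso : IsIsoOver K base.toPartialEquiv
  comm : ∀ x ∈ θ.source, φ' (θ x) = base (φ x)
  source_degenerate : ∀ x ∈ X.pts, X.IsDegenerate φ (φ x) → x ∈ θ.source
  target_degenerate : ∀ x ∈ X'.pts, X'.IsDegenerate φ' (φ' x) → x ∈ θ.target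

/-- A marking of a conic bundle with five degenerate fibers `E i ∪ F i`. -/
structure CubicSurface.Marking (X : CubicSurface K L) (φ : PSpace L 4 → PSpace L 2) where
  E : Fin 5 → linesOn X.pts
  F : Fin 5 → linesOn X.pts
  ne : ∀ i, E i ≠ F i
  t : Fin 5 → PSpace L 2
  injective : Function.Injective t
  fiber : ∀ i, {x ∈ X.pts | φ x = t i} = ptsOf (E i).1 ∪ ptsOf (F i).1
  exhaust : ∀ s, X.IsDegenerate φ s → ∃ i, s = t i

/-- `M` is the third line in the plane spanned by the proper transforms on `X`
of two lines `Q`, `N` on `S`. -/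
def BlowUp.IsThirdLine {S : QuarticDelPezzo K L} {X : CubicSurface K L} (B : BlowUp S X)
    (Q N : S.Line) (M : linesOn X.pts) : Prop :=
  ∃ (Q₁ N₁ : linesOn X.pts) (P : Submodule L (Fin 4 → L)), B.f '' ptsOf Q₁.1 = ptsOf Q.1 ∧
    B.f '' ptsOf N₁.1 = ptsOf N.1 ∧ Module.finrank L P = 3 ∧
    ptsOf P ∩ X.pts = ptsOf Q₁.1 ∪ ptsOf N₁.1 ∪ ptsOf M.1

/-- The marking `μ` of `S` corresponds to the marking `m` of the conic bundle
(equivalently, to the equivalent marking in which the `E i` and the `F i` are interchanged). -/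
def BlowUp.Corresponds {S : QuarticDelPezzo K L} {X : CubicSurface K L} (B : BlowUp S X)
    {φ : PSpace L 4 → PSpace L 2} (μ : S.Marking) (m : X.Marking φ) : Prop :=
  (∀ i, B.IsThirdLine μ.Q (μ.line i) (m.E i)) ∨ (∀ i, B.IsThirdLine μ.Q (μ.line i) (m.F i))

/-- The transformation carries the marking `m` of `φ` to the marking `m'` of `φ'`. -/
def Transformation.MapsMarking {X X' : CubicSurface K L} {φ φ' : PSpace L 4 → PSpace L 2}
    (T : Transformation X X' φ φ') (m : X.Marking φ) (m' : X'.Marking φ') : Prop :=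
  ∀ i, ptsOf (m'.E i).1 = T.θ '' ptsOf (m.E i).1 ∧ ptsOf (m'.F i).1 = T.θ '' ptsOf (m.F i).1

/-- `ν` is the isomorphism of the schemes of lines determined by the transformation `T`: it commutes with
the Galois action, and for every marking of `S` it takes the lines of this marking to those of a
marking of `S'` obtained by passing to the conic bundle `φ`, then by `T` to `φ'`, then to `S'`;
moreover, it is equivariant for the actions of the Weyl group fixed by these two markings. -/
structure IsTransfer {S S' : QuarticDelPezzo K L} {X X' : CubicSurface K L}
    (B : BlowUp S X) (B' : BlowUp S' X') {φ φ' : PSpace L 4 → PSpace L 2}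
    (T : Transformation X X' φ φ') (ν : S.Line ≃ S'.Line) : Prop where
  galois : ∀ (σ : L ≃ₐ[K] L) (M N : S.Line), N.1 = galSub σ M.1 → (ν N).1 = galSub σ (ν M).1
  exists_marking : Nonempty S.Marking
  marking : ∀ μ : S.Marking, ∃ (m : X.Marking φ) (m' : X'.Marking φ') (μ' : S'.Marking),
    B.Corresponds μ m ∧ T.MapsMarking m m' ∧ B'.Corresponds μ' m' ∧
    ν μ.Q = μ'.Q ∧ (∀ i, ν (μ.line i) = μ'.line i) ∧
    ∃ (act : WeylD5 →* Equiv.Perm S.Line) (act' : WeylD5 →* Equiv.Perm S'.Line),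
      S.IsMarkingAction μ act ∧ S'.IsMarkingAction μ' act' ∧
      ∀ (w : WeylD5) (M : S.Line), ν (act w M) = act' w (ν M)

/-- The point `x` of `X`, not on the exceptional line, lies on the proper transform of the section
of `S` by the hyperplane tangent at the blown up point to the quadric `R`. -/
def BlowUp.OnTangentSection {S : QuarticDelPezzo K L} {X : CubicSurface K L} (B : BlowUp S X)
    (R : PSpace L 2) (x : PSpace L 4) : Prop :=
  x ∈ X.pts ∧ B.f x ≠ B.center ∧ QuadraticMap.polar (S.form R.rep) B.center.rep (B.f x).rep = 0

/-- `δ` is the natural isomorphism from the pencil of quadrics through `S` to the base of the conic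
bundle: it sends `R` to the fiber that is the proper transform of the section of `S` by the
hyperplane tangent to `R` at the blown up point. -/
structure BlowUp.IsPencilIso {S : QuarticDelPezzo K L} {X : CubicSurface K L} (B : BlowUp S X)
    (φ : PSpace L 4 → PSpace L 2) (δ : PSpace L 2 ≃ PSpace L 2) : Prop where
  iso : IsIsoOver K δ.toPartialEquiv
  fiber : ∀ (R : PSpace L 2) (x : PSpace L 4), x ∈ X.pts → B.f x ≠ B.center →
    (φ x = δ R ↔ B.OnTangentSection R x)

end BlowUps

end DelPezzo

open DelPezzo

set_option linter.unusedSectionVars false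

namespace DelPezzo

open QuadraticMap (polar polarBilin polarBilin_apply_apply polar_add_left polar_add_right polar_comm polar_neg_left polar_self polar_smul_left polar_smul_right polar_sub_left polar_sub_right polar_zero_left polar_zero_right)
open Module (finrank)
open Projectivization (rep_nonzero)
open Projectivization renaming mk → pmk, ind → pmk_ind
open Submodule (span mem_span_singleton mem_span_singleton_self mem_map_of_mem mem_span_range_iff_exists_fun)
open Fin (sum_univ_two sum_univ_three sum_univ_four sum_univ_five)
open Matrix (cons_val cons_val_zero cons_val_one)
open Polynomial renaming C → PC, X → PX

section Evaluation

variable {K L : Type*} [Field K] [Field L] [Algebra K L] {n m : ℕ}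

theorem aeval_smul_of_isHomogeneous {F : MvPolynomial (Fin n) K} {d : ℕ} (hF : F.IsHomogeneous d)
    (a : L) (x : Fin n → L) : aeval (a • x) F = a ^ d * aeval x F := by
  rw [aeval_def, aeval_def, eval₂_eq', eval₂_eq', Finset.mul_sum]
  refine Finset.sum_congr rfl fun s hs => ?_
  have hd : ∑ i, s i = d := by
    have := hF.degree_eq_sum_deg_support hs
    rw [this, Finset.sum_subset (Finset.subset_univ s.support)]
    intro i _ hi
    simpa using hi
  simp only [Pi.smul_apply, smul_eq_mul, mul_pow, Finset.prod_mul_distrib, Finset.prod_pow_eq_pow_sum,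
    hd]
  ring

theorem aeval_rep_eq_zero_iff {F : MvPolynomial (Fin n) K} {d : ℕ} (hF : F.IsHomogeneous d)
    (x : Fin n → L) (hx : x ≠ 0) :
    aeval (pmk L x hx).rep F = 0 ↔ aeval x F = 0 := by
  obtain ⟨a, ha⟩ := Projectivization.exists_smul_eq_mk_rep L x hx
  rw [← ha]
  change aeval ((a : L) • x) F = 0 ↔ _
  rw [aeval_smul_of_isHomogeneous hF]
  simp

theorem exists_rep_eq_smul (x : Fin n → L) (hx : x ≠ 0) :
    ∃ a : L, a ≠ 0 ∧ (pmk L x hx).rep = a • x := by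
  obtain ⟨a, ha⟩ := Projectivization.exists_smul_eq_mk_rep L x hx
  exact ⟨a, a.ne_zero, ha.symm⟩

theorem mk_eq_mk_of_smul {x y : Fin n → L} (hx : x ≠ 0) (hy : y ≠ 0) {a : L} (h : x = a • y) :
    pmk L x hx = pmk L y hy :=
  (Projectivization.mk_eq_mk_iff' L x y hx hy).2 ⟨a, h.symm⟩

theorem exists_smul_of_mk_eq_mk {x y : Fin n → L} {hx : x ≠ 0} {hy : y ≠ 0}
    (h : pmk L x hx = pmk L y hy) : ∃ a : L, a ≠ 0 ∧ x = a • y := by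
  obtain ⟨a, ha⟩ := (Projectivization.mk_eq_mk_iff' L x y hx hy).1 h
  refine ⟨a, ?_, ha.symm⟩
  rintro rfl
  exact hx (by rw [← ha, zero_smul])

/-- Vectors all of whose `2 × 2` minors with a given nonzero vector vanish are proportional to it. -/
theorem exists_smul_of_minors {x y : Fin n → L} (hy : y ≠ 0)
    (h : ∀ i j, x i * y j = x j * y i) : ∃ a : L, x = a • y := by
  obtain ⟨j, hj⟩ := Function.ne_iff.1 hy
  refine ⟨x j / y j, funext fun i => ?_⟩
  have hj' : y j ≠ 0 := hj
  simp only [Pi.smul_apply, smul_eq_mul]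
  field_simp
  rw [h i j]

theorem mem_ptsOf_mk {M : Submodule L (Fin n → L)} (x : Fin n → L) (hx : x ≠ 0) :
    pmk L x hx ∈ ptsOf M ↔ x ∈ M := by
  obtain ⟨a, ha, h⟩ := exists_rep_eq_smul x hx
  change (pmk L x hx).rep ∈ M ↔ _
  rw [h]
  exact M.smul_mem_iff ha

/-- The differential of a polynomial. -/
noncomputable def diff (F : MvPolynomial (Fin n) K) (x a : Fin n → L) : L :=
  ∑ j, aeval x (pderiv j F) * a j

@[simp] theorem diff_add (F G : MvPolynomial (Fin n) K) (x a : Fin n → L) :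
    diff (F + G) x a = diff F x a + diff G x a := by
  simp [diff, add_mul, Finset.sum_add_distrib]

@[simp] theorem diff_mul (F G : MvPolynomial (Fin n) K) (x a : Fin n → L) :
    diff (F * G) x a = aeval x F * diff G x a + aeval x G * diff F x a := by
  simp only [diff, Derivation.leibniz, smul_eq_mul, map_add, map_mul, add_mul,
    Finset.sum_add_distrib, Finset.mul_sum, mul_assoc]

@[simp] theorem diff_C (c : K) (x a : Fin n → L) : diff (C c) x a = 0 := by
  simp [diff]

@[simp] theorem diff_X (i : Fin n) (x a : Fin n → L) : diff (X i : MvPolynomial (Fin n) K) x a = a i := by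
  classical
  simp [diff, pderiv_X, Pi.single_apply, apply_ite, ite_mul]

@[simp] theorem diff_sub (F G : MvPolynomial (Fin n) K) (x a : Fin n → L) :
    diff (F - G) x a = diff F x a - diff G x a := by
  simp [diff, sub_mul]

theorem diff_sum {ι : Type*} (s : Finset ι) (F : ι → MvPolynomial (Fin n) K) (x a : Fin n → L) :
    diff (∑ i ∈ s, F i) x a = ∑ i ∈ s, diff (F i) x a := by
  classical
  induction s using Finset.induction_on with
  | empty => simp [diff]
  | insert i s hi ih => rw [Finset.sum_insert hi, Finset.sum_insert hi, diff_add, ih]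

theorem diff_add_right (F : MvPolynomial (Fin n) K) (x a b : Fin n → L) :
    diff F x (a + b) = diff F x a + diff F x b := by
  simp [diff, mul_add, Finset.sum_add_distrib]

theorem diff_smul_right (F : MvPolynomial (Fin n) K) (x : Fin n → L) (r : L) (a : Fin n → L) :
    diff F x (r • a) = r * diff F x a := by
  simp only [diff, Pi.smul_apply, smul_eq_mul, Finset.mul_sum]
  exact Finset.sum_congr rfl fun _ _ => by ring

theorem diff_aeval (H : MvPolynomial (Fin m) K) (F : Fin m → MvPolynomial (Fin n) K)
    (x a : Fin n → L) :
    diff (aeval F H) x a = diff H (fun i => aeval x (F i)) (fun i => diff (F i) x a) := by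
  induction H using MvPolynomial.induction_on with
  | C c => simp [algebraMap_eq]
  | add p q hp hq => rw [map_add, diff_add, diff_add, hp, hq]
  | mul_X p i hp =>
    have := comp_aeval_apply (R := K) F (aeval x : MvPolynomial (Fin n) K →ₐ[K] L) p
    simp only [map_mul, aeval_X, diff_mul, hp, diff_X, this]

theorem diff_self {F : MvPolynomial (Fin n) K} {d : ℕ} (hF : F.IsHomogeneous d) (x : Fin n → L) :
    diff F x x = d * aeval x F := by
  have := congrArg (aeval x) hF.sum_X_mul_pderiv
  simp only [map_sum, map_mul, aeval_X, nsmul_eq_mul, map_natCast] at this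
  rw [diff, ← this]
  exact Finset.sum_congr rfl fun _ _ => mul_comm _ _

theorem diff_smul_left {F : MvPolynomial (Fin n) K} {d : ℕ} (hF : F.IsHomogeneous d) (r : L)
    (x a : Fin n → L) : r * diff F (r • x) a = r ^ d * diff F x a := by
  rcases Nat.eq_zero_or_pos d with rfl | hd
  · have : F = C (coeff 0 F) := by
      have := (totalDegree_zero_iff_isHomogeneous _).2 hF
      exact totalDegree_eq_zero_iff_eq_C.1 this
    rw [this]; simp
  · have h : ∀ j, (pderiv j F).IsHomogeneous (d - 1) := fun j => hF.pderiv
    simp only [diff, Finset.mul_sum]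
    refine Finset.sum_congr rfl fun j _ => ?_
    rw [aeval_smul_of_isHomogeneous (h j)]
    obtain ⟨e, rfl⟩ := Nat.exists_eq_add_of_le' hd
    simp only [Nat.add_sub_cancel]
    ring

theorem exists_coeff_of_isHomogeneous_one {F : MvPolynomial (Fin n) K} (hF : F.IsHomogeneous 1) :
    ∃ a : Fin n → K, F = ∑ i, C (a i) * X i := by
  have h : F ∈ span K (Set.range (X : Fin n → MvPolynomial (Fin n) K)) := by
    rw [← homogeneousSubmodule_one_eq_span_X]; exact hF
  obtain ⟨a, ha⟩ := (mem_span_range_iff_exists_fun K).1 h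
  exact ⟨a, by rw [← ha]; simp [smul_eq_C_mul]⟩

open scoped Pointwise in
theorem exists_coeff_of_isHomogeneous_two {F : MvPolynomial (Fin n) K} (hF : F.IsHomogeneous 2) :
    ∃ a : Fin n → Fin n → K, F = ∑ i, ∑ j, C (a i j) * X i * X j := by
  have h : F ∈ span K (Set.range (X : Fin n → MvPolynomial (Fin n) K) *
      Set.range (X : Fin n → MvPolynomial (Fin n) K)) := by
    rw [← Submodule.span_mul_span, ← homogeneousSubmodule_one_eq_span_X, ← sq,
      homogeneousSubmodule_one_pow]
    exact hF
  clear hF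
  induction h using Submodule.span_induction with
  | mem x hx =>
    obtain ⟨_, ⟨i, rfl⟩, _, ⟨j, rfl⟩, rfl⟩ := hx
    classical
    refine ⟨fun k l => if k = i ∧ l = j then 1 else 0, ?_⟩
    rw [Finset.sum_eq_single i, Finset.sum_eq_single j]
    · simp
    · intro l _ hl; simp [hl]
    · simp
    · intro k _ hk; simp [hk]
    · simp
  | zero => exact ⟨0, by simp⟩
  | add x y hx hy ihx ihy =>
    obtain ⟨a, ha⟩ := ihx
    obtain ⟨b, hb⟩ := ihy
    refine ⟨a + b, ?_⟩
    rw [ha, hb]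
    simp [add_mul, Finset.sum_add_distrib]
  | smul r x hx ih =>
    obtain ⟨a, ha⟩ := ih
    refine ⟨r • a, ?_⟩
    rw [ha]
    simp [smul_eq_C_mul, Finset.mul_sum, mul_assoc]

theorem polar_aeval {F : MvPolynomial (Fin n) K} (hF : F.IsHomogeneous 2) (x y : Fin n → L) :
    polar (fun v : Fin n → L => aeval v F) x y = diff F x y := by
  obtain ⟨a, rfl⟩ := exists_coeff_of_isHomogeneous_two hF
  simp only [polar, diff_sum, diff_mul, diff_C, diff_X, map_sum, map_mul, aeval_C, aeval_X,
    ← Finset.sum_sub_distrib, Pi.add_apply]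
  refine Finset.sum_congr rfl fun i _ => Finset.sum_congr rfl fun j _ => ?_
  ring

/-- The quadratic form defined by a homogeneous polynomial of degree two. -/
noncomputable def evalQuad (L : Type*) [Field L] [Algebra K L] (F : MvPolynomial (Fin n) K)
    (hF : F.IsHomogeneous 2) : QuadraticForm L (Fin n → L) :=
  QuadraticMap.ofPolar (fun v => aeval v F)
    (fun a x => by rw [aeval_smul_of_isHomogeneous hF, sq, smul_eq_mul])
    (fun x x' y => by
      rw [polar_comm, polar_aeval hF, polar_comm _ x, polar_aeval hF,
        polar_comm _ x', polar_aeval hF, diff_add_right])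
    (fun a x y => by
      rw [polar_comm, polar_aeval hF, polar_comm _ x, polar_aeval hF,
        diff_smul_right, smul_eq_mul])

@[simp] theorem evalQuad_apply (F : MvPolynomial (Fin n) K) (hF : F.IsHomogeneous 2) (x : Fin n → L) :
    evalQuad L F hF x = aeval x F := rfl

theorem polar_evalQuad (F : MvPolynomial (Fin n) K) (hF : F.IsHomogeneous 2) (x y : Fin n → L) :
    polar (evalQuad L F hF) x y = diff F x y := polar_aeval hF x y

end Evaluation

section Regular

variable {K L : Type*} [Field K] [Field L] [Algebra K L] {n m : ℕ}

theorem aeval_gal (σ : L ≃ₐ[K] L) (x : Fin n → L) (F : MvPolynomial (Fin n) K) :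
    aeval (fun i => σ (x i)) F = σ (aeval x F) := by
  have := comp_aeval_apply (R := K) x (σ : L →ₐ[K] L) F
  simpa using this.symm

theorem galPt_mk (σ : L ≃ₐ[K] L) (x : Fin n → L) (hx : x ≠ 0) :
    galPt σ (pmk L x hx) =
      pmk L (fun i => σ (x i)) (gal_ne_zero σ hx) := by
  obtain ⟨a, ha, h⟩ := exists_rep_eq_smul x hx
  refine mk_eq_mk_of_smul _ _ (a := σ a) ?_
  rw [h]
  funext i
  simp

theorem galPt_symm_galPt (σ : L ≃ₐ[K] L) (x : PSpace L n) : galPt σ.symm (galPt σ x) = x := by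
  induction x using pmk_ind with
  | h v hv => simp [galPt_mk]

theorem galPt_galPt_symm (σ : L ≃ₐ[K] L) (x : PSpace L n) : galPt σ (galPt σ.symm x) = x := by
  induction x using pmk_ind with
  | h v hv => simp [galPt_mk]

/-- A family of homogeneous polynomials of degree `d` that gives the map `g` wherever
it does not vanish identically. -/
structure IsRepOf (U : Set (PSpace L n)) (g : PSpace L n → PSpace L m) (d : ℕ)
    (F : Fin m → MvPolynomial (Fin n) K) : Prop where
  hom : ∀ i, (F i).IsHomogeneous d
  eq : ∀ (y : Fin n → L) (hy : y ≠ 0) (h : (fun i => aeval y (F i)) ≠ 0),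
    pmk L y hy ∈ U → g (pmk L y hy) = pmk L _ h

theorem aeval_smul_family {d : ℕ} {F : Fin m → MvPolynomial (Fin n) K}
    (hF : ∀ i, (F i).IsHomogeneous d) (a : L) (x : Fin n → L) :
    (fun i => aeval (a • x) (F i)) = a ^ d • fun i => aeval x (F i) := by
  funext i
  rw [aeval_smul_of_isHomogeneous (hF i)]
  rfl

theorem RegularOn.exists_rep {U : Set (PSpace L n)} {g : PSpace L n → PSpace L m}
    (hg : RegularOn K U g) (x : Fin n → L) (hx : x ≠ 0) (hxU : pmk L x hx ∈ U) :
    ∃ (d : ℕ) (F : Fin m → MvPolynomial (Fin n) K), IsRepOf U g d F ∧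
      (fun i => aeval x (F i)) ≠ 0 := by
  obtain ⟨d, F, hd, hF, h⟩ := hg _ hxU
  refine ⟨d, F, ⟨hd, fun y hy hFy hyU => ?_⟩, ?_⟩
  · obtain ⟨a, ha, hrep⟩ := exists_rep_eq_smul y hy
    have h1 : (fun i => aeval (pmk L y hy).rep (F i)) ≠ 0 := by
      rw [hrep, aeval_smul_family hd]
      exact smul_ne_zero (pow_ne_zero _ ha) hFy
    rw [h _ hyU h1]
    refine mk_eq_mk_of_smul _ _ (a := a ^ d) ?_
    rw [hrep, aeval_smul_family hd]
  · obtain ⟨a, ha, hrep⟩ := exists_rep_eq_smul x hx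
    intro h0
    apply hF
    rw [hrep, aeval_smul_family hd, h0, smul_zero]

theorem RegularOn.of_reps {U : Set (PSpace L n)} {g : PSpace L n → PSpace L m}
    (h : ∀ (x : Fin n → L) (hx : x ≠ 0), pmk L x hx ∈ U →
      ∃ (d : ℕ) (F : Fin m → MvPolynomial (Fin n) K), IsRepOf U g d F ∧
      (fun i => aeval x (F i)) ≠ 0) : RegularOn K U g := by
  intro x hx
  have hx' : pmk L x.rep x.rep_nonzero = x := x.mk_rep
  obtain ⟨d, F, hF, h0⟩ := h x.rep x.rep_nonzero (by rwa [hx'])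
  refine ⟨d, F, hF.hom, h0, fun y hy hFy => ?_⟩
  have hy' : pmk L y.rep y.rep_nonzero = y := y.mk_rep
  have := hF.eq y.rep y.rep_nonzero hFy (by rwa [hy'])
  rwa [hy'] at this

theorem RegularOn.galPt {U : Set (PSpace L n)} {g : PSpace L n → PSpace L m}
    (hg : RegularOn K U g) (σ : L ≃ₐ[K] L) {x : PSpace L n} (hx : x ∈ U) (hσ : galPt σ x ∈ U) :
    g (galPt σ x) = DelPezzo.galPt σ (g x) := by
  induction x using pmk_ind with
  | h v hv =>
    obtain ⟨d, F, hF, h0⟩ := hg.exists_rep v hv hx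
    rw [hF.eq v hv h0 hx, galPt_mk]
    rw [galPt_mk] at hσ ⊢
    have h1 : (fun i => aeval (fun i => σ (v i)) (F i)) = fun i => σ (aeval v (F i)) := by
      funext i
      rw [aeval_gal]
    have h2 : (fun i => aeval (fun i => σ (v i)) (F i)) ≠ 0 := by
      rw [h1]; exact gal_ne_zero σ h0
    rw [hF.eq _ _ h2 hσ]
    congr 1

/-- The linear map with matrix `A` over `K`, on vectors over `L`. -/
noncomputable def matLin (L : Type*) [Field L] [Algebra K L] (A : Matrix (Fin m) (Fin n) K) :
    (Fin n → L) →ₗ[L] (Fin m → L) := (A.map (algebraMap K L)).mulVecLin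

theorem matLin_apply (A : Matrix (Fin m) (Fin n) K) (x : Fin n → L) (i : Fin m) :
    matLin L A x i = ∑ j, algebraMap K L (A i j) * x j := by
  simp [matLin, Matrix.mulVec, dotProduct]

theorem matLin_mul {k : ℕ} (A : Matrix (Fin m) (Fin n) K) (B : Matrix (Fin n) (Fin k) K)
    (x : Fin k → L) : matLin L (A * B) x = matLin L A (matLin L B x) := by
  simp [matLin, Matrix.map_mul]

theorem matLin_one (x : Fin n → L) : matLin L (1 : Matrix (Fin n) (Fin n) K) x = x := by
  simp [matLin]

theorem matLin_gal (σ : L ≃ₐ[K] L) (A : Matrix (Fin m) (Fin n) K) (x : Fin n → L) :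
    matLin L A (fun i => σ (x i)) = fun i => σ (matLin L A x i) := by
  funext i
  simp [matLin_apply]

theorem regularOn_of_matrix {U : Set (PSpace L n)} {g : PSpace L n → PSpace L m}
    (A : Matrix (Fin m) (Fin n) K) (h : ∀ (x : Fin n → L) (hx : x ≠ 0),
      pmk L x hx ∈ U → ∃ hA : matLin L A x ≠ 0,
        g (pmk L x hx) = pmk L (matLin L A x) hA) :
    RegularOn K U g := by
  refine RegularOn.of_reps fun x hx hxU => ?_
  have hev : ∀ y : Fin n → L, (fun i => aeval y (∑ j, C (A i j) * X j)) = matLin L A y := by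
    intro y
    funext i
    simp [matLin_apply]
  refine ⟨1, fun i => ∑ j, C (A i j) * X j, ⟨fun i => IsHomogeneous.sum _ _ _ fun j _ => ?_, ?_⟩, ?_⟩
  · exact isHomogeneous_C_mul_X _ _
  · intro y hy hFy hyU
    obtain ⟨hA, h'⟩ := h y hy hyU
    rw [h']
    congr 1
    exact (hev y).symm
  · rw [hev]
    exact (h x hx hxU).1

end Regular

section Zeros

variable {K L : Type*} [Field K] [Field L] [Algebra K L] [IsAlgClosed L] {n : ℕ}

/-- Nullstellensatz for a principal ideal. -/
theorem dvd_pow_of_vanish {D F : MvPolynomial (Fin n) K}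
    (h : ∀ x : Fin n → L, aeval x D = 0 → aeval x F = 0) : ∃ k, D ∣ F ^ k := by
  have : F ∈ vanishingIdeal K (zeroLocus L (Ideal.span {D})) := by
    rw [mem_vanishingIdeal_iff]
    intro x hx
    exact h x (hx D (Ideal.mem_span_singleton_self D))
  rw [vanishingIdeal_zeroLocus_eq_radical] at this
  obtain ⟨k, hk⟩ := this
  exact ⟨k, Ideal.mem_span_singleton.1 hk⟩

theorem dvd_of_vanish {D F : MvPolynomial (Fin n) K} (hD : Squarefree D)
    (h : ∀ x : Fin n → L, aeval x D = 0 → aeval x F = 0) : D ∣ F := by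
  obtain ⟨k, hk⟩ := dvd_pow_of_vanish h
  exact hD.isRadical k F hk

theorem eq_zero_of_vanish {F : MvPolynomial (Fin n) K} (h : ∀ x : Fin n → L, aeval x F = 0) :
    F = 0 := by
  obtain ⟨k, hk⟩ := dvd_pow_of_vanish (D := 0) fun x _ => h x
  by_contra h0
  exact pow_ne_zero k h0 (zero_dvd_iff.1 hk)

/-- A nonunit in a polynomial ring in at least two variables has a zero different from the origin. -/
theorem exists_ne_zero_aeval_eq_zero (hn : 2 ≤ n) {D : MvPolynomial (Fin n) K} (hD : ¬ IsUnit D) :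
    ∃ x : Fin n → L, x ≠ 0 ∧ aeval x D = 0 := by
  by_contra! hcon
  have h : ∀ i : Fin n, ∃ k, D ∣ X i ^ k := fun i => dvd_pow_of_vanish (L := L) fun x hx => by
    have : x = 0 := by
      by_contra h0
      exact hcon x h0 hx
    simp [this]
  let i0 : Fin n := ⟨0, by omega⟩
  let i1 : Fin n := ⟨1, by omega⟩
  have h01 : i1 ≠ i0 := by simp [i0, i1]
  obtain ⟨k, hk⟩ := h i0
  obtain ⟨l, hl⟩ := h i1
  obtain ⟨m, -, hm⟩ := (dvd_prime_pow (X_prime (i := i0) (R := K)) k).1 hk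
  rcases Nat.eq_zero_or_pos m with rfl | hpos
  · exact hD (by simpa using hm)
  · have h1 : (X i0 : MvPolynomial (Fin n) K) ∣ X i1 ^ l :=
      ((dvd_pow_self _ hpos.ne').trans hm.symm.dvd).trans hl
    obtain ⟨q, hq⟩ := h1
    have := congrArg (aeval (fun i => if i = i0 then (0 : K) else 1)) hq
    simp [h01] at this

theorem not_isUnit_of_aeval_zero {D : MvPolynomial (Fin n) K} (h : aeval (0 : Fin n → L) D = 0) :
    ¬ IsUnit D := by
  intro hu
  have := hu.map (aeval (0 : Fin n → L) : MvPolynomial (Fin n) K →ₐ[K] L)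
  rw [h] at this
  exact not_isUnit_zero this

theorem exists_ne_zero_of_aeval_zero (hn : 2 ≤ n) {D : MvPolynomial (Fin n) K}
    (h : aeval (0 : Fin n → L) D = 0) : ∃ x : Fin n → L, x ≠ 0 ∧ aeval x D = 0 :=
  exists_ne_zero_aeval_eq_zero hn (not_isUnit_of_aeval_zero h)

theorem isRelPrime_of_no_common_zero (hn : 2 ≤ n) {F G : MvPolynomial (Fin n) K}
    (h : ∀ x : Fin n → L, x ≠ 0 → aeval x F = 0 → aeval x G ≠ 0) : IsRelPrime F G := by
  intro d hF hG
  by_contra hd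
  obtain ⟨x, hx, hx0⟩ := exists_ne_zero_aeval_eq_zero (L := L) hn hd
  obtain ⟨a, rfl⟩ := hF
  obtain ⟨b, rfl⟩ := hG
  exact h x hx (by simp [hx0]) (by simp [hx0])

end Zeros

section HomogeneousParts

variable {K : Type*} [Field K] {n : ℕ}

attribute [local instance] MvPolynomial.gradedAlgebra in
theorem homogeneousComponent_mul_left {e : MvPolynomial (Fin n) K} {m : ℕ} (he : e.IsHomogeneous m)
    (d : ℕ) (F : MvPolynomial (Fin n) K) :
    homogeneousComponent (m + d) (e * F) = e * homogeneousComponent d F := by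
  have := DirectSum.coe_decompose_mul_add_of_left_mem (homogeneousSubmodule (Fin n) K)
    (i := m) (j := d) (a := e) (b := F) he
  rw [← decomposition.decompose'_apply, ← decomposition.decompose'_apply]
  exact this

end HomogeneousParts

section Cubic

variable {K L : Type*} [Field K] [Field L] [Algebra K L] [IsAlgClosed L]

theorem CubicSurface.smooth_diff (Y : CubicSurface K L) {x : Fin 4 → L} (hx : x ≠ 0)
    (h : aeval x Y.c = 0) : ∃ a, diff Y.c x a ≠ 0 := by
  obtain ⟨a, ha, hrep⟩ := exists_rep_eq_smul x hx
  obtain ⟨j, hj⟩ := Y.smooth (pmk L x hx)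
    ((aeval_rep_eq_zero_iff Y.homogeneous x hx).2 h)
  classical
  refine ⟨Pi.single j 1, ?_⟩
  have h1 : diff Y.c x (Pi.single j 1) = aeval x (pderiv j Y.c) := by
    simp [diff, Pi.single_apply]
  rw [h1]
  rw [hrep, aeval_smul_of_isHomogeneous Y.homogeneous.pderiv] at hj
  exact right_ne_zero_of_mul hj

theorem CubicSurface.squarefree (Y : CubicSurface K L) : Squarefree Y.c := by
  intro g hg
  by_contra hu
  obtain ⟨x, hx, h0⟩ := exists_ne_zero_aeval_eq_zero (L := L) (n := 4) (by norm_num) hu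
  obtain ⟨h, hh⟩ := hg
  obtain ⟨a, ha⟩ := Y.smooth_diff hx (by rw [hh]; simp [h0])
  apply ha
  rw [hh]
  simp [h0]

theorem CubicSurface.dvd_of_vanish (Y : CubicSurface K L) {F : MvPolynomial (Fin 4) K}
    (h : ∀ x : Fin 4 → L, aeval x Y.c = 0 → aeval x F = 0) : Y.c ∣ F :=
  DelPezzo.dvd_of_vanish Y.squarefree h

theorem CubicSurface.diff_eq_zero (Y : CubicSurface K L) {F : MvPolynomial (Fin 4) K}
    (h : ∀ x : Fin 4 → L, x ≠ 0 → aeval x Y.c = 0 → aeval x F = 0) {x a : Fin 4 → L} (hx : x ≠ 0)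
    (hc : aeval x Y.c = 0) (ha : diff Y.c x a = 0) : diff F x a = 0 := by
  obtain ⟨j, hj⟩ := Function.ne_iff.1 hx
  obtain ⟨q, hq⟩ := Y.dvd_of_vanish (F := X j * F) fun y hy => by
    rcases eq_or_ne y 0 with rfl | hy0
    · simp
    · simp [h y hy0 hy]
  have h1 := congrArg (fun F => diff F x a) hq
  simp only [diff_mul, aeval_X, hc, ha, h x hx hc] at h1
  simpa [show x j ≠ 0 from hj] using h1

/-- Linear coordinates on the space of homogeneous coordinates, the first two of which are given. -/
theorem exists_adapted_matrix {e : Fin 2 → MvPolynomial (Fin 4) K} (he : ∀ i, (e i).IsHomogeneous 1)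
    (hind : LinearIndependent K e) :
    ∃ U b : Matrix (Fin 4) (Fin 4) K, U * b = 1 ∧ b * U = 1 ∧
      e 0 = ∑ j, C (U 0 j) * X j ∧ e 1 = ∑ j, C (U 1 j) * X j := by
  choose a ha using fun i => exists_coeff_of_isHomogeneous_one (he i)
  have h2 : LinearIndependent K a := by
    rw [Fintype.linearIndependent_iff] at hind ⊢
    intro g hg
    apply hind g
    have : ∀ i, g i • e i = ∑ j, C (g i * a i j) * X j := by
      intro i
      rw [ha i, Finset.smul_sum]
      simp [smul_eq_C_mul, mul_assoc]
    simp only [this]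
    rw [Finset.sum_comm]
    refine Finset.sum_eq_zero fun j _ => ?_
    rw [← Finset.sum_mul, ← map_sum]
    have := congrFun hg j
    simp only [Finset.sum_apply, Pi.smul_apply, smul_eq_mul, Pi.zero_apply] at this
    rw [this]; simp
  obtain ⟨x, hx⟩ := exists_linearIndependent_snoc_of_lt_finrank h2 (by simp)
  obtain ⟨y, hy⟩ := exists_linearIndependent_snoc_of_lt_finrank hx (by simp)
  let U : Matrix (Fin 4) (Fin 4) K := Fin.snoc (α := fun _ => Fin 4 → K) (Fin.snoc (α := fun _ => Fin 4 → K) a x) y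
  have hU : IsUnit U := Matrix.linearIndependent_rows_iff_isUnit.1 hy
  have hdet := (Matrix.isUnit_iff_isUnit_det U).1 hU
  refine ⟨U, U⁻¹, Matrix.mul_nonsing_inv U hdet, Matrix.nonsing_inv_mul U hdet, ?_, ?_⟩
  · rw [ha 0]; rfl
  · rw [ha 1]; rfl

/-- The equation of a cubic surface containing the line `e 0 = e 1 = 0`, in the form `e 0 * Q 1 - e 1 * Q 0`,
together with the algebraic consequences of smoothness along this line. -/
structure LineEquation (Y : CubicSurface K L) (e Q : Fin 2 → MvPolynomial (Fin 4) K) : Prop where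
  hom_e : ∀ i, (e i).IsHomogeneous 1
  hom_Q : ∀ i, (Q i).IsHomogeneous 2
  eq : Y.c = e 0 * Q 1 - e 1 * Q 0
  no_common_zero : ∀ x : Fin 4 → L, x ≠ 0 → (∀ i, aeval x (e i) = 0) → ∃ i, aeval x (Q i) ≠ 0
  prime_zero : Prime (e 0)
  prime_one : Prime (e 1)
  not_dvd : ¬ e 0 ∣ e 1
  not_dvd' : ¬ e 1 ∣ e 0
  not_dvd_Q : ¬ e 0 ∣ Q 0
  not_dvd_Q' : ¬ e 1 ∣ Q 1
  Q_zero_nzd : ∀ a, Q 0 * a ∈ Ideal.span {e 0, e 1} → a ∈ Ideal.span {e 0, e 1}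
  Q_one_nzd : ∀ a, Q 1 * a ∈ Ideal.span {e 0, e 1, Q 0} → a ∈ Ideal.span {e 0, e 1, Q 0}
  exists_eval : ∃ u : Fin 4 → Fin 4 → L, ∀ i : Fin 2, ∀ j : Fin 4,
    aeval (u j) (e i) = if (i : ℕ) = j then 1 else 0

theorem exists_lineEquation (Y : CubicSurface K L) {e : Fin 2 → MvPolynomial (Fin 4) K}
    (he : ∀ i, (e i).IsHomogeneous 1) (hind : LinearIndependent K e)
    (hE : ∀ x : Fin 4 → L, (∀ i, aeval x (e i) = 0) → aeval x Y.c = 0) :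
    ∃ Q, LineEquation Y e Q := by
  obtain ⟨U, b, hUb, hbU, he0, he1⟩ := exists_adapted_matrix he hind
  -- restriction to the line and the lift of functions from it
  let ρ : MvPolynomial (Fin 4) K →ₐ[K] MvPolynomial (Fin 2) K :=
    aeval fun i => C (b i 2) * X 0 + C (b i 3) * X 1
  let lam : MvPolynomial (Fin 2) K →ₐ[K] MvPolynomial (Fin 4) K :=
    aeval ![∑ j, C (U 2 j) * X j, ∑ j, C (U 3 j) * X j]
  have hUb' : ∀ i j, ∑ k, U i k * b k j = if i = j then 1 else 0 := by
    intro i j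
    have := congrFun (congrFun hUb i) j
    rwa [Matrix.mul_apply, Matrix.one_apply] at this
  have hbU' : ∀ i j, ∑ k, b i k * U k j = if i = j then 1 else 0 := by
    intro i j
    have := congrFun (congrFun hbU i) j
    rwa [Matrix.mul_apply, Matrix.one_apply] at this
  have hlin : ∀ i, ρ (∑ j, C (U i j) * X j) = C (if i = 2 then 1 else 0) * X 0 + C (if i = 3 then 1 else 0) * X 1 := by
    intro i
    rw [← hUb' i 2, ← hUb' i 3]
    simp only [ρ, map_sum, map_mul, aeval_C, aeval_X, algebraMap_eq, Finset.sum_mul, mul_add,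
      Finset.sum_add_distrib, mul_assoc]
  have hρ0 : ρ (e 0) = 0 := by rw [he0, hlin]; simp
  have hρ1 : ρ (e 1) = 0 := by rw [he1, hlin]; simp
  have hmodX : ∀ i, X i - lam (ρ (X i)) ∈ Ideal.span {e 0, e 1} := by
    intro i
    have h1 : (X i : MvPolynomial (Fin 4) K) = ∑ k, C (b i k) * ∑ j, C (U k j) * X j := by
      simp only [Finset.mul_sum, ← mul_assoc, ← C_mul]
      rw [Finset.sum_comm]
      simp only [← Finset.sum_mul, ← map_sum, hbU']
      simp
    have h2 : lam (ρ (X i)) = C (b i 2) * (∑ j, C (U 2 j) * X j) + C (b i 3) * ∑ j, C (U 3 j) * X j := by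
      simp [ρ, lam, algebraMap_eq]
    rw [h2]
    nth_rewrite 1 [h1]
    rw [sum_univ_four, ← he0, ← he1, Ideal.mem_span_pair]
    exact ⟨C (b i 0), C (b i 1), by ring⟩
  have hmod : ∀ F, F - lam (ρ F) ∈ Ideal.span {e 0, e 1} := by
    intro F
    rw [← Ideal.Quotient.mk_eq_mk_iff_sub_mem]
    have : ((Ideal.Quotient.mkₐ K (Ideal.span {e 0, e 1})).comp (lam.comp ρ)) =
        (Ideal.Quotient.mkₐ K (Ideal.span {e 0, e 1})) := by
      apply MvPolynomial.algHom_ext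
      intro i
      exact ((Ideal.Quotient.mk_eq_mk_iff_sub_mem _ _).2 (hmodX i)).symm
    exact (DFunLike.congr_fun this F).symm
  have hker : ∀ F, F ∈ Ideal.span {e 0, e 1} ↔ ρ F = 0 := by
    intro F
    constructor
    · intro h
      obtain ⟨p, q, rfl⟩ := Ideal.mem_span_pair.1 h
      simp [hρ0, hρ1]
    · intro h
      have := hmod F
      rwa [h, map_zero, sub_zero] at this
  -- points of the line
  let P : (Fin 2 → L) → (Fin 4 → L) := fun z i => algebraMap K L (b i 2) * z 0 + algebraMap K L (b i 3) * z 1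
  have hP : ∀ z F, aeval z (ρ F) = aeval (P z) F := by
    intro z F
    have : (aeval z : MvPolynomial (Fin 2) K →ₐ[K] L).comp ρ = aeval (P z) := by
      apply MvPolynomial.algHom_ext
      intro i
      simp [ρ, P]
    exact DFunLike.congr_fun this F
  have hPe : ∀ z i, aeval (P z) (e i) = 0 := by
    intro z i
    rw [← hP]
    fin_cases i
    · simp [hρ0]
    · simp [hρ1]
  have hP0 : ∀ z, z ≠ 0 → P z ≠ 0 := by
    intro z hz h
    apply hz
    have key : ∀ i : Fin 4, aeval z (ρ (∑ j, C (U i j) * X j)) = 0 := by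
      intro i; rw [hP, h]; simp
    have k2 := key 2
    have k3 := key 3
    rw [hlin] at k2 k3
    funext i
    fin_cases i
    · simpa using k2
    · simpa using k3
  have hρc : ρ Y.c = 0 := eq_zero_of_vanish (L := L) fun z => by
    rw [hP]; exact hE _ (hPe z)
  obtain ⟨p, q, hpq⟩ := Ideal.mem_span_pair.1 ((hker _).2 hρc)
  let Q : Fin 2 → MvPolynomial (Fin 4) K := ![-homogeneousComponent 2 q, homogeneousComponent 2 p]
  have hQ : ∀ i, (Q i).IsHomogeneous 2 := by
    intro i
    fin_cases i
    · exact (homogeneousComponent_isHomogeneous 2 q).neg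
    · exact homogeneousComponent_isHomogeneous 2 p
  have heq : Y.c = e 0 * Q 1 - e 1 * Q 0 := by
    have h1 := congrArg (homogeneousComponent (1 + 2)) hpq
    rw [map_add, mul_comm p, mul_comm q, homogeneousComponent_mul_left (he 0),
      homogeneousComponent_mul_left (he 1), homogeneousComponent_eq_self Y.homogeneous] at h1
    rw [← h1]
    simp [Q]
  have hncz : ∀ x : Fin 4 → L, x ≠ 0 → (∀ i, aeval x (e i) = 0) → ∃ i, aeval x (Q i) ≠ 0 := by
    intro x hx hex
    by_contra! h0
    obtain ⟨a, ha⟩ := Y.smooth_diff hx (hE x hex)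
    apply ha
    rw [heq]
    simp [hex, h0]
  have hrel : IsRelPrime (ρ (Q 0)) (ρ (Q 1)) := by
    apply isRelPrime_of_no_common_zero (L := L) le_rfl
    intro z hz h0 h1
    rw [hP] at h0 h1
    obtain ⟨i, hi⟩ := hncz _ (hP0 z hz) (hPe z)
    fin_cases i
    · exact hi h0
    · exact hi h1
  have hQz : ∀ i, ¬ IsUnit (ρ (Q i)) := fun i => not_isUnit_of_aeval_zero (L := L) (by
    rw [hP]
    have : P 0 = (0 : L) • (0 : Fin 4 → L) := by funext i; simp [P]
    rw [this, aeval_smul_of_isHomogeneous (hQ i)]; simp)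
  have hρQ0 : ρ (Q 0) ≠ 0 := by
    intro h
    rw [h] at hrel
    exact hQz 1 (isRelPrime_zero_left.1 hrel)
  have hρQ1 : ρ (Q 1) ≠ 0 := by
    intro h
    rw [h] at hrel
    exact hQz 0 (isRelPrime_zero_right.1 hrel)
  have hexev : ∃ u : Fin 4 → Fin 4 → L, ∀ i : Fin 2, ∀ j : Fin 4,
      aeval (u j) (e i) = if (i : ℕ) = j then 1 else 0 := by
    refine ⟨fun j k => algebraMap K L (b k j), fun i j => ?_⟩
    have key : ∀ i' : Fin 4, aeval (fun k => algebraMap K L (b k j)) (∑ j, C (U i' j) * X j) =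
        if i' = j then 1 else 0 := by
      intro i'
      have := congrArg (algebraMap K L) (hUb' i' j)
      simpa [apply_ite] using this
    fin_cases i
    · have := key 0
      rw [← he0] at this
      simp only [Fin.ext_iff] at this
      simpa using this
    · have := key 1
      rw [← he1] at this
      simp only [Fin.ext_iff] at this
      simpa using this
  have hne : ∀ i, e i ≠ 0 := hind.ne_zero
  have hprime : ∀ i, Prime (e i) := by
    intro i
    refine (irreducible_of_totalDegree_eq_one ((he i).totalDegree (hne i)) fun x hx => ?_).prime
    by_contra hu
    have hx0 : x = 0 := by
      by_contra h; exact hu (isUnit_iff_ne_zero.2 h)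
    apply hne i
    ext m
    have := hx m
    rw [hx0, zero_dvd_iff] at this
    simp [this]
  obtain ⟨u, hu⟩ := hexev
  refine ⟨Q, he, hQ, heq, hncz, hprime 0, hprime 1, ?_, ?_, ?_, ?_, ?_, ?_, ⟨u, hu⟩⟩
  · rintro ⟨r, hr⟩
    have h1 := congrArg (aeval (u 1)) hr
    rw [map_mul, hu, hu] at h1
    simp at h1
  · rintro ⟨r, hr⟩
    have h1 := congrArg (aeval (u 0)) hr
    rw [map_mul, hu, hu] at h1
    simp at h1
  · rintro ⟨r, hr⟩
    apply hρQ0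
    rw [hr, map_mul, hρ0, zero_mul]
  · rintro ⟨r, hr⟩
    apply hρQ1
    rw [hr, map_mul, hρ1, zero_mul]
  · intro a ha
    rw [hker] at ha ⊢
    rw [map_mul] at ha
    exact (mul_eq_zero.1 ha).resolve_left hρQ0
  · intro a ha
    have hmem : ∀ F, F ∈ Ideal.span {e 0, e 1, Q 0} ↔ ρ (Q 0) ∣ ρ F := by
      intro F
      constructor
      · intro h
        obtain ⟨p, q, r, h⟩ := Submodule.mem_span_triple.1 h
        rw [← h]
        simp [hρ0, hρ1]
      · rintro ⟨r, hr⟩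
        have h1 : F - Q 0 * lam r ∈ Ideal.span {e 0, e 1} := by
          rw [hker, map_sub, map_mul, hr]
          have h3 : ρ (lam r) = r := by
            have : ρ.comp lam = AlgHom.id K _ := by
              apply MvPolynomial.algHom_ext
              intro i
              fin_cases i
              · simp only [lam, AlgHom.comp_apply]
                simpa using hlin 2
              · simp only [lam, AlgHom.comp_apply]
                simpa using hlin 3
            exact DFunLike.congr_fun this r
          rw [h3, sub_self]
        obtain ⟨p, q, h2⟩ := Ideal.mem_span_pair.1 h1
        refine Submodule.mem_span_triple.2 ⟨p, q, lam r, ?_⟩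
        simp only [smul_eq_mul]
        linear_combination h2
    rw [hmem] at ha ⊢
    rw [map_mul] at ha
    exact hrel.dvd_of_dvd_mul_left ha

end Cubic

section Hartogs

/-- Multiplication by `a` is injective modulo the ideal `I`. -/
def RegularMod {R : Type*} [CommRing R] (I : Ideal R) (a : R) : Prop := ∀ f, a * f ∈ I → f ∈ I

theorem mem_sup_span_singleton {R : Type*} [CommRing R] {I : Ideal R} {b x : R} :
    x ∈ I ⊔ Ideal.span {b} ↔ ∃ r, x - b * r ∈ I := by
  constructor
  · intro h
    obtain ⟨i, hi, y, hy, rfl⟩ := Submodule.mem_sup.1 h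
    obtain ⟨r, rfl⟩ := Ideal.mem_span_singleton.1 hy
    exact ⟨r, by simpa using hi⟩
  · rintro ⟨r, hr⟩
    have := Ideal.add_mem (I ⊔ Ideal.span {b}) (Ideal.mem_sup_left hr)
      (Ideal.mem_sup_right (Ideal.mul_mem_right r _ (Ideal.mem_span_singleton_self b)))
    simpa using this

theorem RegularMod.swap {R : Type*} [CommRing R] {I : Ideal R} {a b : R} (ha : RegularMod I a)
    (hb : RegularMod (I ⊔ Ideal.span {a}) b) : RegularMod (I ⊔ Ideal.span {b}) a := by
  intro f hf
  obtain ⟨g, hg⟩ := mem_sup_span_singleton.1 hf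
  have h1 : b * g ∈ I ⊔ Ideal.span {a} := mem_sup_span_singleton.2 ⟨f, by
    have := I.neg_mem hg
    convert this using 1; ring⟩
  obtain ⟨h, hh⟩ := mem_sup_span_singleton.1 (hb g h1)
  refine mem_sup_span_singleton.2 ⟨h, ha _ ?_⟩
  have := I.add_mem hg (I.mul_mem_left b hh)
  convert this using 1; ring

theorem RegularMod.pow {R : Type*} [CommRing R] {I : Ideal R} {a : R} (ha : RegularMod I a) (m : ℕ) :
    RegularMod I (a ^ m) := by
  induction m with
  | zero => intro f hf; simpa using hf
  | succ m ih =>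
    intro f hf
    apply ha f
    apply ih
    convert hf using 1; ring

open scoped Polynomial in
theorem regularMod_map_C {R : Type*} [CommRing R] {I : Ideal R} {a : R} (ha : RegularMod I a) :
    RegularMod (I.map PC) (PC a) := by
  intro f hf
  rw [Ideal.mem_map_C_iff] at hf ⊢
  intro n
  have := hf n
  rw [Polynomial.coeff_C_mul] at this
  exact ha _ this

open scoped Polynomial in
theorem regularMod_map_linear {R : Type*} [CommRing R] {I : Ideal R} {a b : R} (ha : RegularMod I a) :
    RegularMod (I.map PC) (PC a * PX - PC b) := by
  intro f hf
  rw [Ideal.mem_map_C_iff] at hf ⊢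
  have key : ∀ k n, f.natDegree < n + k → f.coeff n ∈ I := by
    intro k
    induction k with
    | zero => intro n hn; rw [Polynomial.coeff_eq_zero_of_natDegree_lt (by omega)]; exact I.zero_mem
    | succ k ih =>
      intro n hn
      have h1 := ih (n + 1) (by omega)
      have h2 := hf (n + 1)
      have h3 : ((PC a * PX - PC b) * f).coeff (n + 1) =
          a * f.coeff n - b * f.coeff (n + 1) := by
        have : (PC a * PX - PC b) * f =
          PC a * (f * PX) - PC b * f := by ring
        rw [this, Polynomial.coeff_sub, Polynomial.coeff_C_mul, Polynomial.coeff_C_mul, Polynomial.coeff_mul_X]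
      rw [h3] at h2
      apply ha
      have := I.add_mem h2 (I.mul_mem_left b h1)
      convert this using 1; ring
  intro n
  exact key (f.natDegree + 1) n (by omega)

variable {R : Type*} [CommRing R] [IsDomain R]

theorem Prime.regularMod {p a : R} (hp : Prime p) (ha : ¬ p ∣ a) : RegularMod (Ideal.span {p}) a := by
  intro f hf
  rw [Ideal.mem_span_singleton] at hf ⊢
  exact (hp.dvd_or_dvd hf).resolve_left ha

open scoped Polynomial in
/-- A function with a pole along the line `e₀ = e₁ = 0` on `e₀ Q₁ = e₁ Q₀` is a polynomial in
`w = Q₀ / e₀ = Q₁ / e₁`. -/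
theorem exists_polynomial_of_pole {e₀ e₁ Q₀ Q₁ : R} (hp : Prime e₀) (he : ¬ e₀ ∣ e₁) (hQ : ¬ e₀ ∣ Q₀)
    (h₀ : RegularMod (Ideal.span {e₀, e₁}) Q₀) (h₁ : RegularMod (Ideal.span {e₀, e₁, Q₀}) Q₁)
    {A B h : R} {m : ℕ} (hAB : e₁ ^ m * A - e₀ ^ m * B = (e₀ * Q₁ - e₁ * Q₀) * h) :
    ∃ T : R[X], PC A - PC e₀ ^ m * T ∈
        Ideal.span {PC e₀ * PX - PC Q₀, PC e₁ * PX - PC Q₁} ∧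
      PC B - PC e₁ ^ m * T ∈
        Ideal.span {PC e₀ * PX - PC Q₀, PC e₁ * PX - PC Q₁} := by
  set g₀ : R[X] := PC e₀ * PX - PC Q₀ with hg₀
  set g₁ : R[X] := PC e₁ * PX - PC Q₁ with hg₁
  set J : Ideal R[X] := Ideal.span {g₀, g₁} with hJ
  have hJ' : J = Ideal.span {g₀} ⊔ Ideal.span {g₁} := by rw [hJ, Ideal.span_insert]
  have hpC : Prime (PC e₀) := Polynomial.prime_C_iff.2 hp
  -- `e₁` modulo `(e₀, Q₀)`
  have r1 : RegularMod (Ideal.span {e₀} ⊔ Ideal.span {Q₀}) e₁ := by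
    apply RegularMod.swap (Prime.regularMod hp he)
    rwa [← Ideal.span_insert]
  have hsup : Ideal.span {g₀} ⊔ Ideal.span {PC e₀} =
      (Ideal.span {e₀} ⊔ Ideal.span {Q₀}).map PC := by
    rw [Ideal.map_sup, Ideal.map_span, Ideal.map_span, Set.image_singleton, Set.image_singleton]
    apply le_antisymm
    · refine sup_le ?_ le_sup_left
      rw [Ideal.span_singleton_le_iff_mem]
      exact Ideal.sub_mem _ (Ideal.mem_sup_left (Ideal.mul_mem_right _ _ (Ideal.mem_span_singleton_self _)))
        (Ideal.mem_sup_right (Ideal.mem_span_singleton_self _))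
    · refine sup_le le_sup_right ?_
      rw [Ideal.span_singleton_le_iff_mem]
      refine mem_sup_span_singleton.2 ⟨PX, ?_⟩
      have := (Ideal.span {g₀}).neg_mem (Ideal.mem_span_singleton_self g₀)
      convert this using 1; rw [hg₀]; ring
  have r3 : RegularMod (Ideal.span {g₀}) (PC e₀) := by
    have hb : RegularMod (⊥ : Ideal R[X]) (PC e₀) := by
      intro f hf
      rw [Ideal.mem_bot] at hf ⊢
      exact (mul_eq_zero.1 hf).resolve_left hpC.ne_zero
    have := hb.swap (b := g₀) (by
      rw [bot_sup_eq]
      apply Prime.regularMod hpC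
      rw [Polynomial.C_dvd_iff_dvd_coeff]
      intro h
      apply hQ
      have := h 0
      simpa [hg₀] using this)
    rwa [bot_sup_eq] at this
  have r4 : RegularMod ((Ideal.span {e₀} ⊔ Ideal.span {Q₀}).map PC) g₁ :=
    regularMod_map_linear r1
  have N1 : RegularMod J (PC e₀) := by
    rw [hJ']
    apply r3.swap
    rwa [hsup]
  have N2 : RegularMod (J ⊔ Ideal.span {PC e₀}) (PC e₁) := by
    have : J ⊔ Ideal.span {PC e₀} =
        (Ideal.span {e₀} ⊔ Ideal.span {Q₀}).map PC ⊔ Ideal.span {g₁} := by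
      rw [hJ', sup_right_comm, hsup]
    rw [this]
    apply (regularMod_map_C r1).swap
    have hI : (Ideal.span {e₀} ⊔ Ideal.span {Q₀}).map PC ⊔ Ideal.span {PC e₁} =
        (Ideal.span {e₀, e₁, Q₀}).map PC := by
      have : Ideal.span {e₀, e₁, Q₀} = (Ideal.span {e₀} ⊔ Ideal.span {Q₀}) ⊔ Ideal.span {e₁} := by
        rw [Ideal.span_insert, Ideal.span_insert, sup_assoc, sup_comm (Ideal.span {e₁})]
      rw [this, Ideal.map_sup _ (Ideal.span {e₀} ⊔ Ideal.span {Q₀}), Ideal.map_span _ {e₁}, Set.image_singleton]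
    intro f hf
    rw [hI] at hf ⊢
    apply regularMod_map_C h₁
    have h2 : PC e₁ ∈ (Ideal.span {e₀, e₁, Q₀}).map PC :=
      Ideal.mem_map_of_mem _ (Ideal.subset_span (by simp))
    have := Ideal.sub_mem _ (Ideal.mul_mem_right (PX * f) _ h2) hf
    convert this using 1; rw [hg₁]; ring
  have key : ∀ k (a : R[X]), PC e₁ ^ m * a ∈ J ⊔ Ideal.span {PC e₀ ^ k} →
      a ∈ J ⊔ Ideal.span {PC e₀ ^ k} := by
    intro k
    induction k with
    | zero => intro a _; simp
    | succ k ih =>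
      intro a ha
      obtain ⟨b, hb⟩ := mem_sup_span_singleton.1 ha
      have h1 : a ∈ J ⊔ Ideal.span {PC e₀} := by
        apply N2.pow m
        refine mem_sup_span_singleton.2 ⟨PC e₀ ^ k * b, ?_⟩
        convert hb using 1; ring
      obtain ⟨a', ha'⟩ := mem_sup_span_singleton.1 h1
      have h2 : PC e₁ ^ m * a' ∈ J ⊔ Ideal.span {PC e₀ ^ k} := by
        refine mem_sup_span_singleton.2 ⟨b, N1 _ ?_⟩
        have := J.sub_mem hb (J.mul_mem_left (PC e₁ ^ m) ha')
        convert this using 1; ring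
      obtain ⟨r, hr⟩ := mem_sup_span_singleton.1 (ih a' h2)
      refine mem_sup_span_singleton.2 ⟨r, ?_⟩
      have := J.add_mem ha' (J.mul_mem_left (PC e₀) hr)
      convert this using 1; ring
  have hc : PC (e₀ * Q₁ - e₁ * Q₀) ∈ J := by
    have := J.sub_mem (J.mul_mem_left (PC e₁) (Ideal.subset_span (by simp) : g₀ ∈ J))
      (J.mul_mem_left (PC e₀) (Ideal.subset_span (by simp) : g₁ ∈ J))
    convert this using 1
    rw [hg₀, hg₁]; simp only [map_sub, map_mul]; ring
  have hAB' : PC e₁ ^ m * PC A - PC e₀ ^ m * PC B ∈ J := by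
    have := J.mul_mem_right (PC h) hc
    convert this using 1
    rw [← map_mul, ← hAB]; simp
  obtain ⟨T, hT⟩ := mem_sup_span_singleton.1 (key m (PC A)
    (mem_sup_span_singleton.2 ⟨PC B, hAB'⟩))
  refine ⟨T, hT, N1.pow m _ ?_⟩
  have := J.sub_mem (J.mul_mem_left (PC e₁ ^ m) hT) hAB'
  convert this using 1; ring

end Hartogs

section Pencil

variable {k V : Type*} [Field k] [AddCommGroup V] [Module k V]

/-- The member with coordinates `R` of a pencil of quadratic forms. -/
def pencil (q : Fin 2 → QuadraticForm k V) (R : Fin 2 → k) : QuadraticForm k V :=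
  R 0 • q 0 + R 1 • q 1

theorem pencil_apply (q : Fin 2 → QuadraticForm k V) (R : Fin 2 → k) (v : V) :
    pencil q R v = R 0 * q 0 v + R 1 * q 1 v := rfl

theorem polar_pencil (q : Fin 2 → QuadraticForm k V) (R : Fin 2 → k) (v u : V) :
    polar (pencil q R) v u =
      R 0 * polar (q 0) v u + R 1 * polar (q 1) v u := by
  simp only [polar, pencil_apply]
  ring

theorem pencil_eq_zero {q : Fin 2 → QuadraticForm k V} {v : V} (h : ∀ i, q i v = 0) (R : Fin 2 → k) :
    pencil q R v = 0 := by
  simp [pencil_apply, h]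

/-- The base locus of the pencil is smooth. -/
def SmoothPencil (q : Fin 2 → QuadraticForm k V) : Prop :=
  ∀ v, v ≠ 0 → (∀ i, q i v = 0) → ∀ R : Fin 2 → k, R ≠ 0 → ∃ u, polar (pencil q R) v u ≠ 0

/-- The polar form as a functional of the second argument. -/
def polarLin (q : QuadraticForm k V) (v : V) : V →ₗ[k] k where
  toFun u := polar q v u
  map_add' := polar_add_right q v
  map_smul' r u := polar_smul_right q r v u

@[simp] theorem polarLin_apply (q : QuadraticForm k V) (v u : V) :
    polarLin q v u = polar q v u := rfl

end Pencil

section Surface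

variable {K L : Type*} [Field K] [Field L] [Algebra K L]

/-- The quadratic forms that define the surface. -/
noncomputable def QuarticDelPezzo.qf (S : QuarticDelPezzo K L) (i : Fin 2) :
    QuadraticForm L (Fin 5 → L) := evalQuad L (S.q i) (S.homogeneous i)

theorem QuarticDelPezzo.qf_apply (S : QuarticDelPezzo K L) (i : Fin 2) (v : Fin 5 → L) :
    S.qf i v = aeval v (S.q i) := rfl

theorem QuarticDelPezzo.polar_qf (S : QuarticDelPezzo K L) (i : Fin 2) (v u : Fin 5 → L) :
    polar (S.qf i) v u = diff (S.q i) v u := polar_evalQuad _ _ v u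

theorem QuarticDelPezzo.form_eq (S : QuarticDelPezzo K L) (R : Fin 2 → L) :
    S.form R = ⇑(pencil S.qf R) := by
  funext v
  simp [form, pencil_apply, qf_apply]

theorem QuarticDelPezzo.mk_mem_pts (S : QuarticDelPezzo K L) (v : Fin 5 → L) (hv : v ≠ 0) :
    pmk L v hv ∈ S.pts ↔ ∀ i, S.qf i v = 0 :=
  forall_congr' fun i => aeval_rep_eq_zero_iff (S.homogeneous i) v hv

theorem CubicSurface.mk_mem_pts (Y : CubicSurface K L) (x : Fin 4 → L) (hx : x ≠ 0) :
    pmk L x hx ∈ Y.pts ↔ aeval x Y.c = 0 :=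
  aeval_rep_eq_zero_iff Y.homogeneous x hx

theorem QuarticDelPezzo.smoothPencil (S : QuarticDelPezzo K L) : SmoothPencil S.qf := by
  intro v hv h R hR
  by_contra! hcon
  obtain ⟨a, ha, hrep⟩ := exists_rep_eq_smul v hv
  have hind := S.smooth _ ((S.mk_mem_pts v hv).2 h)
  rw [Fintype.linearIndependent_iff] at hind
  apply hR
  have := hind R (by
    funext j
    have h1 := hcon (Pi.single j 1)
    rw [polar_pencil, S.polar_qf, S.polar_qf] at h1
    have h2 : ∀ F : MvPolynomial (Fin 5) K, diff F v (Pi.single j 1) = aeval v (pderiv j F) := by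
      intro F; classical simp [diff, Pi.single_apply]
    rw [h2, h2] at h1
    simp only [sum_univ_two, Pi.add_apply, Pi.smul_apply, smul_eq_mul, Pi.zero_apply, hrep]
    rw [aeval_smul_of_isHomogeneous (S.homogeneous 0).pderiv,
      aeval_smul_of_isHomogeneous (S.homogeneous 1).pderiv]
    linear_combination a ^ (2 - 1) * h1)
  funext i
  exact this i

end Surface

section Sec

variable {K L : Type*} [Field K] [Field L] [Algebra K L] [IsAlgClosed L]
  {S : QuarticDelPezzo K L} {Y : CubicSurface K L} (B : BlowUp S Y)

/-- `x` represents a point of the cubic surface not on the exceptional line. -/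
def BlowUp.Off (x : Fin 4 → L) : Prop := x ≠ 0 ∧ aeval x Y.c = 0 ∧ ∃ i, aeval x (B.e i) ≠ 0

/-- A local representation of the blow up. -/
abbrev BlowUp.IsRep (d : ℕ) (F : Fin 5 → MvPolynomial (Fin 4) K) : Prop := IsRepOf Y.pts B.f d F

/-- The values of a family of polynomials. -/
noncomputable def evs {n m : ℕ} (F : Fin m → MvPolynomial (Fin n) K) (x : Fin n → L) : Fin m → L :=
  fun i => aeval x (F i)

/-- The differentials of a family of polynomials. -/
noncomputable def diffs {n m : ℕ} (F : Fin m → MvPolynomial (Fin n) K) (x a : Fin n → L) : Fin m → L :=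
  fun i => diff (F i) x a

theorem diffs_add {n m : ℕ} (F : Fin m → MvPolynomial (Fin n) K) (x a b : Fin n → L) :
    diffs F x (a + b) = diffs F x a + diffs F x b := funext fun i => diff_add_right (F i) x a b

theorem diffs_smul {n m : ℕ} (F : Fin m → MvPolynomial (Fin n) K) (x : Fin n → L) (r : L) (a : Fin n → L) :
    diffs F x (r • a) = r • diffs F x a := funext fun i => diff_smul_right (F i) x r a

theorem diffs_self {n m : ℕ} {F : Fin m → MvPolynomial (Fin n) K} {d : ℕ} (hF : ∀ i, (F i).IsHomogeneous d)
    (x : Fin n → L) : diffs F x x = (d : L) • evs F x := funext fun i => diff_self (hF i) x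

variable {B}

theorem BlowUp.mem_exceptional_iff (x : Fin 4 → L) (hx : x ≠ 0) :
    (∀ i, aeval x (B.e i) = 0) ↔
      (aeval x Y.c = 0 ∧ B.f (pmk L x hx) = B.center) := by
  have h1 : pmk L x hx ∈ zeros L B.e ↔ ∀ i, aeval x (B.e i) = 0 :=
    forall_congr' fun i => aeval_rep_eq_zero_iff (B.e_homogeneous i) x hx
  rw [← h1, B.exceptional, ← Y.mk_mem_pts x hx]
  rfl

theorem BlowUp.Off.f_ne {x : Fin 4 → L} (hx : B.Off x) :
    B.f (pmk L x hx.1) ≠ B.center := by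
  intro h
  obtain ⟨i, hi⟩ := hx.2.2
  exact hi ((BlowUp.mem_exceptional_iff x hx.1).2 ⟨hx.2.1, h⟩ i)

theorem BlowUp.Off.mem {x : Fin 4 → L} (hx : B.Off x) : pmk L x hx.1 ∈ Y.pts :=
  (Y.mk_mem_pts x hx.1).2 hx.2.1

theorem BlowUp.IsRep.qf_eq_zero {d : ℕ} {F : Fin 5 → MvPolynomial (Fin 4) K} (hF : B.IsRep d F)
    {x : Fin 4 → L} (hx : x ≠ 0) (hc : aeval x Y.c = 0) (i : Fin 2) : S.qf i (evs F x) = 0 := by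
  by_cases h : evs F x = 0
  · rw [h]; exact QuadraticMap.map_zero _
  · have hm := (Y.mk_mem_pts x hx).2 hc
    have := B.mapsTo hm
    rw [hF.eq x hx h hm] at this
    exact (S.mk_mem_pts _ h).1 this i

theorem BlowUp.IsRep.polar_eq_zero {d : ℕ} {F : Fin 5 → MvPolynomial (Fin 4) K} (hF : B.IsRep d F)
    {x a : Fin 4 → L} (hx : x ≠ 0) (hc : aeval x Y.c = 0) (ha : diff Y.c x a = 0) (i : Fin 2) :
    polar (S.qf i) (evs F x) (diffs F x a) = 0 := by
  have h := Y.diff_eq_zero (F := aeval F (S.q i)) (fun y hy hyc => by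
    have h1 := hF.qf_eq_zero hy hyc i
    rw [S.qf_apply] at h1
    have h2 := comp_aeval_apply (R := K) F (aeval y : MvPolynomial (Fin 4) K →ₐ[K] L) (S.q i)
    rw [h2]
    exact h1) hx hc ha
  rw [diff_aeval] at h
  rw [S.polar_qf]
  exact h

theorem BlowUp.IsRep.minors {d d' : ℕ} {F F' : Fin 5 → MvPolynomial (Fin 4) K} (hF : B.IsRep d F)
    (hF' : B.IsRep d' F') {x : Fin 4 → L} (hx : x ≠ 0) (hc : aeval x Y.c = 0) (i j : Fin 5) :
    evs F x i * evs F' x j = evs F x j * evs F' x i := by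
  by_cases h : evs F x = 0
  · simp [h]
  by_cases h' : evs F' x = 0
  · simp [h']
  have hm := (Y.mk_mem_pts x hx).2 hc
  have := (hF.eq x hx h hm).symm.trans (hF'.eq x hx h' hm)
  obtain ⟨a, -, ha⟩ := exists_smul_of_mk_eq_mk this
  change evs F x = a • evs F' x at ha
  rw [ha]
  simp only [Pi.smul_apply, smul_eq_mul]
  ring

theorem BlowUp.IsRep.diffs_sub {d d' : ℕ} {F F' : Fin 5 → MvPolynomial (Fin 4) K} (hF : B.IsRep d F)
    (hF' : B.IsRep d' F') {x a : Fin 4 → L} (hx : x ≠ 0) (hc : aeval x Y.c = 0)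
    (ha : diff Y.c x a = 0) (h' : evs F' x ≠ 0) {r : L} (hr : evs F x = r • evs F' x) :
    ∃ s : L, diffs F x a = r • diffs F' x a + s • evs F' x := by
  have h1 : ∃ s : L, diffs F x a - r • diffs F' x a = s • evs F' x := by
    apply exists_smul_of_minors h'
    intro i j
    have h := Y.diff_eq_zero (F := F i * F' j - F j * F' i) (fun y hy hyc => by
      have := hF.minors hF' hy hyc i j
      simp only [evs] at this
      simp [this]) hx hc ha
    have e1 : ∀ i, aeval x (F i) = r * aeval x (F' i) := fun i => congrFun hr i
    simp only [diff_sub, diff_mul, e1] at h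
    simp only [Pi.sub_apply, Pi.smul_apply, smul_eq_mul, diffs, evs]
    linear_combination h
  obtain ⟨s, hs⟩ := h1
  exact ⟨s, by rw [← hs]; abel⟩

/-- The blow up is unramified away from the exceptional line. -/
theorem BlowUp.IsRep.exists_eq_smul {d : ℕ} {F : Fin 5 → MvPolynomial (Fin 4) K} (hF : B.IsRep d F)
    {x a : Fin 4 → L} (hx : B.Off x) (ha : diff Y.c x a = 0) (h0 : evs F x ≠ 0) {r : L}
    (hr : diffs F x a = r • evs F x) : ∃ t : L, a = t • x := by
  obtain ⟨u, hsrc, htgt, heq, -, hreg⟩ := B.iso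
  have hsym : ∀ y (hy : B.Off y), u.symm (B.f (pmk L y hy.1)) = pmk L y hy.1 := by
    intro y hy
    have hs : pmk L y hy.1 ∈ u.source := by
      rw [hsrc]; exact ⟨hy.mem, hy.f_ne⟩
    rw [← heq hs]
    exact u.left_inv hs
  have htg : ∀ y (hy : B.Off y), B.f (pmk L y hy.1) ∈ u.target := by
    intro y hy
    rw [htgt]
    exact ⟨B.mapsTo hy.mem, hy.f_ne⟩
  have hfx : B.f (pmk L x hx.1) = pmk L (evs F x) h0 :=
    hF.eq x hx.1 h0 hx.mem
  obtain ⟨dG, G, hG, hG0⟩ := hreg.exists_rep (evs F x) h0 (by rw [← hfx]; exact htg x hx)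
  obtain ⟨l, hl⟩ := hx.2.2
  obtain ⟨k, hk⟩ := Function.ne_iff.1 h0
  have hcomp : ∀ (y : Fin 4 → L) i, aeval y (aeval F (G i)) = aeval (evs F y) (G i) := fun y i =>
    comp_aeval_apply (R := K) F (aeval y : MvPolynomial (Fin 4) K →ₐ[K] L) (G i)
  have hprop : ∀ y (hy : B.Off y), evs F y ≠ 0 → ∀ i j,
      aeval (evs F y) (G i) * y j = aeval (evs F y) (G j) * y i := by
    intro y hy hFy i j
    by_cases hGy : (fun i => aeval (evs F y) (G i)) = 0
    · have := fun i => congrFun hGy i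
      simp only [Pi.zero_apply] at this
      rw [this, this]; simp
    · have hfy : B.f (pmk L y hy.1) = pmk L (evs F y) hFy :=
        hF.eq y hy.1 hFy hy.mem
      have h1 := hsym y hy
      rw [hfy, hG.eq _ hFy hGy (by rw [← hfy]; exact htg y hy)] at h1
      obtain ⟨t, -, ht⟩ := exists_smul_of_mk_eq_mk h1
      have := fun i => congrFun ht i
      simp only [Pi.smul_apply, smul_eq_mul] at this
      rw [this, this]; ring
  have hGx : ∃ m : L, m ≠ 0 ∧ ∀ i, aeval (evs F x) (G i) = m * x i := by
    have h1 := hsym x hx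
    rw [hfx, hG.eq _ h0 hG0 (by rw [← hfx]; exact htg x hx)] at h1
    obtain ⟨t, ht0, ht⟩ := exists_smul_of_mk_eq_mk h1
    exact ⟨t, ht0, fun i => congrFun ht i⟩
  obtain ⟨m, hm0, hm⟩ := hGx
  apply exists_smul_of_minors hx.1
  intro i j
  have h := Y.diff_eq_zero (F := B.e l * F k * (aeval F (G i) * X j - aeval F (G j) * X i))
    (fun y hy hyc => by
      by_cases hel : aeval y (B.e l) = 0
      · simp [hel]
      by_cases hFy : evs F y = 0
      · have : aeval y (F k) = 0 := congrFun hFy k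
        simp [this]
      have := hprop y ⟨hy, hyc, l, hel⟩ hFy i j
      simp only [map_mul, map_sub, hcomp, aeval_X, this, sub_self, mul_zero])
    hx.1 hx.2.1 ha
  have hdG : ∀ i, diff (aeval F (G i)) x a = r * (dG * (m * x i)) := by
    intro i
    rw [diff_aeval]
    have : (fun i => diff (F i) x a) = r • evs F x := hr
    rw [this]
    change diff (G i) (evs F x) (r • evs F x) = _
    rw [diff_smul_right, diff_self (hG.hom i), hm]
  have hz : aeval x (aeval F (G i) * X j - aeval F (G j) * X i) = 0 := by
    rw [map_sub, map_mul, map_mul, hcomp, hcomp, aeval_X, aeval_X, hm, hm]; ring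
  rw [diff_mul, hz, zero_mul, add_zero, diff_sub, diff_mul, diff_mul, hdG, hdG, diff_X, diff_X, hcomp,
    hcomp, hm, hm, aeval_X, aeval_X] at h
  have h2 := (mul_eq_zero.1 h).resolve_left (by
    rw [map_mul]; exact mul_ne_zero hl hk)
  have h3 : m * (a i * x j - a j * x i) = 0 := by linear_combination -h2
  have := (mul_eq_zero.1 h3).resolve_left hm0
  linear_combination this

end Sec

section Determinants

variable {L : Type*} [Field L]

/-- The determinant of a family of row vectors. -/
def rowDet {n : ℕ} (v : Fin n → Fin n → L) : L := (Matrix.of v).det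

theorem rowDet_comb {n : ℕ} {v w : Fin n → Fin n → L} (C : Matrix (Fin n) (Fin n) L)
    (h : ∀ i, v i = ∑ j, C i j • w j) : rowDet v = C.det * rowDet w := by
  rw [rowDet, rowDet, ← Matrix.det_mul]
  congr 1
  ext i l
  simp [h i, Matrix.mul_apply, Finset.sum_apply]

theorem exists_comb_of_rowDet_ne_zero {n : ℕ} {w : Fin n → Fin n → L} (hw : rowDet w ≠ 0)
    (v : Fin n → L) : ∃ c : Fin n → L, v = ∑ j, c j • w j := by
  refine ⟨Matrix.vecMul v (Matrix.of w)⁻¹, ?_⟩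
  have h : Matrix.vecMul (Matrix.vecMul v (Matrix.of w)⁻¹) (Matrix.of w) = v := by
    rw [Matrix.vecMul_vecMul, Matrix.nonsing_inv_mul _ (Ne.isUnit hw), Matrix.vecMul_one]
  conv_lhs => rw [← h]
  funext l
  simp [Matrix.vecMul, dotProduct, Finset.sum_apply]

theorem rowDet_ne_zero_of_comb {n : ℕ} {w : Fin n → Fin n → L}
    (h : ∀ c : Fin n → L, ∑ j, c j • w j = 0 → c = 0) : rowDet w ≠ 0 := by
  intro h0
  obtain ⟨c, hc, hcw⟩ := Matrix.exists_vecMul_eq_zero_iff.2 h0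
  apply hc
  apply h
  rw [← hcw]
  funext l
  simp [Matrix.vecMul, dotProduct, Finset.sum_apply]

theorem rowDet_comb_four {x a b n a' b' n' : Fin 4 → L} {α β ν : Fin 4 → L} (hα : α 3 = 0) (hβ : β 3 = 0)
    (ha : a = ∑ j, α j • ![x, a', b', n'] j) (hb : b = ∑ j, β j • ![x, a', b', n'] j)
    (hn : n = ∑ j, ν j • ![x, a', b', n'] j) :
    rowDet ![x, a, b, n] = (α 1 * β 2 - α 2 * β 1) * ν 3 * rowDet ![x, a', b', n'] := by
  rw [rowDet_comb (w := ![x, a', b', n']) (Matrix.of ![![1, 0, 0, 0], α, β, ν])]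
  · congr 1
    simp [Matrix.det_succ_row_zero, Fin.sum_univ_succ, Fin.succAbove, hα, hβ]
    ring
  · intro i
    fin_cases i
    · simp [sum_univ_four]
    · simpa using ha
    · simpa using hb
    · simpa using hn

theorem rowDet_comb_five {y a b n m a' b' n' m' : Fin 5 → L} {α β ν μ : Fin 5 → L}
    (hα : α 3 = 0) (hβ : β 3 = 0) (hα' : α 4 = 0) (hβ' : β 4 = 0)
    (ha : a = ∑ j, α j • ![y, a', b', n', m'] j) (hb : b = ∑ j, β j • ![y, a', b', n', m'] j)
    (hn : n = ∑ j, ν j • ![y, a', b', n', m'] j) (hm : m = ∑ j, μ j • ![y, a', b', n', m'] j) :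
    rowDet ![y, a, b, n, m] = (α 1 * β 2 - α 2 * β 1) * (ν 3 * μ 4 - ν 4 * μ 3) *
      rowDet ![y, a', b', n', m'] := by
  rw [rowDet_comb (w := ![y, a', b', n', m']) (Matrix.of ![![1, 0, 0, 0, 0], α, β, ν, μ])]
  · congr 1
    simp [Matrix.det_succ_row_zero, Fin.sum_univ_succ, Fin.succAbove, hα, hβ, hα', hβ']
    ring
  · intro i
    fin_cases i
    · simp [sum_univ_five]
    · simpa using ha
    · simpa using hb
    · simpa using hn
    · simpa using hm

theorem exists_rowDet_tangent (x γ : Fin 4 → L) {k l : Fin 4} (hkl : k ≠ l) (hk : γ k ≠ 0) (hl : x l ≠ 0) :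
    ∃ i j, rowDet ![x, γ k • Pi.single i 1 - γ i • Pi.single k 1,
      γ k • Pi.single j 1 - γ j • Pi.single k 1, Pi.single k 1] ≠ 0 := by
  obtain ⟨i, j, hij, hik, hil, hjk, hjl⟩ : ∃ i j : Fin 4, i ≠ j ∧ i ≠ k ∧ i ≠ l ∧ j ≠ k ∧ j ≠ l := by
    have : ∀ k l : Fin 4, k ≠ l → ∃ i j : Fin 4, i ≠ j ∧ i ≠ k ∧ i ≠ l ∧ j ≠ k ∧ j ≠ l := by decide
    exact this k l hkl
  refine ⟨i, j, rowDet_ne_zero_of_comb fun c hc => ?_⟩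
  have h := fun p => congrFun hc p
  simp only [sum_univ_four, cons_val, Pi.add_apply, Pi.smul_apply, Pi.sub_apply,
    Pi.single_apply, smul_eq_mul, Pi.zero_apply] at h
  have h0 : c 0 = 0 := by
    have := h l
    simp only [hil.symm, hjl.symm, hkl.symm, if_false] at this
    simpa [hl] using this
  have h1 : c 1 = 0 := by
    have := h i
    simp only [h0, hij, hik, if_false, if_true] at this
    simpa [hk] using this
  have h2 : c 2 = 0 := by
    have := h j
    simp only [h0, hij.symm, hjk, if_false, if_true] at this
    simpa [hk] using this
  have h3 : c 3 = 0 := by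
    have := h k
    simpa [h0, h1, h2] using this
  funext p
  fin_cases p <;> assumption

end Determinants

section Section

variable {K L : Type*} [Field K] [Field L] [Algebra K L] [IsAlgClosed L]
  {S : QuarticDelPezzo K L} {Y : CubicSurface K L} (B : BlowUp S Y)

/-- The determinant of the differentials of the two equations of `S` at `y` on two vectors. -/
noncomputable def QuarticDelPezzo.dq (S : QuarticDelPezzo K L) (y n m : Fin 5 → L) : L :=
  polar (S.qf 0) y n * polar (S.qf 1) y m -
    polar (S.qf 0) y m * polar (S.qf 1) y n

/-- `s` is the value at `x` of the lift of the blow up to vectors, homogeneous of degree one, which is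
defined by comparing the residues of the standard volume forms. -/
def BlowUp.IsSec (x : Fin 4 → L) (s : Fin 5 → L) : Prop :=
  ∀ d F, B.IsRep d F → ∀ a b, diff Y.c x a = 0 → diff Y.c x b = 0 → ∀ n n₁ n₂,
    (rowDet ![evs F x, diffs F x a, diffs F x b, n₁, n₂] * diff Y.c x n) • s =
      (rowDet ![x, a, b, n] * S.dq (evs F x) n₁ n₂) • evs F x

variable {B}

theorem QuarticDelPezzo.exists_dq_ne_zero (S : QuarticDelPezzo K L) {y : Fin 5 → L} (hy : y ≠ 0)
    (h : ∀ i, S.qf i y = 0) : ∃ i j, S.dq y (Pi.single i 1) (Pi.single j 1) ≠ 0 := by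
  by_contra! hcon
  have hlin : ∀ (i : Fin 2) u, polar (S.qf i) y u =
      ∑ j, polar (S.qf i) y (Pi.single j 1) * u j := by
    intro i u
    have := (polarLin (S.qf i) y).pi_apply_eq_sum_univ u
    simp only [polarLin_apply, smul_eq_mul] at this
    rw [this]
    refine Finset.sum_congr rfl fun j _ => ?_
    rw [mul_comm]
    congr 2
    funext l
    simp [Pi.single_apply, eq_comm]
  have h1 : (fun j => polar (S.qf 1) y (Pi.single j 1)) ≠ 0 := by
    intro h0
    obtain ⟨u, hu⟩ := S.smoothPencil y hy h ![0, 1] (by intro h; simpa using congrFun h 1)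
    apply hu
    rw [polar_pencil, hlin 1]
    have := fun j => congrFun h0 j
    simp only [Pi.zero_apply] at this
    simp [this]
  obtain ⟨t, ht⟩ := exists_smul_of_minors
    (x := fun j => polar (S.qf 0) y (Pi.single j 1)) h1 (fun i j => by
      have := hcon i j
      unfold dq at this
      linear_combination this)
  obtain ⟨u, hu⟩ := S.smoothPencil y hy h ![1, -t] (by intro h; simpa using congrFun h 0)
  apply hu
  rw [polar_pencil, hlin 0, hlin 1]
  have := fun j => congrFun ht j
  simp only [Pi.smul_apply, smul_eq_mul] at this
  simp [this, Finset.mul_sum, mul_assoc]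

/-- A base point for the determination of the lift. -/
structure BlowUp.Frame (B : BlowUp S Y) (x : Fin 4 → L) (d : ℕ) (F : Fin 5 → MvPolynomial (Fin 4) K)
    (a b n : Fin 4 → L) (n₁ n₂ : Fin 5 → L) : Prop where
  rep : B.IsRep d F
  ha : diff Y.c x a = 0
  hb : diff Y.c x b = 0
  hn : diff Y.c x n ≠ 0
  det : rowDet ![x, a, b, n] ≠ 0
  dq : S.dq (evs F x) n₁ n₂ ≠ 0
  ne : evs F x ≠ 0

theorem BlowUp.Frame.rowDet_ne_zero {x : Fin 4 → L} (hx : B.Off x) {d : ℕ}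
    {F : Fin 5 → MvPolynomial (Fin 4) K} {a b n : Fin 4 → L} {n₁ n₂ : Fin 5 → L}
    (h : B.Frame x d F a b n n₁ n₂) :
    rowDet ![evs F x, diffs F x a, diffs F x b, n₁, n₂] ≠ 0 := by
  apply rowDet_ne_zero_of_comb
  intro c hc
  have hq : ∀ i, c 3 * polar (S.qf i) (evs F x) n₁ +
      c 4 * polar (S.qf i) (evs F x) n₂ = 0 := by
    intro i
    have h1 := congrArg (polarLin (S.qf i) (evs F x)) hc
    simp only [sum_univ_five, cons_val, map_add, map_smul, polarLin_apply, map_zero] at h1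
    rw [polar_self, h.rep.qf_eq_zero hx.1 hx.2.1,
      h.rep.polar_eq_zero hx.1 hx.2.1 h.ha, h.rep.polar_eq_zero hx.1 hx.2.1 h.hb] at h1
    simpa using h1
  have hdq := h.dq
  unfold QuarticDelPezzo.dq at hdq
  have h3 : c 3 = 0 := by
    apply (mul_eq_zero.1 (_ : c 3 * _ = 0)).resolve_right hdq
    linear_combination polar (S.qf 1) (evs F x) n₂ * hq 0 -
      polar (S.qf 0) (evs F x) n₂ * hq 1
  have h4 : c 4 = 0 := by
    apply (mul_eq_zero.1 (_ : c 4 * _ = 0)).resolve_right hdq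
    linear_combination polar (S.qf 0) (evs F x) n₁ * hq 1 -
      polar (S.qf 1) (evs F x) n₁ * hq 0
  simp only [sum_univ_five, cons_val, h3, h4, zero_smul, add_zero] at hc
  obtain ⟨t, ht⟩ := h.rep.exists_eq_smul (a := c 1 • a + c 2 • b) (r := -c 0) hx (by
    rw [diff_add_right, diff_smul_right, diff_smul_right, h.ha, h.hb]; ring) h.ne (by
    rw [diffs_add, diffs_smul, diffs_smul, neg_smul]
    rw [add_assoc] at hc
    exact eq_neg_of_add_eq_zero_right hc)
  have hli : LinearIndependent L ![x, a, b, n] :=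
    Matrix.linearIndependent_rows_of_det_ne_zero h.det
  have := Fintype.linearIndependent_iff.1 hli ![-t, c 1, c 2, 0] (by
    simp only [sum_univ_four, cons_val, zero_smul, add_zero, neg_smul]
    rw [add_assoc, ht]; simp)
  have h1 := this 1
  have h2 := this 2
  simp only [cons_val] at h1 h2
  rw [h1, h2] at hc
  simp only [zero_smul, add_zero, smul_eq_zero, h.ne, or_false] at hc
  funext p
  fin_cases p <;> assumption

theorem BlowUp.Frame.isSec {x : Fin 4 → L} (hx : B.Off x) {d : ℕ}
    {F : Fin 5 → MvPolynomial (Fin 4) K} {a b n : Fin 4 → L} {n₁ n₂ : Fin 5 → L}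
    (h : B.Frame x d F a b n n₁ n₂) :
    B.IsSec x ((rowDet ![x, a, b, n] * S.dq (evs F x) n₁ n₂ /
      (rowDet ![evs F x, diffs F x a, diffs F x b, n₁, n₂] * diff Y.c x n)) • evs F x) := by
  have hD := h.rowDet_ne_zero hx
  have hn := h.hn
  have main : ∀ a' b', diff Y.c x a' = 0 → diff Y.c x b' = 0 → ∀ n' n₁' n₂',
      (rowDet ![evs F x, diffs F x a', diffs F x b', n₁', n₂'] * diff Y.c x n') *
        (rowDet ![x, a, b, n] * S.dq (evs F x) n₁ n₂) =
      (rowDet ![x, a', b', n'] * S.dq (evs F x) n₁' n₂') *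
       (rowDet ![evs F x, diffs F x a, diffs F x b, n₁, n₂] * diff Y.c x n) := by
    intro a' b' ha' hb' n' n₁' n₂'
    have key4 : ∀ v, ∃ c : Fin 4 → L, v = ∑ j, c j • ![x, a, b, n] j ∧
        diff Y.c x v = c 3 * diff Y.c x n := by
      intro v
      obtain ⟨c, hc⟩ := exists_comb_of_rowDet_ne_zero h.det v
      refine ⟨c, hc, ?_⟩
      rw [hc]
      simp only [sum_univ_four, cons_val, diff_add_right, diff_smul_right, h.ha, h.hb,
        diff_self Y.homogeneous, hx.2.1]
      ring
    have key5 : ∀ v, ∃ c : Fin 5 → L, v = ∑ j, c j • ![evs F x, diffs F x a, diffs F x b, n₁, n₂] j ∧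
        ∀ i, polar (S.qf i) (evs F x) v =
          c 3 * polar (S.qf i) (evs F x) n₁ + c 4 * polar (S.qf i) (evs F x) n₂ := by
      intro v
      obtain ⟨c, hc⟩ := exists_comb_of_rowDet_ne_zero hD v
      refine ⟨c, hc, fun i => ?_⟩
      have h1 := congrArg (polarLin (S.qf i) (evs F x)) hc
      simp only [sum_univ_five, cons_val, map_add, map_smul, polarLin_apply] at h1
      rw [polar_self, h.rep.qf_eq_zero hx.1 hx.2.1,
        h.rep.polar_eq_zero hx.1 hx.2.1 h.ha, h.rep.polar_eq_zero hx.1 hx.2.1 h.hb] at h1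
      simpa using h1
    obtain ⟨α, hα, hα3⟩ := key4 a'
    obtain ⟨β, hβ, hβ3⟩ := key4 b'
    obtain ⟨ν, hν, hν3⟩ := key4 n'
    obtain ⟨μ₁, hμ₁, hμ₁q⟩ := key5 n₁'
    obtain ⟨μ₂, hμ₂, hμ₂q⟩ := key5 n₂'
    rw [ha', zero_eq_mul, or_iff_left hn] at hα3
    rw [hb', zero_eq_mul, or_iff_left hn] at hβ3
    have hda : ∀ (α : Fin 4 → L), α 3 = 0 → ∀ a', a' = ∑ j, α j • ![x, a, b, n] j →
        diffs F x a' = ∑ j, ![α 0 * d, α 1, α 2, 0, 0] j •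
          ![evs F x, diffs F x a, diffs F x b, n₁, n₂] j := by
      intro α hα a' ha'
      rw [ha']
      simp only [sum_univ_four, sum_univ_five, cons_val, diffs_add, diffs_smul, hα,
        diffs_self h.rep.hom, smul_smul, zero_smul, add_zero]
    rw [rowDet_comb_four hα3 hβ3 hα hβ hν,
      rowDet_comb_five (by simp) (by simp) (by simp) (by simp) (hda α hα3 _ hα) (hda β hβ3 _ hβ) hμ₁ hμ₂]
    unfold QuarticDelPezzo.dq
    simp only [hμ₁q, hμ₂q, hν3, cons_val]
    ring
  intro d' F' hF' a' b' ha' hb' n' n₁' n₂'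
  obtain ⟨r, hr⟩ := exists_smul_of_minors (x := evs F' x) h.ne (hF'.minors h.rep hx.1 hx.2.1)
  obtain ⟨s₁, hs₁⟩ := hF'.diffs_sub h.rep hx.1 hx.2.1 ha' h.ne hr
  obtain ⟨s₂, hs₂⟩ := hF'.diffs_sub h.rep hx.1 hx.2.1 hb' h.ne hr
  have hdet : rowDet ![evs F' x, diffs F' x a', diffs F' x b', n₁', n₂'] = r ^ 3 *
      rowDet ![evs F x, diffs F x a', diffs F x b', n₁', n₂'] := by
    rw [rowDet_comb (w := ![evs F x, diffs F x a', diffs F x b', n₁', n₂'])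
      (Matrix.of ![![r, 0, 0, 0, 0], ![s₁, r, 0, 0, 0], ![s₂, 0, r, 0, 0], ![0, 0, 0, 1, 0], ![0, 0, 0, 0, 1]])]
    · congr 1
      simp [Matrix.det_succ_row_zero, Fin.sum_univ_succ, Fin.succAbove]
      ring
    · intro i
      fin_cases i
      · simp [sum_univ_five, hr]
      · simp [sum_univ_five, hs₁, add_comm]
      · simp [sum_univ_five, hs₂, add_comm]
      · simp [sum_univ_five]
      · simp [sum_univ_five]
  have hdq : S.dq (evs F' x) n₁' n₂' = r ^ 2 * S.dq (evs F x) n₁' n₂' := by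
    unfold QuarticDelPezzo.dq
    rw [hr]
    simp only [polar_smul_left, smul_eq_mul]
    ring
  rw [hdet, hdq, hr, smul_smul, smul_smul]
  congr 1
  field_simp
  linear_combination r ^ 3 * main a' b' ha' hb' n' n₁' n₂'

end Section

section Section

variable {K L : Type*} [Field K] [Field L] [Algebra K L] [IsAlgClosed L]
  {S : QuarticDelPezzo K L} {Y : CubicSurface K L} {B : BlowUp S Y}

theorem BlowUp.Frame.smul_eq {x : Fin 4 → L} {d : ℕ}
    {F : Fin 5 → MvPolynomial (Fin 4) K} {a b n : Fin 4 → L} {n₁ n₂ : Fin 5 → L}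
    (h : B.Frame x d F a b n n₁ n₂) {s : Fin 5 → L} (hs : B.IsSec x s) :
    (rowDet ![evs F x, diffs F x a, diffs F x b, n₁, n₂] * diff Y.c x n) • s =
      (rowDet ![x, a, b, n] * S.dq (evs F x) n₁ n₂) • evs F x :=
  hs d F h.rep a b h.ha h.hb n n₁ n₂

theorem diff_single {n : ℕ} (F : MvPolynomial (Fin n) K) (x : Fin n → L) (j : Fin n) :
    diff F x (Pi.single j 1) = aeval x (pderiv j F) := by
  classical simp [diff, Pi.single_apply]

/-- The polynomial tangent vector field along the surface in the directions of two coordinates. -/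
noncomputable def CubicSurface.tangentField (Y : CubicSurface K L) (k i : Fin 4) :
    Fin 4 → MvPolynomial (Fin 4) K :=
  fun p => pderiv k Y.c * Pi.single (M := fun _ => MvPolynomial (Fin 4) K) i 1 p -
    pderiv i Y.c * Pi.single (M := fun _ => MvPolynomial (Fin 4) K) k 1 p

theorem CubicSurface.evs_tangentField (Y : CubicSurface K L) (k i : Fin 4) (x : Fin 4 → L) :
    evs (Y.tangentField k i) x = diff Y.c x (Pi.single k 1) • Pi.single i 1 -
      diff Y.c x (Pi.single i 1) • Pi.single k 1 := by
  funext p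
  simp only [evs, tangentField, diff_single, map_sub, map_mul, Pi.sub_apply, Pi.smul_apply, smul_eq_mul]
  congr 2 <;> (rw [Pi.single_apply, Pi.single_apply]; split_ifs <;> simp)

theorem CubicSurface.diff_tangentField (Y : CubicSurface K L) (k i : Fin 4) (x : Fin 4 → L) :
    diff Y.c x (evs (Y.tangentField k i) x) = 0 := by
  rw [evs_tangentField, sub_eq_add_neg, diff_add_right, ← neg_smul, diff_smul_right, diff_smul_right]
  ring

theorem BlowUp.exists_frame {x : Fin 4 → L} (hx : B.Off x) {d : ℕ}
    {F : Fin 5 → MvPolynomial (Fin 4) K} (hF : B.IsRep d F) (h : evs F x ≠ 0) :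
    ∃ i j k m n, B.Frame x d F (evs (Y.tangentField k i) x) (evs (Y.tangentField k j) x)
      (Pi.single k 1) (Pi.single m 1) (Pi.single n 1) := by
  obtain ⟨m, n, hmn⟩ := S.exists_dq_ne_zero h (hF.qf_eq_zero hx.1 hx.2.1)
  obtain ⟨l, hl⟩ := Function.ne_iff.1 hx.1
  have hk : ∃ k, k ≠ l ∧ diff Y.c x (Pi.single k 1) ≠ 0 := by
    by_contra! hcon
    have h1 : diff Y.c x (Pi.single l 1) = 0 := by
      have := diff_self Y.homogeneous x
      rw [hx.2.1, mul_zero, diff, Finset.sum_eq_single l] at this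
      · rw [diff_single]
        exact (mul_eq_zero.1 this).resolve_right hl
      · intro k _ hk
        rw [← diff_single, hcon k hk, zero_mul]
      · simp
    obtain ⟨a, ha⟩ := Y.smooth_diff hx.1 hx.2.1
    apply ha
    rw [diff]
    refine Finset.sum_eq_zero fun k _ => ?_
    rw [← diff_single]
    rcases eq_or_ne k l with rfl | hk
    · rw [h1, zero_mul]
    · rw [hcon k hk, zero_mul]
  obtain ⟨k, hkl, hk⟩ := hk
  obtain ⟨i, j, hij⟩ := exists_rowDet_tangent x (fun k => diff Y.c x (Pi.single k 1)) hkl hk hl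
  refine ⟨i, j, k, m, n, hF, Y.diff_tangentField k i x, Y.diff_tangentField k j x, hk, ?_, hmn, h⟩
  rw [Y.evs_tangentField, Y.evs_tangentField]
  exact hij

theorem BlowUp.exists_rep {x : Fin 4 → L} (hx : B.Off x) :
    ∃ d F, B.IsRep d F ∧ evs F x ≠ 0 :=
  B.regular.exists_rep x hx.1 hx.mem

theorem BlowUp.exists_isSec {x : Fin 4 → L} (hx : B.Off x) : ∃ s, B.IsSec x s := by
  obtain ⟨d, F, hF, h⟩ := BlowUp.exists_rep hx
  obtain ⟨i, j, k, m, n, hf⟩ := BlowUp.exists_frame hx hF h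
  exact ⟨_, hf.isSec hx⟩

theorem BlowUp.IsSec.unique {x : Fin 4 → L} (hx : B.Off x) {s t : Fin 5 → L} (hs : B.IsSec x s)
    (ht : B.IsSec x t) : s = t := by
  obtain ⟨d, F, hF, h⟩ := BlowUp.exists_rep hx
  obtain ⟨i, j, k, m, n, hf⟩ := BlowUp.exists_frame hx hF h
  exact smul_right_injective _ (mul_ne_zero (hf.rowDet_ne_zero hx) hf.hn)
    ((hf.smul_eq hs).trans (hf.smul_eq ht).symm)

theorem BlowUp.IsSec.f_eq {x : Fin 4 → L} (hx : B.Off x) {s : Fin 5 → L} (hs : B.IsSec x s) :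
    ∃ h : s ≠ 0, B.f (pmk L x hx.1) = pmk L s h := by
  obtain ⟨d, F, hF, h⟩ := BlowUp.exists_rep hx
  obtain ⟨i, j, k, m, n, hf⟩ := BlowUp.exists_frame hx hF h
  have h1 := hf.smul_eq hs
  have h2 := mul_ne_zero (hf.rowDet_ne_zero hx) hf.hn
  have h3 := mul_ne_zero hf.det hf.dq
  have hs0 : s ≠ 0 := by
    rintro rfl
    rw [smul_zero] at h1
    exact smul_ne_zero h3 h h1.symm
  refine ⟨hs0, ?_⟩
  rw [hF.eq x hx.1 h hx.mem]
  have h4 : evs F x = ((rowDet ![x, evs (Y.tangentField k i) x, evs (Y.tangentField k j) x, Pi.single k 1] *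
      S.dq (evs F x) (Pi.single m 1) (Pi.single n 1))⁻¹ *
      (rowDet ![evs F x, diffs F x (evs (Y.tangentField k i) x), diffs F x (evs (Y.tangentField k j) x),
        Pi.single m 1, Pi.single n 1] * diff Y.c x (Pi.single k 1))) • s := by
    have := congrArg (fun v => (rowDet ![x, evs (Y.tangentField k i) x, evs (Y.tangentField k j) x, Pi.single k 1] *
      S.dq (evs F x) (Pi.single m 1) (Pi.single n 1))⁻¹ • v) h1
    simp only [smul_smul] at this
    rw [inv_mul_cancel₀ h3, one_smul] at this
    exact this.symm
  exact mk_eq_mk_of_smul _ _ h4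

theorem BlowUp.Off.smul {x : Fin 4 → L} (hx : B.Off x) {r : L} (hr : r ≠ 0) : B.Off (r • x) := by
  refine ⟨smul_ne_zero hr hx.1, ?_, ?_⟩
  · rw [aeval_smul_of_isHomogeneous Y.homogeneous, hx.2.1, mul_zero]
  · obtain ⟨i, hi⟩ := hx.2.2
    refine ⟨i, ?_⟩
    rw [aeval_smul_of_isHomogeneous (B.e_homogeneous i)]
    exact mul_ne_zero (pow_ne_zero _ hr) hi

theorem BlowUp.IsSec.smul {x : Fin 4 → L} {s : Fin 5 → L} (hs : B.IsSec x s)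
    {r : L} (hr : r ≠ 0) : B.IsSec (r • x) (r • s) := by
  intro d F hF a b ha hb n n₁ n₂
  have hT : ∀ a, diff Y.c (r • x) a = 0 → diff Y.c x a = 0 := by
    intro a ha
    have := diff_smul_left Y.homogeneous r x a
    rw [ha, mul_zero, zero_eq_mul] at this
    exact this.resolve_left (pow_ne_zero _ hr)
  have hD : ∀ a, diffs F (r • x) a = (r⁻¹ * r ^ d) • diffs F x a := by
    intro a
    funext i
    have := diff_smul_left (hF.hom i) r x a
    simp only [diffs, Pi.smul_apply, smul_eq_mul]
    rw [mul_assoc, ← this, inv_mul_cancel_left₀ hr]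
  have hc : diff Y.c (r • x) n = r ^ 2 * diff Y.c x n := by
    have := diff_smul_left Y.homogeneous r x n
    apply mul_left_cancel₀ hr
    rw [this]; ring
  have hE : evs F (r • x) = r ^ d • evs F x := aeval_smul_family hF.hom r x
  have h1 : rowDet ![evs F (r • x), diffs F (r • x) a, diffs F (r • x) b, n₁, n₂] =
      (r ^ d) * (r⁻¹ * r ^ d) ^ 2 * rowDet ![evs F x, diffs F x a, diffs F x b, n₁, n₂] := by
    rw [rowDet_comb (w := ![evs F x, diffs F x a, diffs F x b, n₁, n₂])
      (Matrix.diagonal ![r ^ d, r⁻¹ * r ^ d, r⁻¹ * r ^ d, 1, 1])]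
    · congr 1
      rw [Matrix.det_diagonal]
      simp [Fin.prod_univ_five]
      ring
    · intro i
      simp only [Matrix.diagonal_apply, ite_smul, zero_smul, Finset.sum_ite_eq, Finset.mem_univ, if_true]
      fin_cases i <;> simp [hE, hD]
  have h2 : rowDet ![r • x, a, b, n] = r * rowDet ![x, a, b, n] := by
    rw [rowDet_comb (w := ![x, a, b, n]) (Matrix.diagonal ![r, 1, 1, 1])]
    · congr 1
      rw [Matrix.det_diagonal]
      simp [Fin.prod_univ_four]
    · intro i
      simp only [Matrix.diagonal_apply, ite_smul, zero_smul, Finset.sum_ite_eq, Finset.mem_univ, if_true]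
      fin_cases i <;> simp
  have h3 : S.dq (evs F (r • x)) n₁ n₂ = (r ^ d) ^ 2 * S.dq (evs F x) n₁ n₂ := by
    unfold QuarticDelPezzo.dq
    rw [hE]
    simp only [polar_smul_left, smul_eq_mul]
    ring
  have h0 := hs d F hF a b (hT a ha) (hT b hb) n n₁ n₂
  rw [h1, h2, h3, hc, hE, smul_smul, smul_smul]
  have e1 : r ^ d * (r⁻¹ * r ^ d) ^ 2 * rowDet ![evs F x, diffs F x a, diffs F x b, n₁, n₂] *
      (r ^ 2 * diff Y.c x n) * r = (r ^ d) ^ 3 * r * (rowDet ![evs F x, diffs F x a, diffs F x b, n₁, n₂] * diff Y.c x n) := by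
    field_simp
  rw [e1, mul_smul, h0, smul_smul]
  congr 1
  ring

variable (B) in
open scoped Classical in
/-- The lift of the blow up to vectors. -/
noncomputable def BlowUp.sec (x : Fin 4 → L) : Fin 5 → L :=
  if h : B.Off x then (BlowUp.exists_isSec h).choose else 0

theorem BlowUp.isSec {x : Fin 4 → L} (hx : B.Off x) : B.IsSec x (B.sec x) := by
  rw [BlowUp.sec, dif_pos hx]
  exact (BlowUp.exists_isSec hx).choose_spec

theorem BlowUp.sec_smul {x : Fin 4 → L} (hx : B.Off x) {r : L} (hr : r ≠ 0) :
    B.sec (r • x) = r • B.sec x :=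
  (BlowUp.isSec (hx.smul hr)).unique (hx.smul hr) ((BlowUp.isSec hx).smul hr)

/-- The lift is locally rational. -/
theorem BlowUp.exists_denominator {x : Fin 4 → L} (hx : B.Off x) :
    ∃ (D : MvPolynomial (Fin 4) K) (N : Fin 5 → MvPolynomial (Fin 4) K), aeval x D ≠ 0 ∧
      ∀ y, B.Off y → aeval y D • B.sec y = evs N y := by
  obtain ⟨d, F, hF, h⟩ := BlowUp.exists_rep hx
  obtain ⟨i, j, k, m, n, hf⟩ := BlowUp.exists_frame hx hF h
  let dP : (Fin 5 → MvPolynomial (Fin 4) K) → (Fin 4 → MvPolynomial (Fin 4) K) →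
      Fin 5 → MvPolynomial (Fin 4) K := fun F a p => ∑ l, pderiv l (F p) * a l
  have hdP : ∀ F a (y : Fin 4 → L), evs (dP F a) y = diffs F y (evs a y) := by
    intro F a y
    funext p
    simp [dP, evs, diffs, diff]
  let b : ∀ (q : ℕ), Fin q → Fin q → MvPolynomial (Fin 4) K := fun q p => Pi.single p 1
  have hb : ∀ q p (y : Fin 4 → L), evs (b q p) y = Pi.single p 1 := by
    intro q p y
    funext l
    simp only [evs, b, Pi.single_apply]
    split_ifs <;> simp
  have hdet : ∀ {q : ℕ} (M : Fin q → Fin q → MvPolynomial (Fin 4) K) (y : Fin 4 → L),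
      aeval y (Matrix.det (Matrix.of M)) = rowDet (fun i => evs (M i) y) := by
    intro q M y
    rw [AlgHom.map_det]
    rfl
  let qP : Fin 2 → (Fin 5 → MvPolynomial (Fin 4) K) → (Fin 5 → MvPolynomial (Fin 4) K) →
      MvPolynomial (Fin 4) K := fun i F u => ∑ l, aeval F (pderiv l (S.q i)) * u l
  have hqP : ∀ i F u (y : Fin 4 → L), aeval y (qP i F u) = polar (S.qf i) (evs F y) (evs u y) := by
    intro i F u y
    rw [S.polar_qf]
    simp only [qP, diff, map_sum, map_mul]
    refine Finset.sum_congr rfl fun l _ => ?_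
    congr 1
    exact comp_aeval_apply (R := K) F (aeval y : MvPolynomial (Fin 4) K →ₐ[K] L) _
  let D : MvPolynomial (Fin 4) K := Matrix.det (Matrix.of ![F, dP F (Y.tangentField k i),
    dP F (Y.tangentField k j), b 5 m, b 5 n]) * pderiv k Y.c
  let N : MvPolynomial (Fin 4) K := Matrix.det (Matrix.of ![X, Y.tangentField k i,
    Y.tangentField k j, b 4 k]) * (qP 0 F (b 5 m) * qP 1 F (b 5 n) - qP 0 F (b 5 n) * qP 1 F (b 5 m))
  have hD : ∀ y : Fin 4 → L, aeval y D = rowDet ![evs F y, diffs F y (evs (Y.tangentField k i) y),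
      diffs F y (evs (Y.tangentField k j) y), Pi.single m 1, Pi.single n 1] * diff Y.c y (Pi.single k 1) := by
    intro y
    simp only [D, map_mul, hdet, diff_single]
    congr 2
    funext p
    fin_cases p <;> simp [hdP, hb]
  have hN : ∀ y : Fin 4 → L, aeval y N = rowDet ![y, evs (Y.tangentField k i) y, evs (Y.tangentField k j) y,
      Pi.single k 1] * S.dq (evs F y) (Pi.single m 1) (Pi.single n 1) := by
    intro y
    simp only [N, map_mul, map_sub, hdet, hqP, hb, QuarticDelPezzo.dq]
    congr 2
    funext p
    fin_cases p
    · funext l; simp [evs]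
    · rfl
    · rfl
    · exact hb 4 k y
  refine ⟨D, fun p => N * F p, ?_, fun y hy => ?_⟩
  · rw [hD]
    exact mul_ne_zero (hf.rowDet_ne_zero hx) hf.hn
  · rw [hD, BlowUp.isSec hy d F hF _ _ (Y.diff_tangentField k i y) (Y.diff_tangentField k j y), ← hN]
    funext p
    simp [evs]

theorem BlowUp.exists_pow_denominator : ∃ (r : ℕ) (A : Fin 2 → Fin 5 → MvPolynomial (Fin 4) K), 0 < r ∧
    ∀ i y, B.Off y → aeval y (B.e i) ^ r • B.sec y = evs (A i) y := by
  let I : Ideal (MvPolynomial (Fin 4) K) :=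
    { carrier := {D | ∃ N : Fin 5 → MvPolynomial (Fin 4) K, ∀ y, B.Off y → aeval y D • B.sec y = evs N y}
      zero_mem' := ⟨0, fun y _ => by funext p; simp [evs]⟩
      add_mem' := by
        rintro D D' ⟨N, hN⟩ ⟨N', hN'⟩
        refine ⟨N + N', fun y hy => ?_⟩
        rw [map_add, add_smul, hN y hy, hN' y hy]
        funext p; simp [evs]
      smul_mem' := by
        rintro c D ⟨N, hN⟩
        refine ⟨fun p => c * N p, fun y hy => ?_⟩
        rw [smul_eq_mul, map_mul, mul_smul, hN y hy]
        funext p; simp [evs] }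
  have hrad : ∀ i, ∃ r, B.e i ^ r ∈ I := by
    intro i
    have : B.e i ∈ vanishingIdeal K (zeroLocus L I) := by
      rw [mem_vanishingIdeal_iff]
      intro y hy
      by_contra hne
      have hc : aeval y Y.c = 0 := hy Y.c ⟨0, fun z hz => by rw [hz.2.1]; funext p; simp [evs]⟩
      have hoff : B.Off y := by
        refine ⟨?_, hc, i, hne⟩
        rintro rfl
        apply hne
        have := aeval_smul_of_isHomogeneous (B.e_homogeneous i) (0 : L) (0 : Fin 4 → L)
        simpa using this
      obtain ⟨D, N, hD, hN⟩ := BlowUp.exists_denominator hoff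
      exact hD (hy D ⟨N, hN⟩)
    rw [vanishingIdeal_zeroLocus_eq_radical] at this
    exact this
  choose r hr using hrad
  have : ∀ i, B.e i ^ (r 0 + r 1 + 1) ∈ I := by
    intro i
    apply I.pow_mem_of_pow_mem (hr i)
    fin_cases i <;> simp <;> omega
  choose A hA using this
  refine ⟨r 0 + r 1 + 1, A, by omega, fun i y hy => ?_⟩
  rw [← map_pow]
  exact hA i y hy

end Section

section LinearSection

variable {K L : Type*} [Field K] [Field L] [Algebra K L]

theorem coeff_aeval_line {n : ℕ} (y : Fin n → L) (F : MvPolynomial (Fin n) K) :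
    (aeval (fun i => PC (y i) * PX) F).coeff 0 = aeval (0 : Fin n → L) F ∧
    (aeval (fun i => PC (y i) * PX) F).coeff 1 = diff F 0 y := by
  induction F using MvPolynomial.induction_on with
  | C c =>
    have : (algebraMap K (Polynomial L)) c = PC (algebraMap K L c) := rfl
    simp [this, diff_C, Polynomial.coeff_C]
  | add p q hp hq => simp [hp.1, hp.2, hq.1, hq.2]
  | mul_X p i hp =>
    constructor
    · simp [hp.1, Polynomial.mul_coeff_zero]
    · simp [Polynomial.mul_coeff_one, hp.1, hp.2]

/-- Evaluation of a polynomial in an additional variable. -/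
noncomputable def evalAt {n : ℕ} (y : Fin n → L) (w : L) :
    Polynomial (MvPolynomial (Fin n) K) →+* L :=
  Polynomial.eval₂RingHom (aeval y : MvPolynomial (Fin n) K →ₐ[K] L).toRingHom w

theorem evalAt_linear [Infinite L] {n : ℕ} {y : Fin n → L} {w s : L}
    {T : Polynomial (MvPolynomial (Fin n) K)}
    (h : ∀ r : L, r ≠ 0 → evalAt (r • y) (r * w) T = r * s) :
    s = diff (T.coeff 0) 0 y + w * aeval (0 : Fin n → L) (T.coeff 1) := by
  let ψ : MvPolynomial (Fin n) K →ₐ[K] Polynomial L := aeval (fun i => PC (y i) * PX)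
  let P : Polynomial (MvPolynomial (Fin n) K) →+* Polynomial L :=
    Polynomial.eval₂RingHom ψ.toRingHom (PC w * PX)
  have hPC : ∀ F, P (PC F) = ψ F := fun F => Polynomial.eval₂_C _ _
  have hPX : P PX = PC w * PX := Polynomial.eval₂_X _ _
  have heval : ∀ r, (P T).eval r = evalAt (r • y) (r * w) T := by
    intro r
    have : (Polynomial.evalRingHom r).comp P = evalAt (r • y) (r * w) := by
      apply Polynomial.ringHom_ext
      · intro F
        rw [RingHom.comp_apply, hPC]
        have h1 : evalAt (r • y) (r * w) (PC F) = aeval (r • y) F := Polynomial.eval₂_C _ _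
        rw [h1]
        have := comp_aeval_apply (R := K) (fun i => PC (y i) * PX)
          ((Polynomial.aeval r : Polynomial L →ₐ[L] L).restrictScalars K) F
        simp only [AlgHom.restrictScalars_apply, map_mul, Polynomial.aeval_C, Polynomial.aeval_X] at this
        rw [Polynomial.coe_evalRingHom, ← Polynomial.coe_aeval_eq_eval]
        rw [this]
        congr 2
        funext i
        exact mul_comm _ _
      · have h1 : evalAt (K := K) (r • y) (r * w) PX = r * w := Polynomial.eval₂_X _ _
        rw [RingHom.comp_apply, hPX, h1, Polynomial.coe_evalRingHom, Polynomial.eval_mul, Polynomial.eval_C,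
          Polynomial.eval_X, mul_comm]
    exact congrArg (fun f => f T) this
  have hP : P T = PC s * PX := by
    apply Polynomial.eq_of_infinite_eval_eq
    apply Set.Infinite.mono (s := {0}ᶜ)
    · intro r hr
      have := h r hr
      rw [← heval] at this
      simp only [Set.mem_ofPred_eq, this]
      simp only [Polynomial.eval_mul, Polynomial.eval_C, Polynomial.eval_X]
      ring
    · exact (Set.finite_singleton _).infinite_compl
  have hs : s = (P T).coeff 1 := by rw [hP]; simp
  have hT : ∀ T, P T = ψ (T.coeff 0) + PC w * (P T.divX * PX) := by
    intro T
    conv_lhs => rw [← Polynomial.divX_mul_X_add T]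
    rw [map_add, map_mul, hPC, hPX]; ring
  rw [hs, hT T, Polynomial.coeff_add, (coeff_aeval_line y _).2, Polynomial.coeff_C_mul,
    Polynomial.coeff_mul_X, hT T.divX, Polynomial.coeff_add, (coeff_aeval_line y _).1, Polynomial.coeff_divX]
  simp

theorem aeval_zero_eq {n : ℕ} (F : MvPolynomial (Fin n) K) :
    aeval (0 : Fin n → L) F = algebraMap K L (constantCoeff F) := by
  have := aeval_zero' (S₁ := L) (p := F)
  exact this

variable [IsAlgClosed L] {S : QuarticDelPezzo K L} {Y : CubicSurface K L} {B : BlowUp S Y}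

theorem LineEquation.cone {e Q : Fin 2 → MvPolynomial (Fin 4) K} (h : LineEquation Y e Q)
    (y : Fin 4 → L) : aeval y Y.c = aeval y (e 0) * aeval y (Q 1) - aeval y (e 1) * aeval y (Q 0) := by
  rw [h.eq]; simp

/-- The lift of the blow up to vectors is linear in the coordinates and in the slope function. -/
theorem BlowUp.exists_linear_sec {Q : Fin 2 → MvPolynomial (Fin 4) K} (hQ : LineEquation Y B.e Q) :
    ∃ (l : Matrix (Fin 5) (Fin 4) K) (κ : Fin 5 → K), ∀ y w, B.Off y →
      (∀ j, w * aeval y (B.e j) = aeval y (Q j)) →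
      B.sec y = matLin L l y + w • fun i => algebraMap K L (κ i) := by
  obtain ⟨r, A, hr, hA⟩ := BlowUp.exists_pow_denominator (B := B)
  have key : ∀ i, ∃ T : Polynomial (MvPolynomial (Fin 4) K), ∀ y w, B.Off y →
      (∀ j, w * aeval y (B.e j) = aeval y (Q j)) → evalAt y w T = B.sec y i := by
    intro i
    obtain ⟨h, hh⟩ := Y.dvd_of_vanish (F := B.e 1 ^ r * A 0 i - B.e 0 ^ r * A 1 i) (by
      intro y hy
      by_cases he : ∀ j, aeval y (B.e j) = 0
      · simp [he, hr.ne']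
      · push Not at he
        have hoff : B.Off y := by
          refine ⟨?_, hy, he⟩
          rintro rfl
          obtain ⟨j, hj⟩ := he
          apply hj
          have := aeval_smul_of_isHomogeneous (B.e_homogeneous j) (0 : L) (0 : Fin 4 → L)
          simpa using this
        have h0 : ∀ j, aeval y (A j i) = aeval y (B.e j) ^ r * B.sec y i := fun j =>
          (congrFun (hA j y hoff) i).symm
        simp only [map_sub, map_mul, map_pow, h0]
        ring)
    rw [hQ.eq] at hh
    obtain ⟨T, hT0, hT1⟩ := exists_polynomial_of_pole hQ.prime_zero hQ.not_dvd hQ.not_dvd_Q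
      hQ.Q_zero_nzd hQ.Q_one_nzd hh
    refine ⟨T, fun y w hy hw => ?_⟩
    have hC : ∀ F : MvPolynomial (Fin 4) K, evalAt y w (PC F) = aeval y F :=
      fun F => Polynomial.eval₂_C _ _
    have hX : evalAt (K := K) y w PX = w := Polynomial.eval₂_X _ _
    have hJ : ∀ f ∈ Ideal.span {PC (B.e 0) * PX - PC (Q 0),
        PC (B.e 1) * PX - PC (Q 1)}, evalAt y w f = 0 := by
      intro f hf
      have : Ideal.span {PC (B.e 0) * PX - PC (Q 0),
        PC (B.e 1) * PX - PC (Q 1)} ≤ RingHom.ker (evalAt y w) := by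
        rw [Ideal.span_le]
        rintro f (rfl | rfl)
        all_goals
          simp only [SetLike.mem_coe, RingHom.mem_ker, map_sub, map_mul, hC, hX, ← hw]
          ring
      exact this hf
    have h0 := hJ _ hT0
    have h1 := hJ _ hT1
    simp only [map_sub, map_mul, map_pow, hC] at h0 h1
    have hs : ∀ j, aeval y (A j i) = aeval y (B.e j) ^ r * B.sec y i := fun j =>
      (congrFun (hA j y hy) i).symm
    obtain ⟨j, hj⟩ := hy.2.2
    have hfin : aeval y (B.e j) ^ r * (B.sec y i - evalAt y w T) = 0 := by
      fin_cases j
      · rw [hs] at h0; simp only [Fin.zero_eta]; linear_combination h0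
      · rw [hs] at h1; simp only [Fin.mk_one]; linear_combination h1
    exact (sub_eq_zero.1 ((mul_eq_zero.1 hfin).resolve_left (pow_ne_zero _ hj))).symm
  choose T hT using key
  refine ⟨Matrix.of fun i j => constantCoeff (pderiv j ((T i).coeff 0)),
    fun i => constantCoeff ((T i).coeff 1), fun y w hy hw => ?_⟩
  funext i
  have := evalAt_linear (T := T i) (y := y) (w := w) (s := B.sec y i) (by
    intro r hr
    rw [hT i (r • y) (r * w) (hy.smul hr), BlowUp.sec_smul hy hr]
    · rfl
    · intro j
      rw [aeval_smul_of_isHomogeneous (hQ.hom_e j), aeval_smul_of_isHomogeneous (hQ.hom_Q j), ← hw j]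
      ring)
  rw [this]
  simp only [matLin_apply, Pi.add_apply, Pi.smul_apply, smul_eq_mul, diff, aeval_zero_eq, Matrix.of_apply]

end LinearSection

section Isotropic

variable {k V : Type*} [Field k] [AddCommGroup V] [Module k V] [FiniteDimensional k V]

theorem exists_binary_zero [IsAlgClosed k] (A B C : k) :
    ∃ a b : k, (a ≠ 0 ∨ b ≠ 0) ∧ A * a ^ 2 + B * a * b + C * b ^ 2 = 0 := by
  by_cases hA : A = 0
  · exact ⟨1, 0, Or.inl one_ne_zero, by simp [hA]⟩
  · obtain ⟨z, hz⟩ := IsAlgClosed.exists_root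
      (PC A * PX ^ 2 + PC B * PX + PC C)
      (by rw [Polynomial.degree_quadratic hA]; decide)
    refine ⟨z, 1, Or.inr one_ne_zero, ?_⟩
    simp only [Polynomial.IsRoot.def, Polynomial.eval_add, Polynomial.eval_mul, Polynomial.eval_C,
      Polynomial.eval_pow, Polynomial.eval_X] at hz
    linear_combination hz

theorem exists_pair_of_finrank {W : Submodule k V} (hW : 2 ≤ finrank k W) :
    ∃ u ∈ W, ∃ v ∈ W, ∀ a b : k, a • u + b • v = 0 → a = 0 ∧ b = 0 := by
  obtain ⟨f, hf⟩ := exists_linearIndependent_of_le_finrank hW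
  refine ⟨f 0, (f 0).2, f 1, (f 1).2, fun a b h => ?_⟩
  have := Fintype.linearIndependent_iff.1 hf ![a, b] (by
    rw [sum_univ_two]
    exact Subtype.ext h)
  exact ⟨this 0, this 1⟩

theorem exists_isotropic [IsAlgClosed k] (q : QuadraticForm k V) {W : Submodule k V}
    (hW : 2 ≤ finrank k W) : ∃ v ∈ W, v ≠ 0 ∧ q v = 0 := by
  obtain ⟨u, hu, v, hv, h⟩ := exists_pair_of_finrank hW
  obtain ⟨a, b, hab, h0⟩ := exists_binary_zero (q u) (polar q u v) (q v)
  refine ⟨a • u + b • v, W.add_mem (W.smul_mem a hu) (W.smul_mem b hv), ?_, ?_⟩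
  · intro h1
    obtain ⟨rfl, rfl⟩ := h a b h1
    simp at hab
  · rw [QuadraticMap.map_add (⇑q), QuadraticMap.map_smul, QuadraticMap.map_smul, polar_smul_left,
      polar_smul_right]
    simp only [smul_eq_mul]
    linear_combination h0

theorem finrank_le_finrank_inf_ker_add {m : ℕ} (W : Submodule k V) (f : V →ₗ[k] (Fin m → k)) :
    finrank k W ≤ finrank k ↥(W ⊓ LinearMap.ker f) + m := by
  have h := LinearMap.finrank_range_add_finrank_ker (f.domRestrict W)
  have h1 : finrank k (LinearMap.range (f.domRestrict W)) ≤ m := by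
    have := Submodule.finrank_le (LinearMap.range (f.domRestrict W))
    rwa [Module.finrank_fin_fun] at this
  have h2 : finrank k (LinearMap.ker (f.domRestrict W)) = finrank k ↥(W ⊓ LinearMap.ker f) := by
    rw [LinearMap.ker_domRestrict, ← Submodule.finrank_map_subtype_eq W, Submodule.map_comap_subtype]
  omega

theorem exists_ne_zero_mem_ker {m : ℕ} {W : Submodule k V} (f : V →ₗ[k] (Fin m → k))
    (h : m < finrank k W) : ∃ v ∈ W, v ≠ 0 ∧ f v = 0 := by
  have := finrank_le_finrank_inf_ker_add W f
  have h1 : 0 < finrank k ↥(W ⊓ LinearMap.ker f) := by omega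
  obtain ⟨⟨v, hv⟩, hv0⟩ := (Module.finrank_pos_iff_exists_ne_zero (R := k)).1 h1
  exact ⟨v, hv.1, fun h => hv0 (Subtype.ext h), hv.2⟩

theorem exists_span_fin {m : ℕ} {C : Submodule k V} (hC : finrank k C ≤ m) :
    ∃ n : Fin m → V, ∀ c ∈ C, ∃ a : Fin m → k, c = ∑ i, a i • n i := by
  let b := Module.finBasis k C
  refine ⟨fun i => if h : (i : ℕ) < finrank k C then b ⟨i, h⟩ else 0, fun c hc => ?_⟩
  refine ⟨fun i => if h : (i : ℕ) < finrank k C then b.repr ⟨c, hc⟩ ⟨i, h⟩ else 0, ?_⟩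
  have h1 := congrArg Subtype.val (b.sum_repr ⟨c, hc⟩)
  simp only [Submodule.coe_sum, Submodule.coe_smul] at h1
  refine h1.symm.trans ?_
  refine Finset.sum_of_injOn (Fin.castLE hC) ((Fin.castLE_injective hC).injOn) (by simp) ?_ ?_
  · intro i _ hi
    have : ¬ (i : ℕ) < finrank k C := by
      intro h
      exact hi ⟨⟨i, h⟩, by simp, by ext; simp⟩
    simp [this]
  · intro i _
    simp

theorem exists_complement {m n : ℕ} {W : Submodule k V} (hW : n ≤ finrank k W)
    (hV : finrank k V = n + m) :
    ∃ c : Fin m → V, ∀ v, ∃ w ∈ W, ∃ a : Fin m → k, v = w + ∑ i, a i • c i := by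
  obtain ⟨C, hC⟩ := exists_isCompl W
  have := Submodule.finrank_add_eq_of_isCompl hC
  obtain ⟨c, hc⟩ := exists_span_fin (m := m) (C := C) (by omega)
  refine ⟨c, fun v => ?_⟩
  obtain ⟨w, hw, u, hu, rfl⟩ := Submodule.mem_sup.1 (hC.sup_eq_top ▸ Submodule.mem_top : v ∈ W ⊔ C)
  obtain ⟨a, ha⟩ := hc u hu
  exact ⟨w, hw, a, by rw [ha]⟩

end Isotropic

section Pencil

variable {k V : Type*} [Field k] [AddCommGroup V] [Module k V] [FiniteDimensional k V]
  {q : Fin 2 → QuadraticForm k V}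

theorem polar_eq_zero_of_isotropic {q : QuadraticForm k V} {W : Submodule k V} (h : ∀ v ∈ W, q v = 0) {u v : V}
    (hu : u ∈ W) (hv : v ∈ W) : polar q u v = 0 := by
  simp [polar, h u hu, h v hv, h _ (W.add_mem hu hv)]

theorem eq_zero_of_pencil {R R' : Fin 2 → k} (h : R 0 * R' 1 - R 1 * R' 0 ≠ 0) {v : V}
    (h1 : pencil q R v = 0) (h2 : pencil q R' v = 0) (i : Fin 2) : q i v = 0 := by
  rw [pencil_apply] at h1 h2
  apply (mul_eq_zero.1 (_ : (R 0 * R' 1 - R 1 * R' 0) * q i v = 0)).resolve_left h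
  fin_cases i
  · simp only [Fin.zero_eta]; linear_combination R' 1 * h1 - R 1 * h2
  · simp only [Fin.mk_one]; linear_combination R 0 * h2 - R' 0 * h1

theorem exists_independent {R : Fin 2 → k} (hR : R ≠ 0) : ∃ R' : Fin 2 → k, R 0 * R' 1 - R 1 * R' 0 ≠ 0 := by
  by_cases h : R 1 = 0
  · refine ⟨![0, 1], ?_⟩
    intro h0
    apply hR
    funext i
    fin_cases i
    · simpa using h0
    · simpa using h
  · exact ⟨![1, 0], by simpa using h⟩

/-- A smooth intersection of two quadrics in four-dimensional space contains no plane. -/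
theorem SmoothPencil.no_plane [IsAlgClosed k] (hq : SmoothPencil q) (hV : finrank k V = 5)
    {W : Submodule k V} (hW : 3 ≤ finrank k W) : ¬ ∀ v ∈ W, ∀ i, q i v = 0 := by
  intro h
  obtain ⟨c, hc⟩ := exists_complement (m := 2) (n := 3) hW hV
  obtain ⟨u, hu, v, hv, huv⟩ := exists_pair_of_finrank (show 2 ≤ finrank k W by omega)
  let p : Fin 2 → V → Fin 2 → k := fun i w j => polar (q i) w (c j)
  obtain ⟨a, b, hab, h0⟩ := exists_binary_zero (p 0 u 0 * p 1 u 1 - p 0 u 1 * p 1 u 0)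
    (p 0 u 0 * p 1 v 1 + p 0 v 0 * p 1 u 1 - p 0 u 1 * p 1 v 0 - p 0 v 1 * p 1 u 0)
    (p 0 v 0 * p 1 v 1 - p 0 v 1 * p 1 v 0)
  set w := a • u + b • v with hw
  have hwW : w ∈ W := W.add_mem (W.smul_mem a hu) (W.smul_mem b hv)
  have hw0 : w ≠ 0 := by
    intro h1
    obtain ⟨rfl, rfl⟩ := huv a b h1
    simp at hab
  have hp : ∀ i j, p i w j = a * p i u j + b * p i v j := by
    intro i j
    simp [p, hw, polar_add_left, polar_smul_left]
  have hdet : (Matrix.of fun i j => p i w j).det = 0 := by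
    rw [Matrix.det_fin_two]
    simp only [Matrix.of_apply, hp]
    linear_combination h0
  obtain ⟨R, hR, hRp⟩ := Matrix.exists_vecMul_eq_zero_iff.2 hdet
  obtain ⟨z, hz⟩ := hq w hw0 (h w hwW) R hR
  apply hz
  obtain ⟨y, hy, s, rfl⟩ := hc z
  have h1 : ∀ j, polar (pencil q R) w (c j) = 0 := by
    intro j
    have := congrFun hRp j
    simp only [Matrix.vecMul, dotProduct, sum_univ_two, Matrix.of_apply, Pi.zero_apply] at this
    rw [polar_pencil]; exact this
  have h2 : polar (pencil q R) w y = 0 :=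
    polar_eq_zero_of_isotropic (fun v hv => pencil_eq_zero (h v hv) R) hwW hy
  rw [sum_univ_two, polar_add_right, polar_add_right,
    polar_smul_right, polar_smul_right, h1, h1, h2]
  simp

/-- A quadric of the pencil contains no linear subspace of dimension three. -/
theorem SmoothPencil.no_solid [IsAlgClosed k] (hq : SmoothPencil q) (hV : finrank k V = 5)
    {W : Submodule k V} (hW : 4 ≤ finrank k W) {R : Fin 2 → k} (hR : R ≠ 0) :
    ¬ ∀ v ∈ W, pencil q R v = 0 := by
  intro h
  obtain ⟨c, hc⟩ := exists_complement (m := 1) (n := 4) hW hV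
  obtain ⟨R', hR'⟩ := exists_independent hR
  let f : V →ₗ[k] (Fin 1 → k) := LinearMap.pi fun _ => polarLin (pencil q R) (c 0)
  have h1 := finrank_le_finrank_inf_ker_add W f
  obtain ⟨v, ⟨hv, hvf⟩, hv0, hvq⟩ := exists_isotropic (pencil q R') (W := W ⊓ LinearMap.ker f) (by omega)
  obtain ⟨z, hz⟩ := hq v hv0 (eq_zero_of_pencil hR' (h v hv) hvq) R hR
  apply hz
  obtain ⟨y, hy, s, rfl⟩ := hc z
  have h3 : polar (pencil q R) v (c 0) = 0 := by
    rw [polar_comm]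
    exact congrFun hvf 0
  rw [polar_add_right, polar_eq_zero_of_isotropic h hv hy]
  simp [polar_smul_right, h3]

end Pencil

section LinearModel

variable {K L : Type*} [Field K] [Field L] [Algebra K L]

theorem aeval_add_of_isHomogeneous_one {n : ℕ} {F : MvPolynomial (Fin n) K} (hF : F.IsHomogeneous 1)
    (x y : Fin n → L) : aeval (x + y) F = aeval x F + aeval y F := by
  obtain ⟨a, rfl⟩ := exists_coeff_of_isHomogeneous_one hF
  simp [mul_add, Finset.sum_add_distrib]

theorem diff_of_isHomogeneous_one {n : ℕ} {F : MvPolynomial (Fin n) K} (hF : F.IsHomogeneous 1)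
    (x y : Fin n → L) : diff F x y = aeval y F := by
  obtain ⟨a, rfl⟩ := exists_coeff_of_isHomogeneous_one hF
  simp [diff_sum]

/-- The linear functional defined by a linear form. -/
noncomputable def evalLin (L : Type*) [Field L] [Algebra K L] {n : ℕ} (F : MvPolynomial (Fin n) K)
    (hF : F.IsHomogeneous 1) : (Fin n → L) →ₗ[L] L where
  toFun x := aeval x F
  map_add' := aeval_add_of_isHomogeneous_one hF
  map_smul' a x := by rw [aeval_smul_of_isHomogeneous hF, pow_one]; rfl

theorem constantCoeff_of_isHomogeneous {n d : ℕ} {F : MvPolynomial (Fin n) K} (hF : F.IsHomogeneous d)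
    (hd : d ≠ 0) : constantCoeff F = 0 := by
  by_contra h
  have := hF (d := 0) h
  simp at this
  exact hd this.symm

variable [IsAlgClosed L] {S : QuarticDelPezzo K L} {Y : CubicSurface K L} {B : BlowUp S Y}

theorem LineEquation.exists_coefficients {e Q : Fin 2 → MvPolynomial (Fin 4) K} (h : LineEquation Y e Q)
    {a b : MvPolynomial (Fin 4) K} {c₀ : K} (ha : a.IsHomogeneous 2) (hb : b.IsHomogeneous 1)
    (hdvd : Y.c ∣ e 1 * (e 0 ^ 2 * a + e 0 * b * Q 0 + C c₀ * Q 0 ^ 2)) :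
    c₀ = 0 ∧ ∃ m : Fin 2 → K, b = ∑ j, C (m j) * e j ∧ a = -∑ j, C (m j) * Q j := by
  have hp0 := h.prime_zero
  have hp1 := h.prime_one
  have he0 : e 0 ≠ 0 := hp0.ne_zero
  have he1 : e 1 ≠ 0 := hp1.ne_zero
  obtain ⟨k, hk⟩ := hdvd
  rw [h.eq] at hk
  have h1 : e 1 ∣ k := by
    have : e 1 ∣ e 0 * Q 1 * k :=
      ⟨e 0 ^ 2 * a + e 0 * b * Q 0 + C c₀ * Q 0 ^ 2 + Q 0 * k, by linear_combination -hk⟩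
    rcases hp1.dvd_or_dvd this with h2 | h2
    · rcases hp1.dvd_or_dvd h2 with h3 | h3
      · exact absurd h3 h.not_dvd'
      · exact absurd h3 h.not_dvd_Q'
    · exact h2
  obtain ⟨k', rfl⟩ := h1
  have hH : e 0 ^ 2 * a + e 0 * b * Q 0 + C c₀ * Q 0 ^ 2 = (e 0 * Q 1 - e 1 * Q 0) * k' :=
    mul_left_cancel₀ he1 (by linear_combination hk)
  obtain ⟨r, hr⟩ : e 0 ∣ C c₀ * Q 0 + e 1 * k' := by
    have : e 0 ∣ Q 0 * (C c₀ * Q 0 + e 1 * k') :=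
      ⟨Q 1 * k' - e 0 * a - b * Q 0, by linear_combination hH⟩
    exact (hp0.dvd_or_dvd this).resolve_left h.not_dvd_Q
  have h3 : e 0 * a + b * Q 0 = Q 1 * k' - Q 0 * r :=
    mul_left_cancel₀ he0 (by linear_combination hH - Q 0 * hr)
  have hc : c₀ = 0 := by
    have h4 : Q 0 * C c₀ ∈ Ideal.span {e 0, e 1} :=
      Ideal.mem_span_pair.2 ⟨r, -k', by linear_combination -hr⟩
    obtain ⟨u, v, huv⟩ := Ideal.mem_span_pair.1 (h.Q_zero_nzd _ h4)
    have := congrArg constantCoeff huv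
    simpa [constantCoeff_of_isHomogeneous (h.hom_e 0) one_ne_zero,
      constantCoeff_of_isHomogeneous (h.hom_e 1) one_ne_zero] using this.symm
  subst hc
  simp only [map_zero, zero_mul, zero_add] at hr
  obtain ⟨t, rfl⟩ : e 0 ∣ k' := (hp0.dvd_or_dvd ⟨r, hr⟩).resolve_left h.not_dvd
  have hr' : r = e 1 * t := mul_left_cancel₀ he0 (by linear_combination -hr)
  subst hr'
  obtain ⟨s, hs⟩ : e 0 ∣ b + e 1 * t := by
    have : e 0 ∣ Q 0 * (b + e 1 * t) := ⟨Q 1 * t - a, by linear_combination h3⟩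
    exact (hp0.dvd_or_dvd this).resolve_left h.not_dvd_Q
  have ha' : a = Q 1 * t - Q 0 * s := mul_left_cancel₀ he0 (by linear_combination h3 - Q 0 * hs)
  have hb' : b = e 0 * s - e 1 * t := by linear_combination hs
  have hcomp : ∀ {F : MvPolynomial (Fin 4) K} {d}, F.IsHomogeneous d → ∀ G,
      homogeneousComponent d (F * G) = F * C (coeff 0 G) := by
    intro F d hF G
    have := homogeneousComponent_mul_left hF 0 G
    rwa [add_zero, homogeneousComponent_zero] at this
  have hself : ∀ {F : MvPolynomial (Fin 4) K} {d}, F.IsHomogeneous d → homogeneousComponent d F = F := by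
    intro F d hF
    rw [homogeneousComponent_of_mem hF, if_pos rfl]
  refine ⟨rfl, ![coeff 0 s, -coeff 0 t], ?_, ?_⟩
  · rw [← hself hb, hb', map_sub, hcomp (h.hom_e 0), hcomp (h.hom_e 1)]
    simp; ring
  · rw [← hself ha, ha', map_sub, hcomp (h.hom_Q 0), hcomp (h.hom_Q 1)]
    simp; ring

/-- A linear lift of the blow up, in terms of the coordinates and the slope. -/
structure BlowUp.LinearSec (B : BlowUp S Y) (Q : Fin 2 → MvPolynomial (Fin 4) K)
    (l : Matrix (Fin 5) (Fin 4) K) (κ : Fin 5 → K) : Prop where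
  eqn : LineEquation Y B.e Q
  sec : ∀ y w, B.Off y → (∀ j, w * aeval y (B.e j) = aeval y (Q j)) →
      B.sec y = matLin L l y + w • fun i => algebraMap K L (κ i)

theorem off_of_slope {Q : Fin 2 → MvPolynomial (Fin 4) K} (hQ : LineEquation Y B.e Q) {y : Fin 4 → L}
    (hy : y ≠ 0) {w : L} (hw : ∀ j, w * aeval y (B.e j) = aeval y (Q j)) : B.Off y := by
  refine ⟨hy, ?_, ?_⟩
  · rw [hQ.cone, ← hw, ← hw]; ring
  · by_contra! h
    obtain ⟨j, hj⟩ := hQ.no_common_zero y hy h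
    rw [← hw j, h j, mul_zero] at hj
    exact hj rfl

theorem exists_slope {Q : Fin 2 → MvPolynomial (Fin 4) K} (hQ : LineEquation Y B.e Q) {y : Fin 4 → L}
    (hy : B.Off y) : ∃ w : L, ∀ j, w * aeval y (B.e j) = aeval y (Q j) := by
  obtain ⟨-, hc, i, hi⟩ := hy
  rw [hQ.cone] at hc
  refine ⟨aeval y (Q i) / aeval y (B.e i), fun j => ?_⟩
  rw [div_mul_eq_mul_div, div_eq_iff hi]
  fin_cases i <;> fin_cases j <;> simp only [Fin.zero_eta, Fin.mk_one] <;>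
    first | ring1 | linear_combination hc | linear_combination -hc

theorem BlowUp.LinearSec.exists_matrix {Q : Fin 2 → MvPolynomial (Fin 4) K}
    {l : Matrix (Fin 5) (Fin 4) K} {κ : Fin 5 → K} (h : B.LinearSec Q l κ) :
    ∃ m : Fin 2 → Fin 2 → K, ∀ i (y : Fin 4 → L) (w : L),
      S.qf i (matLin L l y + w • fun i => algebraMap K L (κ i)) =
        ∑ j, algebraMap K L (m i j) * (w * aeval y (B.e j) - aeval y (Q j)) := by
  have key : ∀ i, ∃ m : Fin 2 → K, ∀ (y : Fin 4 → L) (w : L),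
      S.qf i (matLin L l y + w • fun i => algebraMap K L (κ i)) =
        ∑ j, algebraMap K L (m j) * (w * aeval y (B.e j) - aeval y (Q j)) := by
    intro i
    let lp : Fin 5 → MvPolynomial (Fin 4) K := fun p => ∑ j, C (l p j) * X j
    have hlp : ∀ p, (lp p).IsHomogeneous 1 := fun p =>
      IsHomogeneous.sum _ _ _ fun j _ => isHomogeneous_C_mul_X _ _
    have hlpe : ∀ y : Fin 4 → L, (fun p => aeval y (lp p)) = matLin L l y := by
      intro y; funext p; simp [lp, matLin_apply]
    let a := aeval lp (S.q i)
    let b := ∑ p, aeval lp (pderiv p (S.q i)) * C (κ p)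
    have hae : ∀ y : Fin 4 → L, aeval y a = S.qf i (matLin L l y) := by
      intro y
      rw [← hlpe]
      exact comp_aeval_apply (R := K) lp (aeval y : MvPolynomial (Fin 4) K →ₐ[K] L) _
    have hbe : ∀ y : Fin 4 → L, aeval y b = polar (S.qf i) (matLin L l y) fun i => algebraMap K L (κ i) := by
      intro y
      rw [S.polar_qf, ← hlpe]
      simp only [b, diff, map_sum, map_mul]
      refine Finset.sum_congr rfl fun p _ => ?_
      congr 1
      · exact comp_aeval_apply (R := K) lp (aeval y : MvPolynomial (Fin 4) K →ₐ[K] L) _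
      · exact aeval_C _ _
    have ha : a.IsHomogeneous 2 := by
      have := (S.homogeneous i).aeval lp hlp
      rwa [one_mul] at this
    have hb : b.IsHomogeneous 1 := by
      refine IsHomogeneous.sum _ _ _ fun p _ => ?_
      have h1 := ((S.homogeneous i).pderiv (i := p)).aeval lp hlp
      have h2 := h1.mul (isHomogeneous_C (Fin 4) (κ p))
      rwa [one_mul, add_zero] at h2
    let c₀ : K := aeval κ (S.q i)
    have hce : algebraMap K L c₀ = S.qf i fun i => algebraMap K L (κ i) := by
      rw [S.qf_apply]
      have := comp_aeval_apply (R := K) κ (Algebra.ofId K L) (S.q i)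
      exact this
    have hexp : ∀ (y : Fin 4 → L) (w : L), S.qf i (matLin L l y + w • fun i => algebraMap K L (κ i)) =
        aeval y a + w * aeval y b + w ^ 2 * algebraMap K L c₀ := by
      intro y w
      rw [QuadraticMap.map_add (⇑(S.qf i)), QuadraticMap.map_smul, polar_smul_right, hae, hbe, hce]
      simp only [smul_eq_mul]; ring
    obtain ⟨hc0, m, hbm, ham⟩ := h.eqn.exists_coefficients ha hb (c₀ := c₀) (Y.dvd_of_vanish (by
      intro y hy
      by_cases h1 : aeval y (B.e 1) = 0
      · simp [h1]
      have hoff : B.Off y := by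
        refine ⟨?_, hy, 1, h1⟩
        rintro rfl
        have := aeval_smul_of_isHomogeneous (B.e_homogeneous 1) (0 : L) (0 : Fin 4 → L)
        rw [zero_smul, pow_one, zero_mul] at this
        exact h1 this
      obtain ⟨w, hw⟩ := exists_slope h.eqn hoff
      obtain ⟨hs0, hs⟩ := (BlowUp.isSec hoff).f_eq hoff
      have hq : S.qf i (B.sec y) = 0 := by
        have := B.mapsTo hoff.mem
        rw [hs] at this
        exact (S.mk_mem_pts _ hs0).1 this i
      rw [h.sec y w hoff hw, hexp] at hq
      simp only [map_mul, map_add, map_pow, aeval_C, ← hw]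
      linear_combination aeval y (B.e 1) * aeval y (B.e 0) ^ 2 * hq))
    refine ⟨m, fun y w => ?_⟩
    rw [hexp, hc0, hbm, ham]
    simp only [sum_univ_two, map_neg, map_add, map_mul, aeval_C, map_zero]
    ring
  choose m hm using key
  exact ⟨m, hm⟩

end LinearModel

section Inversion

variable {K L : Type*} [Field K] [Field L] [Algebra K L] [IsAlgClosed L]
  {S : QuarticDelPezzo K L} {Y : CubicSurface K L} {B : BlowUp S Y}
  {Q : Fin 2 → MvPolynomial (Fin 4) K} {l : Matrix (Fin 5) (Fin 4) K} {κ : Fin 5 → K}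

/-- The quadratic form `w e_j - Q_j` in the coordinates and the slope. -/
noncomputable def LineEquation.slopeForm {e : Fin 2 → MvPolynomial (Fin 4) K} (h : LineEquation Y e Q) (j : Fin 2) :
    QuadraticForm L ((Fin 4 → L) × L) :=
  QuadraticMap.linMulLin (LinearMap.snd L _ L) ((evalLin L (e j) (h.hom_e j)).comp (LinearMap.fst L _ L)) -
    (evalQuad L (Q j) (h.hom_Q j)).comp (LinearMap.fst L _ L)

theorem LineEquation.slopeForm_apply {e : Fin 2 → MvPolynomial (Fin 4) K} (h : LineEquation Y e Q) (j : Fin 2)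
    (z : (Fin 4 → L) × L) : h.slopeForm j z = z.2 * aeval z.1 (e j) - aeval z.1 (Q j) := rfl

theorem LineEquation.polar_slopeForm {e : Fin 2 → MvPolynomial (Fin 4) K} (h : LineEquation Y e Q) (j : Fin 2)
    (z z' : (Fin 4 → L) × L) : polar (h.slopeForm j) z z' =
      z.2 * aeval z'.1 (e j) + z'.2 * aeval z.1 (e j) - diff (Q j) z.1 z'.1 := by
  have := polar_evalQuad (L := L) (Q j) (h.hom_Q j) z.1 z'.1
  simp only [polar, evalQuad_apply] at this
  simp only [polar, slopeForm_apply, Prod.fst_add, Prod.snd_add,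
    aeval_add_of_isHomogeneous_one (h.hom_e j)]
  linear_combination -this

/-- The linear lift of the blow up. -/
noncomputable def liftLin (L : Type*) [Field L] [Algebra K L] (l : Matrix (Fin 5) (Fin 4) K) (κ : Fin 5 → K) :
    ((Fin 4 → L) × L) →ₗ[L] (Fin 5 → L) :=
  (matLin L l).coprod (LinearMap.toSpanSingleton L _ fun i => algebraMap K L (κ i))

theorem liftLin_apply (z : (Fin 4 → L) × L) :
    liftLin L l κ z = matLin L l z.1 + z.2 • fun i => algebraMap K L (κ i) := rfl

theorem BlowUp.LinearSec.lift_ne_zero (h : B.LinearSec Q l κ) {z : (Fin 4 → L) × L} (hz : z.1 ≠ 0)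
    (hg : ∀ j, h.eqn.slopeForm j z = 0) : liftLin L l κ z ≠ 0 := by
  have hw : ∀ j, z.2 * aeval z.1 (B.e j) = aeval z.1 (Q j) := fun j => sub_eq_zero.1 (hg j)
  have hoff := off_of_slope h.eqn hz hw
  rw [liftLin_apply, ← h.sec _ _ hoff hw]
  exact ((BlowUp.isSec hoff).f_eq hoff).1

theorem BlowUp.exists_off (hQ : LineEquation Y B.e Q) : ∃ y : Fin 4 → L, B.Off y := by
  by_contra! hcon
  have h1 : Y.c ∣ B.e 0 := Y.dvd_of_vanish (by
    intro y hy
    by_contra h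
    apply hcon y
    refine ⟨?_, hy, 0, h⟩
    rintro rfl
    have := aeval_smul_of_isHomogeneous (B.e_homogeneous 0) (0 : L) (0 : Fin 4 → L)
    rw [zero_smul, pow_one, zero_mul] at this
    exact h this)
  obtain ⟨k, hk⟩ := h1
  have hp := hQ.prime_zero
  rcases hp.dvd_or_dvd (show B.e 0 ∣ Y.c * k from ⟨1, by rw [mul_one]; exact hk.symm⟩) with h2 | ⟨k', rfl⟩
  · rw [hQ.eq] at h2
    have : B.e 0 ∣ B.e 1 * Q 0 := (dvd_sub_right (dvd_mul_right _ _)).1 h2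
    rcases hp.dvd_or_dvd this with h3 | h3
    · exact hQ.not_dvd h3
    · exact hQ.not_dvd_Q h3
  · have h3 : Y.c * k' = 1 := mul_left_cancel₀ hp.ne_zero (by linear_combination -hk)
    exact not_isUnit_of_aeval_zero (L := L) (n := 4) (by
      have := aeval_smul_of_isHomogeneous Y.homogeneous (0 : L) (0 : Fin 4 → L)
      simpa using this) (IsUnit.of_mul_eq_one _ h3)

/-- The kernel of the linear lift is transversal to the tangent space. -/
theorem BlowUp.LinearSec.eq_zero_of_polar (h : B.LinearSec Q l κ) {η z : (Fin 4 → L) × L} (hη : η.1 ≠ 0)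
    (hg : ∀ j, h.eqn.slopeForm j η = 0) (hz : liftLin L l κ z = 0)
    (hp : ∀ j, polar (h.eqn.slopeForm j) η z = 0) : z = 0 := by
  obtain ⟨y, w⟩ := η
  obtain ⟨a, w'⟩ := z
  simp only at hη
  have hw : ∀ j, w * aeval y (B.e j) = aeval y (Q j) := fun j => sub_eq_zero.1 (hg j)
  have hoff := off_of_slope h.eqn hη hw
  have hdQ : ∀ j, diff (Q j) y a = w * aeval a (B.e j) + w' * aeval y (B.e j) := by
    intro j
    have := hp j
    rw [h.eqn.polar_slopeForm] at this
    linear_combination -this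
  have hlin : ∀ j, diff (B.e j) y a = aeval a (B.e j) := fun j => diff_of_isHomogeneous_one (B.e_homogeneous j) y a
  have hT : diff Y.c y a = 0 := by
    rw [h.eqn.eq]
    simp only [diff_sub, diff_mul, hlin, hdQ, ← hw]
    ring
  obtain ⟨i, hi⟩ := hoff.2.2
  let G : Fin 5 → MvPolynomial (Fin 4) K := fun p => B.e i * (∑ j, C (l p j) * X j) + C (κ p) * Q i
  let F : Fin 5 → MvPolynomial (Fin 4) K := fun p => B.e i * G p
  have hlp : ∀ p, (∑ j, C (l p j) * X j : MvPolynomial (Fin 4) K).IsHomogeneous 1 := fun p =>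
    IsHomogeneous.sum _ _ _ fun j _ => isHomogeneous_C_mul_X _ _
  have hlpe : ∀ (x : Fin 4 → L) p, aeval x (∑ j, C (l p j) * X j) = matLin L l x p := by
    intro x p; simp [matLin_apply]
  have hGe : ∀ (x : Fin 4 → L) (v : L), v * aeval x (B.e i) = aeval x (Q i) → ∀ p,
      aeval x (G p) = aeval x (B.e i) * liftLin L l κ (x, v) p := by
    intro x v hv p
    simp only [G, map_add, map_mul, hlpe, aeval_C, ← hv, liftLin_apply, Pi.add_apply, Pi.smul_apply, smul_eq_mul]
    ring
  have hFe : ∀ (x : Fin 4 → L) (v : L), v * aeval x (B.e i) = aeval x (Q i) →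
      evs F x = aeval x (B.e i) ^ 2 • liftLin L l κ (x, v) := by
    intro x v hv
    funext p
    simp only [evs, F, map_mul, hGe x v hv, Pi.smul_apply, smul_eq_mul]
    ring
  have hFrep : B.IsRep 3 F := by
    refine ⟨fun p => ?_, fun x hx hFx hxY => ?_⟩
    · have h1 := (h.eqn.hom_e i).mul (((h.eqn.hom_e i).mul (hlp p)).add
        (show (C (κ p) * Q i).IsHomogeneous (1 + 1) by simpa using (isHomogeneous_C _ (κ p)).mul (h.eqn.hom_Q i)))
      exact h1
    · have hxe : aeval x (B.e i) ≠ 0 := by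
        intro h0
        apply hFx
        funext p
        simp [F, h0]
      have hxoff : B.Off x := ⟨hx, (Y.mk_mem_pts x hx).1 hxY, i, hxe⟩
      obtain ⟨v, hv⟩ := exists_slope h.eqn hxoff
      obtain ⟨hs0, hs⟩ := (BlowUp.isSec hxoff).f_eq hxoff
      rw [hs]
      refine (mk_eq_mk_of_smul hFx hs0 (a := aeval x (B.e i) ^ 2) ?_).symm
      rw [h.sec x v hxoff hv]
      exact hFe x v (hv i)
  have hsec := h.lift_ne_zero (z := (y, w)) hη hg
  have hFy := hFe y w (hw i)
  have hF0 : evs F y ≠ 0 := by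
    rw [hFy]; exact smul_ne_zero (pow_ne_zero _ hi) hsec
  obtain ⟨t, rfl⟩ := hFrep.exists_eq_smul (a := a) (r := 2 * aeval a (B.e i) / aeval y (B.e i)) hoff hT hF0 (by
    rw [hFy]
    funext p
    have hza : matLin L l a p = - (w' * algebraMap K L (κ p)) := by
      have := congrFun hz p
      rw [liftLin_apply] at this
      simp only [Pi.add_apply, Pi.smul_apply, smul_eq_mul, Pi.zero_apply] at this
      linear_combination this
    simp only [diffs, F, diff_mul, hlin, G, diff_add, diff_C, diff_of_isHomogeneous_one (hlp p), hlpe, hza, hdQ,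
      Pi.smul_apply, smul_eq_mul, liftLin_apply, Pi.add_apply, map_add, map_mul, aeval_C, ← hw]
    field_simp
    ring)
  have hw' : w' = t * w := by
    have h1 := hdQ i
    rw [diff_smul_right, diff_self (h.eqn.hom_Q i), ← hw, aeval_smul_of_isHomogeneous (B.e_homogeneous i)] at h1
    have h2 : (w' - t * w) * aeval y (B.e i) = 0 := by
      push_cast at h1
      linear_combination -h1
    exact sub_eq_zero.1 ((mul_eq_zero.1 h2).resolve_right hi)
  have hsm : ((t • y, w') : (Fin 4 → L) × L) = t • (y, w) := by rw [hw']; rfl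
  rw [hsm, map_smul] at hz
  rw [hsm, (smul_eq_zero.1 hz).resolve_right hsec, zero_smul]

theorem BlowUp.LinearSec.injective (h : B.LinearSec Q l κ) : Function.Injective (liftLin L l κ) := by
  obtain ⟨m, hm⟩ := h.exists_matrix
  rw [← LinearMap.ker_eq_bot]
  set mL : Fin 2 → Fin 2 → L := fun i j => algebraMap K L (m i j) with hmL
  have hq : ∀ i z, S.qf i (liftLin L l κ z) = ∑ j, mL i j * h.eqn.slopeForm j z := fun i z => hm i z.1 z.2
  have hpol : ∀ i z z', polar (S.qf i) (liftLin L l κ z) (liftLin L l κ z') =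
      ∑ j, mL i j * polar (h.eqn.slopeForm j) z z' := by
    intro i z z'
    simp only [polar, ← map_add, hq, sum_univ_two]
    ring
  have hker : ∀ z, liftLin L l κ z = 0 → (∀ i, ∑ j, mL i j * h.eqn.slopeForm j z = 0) ∧
      ∀ i z', ∑ j, mL i j * polar (h.eqn.slopeForm j) z z' = 0 := by
    intro z hz
    refine ⟨fun i => ?_, fun i z' => ?_⟩
    · rw [← hq, hz, QuadraticMap.map_zero]
    · rw [← hpol, hz, polar_zero_left]
  have hmain : ∀ z, liftLin L l κ z = 0 → (∀ j, h.eqn.slopeForm j z = 0) → ∀ i, mL i ≠ 0 → z = 0 := by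
    rintro ⟨y, w⟩ hz hg i hmi
    by_cases hy : y = 0
    · subst hy
      by_contra hne
      have hw : w ≠ 0 := by rintro rfl; exact hne rfl
      apply hmi
      obtain ⟨u, hu⟩ := h.eqn.exists_eval
      have h1 : ∀ j : Fin 2, mL i j = 0 := by
        intro j
        have := (hker _ hz).2 i (u (Fin.castLE (by omega) j), 0)
        simp only [h.eqn.polar_slopeForm, hu, sum_univ_two] at this
        have h0 : ∀ k (v : Fin 4 → L), diff (Q k) 0 v = 0 := by
          intro k v
          rw [← polar_evalQuad (Q k) (h.eqn.hom_Q k), polar_zero_left]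
        fin_cases j <;> simpa [h0, hw] using this
      funext j; exact h1 j
    · exact absurd hz (h.lift_ne_zero hy hg)
  have hrn := LinearMap.finrank_range_add_finrank_ker (liftLin L l κ)
  have hdim : finrank L ((Fin 4 → L) × L) = 5 := by simp
  have hdim5 : finrank L (Fin 5 → L) = 5 := by simp
  rw [hdim] at hrn
  by_cases hdet : (Matrix.of mL).det = 0
  · exfalso
    obtain ⟨R, hR, hRm⟩ := Matrix.exists_vecMul_eq_zero_iff.2 hdet
    have hRj : ∀ j, R 0 * mL 0 j + R 1 * mL 1 j = 0 := by
      intro j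
      have := congrFun hRm j
      simpa [Matrix.vecMul, dotProduct, sum_univ_two] using this
    have h3 : ¬ 4 ≤ finrank L (LinearMap.range (liftLin L l κ)) := by
      intro h4
      apply S.smoothPencil.no_solid hdim5 h4 hR
      rintro _ ⟨z, rfl⟩
      rw [pencil_apply, hq, hq, sum_univ_two, sum_univ_two]
      linear_combination h.eqn.slopeForm 0 z * hRj 0 + h.eqn.slopeForm 1 z * hRj 1
    by_cases hm0 : ∀ i, mL i = 0
    · have h4 : ¬ 3 ≤ finrank L (LinearMap.range (liftLin L l κ)) := by
        intro h4
        apply S.smoothPencil.no_plane hdim5 h4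
        rintro _ ⟨z, rfl⟩ i
        rw [hq, hm0 i]
        simp
      obtain ⟨y, hy⟩ := BlowUp.exists_off h.eqn
      obtain ⟨w, hw⟩ := exists_slope h.eqn hy
      obtain ⟨z, hz, hz0, hzp⟩ := exists_ne_zero_mem_ker (W := LinearMap.ker (liftLin L l κ))
        (LinearMap.pi fun j : Fin 2 => polarLin (h.eqn.slopeForm j) (y, w)) (by omega)
      exact hz0 (h.eq_zero_of_polar (η := (y, w)) hy.1 (fun j => sub_eq_zero.2 (hw j)) hz
        fun j => congrFun hzp j)
    · push Not at hm0
      obtain ⟨i, hi⟩ := hm0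
      obtain ⟨R', hR'⟩ := exists_independent hi
      obtain ⟨z, hz, hz0, hzq⟩ := exists_isotropic (pencil h.eqn.slopeForm R')
        (W := LinearMap.ker (liftLin L l κ)) (by omega)
      refine hz0 (hmain z hz (eq_zero_of_pencil hR' ?_ hzq) i hi)
      have := (hker z hz).1 i
      rwa [sum_univ_two] at this
  · rw [LinearMap.ker_eq_bot']
    intro z hz
    have h0 := fun i => (hker z hz).1 i
    simp only [sum_univ_two] at h0
    rw [Matrix.det_fin_two] at hdet
    simp only [Matrix.of_apply] at hdet
    refine hmain z hz (fun j => ?_) 0 ?_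
    · apply (mul_eq_zero.1 (_ : (mL 0 0 * mL 1 1 - mL 0 1 * mL 1 0) * _ = 0)).resolve_left hdet
      fin_cases j
      · simp only [Fin.zero_eta]; linear_combination mL 1 1 * h0 0 - mL 0 1 * h0 1
      · simp only [Fin.mk_one]; linear_combination mL 0 0 * h0 1 - mL 1 0 * h0 0
    · intro h00
      have := fun j => congrFun h00 j
      simp only [Pi.zero_apply] at this
      apply hdet
      rw [this, this]; ring

end Inversion

section Model

variable {K L : Type*} [Field K] [Field L] [Algebra K L]

/-- A vector over the base field viewed over the extension. -/
def baseVec (L : Type*) [Field L] [Algebra K L] {n : ℕ} (v : Fin n → K) : Fin n → L :=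
  fun i => algebraMap K L (v i)

theorem baseVec_ne_zero {n : ℕ} {v : Fin n → K} (hv : v ≠ 0) : baseVec L v ≠ 0 := by
  intro h
  apply hv
  funext i
  exact (map_eq_zero _).1 (congrFun h i)

theorem matLin_baseVec {n m : ℕ} (A : Matrix (Fin m) (Fin n) K) (v : Fin n → K) :
    matLin L A (baseVec L v) = baseVec L (A.mulVec v) := by
  funext i
  simp [matLin_apply, baseVec, Matrix.mulVec, dotProduct]

variable [IsAlgClosed L] {S : QuarticDelPezzo K L} {Y : CubicSurface K L}

/-- The description of a blow up as the inverse of the projection from the center, and of the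
conic bundle by means of the pencil of quadrics. -/
structure BlowUp.Model (B : BlowUp S Y) (φ : PSpace L 4 → PSpace L 2) where
  p : Fin 5 → K
  P : Matrix (Fin 4) (Fin 5) K
  l : Matrix (Fin 5) (Fin 4) K
  N : Matrix (Fin 2) (Fin 2) K
  N' : Matrix (Fin 2) (Fin 2) K
  Pl : P * l = 1
  NN' : N * N' = 1
  N'N : N' * N = 1
  p_ne : baseVec L p ≠ 0
  center : B.center = pmk L (baseVec L p) p_ne
  ker : ∀ v : Fin 5 → L, matLin L P v = 0 ↔ ∃ a : L, v = a • baseVec L p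
  fiber : ∀ (v : Fin 5 → L) (hv : matLin L P v ≠ 0) (R : Fin 2 → L) (hR : matLin L N R ≠ 0),
    (pmk L (matLin L P v) hv ∈ Y.pts ∧
      φ (pmk L (matLin L P v) hv) = pmk L (matLin L N R) hR) ↔
    (polar (pencil S.qf R) (baseVec L p) v = 0 ∧ pencil S.qf R v = 0)
  map : ∀ (v : Fin 5 → L) (hv : v ≠ 0) (hπ : matLin L P v ≠ 0), (∀ i, S.qf i v = 0) →
    pmk L (matLin L P v) hπ ∈ Y.pts ∧
      B.f (pmk L (matLin L P v) hπ) = pmk L v hv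
  lift : ∀ (y : Fin 4 → L) (hy : y ≠ 0), pmk L y hy ∈ Y.pts →
    B.f (pmk L y hy) ≠ B.center → ∃ v, (∀ i, S.qf i v = 0) ∧ matLin L P v = y
  exc : ∀ (v : Fin 5 → L) (hv : matLin L P v ≠ 0),
    (∀ i, polar (S.qf i) (baseVec L p) v = 0) ↔
      pmk L (matLin L P v) hv ∈ Y.pts ∧
        B.f (pmk L (matLin L P v) hv) = B.center

variable {B : BlowUp S Y} {Q : Fin 2 → MvPolynomial (Fin 4) K}

theorem IsConicBundle.eq_off {φ : PSpace L 4 → PSpace L 2} (hφ : B.IsConicBundle φ) {y : Fin 4 → L}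
    (hy : B.Off y) : ∃ h, φ (pmk L y hy.1) =
      pmk L (fun i => aeval y (B.e i)) h := by
  obtain ⟨i, hi⟩ := hy.2.2
  have h0 : (fun i => aeval y (B.e i)) ≠ 0 := fun h => hi (congrFun h i)
  refine ⟨h0, ?_⟩
  obtain ⟨a, ha, hrep⟩ := exists_rep_eq_smul y hy.1
  have h1 : (fun i => aeval (pmk L y hy.1).rep (B.e i)) = a ^ 1 • fun i => aeval y (B.e i) := by
    rw [hrep]; exact aeval_smul_family B.e_homogeneous a y
  have h2 : (fun i => aeval (pmk L y hy.1).rep (B.e i)) ≠ 0 := by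
    rw [h1]; exact smul_ne_zero (pow_ne_zero _ ha) h0
  rw [hφ.projection _ hy.mem h2]
  exact mk_eq_mk_of_smul _ _ h1

theorem IsConicBundle.eq_exceptional {φ : PSpace L 4 → PSpace L 2} (hφ : B.IsConicBundle φ)
    (hQ : LineEquation Y B.e Q) {y : Fin 4 → L} (hy : y ≠ 0) (he : ∀ j, aeval y (B.e j) = 0) :
    ∃ h, φ (pmk L y hy) = pmk L (fun i => aeval y (Q i)) h := by
  have hc : aeval y Y.c = 0 := by rw [hQ.cone, he, he]; ring
  obtain ⟨d, F, hF, hF0⟩ := hφ.regular.exists_rep y hy ((Y.mk_mem_pts y hy).2 hc)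
  obtain ⟨h, hh⟩ := Y.dvd_of_vanish (F := F 0 * B.e 1 - F 1 * B.e 0) (by
    intro x hx
    by_cases hxe : ∀ j, aeval x (B.e j) = 0
    · simp [hxe]
    push Not at hxe
    have hoff : B.Off x := by
      refine ⟨?_, hx, hxe⟩
      rintro rfl
      obtain ⟨j, hj⟩ := hxe
      apply hj
      have := aeval_smul_of_isHomogeneous (B.e_homogeneous j) (0 : L) (0 : Fin 4 → L)
      simpa using this
    by_cases hFx : (fun i => aeval x (F i)) = 0
    · have := fun i => congrFun hFx i
      simp only [Pi.zero_apply] at this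
      simp [this]
    · obtain ⟨h1, h2⟩ := IsConicBundle.eq_off hφ hoff
      rw [hF.eq x hoff.1 hFx hoff.mem] at h2
      obtain ⟨a, -, ha⟩ := exists_smul_of_mk_eq_mk h2
      have := fun i => congrFun ha i
      simp only [Pi.smul_apply, smul_eq_mul] at this
      simp only [map_sub, map_mul, this]
      ring)
  rw [hQ.eq] at hh
  have hp := hQ.prime_zero
  obtain ⟨s, hs⟩ : B.e 0 ∣ F 0 + h * Q 0 := by
    have : B.e 0 ∣ B.e 1 * (F 0 + h * Q 0) := ⟨F 1 + h * Q 1, by linear_combination hh⟩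
    exact (hp.dvd_or_dvd this).resolve_left hQ.not_dvd
  have hF1 : F 1 = B.e 1 * s - h * Q 1 := mul_left_cancel₀ hp.ne_zero (by linear_combination B.e 1 * hs - hh)
  have hF0' : F 0 = B.e 0 * s - h * Q 0 := by linear_combination hs
  have hval : (fun i => aeval y (F i)) = (-aeval y h) • fun i => aeval y (Q i) := by
    funext i
    fin_cases i
    · simp [hF0', he]
    · simp [hF1, he]
  have hQ0 : (fun i => aeval y (Q i)) ≠ 0 := by
    intro h0
    rw [h0, smul_zero] at hval
    exact hF0 hval
  refine ⟨hQ0, ?_⟩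
  rw [hF.eq y hy hF0 ((Y.mk_mem_pts y hy).2 hc)]
  exact mk_eq_mk_of_smul _ _ hval

theorem eq_mk_iff_of_two {u n : Fin 2 → L} (hu : u ≠ 0) (hn : n ≠ 0) :
    pmk L u hu = pmk L n hn ↔ u 0 * n 1 = u 1 * n 0 := by
  constructor
  · intro h
    obtain ⟨a, -, rfl⟩ := exists_smul_of_mk_eq_mk h
    simp only [Pi.smul_apply, smul_eq_mul]; ring
  · intro h
    obtain ⟨a, ha⟩ := exists_smul_of_minors (x := u) hn (by
      intro i j
      fin_cases i <;> fin_cases j <;> simp only [Fin.zero_eta, Fin.mk_one]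
      · exact h
      · exact h.symm)
    exact mk_eq_mk_of_smul _ _ ha

theorem BlowUp.exists_model (B : BlowUp S Y) {φ : PSpace L 4 → PSpace L 2} (hφ : B.IsConicBundle φ) :
    Nonempty (B.Model φ) := by
  obtain ⟨Q, hQ⟩ := exists_lineEquation Y B.e_homogeneous B.e_independent (by
    intro x hx
    rcases eq_or_ne x 0 with rfl | h0
    · have := aeval_smul_of_isHomogeneous Y.homogeneous (0 : L) (0 : Fin 4 → L)
      simpa using this
    · exact ((BlowUp.mem_exceptional_iff x h0).1 hx).1)
  obtain ⟨l, κ, hsec⟩ := BlowUp.exists_linear_sec hQ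
  have h : B.LinearSec Q l κ := ⟨hQ, hsec⟩
  obtain ⟨m, hm⟩ := h.exists_matrix
  have hinj := h.injective
  set mL : Fin 2 → Fin 2 → L := fun i j => algebraMap K L (m i j) with hmL
  have hq : ∀ i z, S.qf i (liftLin L l κ z) = ∑ j, mL i j * hQ.slopeForm j z := fun i z => hm i z.1 z.2
  have hpol : ∀ i z z', polar (S.qf i) (liftLin L l κ z) (liftLin L l κ z') =
      ∑ j, mL i j * polar (hQ.slopeForm j) z z' := by
    intro i z z'
    simp only [polar, ← map_add, hq, sum_univ_two]
    ring
  -- the matrix of the lift and its inverse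
  let M : Matrix (Fin 5) (Fin 5) K := Matrix.of fun i j => Fin.cases (κ i) (fun j => l i j) j
  have hM : ∀ (y : Fin 4 → L) (w : L), matLin L M (Fin.cons w y) = liftLin L l κ (y, w) := by
    intro y w
    funext i
    simp only [matLin_apply, liftLin_apply, Pi.add_apply, Pi.smul_apply, smul_eq_mul, Fin.sum_univ_succ (n := 4),
      M, Matrix.of_apply, Fin.cons_zero, Fin.cons_succ, Fin.cases_zero, Fin.cases_succ]
    ring
  have hdetM : IsUnit M.det := by
    rw [isUnit_iff_ne_zero]
    intro h0
    obtain ⟨v, hv, hMv⟩ := Matrix.exists_mulVec_eq_zero_iff.2 h0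
    apply baseVec_ne_zero (L := L) hv
    have h1 : matLin L M (baseVec L v) = 0 := by
      rw [matLin_baseVec, hMv]; funext i; simp [baseVec]
    rw [← Fin.cons_self_tail (baseVec L v), hM] at h1
    have h2 := hinj (h1.trans (map_zero _).symm)
    rw [← Fin.cons_self_tail (baseVec L v)]
    obtain ⟨h3, h4⟩ := Prod.mk.inj h2
    rw [h3, h4]
    funext i
    refine Fin.cases ?_ (fun j => ?_) i <;> simp
  have hMM : M * M⁻¹ = 1 := Matrix.mul_nonsing_inv M hdetM
  have hMM' : M⁻¹ * M = 1 := Matrix.nonsing_inv_mul M hdetM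
  let P : Matrix (Fin 4) (Fin 5) K := Matrix.of fun i j => M⁻¹ i.succ j
  let ω : (Fin 5 → L) → L := fun v => matLin L M⁻¹ v 0
  have hPt : ∀ v, matLin L P v = Fin.tail (matLin L M⁻¹ v) := by
    intro v; funext i; simp [matLin_apply, P, Fin.tail]
  have hv : ∀ v, liftLin L l κ (matLin L P v, ω v) = v := by
    intro v
    rw [← hM, hPt, show ω v = matLin L M⁻¹ v 0 from rfl, Fin.cons_self_tail, ← matLin_mul, hMM, matLin_one]
  have hPΦ : ∀ y w, matLin L P (liftLin L l κ (y, w)) = y := by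
    intro y w
    rw [← hM, hPt, ← matLin_mul, hMM', matLin_one, Fin.tail_cons]
  have hωΦ : ∀ y w, ω (liftLin L l κ (y, w)) = w := by
    intro y w
    simp only [ω]
    rw [← hM, ← matLin_mul, hMM', matLin_one, Fin.cons_zero]
  have hκ : liftLin L l κ (0, 1) = baseVec L κ := by
    rw [liftLin_apply, map_zero, zero_add, one_smul]; rfl
  have hκ0 : baseVec L κ ≠ 0 := by
    intro h0
    rw [← hκ] at h0
    have := hinj (h0.trans (map_zero _).symm)
    simp at this
  have hker : ∀ v : Fin 5 → L, matLin L P v = 0 ↔ ∃ a : L, v = a • baseVec L κ := by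
    intro v
    constructor
    · intro h0
      refine ⟨ω v, ?_⟩
      rw [← hκ, ← map_smul]
      conv_lhs => rw [← hv v, h0]
      congr 1
      simp
    · rintro ⟨a, rfl⟩
      rw [map_smul, ← hκ, hPΦ, smul_zero]
  -- the matrix of the pencil
  have hqv : ∀ i v, S.qf i v = ∑ j, mL i j * hQ.slopeForm j (matLin L P v, ω v) := by
    intro i v
    rw [← hq, hv]
  have hpv : ∀ i v, polar (S.qf i) (baseVec L κ) v =
      ∑ j, mL i j * aeval (matLin L P v) (B.e j) := by
    intro i v
    have hd : ∀ j (u : Fin 4 → L), diff (Q j) 0 u = 0 := by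
      intro j u
      rw [← polar_evalQuad (Q j) (hQ.hom_Q j), polar_zero_left]
    have he : ∀ j, aeval (0 : Fin 4 → L) (B.e j) = 0 := by
      intro j
      have := aeval_smul_of_isHomogeneous (B.e_homogeneous j) (0 : L) (0 : Fin 4 → L)
      simpa using this
    conv_lhs => rw [← hκ, ← hv v]
    rw [hpol]
    simp [hQ.polar_slopeForm, hd, he]
  have hdet : m 0 0 * m 1 1 - m 0 1 * m 1 0 ≠ 0 := by
    intro h0
    have h1 : (Matrix.of mL).det = 0 := by
      rw [Matrix.det_fin_two]
      simp only [Matrix.of_apply, hmL, ← map_mul, ← map_sub, h0, map_zero]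
    obtain ⟨R, hR, hRm⟩ := Matrix.exists_vecMul_eq_zero_iff.2 h1
    refine S.smoothPencil.no_solid (W := ⊤) (by simp) (by simp) hR fun v _ => ?_
    have hRj : ∀ j, R 0 * mL 0 j + R 1 * mL 1 j = 0 := by
      intro j
      have := congrFun hRm j
      simpa [Matrix.vecMul, dotProduct, sum_univ_two] using this
    rw [pencil_apply, hqv, hqv, sum_univ_two, sum_univ_two]
    linear_combination hQ.slopeForm 0 (matLin L P v, ω v) * hRj 0 + hQ.slopeForm 1 (matLin L P v, ω v) * hRj 1
  have hdetL : mL 0 0 * mL 1 1 - mL 0 1 * mL 1 0 ≠ 0 := by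
    simp only [hmL, ← map_mul, ← map_sub]
    exact fun h => hdet ((map_eq_zero _).1 h)
  have hsolve : ∀ u : Fin 2 → L, (∀ i, ∑ j, mL i j * u j = 0) → ∀ j, u j = 0 := by
    intro u hu j
    simp only [sum_univ_two] at hu
    apply (mul_eq_zero.1 (_ : (mL 0 0 * mL 1 1 - mL 0 1 * mL 1 0) * _ = 0)).resolve_left hdetL
    fin_cases j
    · simp only [Fin.zero_eta]; linear_combination mL 1 1 * hu 0 - mL 0 1 * hu 1
    · simp only [Fin.mk_one]; linear_combination mL 0 0 * hu 1 - mL 1 0 * hu 0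
  let N : Matrix (Fin 2) (Fin 2) K := !![-m 0 1, -m 1 1; m 0 0, m 1 0]
  have hN : IsUnit N.det := by
    rw [isUnit_iff_ne_zero, Matrix.det_fin_two]
    simp only [N, Matrix.of_apply, cons_val]
    intro h0
    apply hdet
    linear_combination h0
  have hNR0 : ∀ R : Fin 2 → L, matLin L N R 0 = -(R 0 * mL 0 1 + R 1 * mL 1 1) := by
    intro R; simp [matLin_apply, N, hmL]; ring
  have hNR1 : ∀ R : Fin 2 → L, matLin L N R 1 = R 0 * mL 0 0 + R 1 * mL 1 0 := by
    intro R; simp [matLin_apply, N, hmL]; ring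
  have hS : ∀ v, (∀ i, S.qf i v = 0) → ∀ j, ω v * aeval (matLin L P v) (B.e j) = aeval (matLin L P v) (Q j) := by
    intro v hvq j
    have := hsolve (fun j => hQ.slopeForm j (matLin L P v, ω v)) (fun i => by rw [← hqv, hvq]) j
    exact sub_eq_zero.1 this
  have hmap : ∀ (v : Fin 5 → L) (hv0 : v ≠ 0) (hπ : matLin L P v ≠ 0), (∀ i, S.qf i v = 0) →
      pmk L (matLin L P v) hπ ∈ Y.pts ∧
      B.f (pmk L (matLin L P v) hπ) = pmk L v hv0 := by
    intro v hv0 hπ hvq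
    have hoff := off_of_slope hQ hπ (hS v hvq)
    refine ⟨hoff.mem, ?_⟩
    obtain ⟨hs0, hs⟩ := (BlowUp.isSec hoff).f_eq hoff
    rw [hs]
    apply mk_eq_mk_of_smul _ _ (a := 1)
    rw [one_smul, hsec _ _ hoff (hS v hvq)]
    exact hv v
  have hlift : ∀ y (hy : B.Off y), ∃ v, (∀ i, S.qf i v = 0) ∧ matLin L P v = y := by
    intro y hy
    obtain ⟨w, hw⟩ := exists_slope hQ hy
    refine ⟨liftLin L l κ (y, w), fun i => ?_, hPΦ y w⟩
    rw [hq]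
    refine Finset.sum_eq_zero fun j _ => ?_
    rw [hQ.slopeForm_apply, hw, sub_self, mul_zero]
  have hoff : ∀ y (hy : y ≠ 0), pmk L y hy ∈ Y.pts →
      B.f (pmk L y hy) ≠ B.center → B.Off y := by
    intro y hy hyY hyc
    have hc := (Y.mk_mem_pts y hy).1 hyY
    refine ⟨hy, hc, ?_⟩
    by_contra! h0
    exact hyc ((BlowUp.mem_exceptional_iff y hy).1 h0).2
  have hcenter : B.center = pmk L (baseVec L κ) hκ0 := by
    by_contra hne
    have hκq : ∀ i, S.qf i (baseVec L κ) = 0 := by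
      intro i
      have he : ∀ (F : MvPolynomial (Fin 4) K) d, F.IsHomogeneous d → d ≠ 0 → aeval (0 : Fin 4 → L) F = 0 := by
        intro F d hF hd
        have := aeval_smul_of_isHomogeneous hF (0 : L) (0 : Fin 4 → L)
        simpa [hd] using this
      rw [← hκ, hq]
      simp [hQ.slopeForm_apply, he _ _ (B.e_homogeneous _), he _ _ (hQ.hom_Q _)]
    obtain ⟨u, hsrc, htgt, heq, -⟩ := B.iso
    have hmem : pmk L (baseVec L κ) hκ0 ∈ u.target := by
      rw [htgt]
      exact ⟨(S.mk_mem_pts _ hκ0).2 hκq, fun h => hne h.symm⟩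
    have h1 := u.map_target hmem
    have h2 := heq h1
    rw [u.right_inv hmem] at h2
    rw [hsrc] at h1
    generalize u.symm (pmk L (baseVec L κ) hκ0) = x at h1 h2
    induction x using pmk_ind with
    | h y hy =>
      have hyoff := hoff y hy h1.1 h1.2
      obtain ⟨v, hvq, rfl⟩ := hlift y hyoff
      have hv0 : v ≠ 0 := by rintro rfl; exact hy (map_zero _)
      rw [(hmap v hv0 hy hvq).2] at h2
      obtain ⟨a, ha0, ha⟩ := exists_smul_of_mk_eq_mk h2
      apply hy
      apply (hker v).2
      exact ⟨a⁻¹, by rw [ha, smul_smul, inv_mul_cancel₀ ha0, one_smul]⟩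
  refine ⟨⟨κ, P, l, N, N⁻¹, ?_, Matrix.mul_nonsing_inv N hN, Matrix.nonsing_inv_mul N hN, hκ0, hcenter, hker,
    ?_, hmap, fun y hy hyY hyc => hlift y (hoff y hy hyY hyc), ?_⟩⟩
  · ext i j
    have := congrFun (congrFun hMM' i.succ) j.succ
    simp only [Matrix.mul_apply, M, Matrix.of_apply, Fin.cases_succ, Matrix.one_apply, Fin.succ_inj] at this
    simpa [Matrix.mul_apply, P, Matrix.one_apply] using this
  · intro v hv0 R hR
    set y := matLin L P v with hy
    have e1 : polar (pencil S.qf R) (baseVec L κ) v =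
        aeval y (B.e 0) * matLin L N R 1 - aeval y (B.e 1) * matLin L N R 0 := by
      rw [polar_pencil, hpv, hpv, hNR0, hNR1, sum_univ_two, sum_univ_two]; ring
    have e2 : pencil S.qf R v = ω v * polar (pencil S.qf R) (baseVec L κ) v -
        (aeval y (Q 0) * matLin L N R 1 - aeval y (Q 1) * matLin L N R 0) := by
      rw [e1, pencil_apply, hqv, hqv, hNR0, hNR1, sum_univ_two, sum_univ_two]
      simp only [hQ.slopeForm_apply]; ring
    rw [e2, e1, Y.mk_mem_pts, hQ.cone]
    by_cases he : ∀ j, aeval y (B.e j) = 0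
    · obtain ⟨h1, h2⟩ := IsConicBundle.eq_exceptional hφ hQ hv0 he
      rw [h2, eq_mk_iff_of_two, he, he]
      constructor
      · rintro ⟨-, h3⟩
        exact ⟨by ring, by linear_combination -h3⟩
      · rintro ⟨-, h3⟩
        exact ⟨by ring, by linear_combination -h3⟩
    · push Not at he
      constructor
      · rintro ⟨hc, h3⟩
        have hyoff : B.Off y := ⟨hv0, by rw [hQ.cone]; exact hc, he⟩
        obtain ⟨h1, h2⟩ := IsConicBundle.eq_off hφ hyoff
        rw [h2, eq_mk_iff_of_two] at h3
        obtain ⟨w, hw⟩ := exists_slope hQ hyoff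
        refine ⟨sub_eq_zero.2 h3, ?_⟩
        rw [← hw, ← hw]
        linear_combination (ω v - w) * h3
      · rintro ⟨h3, h4⟩
        rw [h3, mul_zero, zero_sub, neg_eq_zero] at h4
        have hc : aeval y (B.e 0) * aeval y (Q 1) - aeval y (B.e 1) * aeval y (Q 0) = 0 := by
          obtain ⟨i, hi⟩ := Function.ne_iff.1 hR
          apply (mul_eq_zero.1 (_ : matLin L N R i * _ = 0)).resolve_left hi
          fin_cases i
          · simp only [Fin.zero_eta]; linear_combination aeval y (Q 0) * h3 - aeval y (B.e 0) * h4
          · simp only [Fin.mk_one]; linear_combination aeval y (Q 1) * h3 - aeval y (B.e 1) * h4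
        have hyoff : B.Off y := ⟨hv0, by rw [hQ.cone]; exact hc, he⟩
        obtain ⟨h1, h2⟩ := IsConicBundle.eq_off hφ hyoff
        refine ⟨hc, ?_⟩
        rw [h2, eq_mk_iff_of_two]
        exact sub_eq_zero.1 h3
  · intro v hv0
    rw [Y.mk_mem_pts, ← BlowUp.mem_exceptional_iff]
    constructor
    · intro h0
      exact hsolve _ fun i => by rw [← hpv, h0]
    · intro h0 i
      rw [hpv]
      simp [h0]

end Model

section LinearAlgebra

variable {k V : Type*} [Field k] [AddCommGroup V] [Module k V] [FiniteDimensional k V]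

theorem mem_of_indep_pair {W : Submodule k V} (hW : finrank k W = 2) {u v : V} (hu : u ∈ W) (hv : v ∈ W)
    (huv : ∀ a b : k, a • u + b • v = 0 → a = 0 ∧ b = 0) {w : V} (hw : w ∈ W) :
    ∃ a b : k, w = a • u + b • v := by
  have hli : LinearIndependent k ![u, v] := LinearIndependent.pair_iff.2 huv
  have h1 : span k (Set.range ![u, v]) = W := by
    apply Submodule.eq_of_le_of_finrank_eq
    · rw [Submodule.span_le]
      rintro _ ⟨i, rfl⟩
      fin_cases i
      · exact hu
      · exact hv
    · rw [finrank_span_eq_card hli, hW]; rfl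
  rw [← h1, Matrix.range_cons, Matrix.range_cons, Matrix.range_empty, Set.union_empty] at hw
  obtain ⟨a, b, h⟩ := Submodule.mem_span_pair.1 (by simpa using hw)
  exact ⟨b, a, by rw [← h, add_comm]⟩

theorem exists_indep_of_mem {W : Submodule k V} (hW : 2 ≤ finrank k W) {u : V} (hu0 : u ≠ 0) :
    ∃ v ∈ W, ∀ a b : k, a • u + b • v = 0 → a = 0 ∧ b = 0 := by
  have h : ∃ v ∈ W, v ∉ span k {u} := by
    by_contra! hcon
    have h1 : W ≤ span k {u} := hcon
    have h2 := Submodule.finrank_mono h1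
    rw [finrank_span_singleton hu0] at h2
    omega
  obtain ⟨v, hv, hvu⟩ := h
  refine ⟨v, hv, fun a b hab => ?_⟩
  have hb : b = 0 := by
    by_contra hb
    apply hvu
    rw [mem_span_singleton]
    refine ⟨-(b⁻¹ * a), ?_⟩
    have : v = b⁻¹ • (b • v) := by rw [smul_smul, inv_mul_cancel₀ hb, one_smul]
    rw [this, eq_neg_of_add_eq_zero_right hab, smul_neg, smul_smul, neg_smul]
  subst hb
  rw [zero_smul, add_zero, smul_eq_zero] at hab
  exact ⟨hab.resolve_right hu0, rfl⟩

theorem indep_of_disjoint {W : Submodule k V} {u v : V} (hu : u ∈ W) (hu0 : u ≠ 0) (hv : v ∉ W) (a b : k)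
    (h : a • u + b • v = 0) : a = 0 ∧ b = 0 := by
  have hb : b = 0 := by
    by_contra hb
    apply hv
    have : v = b⁻¹ • (b • v) := by rw [smul_smul, inv_mul_cancel₀ hb, one_smul]
    rw [this, eq_neg_of_add_eq_zero_right h]
    exact W.smul_mem _ (W.neg_mem (W.smul_mem _ hu))
  subst hb
  rw [zero_smul, add_zero, smul_eq_zero] at h
  exact ⟨h.resolve_right hu0, rfl⟩

theorem finrank_sup_span_singleton {W : Submodule k V} {v : V} (hv : v ∉ W) :
    finrank k ↥(W ⊔ span k {v}) = finrank k W + 1 := by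
  have h0 : v ≠ 0 := by rintro rfl; exact hv W.zero_mem
  have h := Submodule.finrank_sup_add_finrank_inf_eq W (span k {v})
  have h1 : W ⊓ span k {v} = ⊥ := by
    rw [Submodule.eq_bot_iff]
    rintro x ⟨hx, hxv⟩
    obtain ⟨a, rfl⟩ := Submodule.mem_span_singleton.1 hxv
    by_contra hne
    have ha : a ≠ 0 := by rintro rfl; simp at hne
    apply hv
    have := W.smul_mem a⁻¹ hx
    rwa [smul_smul, inv_mul_cancel₀ ha, one_smul] at this
  rw [h1, finrank_bot, finrank_span_singleton h0] at h
  omega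

end LinearAlgebra

section Vertices

variable {k V : Type*} [Field k] [AddCommGroup V] [Module k V] [FiniteDimensional k V]
  {q : Fin 2 → QuadraticForm k V}

theorem polar_pencil_smul (q : Fin 2 → QuadraticForm k V) (R : Fin 2 → k) (a b : k) (u v w : V) :
    polar (pencil q R) w (a • u + b • v) =
      a * polar (pencil q R) w u + b * polar (pencil q R) w v := by
  rw [polar_add_right, polar_smul_right, polar_smul_right]
  rfl

theorem map_comb (q : QuadraticForm k V) (a b : k) (u v : V) :
    q (a • u + b • v) = a ^ 2 * q u + a * b * polar q u v + b ^ 2 * q v := by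
  rw [QuadraticMap.map_add (⇑q), QuadraticMap.map_smul, QuadraticMap.map_smul, polar_smul_left,
    polar_smul_right]
  simp only [smul_eq_mul]
  ring

/-- A pencil of a two-dimensional and a three-dimensional space, given by the polar forms, is degenerate
if it comes from a line on the base locus and a plane through this line. -/
theorem SmoothPencil.no_polar_pair [IsAlgClosed k] (hq : SmoothPencil q) (hV : finrank k V = 5)
    {W : Submodule k V} (hW : 3 ≤ finrank k W) {u v : V}
    (huv : ∀ a b : k, a • u + b • v = 0 → a = 0 ∧ b = 0) (hu : ∀ i, q i u = 0) (hv : ∀ i, q i v = 0)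
    (huv0 : ∀ i, polar (q i) u v = 0) (huW : ∀ i, ∀ w ∈ W, polar (q i) u w = 0)
    (hvW : ∀ i, ∀ w ∈ W, polar (q i) v w = 0) : False := by
  obtain ⟨c, hc⟩ := exists_complement (m := 2) (n := 3) hW hV
  let p : Fin 2 → V → Fin 2 → k := fun i w j => polar (q i) w (c j)
  obtain ⟨a, b, hab, h0⟩ := exists_binary_zero (p 0 u 0 * p 1 u 1 - p 0 u 1 * p 1 u 0)
    (p 0 u 0 * p 1 v 1 + p 0 v 0 * p 1 u 1 - p 0 u 1 * p 1 v 0 - p 0 v 1 * p 1 u 0)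
    (p 0 v 0 * p 1 v 1 - p 0 v 1 * p 1 v 0)
  set w := a • u + b • v with hw
  have hw0 : w ≠ 0 := by
    intro h1
    obtain ⟨rfl, rfl⟩ := huv a b h1
    simp at hab
  have hwq : ∀ i, q i w = 0 := by
    intro i
    rw [hw, map_comb, hu, hv, huv0]; ring
  have hp : ∀ i j, p i w j = a * p i u j + b * p i v j := by
    intro i j
    simp [p, hw, polar_add_left, polar_smul_left]
  have hdet : (Matrix.of fun i j => p i w j).det = 0 := by
    rw [Matrix.det_fin_two]
    simp only [Matrix.of_apply, hp]
    linear_combination h0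
  obtain ⟨R, hR, hRp⟩ := Matrix.exists_vecMul_eq_zero_iff.2 hdet
  obtain ⟨z, hz⟩ := hq w hw0 hwq R hR
  apply hz
  obtain ⟨y, hy, s, rfl⟩ := hc z
  have h1 : ∀ j, polar (pencil q R) w (c j) = 0 := by
    intro j
    have := congrFun hRp j
    simp only [Matrix.vecMul, dotProduct, sum_univ_two, Matrix.of_apply, Pi.zero_apply] at this
    rw [polar_pencil]; exact this
  have h2 : polar (pencil q R) w y = 0 := by
    rw [polar_pencil, hw]
    simp only [polar_add_left, polar_smul_left, huW _ y hy, hvW _ y hy]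
    simp
  rw [sum_univ_two, polar_add_right, polar_add_right,
    polar_smul_right, polar_smul_right, h1, h1, h2]
  simp

/-- `v` is a vertex of the quadric with coordinates `R`. -/
def IsVert (q : Fin 2 → QuadraticForm k V) (R : Fin 2 → k) (v : V) : Prop :=
  v ≠ 0 ∧ pencil q R v = 0 ∧ ∀ u, polar (pencil q R) v u = 0

/-- A line on the base locus of the pencil. -/
def IsLine (q : Fin 2 → QuadraticForm k V) (W : Submodule k V) : Prop :=
  finrank k W = 2 ∧ ∀ v ∈ W, ∀ i, q i v = 0

theorem IsVert.ne_zero (hq : SmoothPencil q) {R R' : Fin 2 → k} {v : V} (hv : IsVert q R v)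
    (hR : R 0 * R' 1 - R 1 * R' 0 ≠ 0) : pencil q R' v ≠ 0 := by
  intro h
  have hR0 : R ≠ 0 := by rintro rfl; simp at hR
  obtain ⟨u, hu⟩ := hq v hv.1 (eq_zero_of_pencil hR hv.2.1 h) R hR0
  exact hu (hv.2.2 u)

theorem IsVert.not_mem_line (hq : SmoothPencil q) {R : Fin 2 → k} (hR : R ≠ 0) {v : V} (hv : IsVert q R v)
    {W : Submodule k V} (hW : IsLine q W) : v ∉ W := by
  intro h
  obtain ⟨R', hR'⟩ := exists_independent hR
  exact hv.ne_zero hq hR' (pencil_eq_zero (hW.2 v h) R')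

theorem IsVert.unique [IsAlgClosed k] (hq : SmoothPencil q) {R : Fin 2 → k} (hR : R ≠ 0) {v w : V}
    (hv : IsVert q R v) (hw : IsVert q R w) : ∃ a : k, w = a • v := by
  by_contra hcon
  obtain ⟨R', hR'⟩ := exists_independent hR
  obtain ⟨a, b, hab, h0⟩ := exists_binary_zero (pencil q R' v) (polar (pencil q R') v w) (pencil q R' w)
  have hne : a • v + b • w ≠ 0 := by
    intro h
    obtain ⟨ha, hb⟩ := indep_of_disjoint (W := span k {v}) (mem_span_singleton_self v) hv.1
      (fun h => hcon (by obtain ⟨a, ha⟩ := Submodule.mem_span_singleton.1 h; exact ⟨a, ha.symm⟩)) a b h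
    simp [ha, hb] at hab
  refine IsVert.ne_zero (R := R) (v := a • v + b • w) hq ⟨hne, ?_, fun u => ?_⟩ hR' ?_
  · rw [map_comb, hv.2.1, hw.2.1, hv.2.2]; ring
  · rw [polar_add_left, polar_smul_left, polar_smul_left, hv.2.2, hw.2.2]
    simp
  · rw [map_comb]; linear_combination h0

theorem IsVert.smul {R : Fin 2 → k} {v : V} (hv : IsVert q R v) (a : k) : IsVert q (a • R) v := by
  refine ⟨hv.1, ?_, fun u => ?_⟩
  · have := hv.2.1
    rw [pencil_apply] at this ⊢
    simp only [Pi.smul_apply, smul_eq_mul]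
    linear_combination a * this
  · have := hv.2.2 u
    rw [polar_pencil] at this ⊢
    simp only [Pi.smul_apply, smul_eq_mul]
    linear_combination a * this

/-- The reflection defined by the projection from a vertex. -/
def refl (q : Fin 2 → QuadraticForm k V) (R' : Fin 2 → k) (v : V) : V →ₗ[k] V where
  toFun x := x - (polar (pencil q R') x v / pencil q R' v) • v
  map_add' x y := by
    rw [polar_add_left, add_div, add_smul]; abel
  map_smul' a x := by
    rw [polar_smul_left, smul_eq_mul, mul_div_assoc, mul_smul, smul_sub]; rfl

theorem refl_apply (R' : Fin 2 → k) (v x : V) :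
    refl q R' v x = x - (polar (pencil q R') x v / pencil q R' v) • v := rfl

theorem refl_refl {R' : Fin 2 → k} {v : V} (h : pencil q R' v ≠ 0) (x : V) :
    refl q R' v (refl q R' v x) = x := by
  rw [refl_apply R' v (refl q R' v x), refl_apply]
  rw [polar_sub_left, polar_smul_left, polar_self]
  have : (polar (pencil q R') x v - (polar (pencil q R') x v / pencil q R' v) •
      (2 • pencil q R' v)) / pencil q R' v = - (polar (pencil q R') x v / pencil q R' v) := by
    simp only [smul_eq_mul, nsmul_eq_mul]
    field_simp
    push_cast
    ring
  rw [this, neg_smul]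
  abel

theorem map_refl {R R' : Fin 2 → k} (hR : R 0 * R' 1 - R 1 * R' 0 ≠ 0) {v : V}
    (hv : IsVert q R v) (h : pencil q R' v ≠ 0) (x : V) (i : Fin 2) : q i (refl q R' v x) = q i x := by
  have hs : ∀ Q : QuadraticForm k V, ∀ c : k, Q (x - c • v) = Q x - c * polar Q x v + c ^ 2 * Q v := by
    intro Q c
    have := map_comb Q 1 (-c) x v
    rw [one_smul, neg_smul, ← sub_eq_add_neg] at this
    rw [this]; ring
  have h1 : pencil q R (refl q R' v x) = pencil q R x := by
    rw [refl_apply, hs, hv.2.1, polar_comm (⇑(pencil q R)), hv.2.2]; ring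
  have h2 : pencil q R' (refl q R' v x) = pencil q R' x := by
    rw [refl_apply, hs]
    field_simp
    ring
  rw [pencil_apply, pencil_apply] at h1 h2
  have : (R 0 * R' 1 - R 1 * R' 0) * (q i (refl q R' v x) - q i x) = 0 := by
    fin_cases i
    · simp only [Fin.zero_eta]; linear_combination R' 1 * h1 - R 1 * h2
    · simp only [Fin.mk_one]; linear_combination R 0 * h2 - R' 0 * h1
  exact sub_eq_zero.1 ((mul_eq_zero.1 this).resolve_left hR)

theorem refl_injective {R' : Fin 2 → k} {v : V} (h : pencil q R' v ≠ 0) :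
    Function.Injective (refl q R' v) := by
  intro x y hxy
  rw [← refl_refl h x, hxy, refl_refl h]

theorem refl_map_map {R' : Fin 2 → k} {v : V} (h : pencil q R' v ≠ 0) (W : Submodule k V) :
    (W.map (refl q R' v)).map (refl q R' v) = W := by
  ext x
  simp only [Submodule.mem_map, exists_exists_and_eq_and]
  constructor
  · rintro ⟨a, ha, rfl⟩
    rwa [refl_refl h]
  · intro hx
    exact ⟨x, hx, refl_refl h x⟩

theorem IsLine.refl {R R' : Fin 2 → k} (hR : R 0 * R' 1 - R 1 * R' 0 ≠ 0) {v : V}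
    (hv : IsVert q R v) (h : pencil q R' v ≠ 0) {W : Submodule k V} (hW : IsLine q W) :
    IsLine q (W.map (refl q R' v)) := by
  refine ⟨?_, ?_⟩
  · rw [← (Submodule.equivMapOfInjective _ (refl_injective h) W).finrank_eq, hW.1]
  · rintro _ ⟨x, hx, rfl⟩ i
    rw [map_refl hR hv h]
    exact hW.2 x hx i

theorem IsLine.refl_ne [IsAlgClosed k] (hq : SmoothPencil q) (hV : finrank k V = 5)
    {R R' : Fin 2 → k} (hR : R 0 * R' 1 - R 1 * R' 0 ≠ 0) {v : V}
    (hv : IsVert q R v) {W : Submodule k V} (hW : IsLine q W) : W.map (DelPezzo.refl q R' v) ≠ W := by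
  intro heq
  have hR0 : R ≠ 0 := by rintro rfl; simp at hR
  have h := hv.ne_zero hq hR
  have hvW := hv.not_mem_line hq hR0 hW
  have h1 : ∀ y ∈ W, ∀ i, polar (q i) y v = 0 := by
    intro y hy
    have h2 : DelPezzo.refl q R' v y ∈ W := heq ▸ mem_map_of_mem hy
    rw [refl_apply] at h2
    have h3 := W.sub_mem hy h2
    rw [sub_sub_cancel] at h3
    have h4 : polar (pencil q R') y v / pencil q R' v = 0 := by
      by_contra hne
      apply hvW
      have := W.smul_mem (polar (pencil q R') y v / pencil q R' v)⁻¹ h3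
      rwa [smul_smul, inv_mul_cancel₀ hne, one_smul] at this
    have h5 := (div_eq_zero_iff.1 h4).resolve_right h
    have h6 := hv.2.2 y
    rw [polar_comm] at h6
    rw [polar_pencil] at h5 h6
    intro i
    apply (mul_eq_zero.1 (_ : (R 0 * R' 1 - R 1 * R' 0) * _ = 0)).resolve_left hR
    fin_cases i
    · simp only [Fin.zero_eta]; linear_combination R' 1 * h6 - R 1 * h5
    · simp only [Fin.mk_one]; linear_combination R 0 * h5 - R' 0 * h6
  obtain ⟨a, ha, b, hb, hab⟩ := exists_pair_of_finrank (show 2 ≤ finrank k W by rw [hW.1])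
  have hpW : ∀ y ∈ W, ∀ i, ∀ w ∈ W ⊔ span k {v}, polar (q i) y w = 0 := by
    intro y hy i w hw
    obtain ⟨z, hz, c, hc, rfl⟩ := Submodule.mem_sup.1 hw
    obtain ⟨c, rfl⟩ := Submodule.mem_span_singleton.1 hc
    rw [polar_add_right, polar_smul_right, h1 y hy i,
      polar_eq_zero_of_isotropic (fun v hv => hW.2 v hv i) hy hz]
    simp
  refine hq.no_polar_pair hV (W := W ⊔ span k {v}) ?_ hab (hW.2 a ha) (hW.2 b hb)
    (fun i => polar_eq_zero_of_isotropic (fun v hv => hW.2 v hv i) ha hb) (hpW a ha) (hpW b hb)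
  rw [finrank_sup_span_singleton hvW, hW.1]

theorem IsLine.exists_mem_refl {R' : Fin 2 → k} {v : V} {W : Submodule k V} (hW : IsLine q W) :
    ∃ y ∈ W, y ≠ 0 ∧ polar (pencil q R') y v = 0 ∧ y ∈ W.map (DelPezzo.refl q R' v) := by
  obtain ⟨y, hy, hy0, hyv⟩ := exists_ne_zero_mem_ker (W := W)
    (LinearMap.pi fun _ : Fin 1 => polarLin (pencil q R') v) (by rw [hW.1]; norm_num)
  have h : polar (pencil q R') y v = 0 := by
    rw [polar_comm]; exact congrFun hyv 0
  refine ⟨y, hy, hy0, h, y, hy, ?_⟩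
  rw [refl_apply, h, zero_div, zero_smul, sub_zero]

/-- Two lines with a common point are exchanged by the reflection of a singular quadric. -/
theorem IsLine.exists_vert_of_meet [IsAlgClosed k] (hq : SmoothPencil q) (hV : finrank k V = 5)
    {W W' : Submodule k V} (hW : IsLine q W) (hW' : IsLine q W') (hne : W ≠ W') (hm : W ⊓ W' ≠ ⊥) :
    ∃ (R : Fin 2 → k) (v : V), R ≠ 0 ∧ IsVert q R v ∧
      ∀ R' : Fin 2 → k, R 0 * R' 1 - R 1 * R' 0 ≠ 0 → W' = W.map (DelPezzo.refl q R' v) := by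
  obtain ⟨a, ⟨haW, haW'⟩, ha0⟩ := Submodule.exists_mem_ne_zero_of_ne_bot hm
  obtain ⟨b, hb, hab⟩ := exists_indep_of_mem (show 2 ≤ finrank k W by rw [hW.1]) ha0
  obtain ⟨c, hc, hac⟩ := exists_indep_of_mem (show 2 ≤ finrank k W' by rw [hW'.1]) ha0
  have hcW : c ∉ W := by
    intro h
    apply hne
    apply Submodule.eq_of_le_of_finrank_eq _ (by rw [hW.1, hW'.1]) |>.symm
    intro w hw
    obtain ⟨x, y, rfl⟩ := mem_of_indep_pair hW'.1 haW' hc hac hw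
    exact W.add_mem (W.smul_mem _ haW) (W.smul_mem _ h)
  have hpab : ∀ i, polar (q i) a b = 0 := fun i =>
    polar_eq_zero_of_isotropic (fun v hv => hW.2 v hv i) haW hb
  have hpac : ∀ i, polar (q i) a c = 0 := fun i =>
    polar_eq_zero_of_isotropic (fun v hv => hW'.2 v hv i) haW' hc
  set T := W ⊔ span k {c} with hT
  have hT3 : finrank k T = 3 := by rw [hT, finrank_sup_span_singleton hcW, hW.1]
  have hTmem : ∀ z ∈ T, ∃ α β γ : k, z = α • a + β • b + γ • c := by
    intro z hz
    obtain ⟨w, hw, u, hu, rfl⟩ := Submodule.mem_sup.1 hz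
    obtain ⟨γ, rfl⟩ := Submodule.mem_span_singleton.1 hu
    obtain ⟨α, β, rfl⟩ := mem_of_indep_pair hW.1 haW hb hab hw
    exact ⟨α, β, γ, rfl⟩
  have hqT : ∀ i (α β γ : k), q i (α • a + β • b + γ • c) = β * γ * polar (q i) b c := by
    intro i α β γ
    rw [← one_smul k (α • a + β • b), map_comb, map_comb, hW.2 a haW, hW.2 b hb, hW'.2 c hc, hpab,
      polar_add_left, polar_smul_left, polar_smul_left, hpac]
    simp only [smul_eq_mul]
    ring
  have hs0 : ∃ i, polar (q i) b c ≠ 0 := by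
    by_contra! hcon
    apply hq.no_plane hV (W := T) (by rw [hT3])
    intro v hv i
    obtain ⟨α, β, γ, rfl⟩ := hTmem v hv
    rw [hqT, hcon, mul_zero]
  let s : Fin 2 → k := fun i => polar (q i) b c
  let R : Fin 2 → k := ![s 1, -s 0]
  have hR0 : R ≠ 0 := by
    intro h
    obtain ⟨i, hi⟩ := hs0
    have h0 := congrFun h 0
    have h1 := congrFun h 1
    simp only [R, cons_val, Pi.zero_apply, neg_eq_zero] at h0 h1
    fin_cases i
    · exact hi h1
    · exact hi h0
  have hRT : ∀ v ∈ T, pencil q R v = 0 := by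
    intro v hv
    obtain ⟨α, β, γ, rfl⟩ := hTmem v hv
    rw [pencil_apply, hqT, hqT]
    simp only [R, s, cons_val]
    ring
  obtain ⟨n, hn⟩ := exists_complement (m := 2) (n := 3) (W := T) (by rw [hT3]) hV
  obtain ⟨v, hvT, hv0, hvn⟩ := exists_ne_zero_mem_ker (W := T)
    (LinearMap.pi fun j : Fin 2 => polarLin (pencil q R) (n j)) (by rw [hT3]; norm_num)
  have hv : IsVert q R v := by
    refine ⟨hv0, hRT v hvT, fun u => ?_⟩
    obtain ⟨w, hw, d, rfl⟩ := hn u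
    have h0 : ∀ j, polar (pencil q R) v (n j) = 0 := by
      intro j
      rw [polar_comm]
      exact congrFun hvn j
    rw [sum_univ_two, polar_add_right, polar_eq_zero_of_isotropic hRT hvT hw, polar_pencil_smul,
      h0, h0]
    ring
  refine ⟨R, v, hR0, hv, fun R' hR' => ?_⟩
  have hv' := hv.ne_zero hq hR'
  obtain ⟨α, β, γ, hvc⟩ := hTmem v hvT
  set σ : k := R' 0 * s 0 + R' 1 * s 1 with hσ
  have hqv : pencil q R' v = β * γ * σ := by
    rw [pencil_apply, hvc, hqT, hqT]; ring
  have hβ : β ≠ 0 := by rintro rfl; simp [hqv] at hv'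
  have hγ : γ ≠ 0 := by rintro rfl; simp [hqv] at hv'
  have hσ0 : σ ≠ 0 := by intro h; simp [hqv, h] at hv'
  have hpol : ∀ R, polar (pencil q R) b c = R 0 * s 0 + R 1 * s 1 := fun R => polar_pencil q R b c
  have hpa : polar (pencil q R') a v = 0 := by
    rw [polar_pencil, hvc]
    simp only [polar_add_right, polar_smul_right, hpab, hpac, polar_self,
      hW.2 a haW]
    simp
  have hpb : polar (pencil q R') b v = γ * σ := by
    rw [polar_pencil, hvc]
    simp only [polar_add_right, polar_smul_right, polar_comm _ b a,
      hpab, polar_self, hW.2 b hb]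
    simp only [smul_eq_mul, hσ, s]
    simp
    ring
  have hra : DelPezzo.refl q R' v a = a := by rw [refl_apply, hpa, zero_div, zero_smul, sub_zero]
  have hrb : DelPezzo.refl q R' v b = (-(α / β)) • a + (-(γ / β)) • c := by
    rw [refl_apply, hpb, hqv]
    have : γ * σ / (β * γ * σ) = β⁻¹ := by field_simp
    rw [this, hvc, smul_add, smul_add, smul_smul, smul_smul, smul_smul, inv_mul_cancel₀ hβ, one_smul, div_eq_inv_mul,
      div_eq_inv_mul, neg_smul, neg_smul]
    abel
  symm
  apply Submodule.eq_of_le_of_finrank_eq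
  · rintro _ ⟨w, hw, rfl⟩
    obtain ⟨x, y, rfl⟩ := mem_of_indep_pair hW.1 haW hb hab hw
    rw [map_add, map_smul, map_smul, hra, hrb]
    exact W'.add_mem (W'.smul_mem _ haW') (W'.smul_mem _ (W'.add_mem (W'.smul_mem _ haW') (W'.smul_mem _ hc)))
  · rw [(hW.refl hR' hv hv').1, hW'.1]

/-- Two disjoint lines have a common neighbour. -/
theorem IsLine.exists_common_neighbour [IsAlgClosed k]
    {W W' : Submodule k V} (hW : IsLine q W) (hW' : IsLine q W') (hm : W ⊓ W' = ⊥) :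
    ∃ N, IsLine q N ∧ N ≠ W ∧ N ≠ W' ∧ W ⊓ N ≠ ⊥ ∧ N ⊓ W' ≠ ⊥ := by
  obtain ⟨a, ha, b, hb, hab⟩ := exists_pair_of_finrank (show 2 ≤ finrank k W by rw [hW.1])
  obtain ⟨c, hc, d, hd, hcd⟩ := exists_pair_of_finrank (show 2 ≤ finrank k W' by rw [hW'.1])
  let p : Fin 2 → V → V → k := fun i x y => polar (q i) x y
  obtain ⟨α, β, hαβ, h0⟩ := exists_binary_zero (p 0 a c * p 1 a d - p 0 a d * p 1 a c)
    (p 0 a c * p 1 b d + p 0 b c * p 1 a d - p 0 a d * p 1 b c - p 0 b d * p 1 a c)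
    (p 0 b c * p 1 b d - p 0 b d * p 1 b c)
  set x := α • a + β • b with hx
  have hxW : x ∈ W := W.add_mem (W.smul_mem α ha) (W.smul_mem β hb)
  have hx0 : x ≠ 0 := by
    intro h
    obtain ⟨rfl, rfl⟩ := hab α β h
    simp at hαβ
  have hpx : ∀ i y, p i x y = α * p i a y + β * p i b y := by
    intro i y
    simp [p, hx, polar_add_left, polar_smul_left]
  have hdet : (Matrix.of ![![p 0 x c, p 0 x d], ![p 1 x c, p 1 x d]]).det = 0 := by
    rw [Matrix.det_fin_two]
    simp only [Matrix.of_apply, cons_val, hpx]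
    linear_combination h0
  obtain ⟨s, hs, hsp⟩ := Matrix.exists_mulVec_eq_zero_iff.2 hdet
  set y := s 0 • c + s 1 • d with hy
  have hyW : y ∈ W' := W'.add_mem (W'.smul_mem _ hc) (W'.smul_mem _ hd)
  have hy0 : y ≠ 0 := by
    intro h
    obtain ⟨h1, h2⟩ := hcd _ _ h
    apply hs
    funext i
    fin_cases i
    · exact h1
    · exact h2
  have hxy : ∀ i, polar (q i) x y = 0 := by
    intro i
    have := congrFun hsp i
    rw [hy, polar_add_right, polar_smul_right, polar_smul_right]
    simp only [Matrix.mulVec, dotProduct, sum_univ_two, Matrix.of_apply, Pi.zero_apply] at this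
    fin_cases i
    · simp only [Fin.zero_eta, cons_val] at this
      simp only [smul_eq_mul, Fin.zero_eta]; linear_combination this
    · simp only [Fin.mk_one, cons_val] at this
      simp only [smul_eq_mul, Fin.mk_one]; linear_combination this
  have hyW0 : y ∉ W := fun h => hy0 ((Submodule.mem_bot k).1 (hm ▸ ⟨h, hyW⟩))
  have hxW0 : x ∉ W' := fun h => hx0 ((Submodule.mem_bot k).1 (hm ▸ ⟨hxW, h⟩))
  have hli := indep_of_disjoint hxW hx0 hyW0
  let N := span k (Set.range ![x, y])
  have hxN : x ∈ N := Submodule.subset_span ⟨0, rfl⟩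
  have hyN : y ∈ N := Submodule.subset_span ⟨1, rfl⟩
  have hN2 : finrank k N = 2 := by
    rw [finrank_span_eq_card (LinearIndependent.pair_iff.2 hli)]; rfl
  refine ⟨N, ⟨hN2, fun v hv i => ?_⟩, ?_, ?_, ?_, ?_⟩
  · obtain ⟨a, b, rfl⟩ := mem_of_indep_pair hN2 hxN hyN hli hv
    rw [map_comb, hW.2 x hxW, hW'.2 y hyW, hxy]; ring
  · rintro h; exact hyW0 (h ▸ hyN)
  · rintro h; exact hxW0 (h ▸ hxN)
  · intro h; exact hx0 ((Submodule.mem_bot k).1 (h ▸ ⟨hxW, hxN⟩))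
  · intro h; exact hy0 ((Submodule.mem_bot k).1 (h ▸ ⟨hyN, hyW⟩))

end Vertices

section Splitting

variable {k V : Type*} [Field k] [AddCommGroup V] [Module k V] [FiniteDimensional k V]
  {q : Fin 2 → QuadraticForm k V}

theorem refl_eq {R R' R'' : Fin 2 → k} (hR : R 0 * R' 1 - R 1 * R' 0 ≠ 0) {v : V}
    (hv : IsVert q R v) (h' : pencil q R' v ≠ 0) (h'' : pencil q R'' v ≠ 0) : refl q R' v = refl q R'' v := by
  obtain ⟨a, b, hab⟩ : ∃ a b : k, ∀ i, R'' i = a * R' i + b * R i := by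
    refine ⟨(R 0 * R'' 1 - R 1 * R'' 0) / (R 0 * R' 1 - R 1 * R' 0),
      (R'' 0 * R' 1 - R'' 1 * R' 0) / (R 0 * R' 1 - R 1 * R' 0), fun i => ?_⟩
    rw [div_mul_eq_mul_div, div_mul_eq_mul_div, ← add_div, eq_div_iff hR]
    fin_cases i <;> simp only [Fin.zero_eta, Fin.mk_one] <;> ring
  have h1 : pencil q R'' v = a * pencil q R' v := by
    have := hv.2.1
    rw [pencil_apply] at this ⊢
    rw [hab, hab, pencil_apply q R']
    linear_combination b * this
  have ha : a ≠ 0 := by rintro rfl; simp [h1] at h''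
  ext x
  rw [refl_apply, refl_apply, h1]
  congr 2
  have h2 := hv.2.2 x
  rw [polar_comm] at h2
  have h3 : polar (pencil q R'') x v = a * polar (pencil q R') x v := by
    rw [polar_pencil] at h2 ⊢
    rw [hab, hab, polar_pencil q R']
    linear_combination b * h2
  rw [h3]
  field_simp

/-- The equation of a singular quadric of the pencil adapted to a point `p` of the base locus. -/
structure Split (q : Fin 2 → QuadraticForm k V) (R : Fin 2 → k) (p : V) where
  v : V
  vert : IsVert q R v
  x : V →ₗ[k] k
  l : V →ₗ[k] k
  l' : V →ₗ[k] k
  w : V →ₗ[k] k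
  form : ∀ z, pencil q R z = x z * w z - l z * l' z
  ker : ∀ z, x z = 0 → l z = 0 → l' z = 0 → w z = 0 → ∃ a : k, z = a • v
  surj : ∀ a b c d : k, ∃ z, x z = a ∧ l z = b ∧ l' z = c ∧ w z = d
  xv : x v = 0
  lv : l v = 0
  l'v : l' v = 0
  wv : w v = 0
  xp : x p = 0
  lp : l p = 0
  l'p : l' p = 0
  wp : w p = 1

/-- The splitting with the two planes interchanged. -/
def Split.swap {R : Fin 2 → k} {p : V} (s : Split q R p) : Split q R p where
  v := s.v
  vert := s.vert
  x := s.x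
  l := s.l'
  l' := s.l
  w := s.w
  form z := by rw [s.form]; ring
  ker z h1 h2 h3 h4 := s.ker z h1 h3 h2 h4
  surj a b c d := by
    obtain ⟨z, h1, h2, h3, h4⟩ := s.surj a c b d
    exact ⟨z, h1, h3, h2, h4⟩
  xv := s.xv
  lv := s.l'v
  l'v := s.lv
  wv := s.wv
  xp := s.xp
  lp := s.l'p
  l'p := s.lp
  wp := s.wp

theorem Split.polar_eq {R : Fin 2 → k} {p : V} (s : Split q R p) (z u : V) :
    polar (pencil q R) z u = s.x z * s.w u + s.w z * s.x u - s.l z * s.l' u - s.l' z * s.l u := by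
  simp only [polar, s.form, map_add]
  ring

theorem Split.polar_p {R : Fin 2 → k} {p : V} (s : Split q R p) (u : V) :
    polar (pencil q R) p u = s.x u := by
  rw [s.polar_eq, s.xp, s.wp, s.lp, s.l'p]; ring

theorem exists_split [IsAlgClosed k] (hq : SmoothPencil q) (hV : finrank k V = 5)
    {R : Fin 2 → k} (hR : R ≠ 0) {v p : V} (hv : IsVert q R v) (hp0 : p ≠ 0) (hp : ∀ i, q i p = 0) :
    Nonempty (Split q R p) := by
  set Q := pencil q R with hQ
  have hQp : Q p = 0 := pencil_eq_zero hp R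
  obtain ⟨R', hR'⟩ := exists_independent hR
  have hv' := hv.ne_zero hq hR'
  -- a vector not orthogonal to `p`
  obtain ⟨t, ht⟩ : ∃ t, polar Q p t = 1 := by
    obtain ⟨u, hu⟩ := hq p hp0 hp R hR
    refine ⟨(polar Q p u)⁻¹ • u, ?_⟩
    rw [polar_smul_right, smul_eq_mul, inv_mul_cancel₀ hu]
  have hpv : ∀ a b : k, a • p + b • v = 0 → a = 0 ∧ b = 0 :=
    indep_of_disjoint (W := span k {p}) (mem_span_singleton_self p) hp0 (by
      intro h
      obtain ⟨a, rfl⟩ := Submodule.mem_span_singleton.1 h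
      apply hv'
      rw [QuadraticMap.map_smul, pencil_eq_zero hp R', smul_zero])
  let M := span k (Set.range ![p, v])
  have hpM : p ∈ M := Submodule.subset_span ⟨0, rfl⟩
  have hvM : v ∈ M := Submodule.subset_span ⟨1, rfl⟩
  have hM : finrank k M = 2 := by
    rw [finrank_span_eq_card (LinearIndependent.pair_iff.2 hpv)]; rfl
  obtain ⟨C, hC⟩ := exists_isCompl M
  have hCf := Submodule.finrank_add_eq_of_isCompl hC
  have hU := finrank_le_finrank_inf_ker_add C (LinearMap.pi fun _ : Fin 1 => polarLin Q p)
  obtain ⟨b, hb, hb0, hbQ⟩ := exists_isotropic Q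
    (W := C ⊓ LinearMap.ker (LinearMap.pi fun _ : Fin 1 => polarLin Q p)) (by omega)
  obtain ⟨b', hb', hbb'⟩ := exists_indep_of_mem
    (W := C ⊓ LinearMap.ker (LinearMap.pi fun _ : Fin 1 => polarLin Q p)) (by omega) hb0
  have hpb : polar Q p b = 0 := congrFun hb.2 0
  have hpb' : polar Q p b' = 0 := congrFun hb'.2 0
  have hpp : polar Q p p = 0 := by rw [polar_self, hQp, smul_zero]
  have hpv0 : polar Q p v = 0 := by rw [polar_comm]; exact hv.2.2 p
  have hli : ∀ c : Fin 5 → k, c 0 • p + c 1 • v + c 2 • b + c 3 • b' + c 4 • t = 0 → c = 0 := by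
    intro c hc
    have h4 : c 4 = 0 := by
      have := congrArg (polarLin Q p) hc
      simpa [hpb, hpb', hpp, hpv0, ht] using this
    rw [h4, zero_smul, add_zero, add_assoc] at hc
    have hmem : c 0 • p + c 1 • v ∈ M ⊓ C := by
      refine ⟨M.add_mem (M.smul_mem _ hpM) (M.smul_mem _ hvM), ?_⟩
      rw [eq_neg_of_add_eq_zero_left hc]
      exact C.neg_mem (C.add_mem (C.smul_mem _ hb.1) (C.smul_mem _ hb'.1))
    rw [hC.inf_eq_bot, Submodule.mem_bot] at hmem
    rw [hmem, zero_add] at hc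
    obtain ⟨h0, h1⟩ := hpv _ _ hmem
    obtain ⟨h2, h3⟩ := hbb' _ _ hc
    funext i
    fin_cases i <;> assumption
  have hli' : LinearIndependent k ![p, v, b, b', t] := by
    rw [Fintype.linearIndependent_iff]
    intro c hc i
    have := hli c (by simpa [sum_univ_five] using hc)
    exact congrFun this i
  let e := basisOfLinearIndependentOfCardEqFinrank hli' (by rw [hV]; rfl)
  have hsum : ∀ z, z = e.coord 0 z • p + e.coord 1 z • v + e.coord 2 z • b + e.coord 3 z • b' + e.coord 4 z • t := by
    intro z
    have := (e.sum_repr z).symm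
    rw [sum_univ_five] at this
    simpa [e, coe_basisOfLinearIndependentOfCardEqFinrank] using this
  have hcoord : ∀ c : Fin 5 → k, ∀ i, e.coord i (c 0 • p + c 1 • v + c 2 • b + c 3 • b' + c 4 • t) = c i := by
    intro c i
    have h1 : c 0 • p + c 1 • v + c 2 • b + c 3 • b' + c 4 • t = ∑ j, c j • e j := by
      rw [sum_univ_five]
      simp [e, coe_basisOfLinearIndependentOfCardEqFinrank]
    rw [h1, Module.Basis.coord_apply, Module.Basis.repr_sum_self]
  have hvl : ∀ u, polar Q u v = 0 := fun u => by rw [polar_comm]; exact hv.2.2 u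
  have hvr : ∀ u, polar Q v u = 0 := hv.2.2
  have hQv : Q v = 0 := hv.2.1
  have hval : ∀ z, Q z = e.coord 2 z * e.coord 3 z * polar Q b b' + e.coord 3 z ^ 2 * Q b' +
      e.coord 4 z * (e.coord 0 z + e.coord 2 z * polar Q b t + e.coord 3 z * polar Q b' t +
        e.coord 4 z * Q t) := by
    intro z
    conv_lhs => rw [hsum z]
    rw [QuadraticMap.map_add (⇑Q) (_ + _ + _ + _), QuadraticMap.map_add (⇑Q) (_ + _ + _),
      QuadraticMap.map_add (⇑Q) (_ + _), QuadraticMap.map_add (⇑Q) (_ • _)]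
    simp only [QuadraticMap.map_smul, polar_add_left, polar_smul_left,
      polar_smul_right, hvl, hpb, hpb', ht, hQp, hbQ, hQv, hvr, smul_eq_mul]
    ring
  set β := polar Q b b' with hβ
  have hβ0 : β ≠ 0 := by
    intro h0
    set c := polar Q b t
    have hz : IsVert q R (b - c • p) := by
      have hcp : b - c • p = (1 : k) • b + (-c) • p := by rw [one_smul, neg_smul, sub_eq_add_neg]
      have hbp : polar Q b p = 0 := by rw [polar_comm]; exact hpb
      refine ⟨?_, ?_, fun u => ?_⟩
      · intro h
        have := hli ![-c, 0, 1, 0, 0] (by simpa [add_comm, sub_eq_add_neg] using h)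
        simpa using congrFun this 2
      · rw [hcp, map_comb, ← hQ, hbQ, hQp, hbp]; ring
      · rw [← hQ, hsum u]
        have hbb : polar Q b b = 0 := by rw [polar_self, hbQ, smul_zero]
        simp only [polar_sub_left, polar_smul_left, polar_add_right,
          polar_smul_right, hvl, hpb, hpb', ht, hpp, hbp, hbb, ← hβ, h0, smul_eq_mul]
        ring
    obtain ⟨a, ha⟩ := IsVert.unique hq hR hv hz
    have := hli ![-c, -a, 1, 0, 0] (by
      simp only [cons_val, neg_smul, one_smul, zero_smul, add_zero, ← ha]; abel)
    simpa using congrFun this 2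
  refine ⟨⟨v, hv, e.coord 4, e.coord 3, -(β • e.coord 2 + Q b' • e.coord 3),
    e.coord 0 + polar Q b t • e.coord 2 + polar Q b' t • e.coord 3 + Q t • e.coord 4,
    fun z => ?_, fun z h1 h2 h3 h4 => ?_, fun a b₁ c d => ?_, ?_, ?_, ?_, ?_, ?_, ?_, ?_, ?_⟩⟩
  · rw [← hQ, hval]
    simp only [LinearMap.neg_apply, LinearMap.add_apply, LinearMap.smul_apply, smul_eq_mul]
    ring
  · simp only [LinearMap.neg_apply, LinearMap.add_apply, LinearMap.smul_apply, smul_eq_mul, h1, h2, mul_zero,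
      add_zero, neg_eq_zero, mul_eq_zero, hβ0, false_or] at h3 h4
    rw [h3, mul_zero, add_zero] at h4
    refine ⟨e.coord 1 z, ?_⟩
    conv_lhs => rw [hsum z, h1, h2, h3, h4]
    simp
  · let c₂ := (-c - Q b' * b₁) / β
    let c₀ := d - polar Q b t * c₂ - polar Q b' t * b₁ - Q t * a
    refine ⟨_, hcoord ![c₀, 0, c₂, b₁, a] 4, hcoord ![c₀, 0, c₂, b₁, a] 3, ?_, ?_⟩
    · rw [LinearMap.neg_apply, LinearMap.add_apply, LinearMap.smul_apply, LinearMap.smul_apply, hcoord, hcoord]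
      simp only [cons_val, smul_eq_mul, c₂]
      field_simp
      ring
    · rw [LinearMap.add_apply, LinearMap.add_apply, LinearMap.add_apply, LinearMap.smul_apply, LinearMap.smul_apply,
        LinearMap.smul_apply, hcoord, hcoord, hcoord, hcoord]
      simp only [cons_val, smul_eq_mul, c₀]
      ring
  all_goals
    have h1 := hcoord ![0, 1, 0, 0, 0]
    have h2 := hcoord ![1, 0, 0, 0, 0]
    simp only [cons_val, zero_smul, one_smul, zero_add, add_zero] at h1 h2
    simp only [LinearMap.neg_apply, LinearMap.add_apply, LinearMap.smul_apply, h1, h2]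
    simp

/-- The vector `p` lies on no line of the base locus. -/
def NoLineThrough (q : Fin 2 → QuadraticForm k V) (p : V) : Prop :=
  ∀ y, (∀ i, q i y = 0) → (∀ i, polar (q i) p y = 0) → ∃ a : k, y = a • p

theorem NoLineThrough.not_mem {p : V} (hp : NoLineThrough q p) {W : Submodule k V}
    (hW : IsLine q W) : p ∉ W := by
  intro h
  by_cases h0 : p = 0
  · obtain ⟨u, hu, v, hv, huv⟩ := exists_pair_of_finrank (show 2 ≤ finrank k W by rw [hW.1])
    obtain ⟨a, ha⟩ := hp u (hW.2 u hu) (fun i => by rw [h0, polar_zero_left])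
    rw [h0, smul_zero] at ha
    have := (huv 1 0 (by simp [ha])).1
    exact one_ne_zero this
  · obtain ⟨u, hu, hpu⟩ := exists_indep_of_mem (show 2 ≤ finrank k W by rw [hW.1]) h0
    obtain ⟨a, ha⟩ := hp u (hW.2 u hu) (fun i => polar_eq_zero_of_isotropic (fun v hv => hW.2 v hv i) h hu)
    have := (hpu (-a) 1 (by rw [ha]; simp)).2
    exact one_ne_zero this

section Types

variable {R : Fin 2 → k} {p : V}

/-- The line `W` meets the plane `x = l = 0` of the splitting outside of the vertex. -/
def Split.Meets (s : Split q R p) (W : Submodule k V) : Prop := ∃ y ∈ W, y ≠ 0 ∧ s.x y = 0 ∧ s.l y = 0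

theorem Split.exists_x_ne (s : Split q R p) (hR : R ≠ 0) (hp : NoLineThrough q p) {W : Submodule k V}
    (hW : IsLine q W) : ∃ y ∈ W, s.x y ≠ 0 := by
  by_contra! hcon
  obtain ⟨R', hR'⟩ := exists_independent hR
  obtain ⟨y, hy, hy0, hyp⟩ := exists_ne_zero_mem_ker (W := W)
    (LinearMap.pi fun _ : Fin 1 => polarLin (pencil q R') p) (by rw [hW.1]; norm_num)
  have h1 : polar (pencil q R') p y = 0 := congrFun hyp 0
  have h2 : polar (pencil q R) p y = 0 := by rw [s.polar_p]; exact hcon y hy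
  obtain ⟨a, rfl⟩ := hp y (hW.2 y hy) (fun i => by
    rw [polar_pencil] at h1 h2
    apply (mul_eq_zero.1 (_ : (R 0 * R' 1 - R 1 * R' 0) * _ = 0)).resolve_left hR'
    fin_cases i
    · simp only [Fin.zero_eta]; linear_combination R' 1 * h2 - R 1 * h1
    · simp only [Fin.mk_one]; linear_combination R 0 * h1 - R' 0 * h2)
  have ha : a ≠ 0 := by rintro rfl; simp at hy0
  apply hp.not_mem hW
  have := W.smul_mem a⁻¹ hy
  rwa [smul_smul, inv_mul_cancel₀ ha, one_smul] at this

theorem Split.meets_or (s : Split q R p) {W : Submodule k V}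
    (hW : IsLine q W) : s.Meets W ∨ s.swap.Meets W := by
  obtain ⟨y, hy, hy0, hyx⟩ := exists_ne_zero_mem_ker (W := W)
    (LinearMap.pi fun _ : Fin 1 => s.x) (by rw [hW.1]; norm_num)
  have hx : s.x y = 0 := congrFun hyx 0
  have h := s.form y
  rw [pencil_eq_zero (hW.2 y hy) R, hx, zero_mul, zero_sub, zero_eq_neg, mul_eq_zero] at h
  rcases h with h | h
  · exact Or.inl ⟨y, hy, hy0, hx, h⟩
  · exact Or.inr ⟨y, hy, hy0, hx, h⟩

theorem Split.coord (s : Split q R p) (hR : R ≠ 0) (hp : NoLineThrough q p) {W : Submodule k V}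
    (hW : IsLine q W) (h : s.Meets W) : ∃ κ : k, ∀ z ∈ W, s.l z = κ * s.x z ∧ s.w z = κ * s.l' z := by
  obtain ⟨y, hy, hy0, hyx, hyl⟩ := h
  obtain ⟨z, hz, hzx⟩ := s.exists_x_ne hR hp hW
  have hli : ∀ a b : k, a • y + b • z = 0 → a = 0 ∧ b = 0 := by
    intro a b hab
    have hb : b = 0 := by
      have := congrArg s.x hab
      simpa [hyx, hzx] using this
    subst hb
    simpa [hy0] using hab
  have hl : ∀ u ∈ W, s.l u = s.l z / s.x z * s.x u := by
    intro u hu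
    obtain ⟨a, b, rfl⟩ := mem_of_indep_pair hW.1 hy hz hli hu
    simp only [map_add, map_smul, hyl, hyx, smul_eq_mul]
    field_simp
    ring
  have hw : ∀ u ∈ W, s.x u ≠ 0 → s.w u = s.l z / s.x z * s.l' u := by
    intro u hu hux
    have h := s.form u
    rw [pencil_eq_zero (hW.2 u hu) R, hl u hu] at h
    apply mul_left_cancel₀ hux
    linear_combination -h
  refine ⟨s.l z / s.x z, fun u hu => ⟨hl u hu, ?_⟩⟩
  have h1 := hw z hz hzx
  have h2 := hw (y + z) (W.add_mem hy hz) (by rw [map_add, hyx, zero_add]; exact hzx)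
  rw [map_add, map_add, h1] at h2
  have h3 : s.w y = s.l z / s.x z * s.l' y := by linear_combination h2
  obtain ⟨a, b, rfl⟩ := mem_of_indep_pair hW.1 hy hz hli hu
  simp only [map_add, map_smul, smul_eq_mul, h1, h3]
  ring

theorem Split.not_meets_both [IsAlgClosed k] (hq : SmoothPencil q)
    (s : Split q R p) (hR : R ≠ 0) (hp : NoLineThrough q p) {W : Submodule k V}
    (hW : IsLine q W) (h : s.Meets W) : ¬ s.swap.Meets W := by
  rintro ⟨y', hy', hy'0, hy'x, hy'l⟩
  obtain ⟨κ, hκ⟩ := s.coord hR hp hW h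
  obtain ⟨y, hy, hy0, hyx, hyl⟩ := h
  obtain ⟨z, hz, hzx⟩ := s.exists_x_ne hR hp hW
  have hli : ∀ a b : k, a • y + b • z = 0 → a = 0 ∧ b = 0 := by
    intro a b hab
    have hb : b = 0 := by
      have := congrArg s.x hab
      simpa [hyx, hzx] using this
    subst hb
    simpa [hy0] using hab
  have hl' : s.l' y = 0 := by
    obtain ⟨a, b, rfl⟩ := mem_of_indep_pair hW.1 hy hz hli hy'
    have hb : b = 0 := by
      have : s.x (a • y + b • z) = 0 := hy'x
      simpa [hyx, hzx] using this
    subst hb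
    have ha : a ≠ 0 := by rintro rfl; simp at hy'0
    have : s.l' (a • y + (0 : k) • z) = 0 := hy'l
    simpa [ha] using this
  have hw := (hκ y hy).2
  rw [hl', mul_zero] at hw
  obtain ⟨a, ha⟩ := s.ker y hyx hyl hl' hw
  apply s.vert.not_mem_line hq hR hW
  have ha0 : a ≠ 0 := by rintro rfl; simp [ha] at hy0
  rw [ha] at hy
  have := W.smul_mem a⁻¹ hy
  rwa [smul_smul, inv_mul_cancel₀ ha0, one_smul] at this

theorem Split.meets_refl (s : Split q R p) {R' : Fin 2 → k} (hR' : pencil q R' s.v ≠ 0) {W : Submodule k V}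
    (h : s.Meets W) : s.Meets (W.map (refl q R' s.v)) := by
  obtain ⟨y, hy, hy0, hyx, hyl⟩ := h
  refine ⟨_, mem_map_of_mem hy, ?_, ?_, ?_⟩
  · intro h0
    exact hy0 (refl_injective hR' (h0.trans (map_zero _).symm))
  · rw [refl_apply, map_sub, map_smul, hyx, s.xv]; simp
  · rw [refl_apply, map_sub, map_smul, hyl, s.lv]; simp

/-- The reflection of another singular quadric interchanges the types of lines. -/
theorem Split.not_meets_refl [IsAlgClosed k] (hq : SmoothPencil q) (hV : finrank k V = 5)
    (s : Split q R p) (hp : NoLineThrough q p)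
    {R₂ R₂' : Fin 2 → k} (hR : R₂ 0 * R 1 - R₂ 1 * R 0 ≠ 0) {v₂ : V} (hv₂ : IsVert q R₂ v₂)
    (hR₂' : R₂ 0 * R₂' 1 - R₂ 1 * R₂' 0 ≠ 0)
    {W : Submodule k V} (hW : IsLine q W) (h : s.Meets W) : ¬ s.Meets (W.map (refl q R₂' v₂)) := by
  have hR0 : R ≠ 0 := by rintro rfl; simp at hR
  have hv2 := hv₂.ne_zero hq hR
  have hW2' := hW.refl hR hv₂ hv2
  have hne := hW.refl_ne hq hV hR hv₂
  rw [refl_eq hR₂' hv₂ (hv₂.ne_zero hq hR₂') hv2]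
  intro h2
  obtain ⟨κ, hκ⟩ := s.coord hR0 hp hW h
  obtain ⟨κ₂, hκ₂⟩ := s.coord hR0 hp hW2' h2
  obtain ⟨y, hy, hy0, hyv, hy2⟩ := hW.exists_mem_refl (q := q) (R' := R) (v := v₂)
  -- the second vertex lies in the plane of the two lines
  have key : κ = κ₂ → False := by
    rintro rfl
    obtain ⟨z, hz, hzv⟩ : ∃ z ∈ W, polar (pencil q R) z v₂ ≠ 0 := by
      by_contra! hcon
      apply hne
      ext u
      constructor
      · rintro ⟨z, hz, rfl⟩
        rw [refl_apply, hcon z hz, zero_div, zero_smul, sub_zero]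
        exact hz
      · intro hu
        exact ⟨u, hu, by rw [refl_apply, hcon u hu, zero_div, zero_smul, sub_zero]⟩
    have h1 := hκ z hz
    have h2 := hκ₂ _ (mem_map_of_mem hz)
    rw [refl_apply] at h2
    set c := polar (pencil q R) z v₂ / pencil q R v₂ with hc
    have hc0 : c ≠ 0 := div_ne_zero hzv hv2
    simp only [map_sub, map_smul, smul_eq_mul] at h2
    apply hv2
    rw [s.form]
    have e1 : s.l v₂ = κ * s.x v₂ := mul_left_cancel₀ hc0 (by linear_combination h1.1 - h2.1)
    have e2 : s.w v₂ = κ * s.l' v₂ := mul_left_cancel₀ hc0 (by linear_combination h1.2 - h2.2)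
    rw [e1, e2]; ring
  have h1 := hκ y hy
  have h2 := hκ₂ y hy2
  by_cases hyx : s.x y = 0
  · have hyl : s.l y = 0 := by rw [h1.1, hyx, mul_zero]
    have hl' : s.l' y ≠ 0 := by
      intro h0
      exact s.not_meets_both hq hR0 hp hW h ⟨y, hy, hy0, hyx, h0⟩
    rw [s.polar_eq, hyx, hyl] at hyv
    have e1 : s.l v₂ = κ * s.x v₂ := mul_left_cancel₀ hl' (by rw [h1.2] at hyv; linear_combination -hyv)
    have e2 : s.l v₂ = κ₂ * s.x v₂ := mul_left_cancel₀ hl' (by rw [h2.2] at hyv; linear_combination -hyv)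
    by_cases hxv : s.x v₂ = 0
    · apply hv2
      rw [s.form, e1, hxv]; ring
    · exact key (mul_right_cancel₀ hxv (e1.symm.trans e2))
  · exact key (mul_right_cancel₀ hyx (h1.1.symm.trans h2.1))

end Types

end Splitting

section Existence

variable {k V : Type*} [Field k] [AddCommGroup V] [Module k V]

/-- A ternary quadratic form with vanishing half-discriminant is singular. -/
theorem exists_ternary_singular [IsAlgClosed k] (a b c d e f : k)
    (h : 4 * a * c * f + b * d * e - a * e ^ 2 - c * d ^ 2 - f * b ^ 2 = 0) :
    ∃ X Y Z : k, ¬ (X = 0 ∧ Y = 0 ∧ Z = 0) ∧ 2 * a * X + b * Y + d * Z = 0 ∧ b * X + 2 * c * Y + e * Z = 0 ∧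
      d * X + e * Y + 2 * f * Z = 0 ∧ a * X ^ 2 + b * X * Y + c * Y ^ 2 + d * X * Z + e * Y * Z + f * Z ^ 2 = 0 := by
  by_cases h2 : (2 : k) = 0
  · by_cases h0 : e = 0 ∧ d = 0 ∧ b = 0
    · obtain ⟨rfl, rfl, rfl⟩ := h0
      obtain ⟨X, Y, hXY, hz⟩ := exists_binary_zero a 0 c
      refine ⟨X, Y, 0, fun hc => ?_, ?_, ?_, ?_, ?_⟩
      · rcases hXY with hX | hY
        · exact hX hc.1
        · exact hY hc.2.1
      · rw [h2]; ring
      · rw [h2]; ring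
      · ring
      · linear_combination hz
    · refine ⟨e, d, b, h0, ?_, ?_, ?_, ?_⟩
      · linear_combination (a * e + b * d) * h2
      · linear_combination (b * e + c * d) * h2
      · linear_combination (d * e + f * b) * h2
      · linear_combination -h + (2 * a * c * f + 2 * b * d * e) * h2
  · obtain ⟨w, hw0, hw⟩ := (Matrix.exists_mulVec_eq_zero_iff (M := !![2 * a, b, d; b, 2 * c, e; d, e, 2 * f])).2 (by
      rw [Matrix.det_fin_three]
      simp only [Matrix.of_apply, Matrix.cons_val', cons_val]
      linear_combination 2 * h)
    have w0 := congrFun hw 0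
    have w1 := congrFun hw 1
    have w2 := congrFun hw 2
    simp only [Matrix.mulVec, dotProduct, sum_univ_three, Matrix.of_apply, Matrix.cons_val', cons_val,
      Pi.zero_apply] at w0 w1 w2
    refine ⟨w 0, w 1, w 2, fun hc => hw0 ?_, w0, w1, w2, ?_⟩
    · funext i
      fin_cases i
      exacts [hc.1, hc.2.1, hc.2.2]
    · refine (mul_eq_zero.1 (?_ : (2 : k) * _ = 0)).resolve_left h2
      linear_combination w 0 * w0 + w 1 * w1 + w 2 * w2

theorem map_comb_three (Q : QuadraticForm k V) (X Y Z : k) (u v w : V) :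
    Q (X • u + Y • v + Z • w) = Q u * X ^ 2 + polar Q u v * X * Y + Q v * Y ^ 2 +
      polar Q u w * X * Z + polar Q v w * Y * Z + Q w * Z ^ 2 := by
  rw [QuadraticMap.map_add (⇑Q) (_ + _), QuadraticMap.map_add (⇑Q) (_ • _)]
  simp only [QuadraticMap.map_smul, polar_add_left, polar_smul_left,
    polar_smul_right, smul_eq_mul]
  ring

/-- The half-discriminant of the restriction of a quadratic form to the span of three vectors. -/
def disc (Q : QuadraticForm k V) (u v w : V) : k :=
  4 * Q u * Q v * Q w + polar Q u v * polar Q u w * polar Q v w -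
    Q u * polar Q v w ^ 2 - Q v * polar Q u w ^ 2 - Q w * polar Q u v ^ 2

theorem exists_singular_of_disc [IsAlgClosed k] (Q : QuadraticForm k V) (u v w : V) (h : disc Q u v w = 0) :
    ∃ X Y Z : k, ¬ (X = 0 ∧ Y = 0 ∧ Z = 0) ∧ Q (X • u + Y • v + Z • w) = 0 ∧
      ∀ X' Y' Z' : k, polar Q (X • u + Y • v + Z • w) (X' • u + Y' • v + Z' • w) = 0 := by
  obtain ⟨X, Y, Z, h0, h1, h2, h3, h4⟩ := exists_ternary_singular _ _ _ _ _ _ h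
  refine ⟨X, Y, Z, h0, by rw [map_comb_three, h4], fun X' Y' Z' => ?_⟩
  simp only [polar_add_left, polar_smul_left, polar_add_right,
    polar_smul_right, polar_self, smul_eq_mul, nsmul_eq_mul,
    polar_comm (⇑Q) v u, polar_comm (⇑Q) w u, polar_comm (⇑Q) w v]
  push_cast
  linear_combination X' * h1 + Y' * h2 + Z' * h3

variable [FiniteDimensional k V] {q : Fin 2 → QuadraticForm k V}

theorem Split.exists_line [IsAlgClosed k] (hV : finrank k V = 5)
    {R : Fin 2 → k} {p : V} (hR : R ≠ 0) (s : Split q R p) : ∃ W, IsLine q W := by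
  obtain ⟨R', hR'⟩ := exists_independent hR
  obtain ⟨ex, x1, x2, x3, x4⟩ := s.surj 1 0 0 0
  obtain ⟨el, l1, l2, l3, l4⟩ := s.surj 0 1 0 0
  obtain ⟨em, m1, m2, m3, m4⟩ := s.surj 0 0 1 0
  obtain ⟨ew, w1, w2, w3, w4⟩ := s.surj 0 0 0 1
  set Q := pencil q R' with hQ
  let b (y z : V) : MvPolynomial (Fin 2) k := C (polar Q y z)
  let c (y : V) : MvPolynomial (Fin 2) k := C (Q y)
  let QA := c ex * X 0 ^ 2 + b ex el * X 0 * X 1 + c el * X 1 ^ 2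
  let QB := c em * X 0 ^ 2 + b em ew * X 0 * X 1 + c ew * X 1 ^ 2
  let vA := b s.v ex * X 0 + b s.v el * X 1
  let vB := b s.v em * X 0 + b s.v ew * X 1
  let AB := b ex em * X 0 ^ 2 + (b ex ew + b el em) * X 0 * X 1 + b el ew * X 1 ^ 2
  let D := 4 * c s.v * QA * QB + vA * vB * AB - c s.v * AB ^ 2 - QA * vB ^ 2 - QB * vA ^ 2
  obtain ⟨lam, hlam, hD⟩ := exists_ne_zero_of_aeval_zero (L := k) (D := D) le_rfl (by
    simp [D, QA, QB, vA, vB, AB])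
  set A := lam 0 • ex + lam 1 • el with hA
  set B := lam 0 • em + lam 1 • ew with hB
  have hdisc : disc Q s.v A B = 0 := by
    rw [← hD]
    simp only [D, QA, QB, vA, vB, AB, b, c, disc, hA, hB, map_comb, polar_add_left,
      polar_smul_left, polar_add_right, polar_smul_right, smul_eq_mul,
      map_sub, map_add, map_mul, map_pow, aeval_X, aeval_C, Algebra.algebraMap_self, RingHom.id_apply, map_ofNat]
    ring
  obtain ⟨a₁, a₂, a₃, h0, hu, hup⟩ := exists_singular_of_disc Q s.v A B hdisc
  have hx : ∀ X Y Z : k, s.x (X • s.v + Y • A + Z • B) = lam 0 * Y ∧ s.l (X • s.v + Y • A + Z • B) = lam 1 * Y ∧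
      s.l' (X • s.v + Y • A + Z • B) = lam 0 * Z ∧ s.w (X • s.v + Y • A + Z • B) = lam 1 * Z := by
    intro X Y Z
    simp only [hA, hB, map_add, map_smul, smul_eq_mul, x1, x2, x3, x4, l1, l2, l3, l4, m1, m2, m3, m4, w1, w2, w3, w4,
      s.xv, s.lv, s.l'v, s.wv]
    refine ⟨?_, ?_, ?_, ?_⟩ <;> ring
  have hind : ∀ X Y Z : k, X • s.v + Y • A + Z • B = 0 → X = 0 ∧ Y = 0 ∧ Z = 0 := by
    intro X Y Z h
    obtain ⟨g1, g2, g3, g4⟩ := hx X Y Z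
    rw [h, map_zero] at g1 g2 g3 g4
    have hlam' : lam 0 ≠ 0 ∨ lam 1 ≠ 0 := by
      by_contra! hc
      apply hlam
      funext i
      fin_cases i
      exacts [hc.1, hc.2]
    have hY : Y = 0 := by
      rcases hlam' with h' | h'
      · exact (mul_eq_zero.1 g1.symm).resolve_left h'
      · exact (mul_eq_zero.1 g2.symm).resolve_left h'
    have hZ : Z = 0 := by
      rcases hlam' with h' | h'
      · exact (mul_eq_zero.1 g3.symm).resolve_left h'
      · exact (mul_eq_zero.1 g4.symm).resolve_left h'
    rw [hY, hZ, zero_smul, zero_smul, add_zero, add_zero] at h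
    exact ⟨(smul_eq_zero.1 h).resolve_right s.vert.1, hY, hZ⟩
  have hR0 : ∀ X Y Z : k, pencil q R (X • s.v + Y • A + Z • B) = 0 := by
    intro X Y Z
    obtain ⟨g1, g2, g3, g4⟩ := hx X Y Z
    rw [s.form, g1, g2, g3, g4]; ring
  let M := span k (Set.range ![s.v, A, B])
  have hM : finrank k M = 3 := by
    rw [finrank_span_eq_card]
    · rfl
    · rw [Fintype.linearIndependent_iff]
      intro g hg i
      have := hind (g 0) (g 1) (g 2) (by simpa [sum_univ_three] using hg)
      fin_cases i
      exacts [this.1, this.2.1, this.2.2]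
  have hMm : ∀ z ∈ M, ∃ X Y Z : k, z = X • s.v + Y • A + Z • B := by
    intro z hz
    obtain ⟨g, rfl⟩ := (mem_span_range_iff_exists_fun k).1 hz
    exact ⟨g 0, g 1, g 2, by simp [sum_univ_three]⟩
  set u := a₁ • s.v + a₂ • A + a₃ • B with hu_def
  have hu0 : u ≠ 0 := fun h => h0 (hind _ _ _ h)
  obtain ⟨T, hT⟩ := exists_isCompl (span k {u})
  have hTf := Submodule.finrank_add_eq_of_isCompl hT
  rw [finrank_span_singleton hu0] at hTf
  have h5 := Submodule.finrank_sup_add_finrank_inf_eq M T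
  have h6 := Submodule.finrank_le (M ⊔ T)
  obtain ⟨z, hz, hz0, hzQ⟩ := exists_isotropic Q (W := M ⊓ T) (by omega)
  have huz := indep_of_disjoint (W := span k {u}) (mem_span_singleton_self u) hu0
    (v := z) (fun h => hz0 (by
      have : z ∈ span k {u} ⊓ T := ⟨h, hz.2⟩
      rwa [hT.inf_eq_bot, Submodule.mem_bot] at this))
  obtain ⟨X, Y, Z, hzM⟩ := hMm z hz.1
  refine ⟨span k (Set.range ![u, z]), ?_, fun y hy i => ?_⟩
  · rw [finrank_span_eq_card (LinearIndependent.pair_iff.2 huz)]; rfl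
  · obtain ⟨g, rfl⟩ := (mem_span_range_iff_exists_fun k).1 hy
    simp only [sum_univ_two, cons_val_zero, cons_val_one]
    refine eq_zero_of_pencil hR' ?_ ?_ i
    · have : g 0 • u + g 1 • z = (g 0 * a₁ + g 1 * X) • s.v + (g 0 * a₂ + g 1 * Y) • A + (g 0 * a₃ + g 1 * Z) • B := by
        rw [hu_def, hzM]; module
      rw [this, hR0]
    · have : polar Q u z = 0 := by rw [hzM]; exact hup X Y Z
      rw [map_comb, ← hQ, hu, hzQ, this]; ring

theorem surjective_pi_of_indep {n : ℕ} (f : Fin n → V →ₗ[k] k)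
    (h : ∀ c : Fin n → k, (∀ v, ∑ i, c i * f i v = 0) → c = 0) : Function.Surjective (LinearMap.pi f) := by
  rw [← LinearMap.range_eq_top]
  by_contra hne
  obtain ⟨g, hg0, hg⟩ := Submodule.exists_le_ker_of_lt_top _ (lt_top_iff_ne_top.2 hne)
  have hsum : ∀ a : Fin n → k, g a = ∑ i, g (Pi.single i 1) * a i := by
    intro a
    conv_lhs => rw [← Finset.univ_sum_single a, map_sum]
    refine Finset.sum_congr rfl fun i _ => ?_
    have : Pi.single i (a i) = a i • (Pi.single i (1 : k) : Fin n → k) := by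
      rw [← Pi.single_smul, smul_eq_mul, mul_one]
    rw [this, map_smul, smul_eq_mul, mul_comm]
  have h0 := h (fun i => g (Pi.single i 1)) (fun v => by
    have := hg (LinearMap.mem_range_self (LinearMap.pi f) v)
    rw [LinearMap.mem_ker, hsum] at this
    exact this)
  apply hg0
  ext i
  exact congrFun h0 i

theorem exists_vertex [IsAlgClosed k] (hq : SmoothPencil q) (hV : finrank k V = 5)
    {p : V} (hp0 : p ≠ 0) (hp : ∀ i, q i p = 0) : ∃ R : Fin 2 → k, R ≠ 0 ∧ ∃ v, IsVert q R v := by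
  have hs := surjective_pi_of_indep (fun i => polarLin (q i) p) (fun c hc => by
    by_contra h0
    obtain ⟨u, hu⟩ := hq p hp0 hp c h0
    apply hu
    rw [polar_pencil, ← hc u, sum_univ_two]
    rfl)
  obtain ⟨f₀, hf₀⟩ := hs ![1, 0]
  obtain ⟨f₁, hf₁⟩ := hs ![0, 1]
  have x00 : polar (q 0) p f₀ = 1 := congrFun hf₀ 0
  have x10 : polar (q 1) p f₀ = 0 := congrFun hf₀ 1
  have x01 : polar (q 0) p f₁ = 0 := congrFun hf₁ 0
  have x11 : polar (q 1) p f₁ = 1 := congrFun hf₁ 1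
  have hpp : ∀ i, polar (q i) p p = 0 := fun i => by
    rw [polar_self, hp i, smul_zero]
  have h3 : finrank k (span k (Set.range ![p, f₀, f₁])) = 3 := by
    rw [finrank_span_eq_card]
    · rfl
    · rw [Fintype.linearIndependent_iff]
      intro g hg i
      simp only [sum_univ_three, cons_val] at hg
      have e0 := congrArg (polarLin (q 0) p) hg
      have e1 := congrArg (polarLin (q 1) p) hg
      simp [x00, x01, x10, x11, hpp] at e0 e1
      rw [e0, e1, zero_smul, zero_smul, add_zero, add_zero] at hg
      have e2 := (smul_eq_zero.1 hg).resolve_right hp0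
      fin_cases i
      exacts [e2, e0, e1]
  obtain ⟨c, hc⟩ := exists_complement (n := 3) (m := 2) h3.ge hV
  obtain ⟨c', hc', hc0⟩ : ∃ c' : Fin 2 → V, (∀ i j, polar (q i) p (c' j) = 0) ∧
      ∀ z, ∃ a b₀ b₁ c₀ c₁ : k, z = a • p + b₀ • f₀ + b₁ • f₁ + c₀ • c' 0 + c₁ • c' 1 := by
    refine ⟨fun j => c j - polar (q 0) p (c j) • f₀ - polar (q 1) p (c j) • f₁, ?_, ?_⟩
    · intro i j
      fin_cases i
      · simp [polar_sub_right, polar_smul_right, x00, x01]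
      · simp [polar_sub_right, polar_smul_right, x10, x11]
    · intro z
      obtain ⟨w, hw, a, rfl⟩ := hc z
      obtain ⟨g, rfl⟩ := (mem_span_range_iff_exists_fun k).1 hw
      refine ⟨g 0, g 1 + a 0 * polar (q 0) p (c 0) + a 1 * polar (q 0) p (c 1),
        g 2 + a 0 * polar (q 1) p (c 0) + a 1 * polar (q 1) p (c 1), a 0, a 1, ?_⟩
      simp only [sum_univ_three, sum_univ_two, cons_val]
      module
  have hli : LinearIndependent k ![p, f₀, f₁, c' 0, c' 1] := by
    apply linearIndependent_of_top_le_span_of_card_eq_finrank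
    · intro z _
      obtain ⟨a, b₀, b₁, c₀, c₁, rfl⟩ := hc0 z
      refine (mem_span_range_iff_exists_fun k).2 ⟨![a, b₀, b₁, c₀, c₁], ?_⟩
      simp [sum_univ_five]
    · rw [hV]; rfl
  rw [Fintype.linearIndependent_iff] at hli
  let b (i : Fin 2) (y z : V) : MvPolynomial (Fin 2) k := C (polar (q i) y z)
  let d (i : Fin 2) (y : V) : MvPolynomial (Fin 2) k := C (q i y)
  let bb (y z : V) : MvPolynomial (Fin 2) k := X 0 * b 0 y z + X 1 * b 1 y z
  let dd (y : V) : MvPolynomial (Fin 2) k := X 0 * d 0 y + X 1 * d 1 y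
  let QU := X 1 ^ 2 * dd f₀ - X 0 * X 1 * bb f₀ f₁ + X 0 ^ 2 * dd f₁
  let UA := X 1 * bb f₀ (c' 0) - X 0 * bb f₁ (c' 0)
  let UB := X 1 * bb f₀ (c' 1) - X 0 * bb f₁ (c' 1)
  let D := 4 * QU * dd (c' 0) * dd (c' 1) + UA * UB * bb (c' 0) (c' 1) - QU * bb (c' 0) (c' 1) ^ 2 -
    dd (c' 0) * UB ^ 2 - dd (c' 1) * UA ^ 2
  obtain ⟨R, hR, hD⟩ := exists_ne_zero_of_aeval_zero (L := k) (D := D) le_rfl (by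
    simp [D, QU, UA, UB, bb, dd])
  set U := R 1 • f₀ + (-R 0) • f₁ with hU
  have hdisc : disc (pencil q R) U (c' 0) (c' 1) = 0 := by
    rw [← hD]
    simp only [D, QU, UA, UB, bb, dd, b, d, disc, hU, map_comb, polar_add_left,
      polar_smul_left, polar_pencil, pencil_apply, smul_eq_mul,
      map_sub, map_add, map_mul, map_pow, aeval_X, aeval_C, Algebra.algebraMap_self, RingHom.id_apply, map_ofNat]
    ring
  obtain ⟨X₁, X₂, X₃, h0, hu, hup⟩ := exists_singular_of_disc _ _ _ _ hdisc
  set u := X₁ • U + X₂ • c' 0 + X₃ • c' 1 with hu_def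
  obtain ⟨g₀, g₁, hg⟩ : ∃ g₀ g₁ : k, R 0 * g₀ + R 1 * g₁ = 1 := by
    by_cases h : R 0 = 0
    · have h1 : R 1 ≠ 0 := by
        intro h1
        apply hR
        funext i
        fin_cases i
        exacts [h, h1]
      exact ⟨0, (R 1)⁻¹, by rw [mul_inv_cancel₀ h1]; ring⟩
    · exact ⟨(R 0)⁻¹, 0, by rw [mul_inv_cancel₀ h]; ring⟩
  have hpu : polar (pencil q R) p u = 0 := by
    simp only [hu_def, hU, polar_add_right, polar_smul_right, polar_pencil, hc', x00, x01,
      x10, x11, smul_eq_mul]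
    ring
  have hup' : polar (pencil q R) u p = 0 := by rw [polar_comm]; exact hpu
  have hppR : polar (pencil q R) p p = 0 := by rw [polar_pencil, hpp, hpp]; ring
  set g := g₀ • f₀ + g₁ • f₁ with hg_def
  have hpg : polar (pencil q R) p g = 1 := by
    rw [← hg]
    simp only [hg_def, polar_add_right, polar_smul_right, polar_pencil, x00, x01,
      x10, x11, smul_eq_mul]
    ring
  set t := polar (pencil q R) u g with ht
  refine ⟨R, hR, u + (-t) • p, ?_, ?_, fun z => ?_⟩
  · intro h
    have := hli ![-t, X₁ * R 1, -(X₁ * R 0), X₂, X₃] (by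
      simp only [sum_univ_five, cons_val]
      rw [← h, hu_def, hU]
      module)
    have i1 := this 1
    have i2 := this 2
    have i3 := this 3
    have i4 := this 4
    simp only [cons_val, neg_eq_zero] at i1 i2 i3 i4
    refine h0 ⟨?_, i3, i4⟩
    linear_combination g₁ * i1 + g₀ * i2 - X₁ * hg
  · have := map_comb (pencil q R) 1 (-t) u p
    rw [one_smul] at this
    rw [this, hu, hup', pencil_eq_zero hp]; ring
  · obtain ⟨a, b₀, b₁, c₀, c₁, rfl⟩ := hc0 z
    have e : a • p + b₀ • f₀ + b₁ • f₁ + c₀ • c' 0 + c₁ • c' 1 =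
        a • p + (R 0 * b₀ + R 1 * b₁) • g + ((b₀ * g₁ - b₁ * g₀) • U + c₀ • c' 0 + c₁ • c' 1) := by
      have e₀ : b₀ = (b₀ * g₁ - b₁ * g₀) * R 1 + (R 0 * b₀ + R 1 * b₁) * g₀ := by linear_combination -b₀ * hg
      have e₁ : b₁ = -(b₀ * g₁ - b₁ * g₀) * R 0 + (R 0 * b₀ + R 1 * b₁) * g₁ := by linear_combination -b₁ * hg
      conv_lhs => rw [e₀, e₁]
      rw [hg_def, hU]
      module
    have hU0 : ∀ b : k, polar (pencil q R) p (b • U + c₀ • c' 0 + c₁ • c' 1) = 0 := by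
      intro b
      simp only [hU, polar_add_right, polar_smul_right, polar_pencil, hc', x00, x01,
        x10, x11, smul_eq_mul]
      ring
    rw [e, polar_add_left, polar_smul_left, polar_add_right,
      polar_add_right (pencil q R) p, hup, hU0]
    simp only [polar_add_right, polar_smul_right, hup', hppR, hpg, ← ht, smul_eq_mul]
    ring

end Existence

section Normal

variable {k V : Type*} [Field k] [AddCommGroup V] [Module k V]
  {q : Fin 2 → QuadraticForm k V}

theorem exists_line [IsAlgClosed k] [FiniteDimensional k V] (hq : SmoothPencil q) (hV : finrank k V = 5)
    {p : V} (hp0 : p ≠ 0) (hp : ∀ i, q i p = 0) : ∃ W, IsLine q W := by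
  obtain ⟨R, hR, v, hv⟩ := exists_vertex hq hV hp0 hp
  obtain ⟨s⟩ := exists_split hq hV hR hv hp0 hp
  exact s.exists_line hV hR

/-- A normal form of a pencil of quadrics at a line of its base locus. -/
structure NormalForm (q : Fin 2 → QuadraticForm k V) (Q : Submodule k V) where
  y : Fin 3 → V →ₗ[k] k
  U : V →ₗ[k] k
  W : V →ₗ[k] k
  inj : ∀ z, (∀ i, y i z = 0) → U z = 0 → W z = 0 → z = 0
  surj : ∀ a : Fin 3 → k, ∀ b c : k, ∃ z, (∀ i, y i z = a i) ∧ U z = b ∧ W z = c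
  mem : ∀ z, z ∈ Q ↔ ∀ i, y i z = 0
  c : Fin 6 → k
  form0 : ∀ z, q 0 z = U z * y 0 z + W z * y 1 z + c 1 * y 0 z ^ 2 + c 2 * y 0 z * y 1 z + c 3 * y 0 z * y 2 z +
    c 4 * y 1 z * y 2 z + c 5 * y 2 z ^ 2
  form1 : ∀ z, q 1 z = U z * y 1 z + W z * y 2 z - c 0 * y 0 z ^ 2

theorem exists_factor [IsAlgClosed k] (α β γ : k) (h : ¬ (α = 0 ∧ β = 0 ∧ γ = 0)) :
    ∃ s t m n : k, ¬ (s = 0 ∧ t = 0) ∧ ¬ (m = 0 ∧ n = 0) ∧ α = s * m ∧ β = s * n + t * m ∧ γ = t * n := by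
  obtain ⟨s, t, m, n, hst, h1, h2, h3⟩ : ∃ s t m n : k, ¬ (s = 0 ∧ t = 0) ∧ α = s * m ∧ β = s * n + t * m ∧ γ = t * n := by
    obtain ⟨X, Y, hXY, hz⟩ := exists_binary_zero α β γ
    by_cases hY : Y = 0
    · subst hY
      have hX : X ≠ 0 := by simpa using hXY
      have hα : α = 0 := by simpa [hX] using hz
      refine ⟨0, 1, β, γ, by simp, by rw [hα]; ring, by ring, by ring⟩
    · refine ⟨Y, -X, α / Y, (β + X * (α / Y)) / Y, by simp [hY], by field_simp, by field_simp; ring, ?_⟩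
      field_simp
      linear_combination hz
  refine ⟨s, t, m, n, hst, fun hc => h ?_, h1, h2, h3⟩
  rw [h1, h2, h3, hc.1, hc.2]
  simp

theorem exists_normalForm [IsAlgClosed k] [FiniteDimensional k V] (hq : SmoothPencil q)
    (hV : finrank k V = 5) {Q : Submodule k V} (hQ : IsLine q Q) : Nonempty (NormalForm q Q) := by
  obtain ⟨e, he, e', he', hee⟩ := exists_pair_of_finrank (show 2 ≤ finrank k Q by rw [hQ.1])
  have hQb : ∀ i, ∀ z ∈ Q, ∀ z' ∈ Q, polar (q i) z z' = 0 := fun i z hz z' hz' =>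
    polar_eq_zero_of_isotropic (fun v hv => hQ.2 v hv i) hz hz'
  obtain ⟨a, ha0, ha⟩ : ∃ a : Fin 4 → k, a ≠ 0 ∧ ∀ z, a 0 * polar (q 0) e z + a 1 * polar (q 1) e z +
      a 2 * polar (q 0) e' z + a 3 * polar (q 1) e' z = 0 := by
    by_contra! hcon
    have hs := surjective_pi_of_indep ![polarLin (q 0) e, polarLin (q 1) e, polarLin (q 0) e', polarLin (q 1) e']
      (fun c hc => by
        by_contra h0
        obtain ⟨z, hz⟩ := hcon c h0
        apply hz
        have := hc z
        rw [sum_univ_four] at this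
        exact this)
    set F := LinearMap.pi ![polarLin (q 0) e, polarLin (q 1) e, polarLin (q 0) e', polarLin (q 1) e'] with hF
    have h1 := F.finrank_range_add_finrank_ker
    rw [LinearMap.range_eq_top.2 hs, finrank_top, Module.finrank_fin_fun, hV] at h1
    have h2 : Q ≤ LinearMap.ker F := by
      intro z hz
      rw [LinearMap.mem_ker]
      funext i
      fin_cases i
      exacts [hQb 0 e he z hz, hQb 1 e he z hz, hQb 0 e' he' z hz, hQb 1 e' he' z hz]
    have h3 := Submodule.finrank_mono h2
    rw [hQ.1] at h3
    omega
  set v := a 0 • e + a 2 • e' with hv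
  set u := -(a 1 • e + a 3 • e') with hu
  have hvQ : v ∈ Q := Q.add_mem (Q.smul_mem _ he) (Q.smul_mem _ he')
  have huQ : u ∈ Q := Q.neg_mem (Q.add_mem (Q.smul_mem _ he) (Q.smul_mem _ he'))
  have huv : ∀ z, polar (q 0) v z = polar (q 1) u z := by
    intro z
    simp only [hv, hu, polar_add_left, polar_smul_left, polar_neg_left, smul_eq_mul]
    linear_combination ha z
  have huv0 : ¬ (u = 0 ∧ v = 0) := by
    rintro ⟨hu0, hv0⟩
    obtain ⟨h0, h2⟩ := hee _ _ (hv ▸ hv0)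
    obtain ⟨h1, h3⟩ := hee _ _ (neg_eq_zero.1 (hu ▸ hu0))
    apply ha0
    funext i
    fin_cases i <;> assumption
  have hind : ∀ m n : k, m • u + n • v = 0 → m = 0 ∧ n = 0 := by
    have hu' : ∀ w : V, w ≠ 0 → w ∈ Q → ∀ R : Fin 2 → k, R ≠ 0 → ∃ z, R 0 * polar (q 0) w z +
        R 1 * polar (q 1) w z ≠ 0 := by
      intro w hw hwQ R hR
      obtain ⟨z, hz⟩ := hq w hw (hQ.2 w hwQ) R hR
      exact ⟨z, by rwa [polar_pencil] at hz⟩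
    intro m n hmn
    by_cases hu0 : u = 0
    · obtain ⟨z, hz⟩ := hu' v (fun h => huv0 ⟨hu0, h⟩) hvQ ![1, 0] (by simp)
      simp [huv, hu0] at hz
    · have hn : n = 0 := by
        by_contra hn
        have hvu : v = (-m / n) • u := by
          have : n • v = (-m) • u := by rw [neg_smul]; exact eq_neg_of_add_eq_zero_right hmn
          rw [neg_div, neg_smul, div_eq_inv_mul, mul_smul, ← smul_neg, ← neg_smul m u, ← this, smul_smul, inv_mul_cancel₀ hn, one_smul]
        obtain ⟨z, hz⟩ := hu' u hu0 huQ ![-m / n, -1] (by simp)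
        apply hz
        have := huv z
        rw [hvu, polar_smul_left, smul_eq_mul] at this
        simp only [cons_val_zero, cons_val_one]
        linear_combination this
      subst hn
      rw [zero_smul, add_zero] at hmn
      exact ⟨(smul_eq_zero.1 hmn).resolve_right hu0, rfl⟩
  have hys := surjective_pi_of_indep ![polarLin (q 0) u, polarLin (q 1) u, polarLin (q 1) v] (fun c hc => by
    by_contra hc0
    obtain ⟨s, t, m, n, hst, hmn, h1, h2, h3⟩ := exists_factor (c 0) (c 1) (c 2) (by
      rintro ⟨h0, h1, h2⟩
      apply hc0
      funext i
      fin_cases i <;> assumption)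
    obtain ⟨z, hz⟩ := hq (m • u + n • v) (fun h => hmn (hind m n h)) (hQ.2 _ (Q.add_mem (Q.smul_mem _ huQ) (Q.smul_mem _ hvQ)))
      ![s, t] (by
        intro h
        exact hst ⟨congrFun h 0, congrFun h 1⟩)
    apply hz
    have := hc z
    simp only [sum_univ_three, cons_val, polarLin_apply, h1, h2, h3] at this
    simp only [polar_pencil, polar_add_left, polar_smul_left, smul_eq_mul, huv,
      cons_val_zero, cons_val_one]
    linear_combination this)
  obtain ⟨g₀, hg₀⟩ := hys ![1, 0, 0]
  obtain ⟨g₁, hg₁⟩ := hys ![0, 1, 0]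
  obtain ⟨g₂, hg₂⟩ := hys ![0, 0, 1]
  have y00 : polar (q 0) u g₀ = 1 := congrFun hg₀ 0
  have y10 : polar (q 1) u g₀ = 0 := congrFun hg₀ 1
  have y20 : polar (q 1) v g₀ = 0 := congrFun hg₀ 2
  have y01 : polar (q 0) u g₁ = 0 := congrFun hg₁ 0
  have y11 : polar (q 1) u g₁ = 1 := congrFun hg₁ 1
  have y21 : polar (q 1) v g₁ = 0 := congrFun hg₁ 2
  have y02 : polar (q 0) u g₂ = 0 := congrFun hg₂ 0
  have y12 : polar (q 1) u g₂ = 0 := congrFun hg₂ 1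
  have y22 : polar (q 1) v g₂ = 1 := congrFun hg₂ 2
  have yu := fun i => hQb i u huQ u huQ
  have yv := fun i => hQb i u huQ v hvQ
  have yu' := fun i => hQb i v hvQ u huQ
  have yv' := fun i => hQb i v hvQ v hvQ
  have hli : LinearIndependent k ![g₀, g₁, g₂, u, v] := by
    rw [Fintype.linearIndependent_iff]
    intro c hc
    simp only [sum_univ_five, cons_val] at hc
    have h0 : c 0 = 0 := by
      have := congrArg (polarLin (q 0) u) hc
      simpa [y00, y01, y02, yu, yv] using this
    have h1 : c 1 = 0 := by
      have := congrArg (polarLin (q 1) u) hc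
      simpa [y10, y11, y12, yu, yv] using this
    have h2 : c 2 = 0 := by
      have := congrArg (polarLin (q 1) v) hc
      simpa [y20, y21, y22, yu', yv'] using this
    rw [h0, h1, h2, zero_smul, zero_smul, zero_smul, add_zero, add_zero, zero_add] at hc
    obtain ⟨h3, h4⟩ := hind _ _ hc
    intro i
    fin_cases i <;> assumption
  let E := basisOfLinearIndependentOfCardEqFinrank hli (by rw [hV]; rfl)
  have hsum : ∀ z, z = E.coord 0 z • g₀ + E.coord 1 z • g₁ + E.coord 2 z • g₂ + E.coord 3 z • u + E.coord 4 z • v := by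
    intro z
    have := (E.sum_repr z).symm
    rw [sum_univ_five] at this
    simpa [E, coe_basisOfLinearIndependentOfCardEqFinrank] using this
  have hcoord : ∀ c : Fin 5 → k, ∀ i, E.coord i (c 0 • g₀ + c 1 • g₁ + c 2 • g₂ + c 3 • u + c 4 • v) = c i := by
    intro c i
    have h1 : c 0 • g₀ + c 1 • g₁ + c 2 • g₂ + c 3 • u + c 4 • v = ∑ j, c j • E j := by
      rw [sum_univ_five]
      simp [E, coe_basisOfLinearIndependentOfCardEqFinrank]
    rw [h1, Module.Basis.coord_apply, Module.Basis.repr_sum_self]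
  have pc := fun i (z z' : V) => polar_comm (⇑(q i)) z z'
  have hval : ∀ i, ∀ a₀ a₁ a₂ a₃ a₄ : k, q i (a₀ • g₀ + a₁ • g₁ + a₂ • g₂ + a₃ • u + a₄ • v) =
      a₀ ^ 2 * q i g₀ + a₁ ^ 2 * q i g₁ + a₂ ^ 2 * q i g₂ + a₀ * a₁ * polar (q i) g₀ g₁ +
      a₀ * a₂ * polar (q i) g₀ g₂ + a₁ * a₂ * polar (q i) g₁ g₂ +
      a₃ * (a₀ * polar (q i) u g₀ + a₁ * polar (q i) u g₁ + a₂ * polar (q i) u g₂) +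
      a₄ * (a₀ * polar (q i) v g₀ + a₁ * polar (q i) v g₁ + a₂ * polar (q i) v g₂) := by
    intro i a₀ a₁ a₂ a₃ a₄
    rw [QuadraticMap.map_add (⇑(q i)) (_ + _ + _ + _), QuadraticMap.map_add (⇑(q i)) (_ + _ + _),
      QuadraticMap.map_add (⇑(q i)) (_ + _), QuadraticMap.map_add (⇑(q i)) (_ • _)]
    simp only [QuadraticMap.map_smul, polar_add_left, polar_smul_left,
      polar_smul_right, hQ.2 u huQ, hQ.2 v hvQ, yv, pc i g₀ u, pc i g₁ u, pc i g₂ u, pc i g₀ v, pc i g₁ v, pc i g₂ v, smul_eq_mul]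
    ring
  have hU : ∀ z, z ∈ Q ↔ ∀ i, ![E.coord 0, E.coord 1, E.coord 2] i z = 0 := by
    intro z
    constructor
    · intro hz
      obtain ⟨m, n, rfl⟩ := mem_of_indep_pair hQ.1 huQ hvQ hind hz
      have := hcoord ![0, 0, 0, m, n]
      simp only [cons_val, zero_smul, zero_add] at this
      intro i
      fin_cases i
      exacts [this 0, this 1, this 2]
    · intro h
      have h0 : E.coord 0 z = 0 := h 0
      have h1 : E.coord 1 z = 0 := h 1
      have h2 : E.coord 2 z = 0 := h 2
      rw [hsum z, h0, h1, h2, zero_smul, zero_smul, zero_smul, add_zero, add_zero, zero_add]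
      exact Q.add_mem (Q.smul_mem _ huQ) (Q.smul_mem _ hvQ)
  set d01 := polar (q 1) g₀ g₁
  set d02 := polar (q 1) g₀ g₂
  set d12 := polar (q 1) g₁ g₂
  let h : V →ₗ[k] k := d01 • E.coord 0 + q 1 g₁ • E.coord 1 + (d12 - q 0 g₁) • E.coord 2
  let h' : V →ₗ[k] k := d02 • E.coord 0 + q 0 g₁ • E.coord 1 + q 1 g₂ • E.coord 2
  have hh : ∀ z, h z = d01 * E.coord 0 z + q 1 g₁ * E.coord 1 z + (d12 - q 0 g₁) * E.coord 2 z := fun z => rfl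
  have hh' : ∀ z, h' z = d02 * E.coord 0 z + q 0 g₁ * E.coord 1 z + q 1 g₂ * E.coord 2 z := fun z => rfl
  refine ⟨⟨![E.coord 0, E.coord 1, E.coord 2], E.coord 3 + h, E.coord 4 + h', fun z hz h3 h4 => ?_,
    fun a b c => ?_, hU,
    ![-q 1 g₀, q 0 g₀ - d01, polar (q 0) g₀ g₁ - q 1 g₁ - d02,
      polar (q 0) g₀ g₂ - d12 + q 0 g₁, polar (q 0) g₁ g₂ - q 1 g₂, q 0 g₂],
    fun z => ?_, fun z => ?_⟩⟩
  · have h0 : E.coord 0 z = 0 := hz 0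
    have h1 : E.coord 1 z = 0 := hz 1
    have h2 : E.coord 2 z = 0 := hz 2
    rw [LinearMap.add_apply, hh, h0, h1, h2] at h3
    rw [LinearMap.add_apply, hh', h0, h1, h2] at h4
    simp only [mul_zero, add_zero] at h3 h4
    rw [hsum z, h0, h1, h2, h3, h4]
    simp
  · let w := a 0 • g₀ + a 1 • g₁ + a 2 • g₂ + (0 : k) • u + (0 : k) • v
    have := hcoord ![a 0, a 1, a 2, b - h w, c - h' w]
    simp only [cons_val] at this
    refine ⟨a 0 • g₀ + a 1 • g₁ + a 2 • g₂ + (b - h w) • u + (c - h' w) • v, fun i => ?_, ?_, ?_⟩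
    · fin_cases i
      exacts [this 0, this 1, this 2]
    · have hw : ∀ m n : k, h (a 0 • g₀ + a 1 • g₁ + a 2 • g₂ + m • u + n • v) = d01 * a 0 + q 1 g₁ * a 1 + (d12 - q 0 g₁) * a 2 := by
        intro m n
        have := hcoord ![a 0, a 1, a 2, m, n]
        simp only [cons_val] at this
        rw [hh, this, this, this]; rfl
      rw [LinearMap.add_apply, this, hw]
      simp only [w, hw, cons_val]
      ring
    · have hw : ∀ m n : k, h' (a 0 • g₀ + a 1 • g₁ + a 2 • g₂ + m • u + n • v) = d02 * a 0 + q 0 g₁ * a 1 + q 1 g₂ * a 2 := by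
        intro m n
        have := hcoord ![a 0, a 1, a 2, m, n]
        simp only [cons_val] at this
        rw [hh', this, this, this]; rfl
      rw [LinearMap.add_apply, this, hw]
      simp only [w, hw, cons_val]
      ring
  · conv_lhs => rw [hsum z]
    rw [hval]
    simp only [LinearMap.add_apply, hh, hh', cons_val, y00, y01, y02, huv, y10, y11, y12]
    ring
  · conv_lhs => rw [hsum z]
    rw [hval]
    simp only [LinearMap.add_apply, hh, hh', cons_val, y20, y21, y22, y10, y11, y12]
    ring

end Normal

section Normal

variable {k V : Type*} [Field k] [AddCommGroup V] [Module k V]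
  [FiniteDimensional k V] {q : Fin 2 → QuadraticForm k V} {Q : Submodule k V}

/-- The binary quintic with coefficients `c`. -/
def quintic (c : Fin 6 → k) (s t : k) : k :=
  c 0 * s ^ 5 + c 1 * s ^ 4 * t + c 2 * s ^ 3 * t ^ 2 + c 3 * s ^ 2 * t ^ 3 + c 4 * s * t ^ 4 + c 5 * t ^ 5

/-- The first partial derivative of the binary quintic. -/
def quinticS (c : Fin 6 → k) (s t : k) : k :=
  5 * c 0 * s ^ 4 + 4 * c 1 * s ^ 3 * t + 3 * c 2 * s ^ 2 * t ^ 2 + 2 * c 3 * s * t ^ 3 + c 4 * t ^ 4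

/-- The second partial derivative of the binary quintic. -/
def quinticT (c : Fin 6 → k) (s t : k) : k :=
  c 1 * s ^ 4 + 2 * c 2 * s ^ 3 * t + 3 * c 3 * s ^ 2 * t ^ 2 + 4 * c 4 * s * t ^ 3 + 5 * c 5 * t ^ 4

namespace NormalForm

variable (N : NormalForm q Q)

theorem ext_of {z z' : V} (h : ∀ i, N.y i z = N.y i z') (hU : N.U z = N.U z') (hW : N.W z = N.W z') : z = z' := by
  rw [← sub_eq_zero]
  exact N.inj _ (fun i => by rw [map_sub, h, sub_self]) (by rw [map_sub, hU, sub_self]) (by rw [map_sub, hW, sub_self])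

theorem polar0 (z z' : V) : polar (q 0) z z' = N.U z * N.y 0 z' + N.U z' * N.y 0 z + N.W z * N.y 1 z' +
    N.W z' * N.y 1 z + 2 * N.c 1 * N.y 0 z * N.y 0 z' + N.c 2 * (N.y 0 z * N.y 1 z' + N.y 0 z' * N.y 1 z) +
    N.c 3 * (N.y 0 z * N.y 2 z' + N.y 0 z' * N.y 2 z) + N.c 4 * (N.y 1 z * N.y 2 z' + N.y 1 z' * N.y 2 z) +
    2 * N.c 5 * N.y 2 z * N.y 2 z' := by
  simp only [polar, N.form0, map_add]
  ring

theorem polar1 (z z' : V) : polar (q 1) z z' = N.U z * N.y 1 z' + N.U z' * N.y 1 z + N.W z * N.y 2 z' +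
    N.W z' * N.y 2 z - 2 * N.c 0 * N.y 0 z * N.y 0 z' := by
  simp only [polar, N.form1, map_add]
  ring

/-- A vertex of a quadric of the pencil lies over the corresponding point of the rational normal curve. -/
theorem exists_of_isVert (hq : SmoothPencil q) (hQ : IsLine q Q) {R : Fin 2 → k} (hR : R ≠ 0) {v : V}
    (hv : IsVert q R v) : ∃ a : k, a ≠ 0 ∧ N.y 0 v = a * R 1 ^ 2 ∧ N.y 1 v = -(a * R 0 * R 1) ∧ N.y 2 v = a * R 0 ^ 2 ∧
      quintic N.c (-R 1) (R 0) = 0 := by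
  obtain ⟨eU, u1, u2, u3⟩ := N.surj 0 1 0
  obtain ⟨eW, w1, w2, w3⟩ := N.surj 0 0 1
  have hU := hv.2.2 eU
  have hW := hv.2.2 eW
  rw [polar_pencil, N.polar0, N.polar1] at hU hW
  simp only [u1, u2, u3, w1, w2, w3, Pi.zero_apply] at hU hW
  have hU' : R 0 * N.y 0 v + R 1 * N.y 1 v = 0 := by linear_combination hU
  have hW' : R 0 * N.y 1 v + R 1 * N.y 2 v = 0 := by linear_combination hW
  obtain ⟨a, h0, h1, h2⟩ : ∃ a : k, N.y 0 v = a * R 1 ^ 2 ∧ N.y 1 v = -(a * R 0 * R 1) ∧ N.y 2 v = a * R 0 ^ 2 := by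
    by_cases h : R 0 = 0
    · have hR1 : R 1 ≠ 0 := by
        intro h1
        apply hR
        funext i
        fin_cases i
        exacts [h, h1]
      rw [h, zero_mul, zero_add] at hU' hW'
      have e1 := (mul_eq_zero.1 hU').resolve_left hR1
      have e2 := (mul_eq_zero.1 hW').resolve_left hR1
      refine ⟨N.y 0 v / R 1 ^ 2, by field_simp, by rw [e1, h]; ring, by rw [e2, h]; ring⟩
    · have e1 : N.y 1 v = -(R 1 * N.y 2 v) / R 0 := by field_simp; linear_combination hW'
      have e2 : N.y 0 v = -(R 1 * N.y 1 v) / R 0 := by field_simp; linear_combination hU'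
      refine ⟨N.y 2 v / R 0 ^ 2, by rw [e2, e1]; field_simp, by rw [e1]; field_simp, by field_simp⟩
  have ha : a ≠ 0 := by
    rintro rfl
    apply hv.not_mem_line hq hR hQ
    rw [N.mem]
    intro i
    fin_cases i
    · simpa using h0
    · simpa using h1
    · simpa using h2
  refine ⟨a, ha, h0, h1, h2, ?_⟩
  have h := hv.2.1
  rw [pencil_apply, N.form0, N.form1, h0, h1, h2] at h
  apply (mul_eq_zero.1 (_ : a ^ 2 * _ = 0)).resolve_left (pow_ne_zero 2 ha)
  rw [quintic]
  linear_combination h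

/-- At a root of the quintic the quadric is singular; its vertex computes the derivatives of the quintic. -/
theorem exists_isVert {R : Fin 2 → k} (hR : R ≠ 0) (h : quintic N.c (-R 1) (R 0) = 0) : ∃ v, IsVert q R v ∧
    N.y 0 v = R 1 ^ 2 ∧ N.y 1 v = -(R 0 * R 1) ∧ N.y 2 v = R 0 ^ 2 ∧ q 0 v = quinticT N.c (-R 1) (R 0) ∧
      q 1 v = - quinticS N.c (-R 1) (R 0) := by
  set s := -R 1 with hs
  set t := R 0 with ht
  have hR1 : R 1 = -s := by rw [hs, neg_neg]
  set C0 := t * (2 * N.c 1 * s ^ 2 + N.c 2 * (s * t) + N.c 3 * t ^ 2) + 2 * s * N.c 0 * s ^ 2 with hC0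
  set C1 := t * (N.c 2 * s ^ 2 + N.c 4 * t ^ 2) with hC1
  set C2 := t * (N.c 3 * s ^ 2 + N.c 4 * (s * t) + 2 * N.c 5 * t ^ 2) with hC2
  have hE : s ^ 2 * C0 + s * t * C1 + t ^ 2 * C2 = 0 := by
    rw [quintic] at h
    rw [hC0, hC1, hC2]
    linear_combination 2 * h
  have hst : ¬ (s = 0 ∧ t = 0) := by
    rintro ⟨h1, h2⟩
    apply hR
    funext i
    fin_cases i
    · exact h2
    · simpa [hs] using h1
  obtain ⟨α, β, e0, e1, e2⟩ : ∃ α β : k, t * α + C0 = 0 ∧ -s * α + t * β + C1 = 0 ∧ -s * β + C2 = 0 := by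
    by_cases hs0 : s = 0
    · have ht0 : t ≠ 0 := fun h => hst ⟨hs0, h⟩
      rw [hs0] at hE ⊢
      refine ⟨-C0 / t, -C1 / t, by field_simp; ring, by field_simp; ring, ?_⟩
      have : t ^ 2 * C2 = 0 := by linear_combination hE
      rw [(mul_eq_zero.1 this).resolve_left (pow_ne_zero 2 ht0)]
      ring
    · refine ⟨(t * (C2 / s) + C1) / s, C2 / s, ?_, by field_simp; ring, by field_simp; ring⟩
      field_simp
      linear_combination hE
  obtain ⟨v, hy, hU, hW⟩ := N.surj ![s ^ 2, s * t, t ^ 2] α β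
  have y0 : N.y 0 v = s ^ 2 := hy 0
  have y1 : N.y 1 v = s * t := hy 1
  have y2 : N.y 2 v = t ^ 2 := hy 2
  have q0 : q 0 v = quinticT N.c s t := by
    rw [N.form0, hU, hW, y0, y1, y2, quinticT]
    rw [hC0] at e0
    rw [hC1] at e1
    rw [hC2] at e2
    linear_combination -s * e1 - 2 * t * e2
  have q1 : q 1 v = - quinticS N.c s t := by
    rw [N.form1, hU, hW, y0, y1, y2, quinticS]
    rw [hC0] at e0
    rw [hC1] at e1
    rw [hC2] at e2
    linear_combination 2 * s * e0 + t * e1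
  refine ⟨v, ⟨?_, ?_, fun z => ?_⟩, by rw [y0, hR1]; ring, by rw [y1, hR1]; ring, by rw [y2], q0, q1⟩
  · rintro rfl
    rw [map_zero] at y0 y2
    exact hst ⟨by simpa using y0.symm, by simpa using y2.symm⟩
  · rw [pencil_apply, hR1, ← ht, q0, q1]
    rw [quintic] at h
    rw [quinticS, quinticT]
    linear_combination 5 * h
  · rw [polar_pencil, hR1, ← ht, N.polar0, N.polar1, hU, hW, y0, y1, y2]
    rw [hC0] at e0
    rw [hC1] at e1
    rw [hC2] at e2
    linear_combination N.y 0 z * e0 + N.y 1 z * e1 + N.y 2 z * e2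

theorem isVert_iff (hq : SmoothPencil q) (hQ : IsLine q Q) {R : Fin 2 → k} (hR : R ≠ 0) :
    (∃ v, IsVert q R v) ↔ quintic N.c (-R 1) (R 0) = 0 := by
  constructor
  · rintro ⟨v, hv⟩
    obtain ⟨a, -, -, -, -, h⟩ := N.exists_of_isVert hq hQ hR hv
    exact h
  · intro h
    obtain ⟨v, hv, -⟩ := N.exists_isVert hR h
    exact ⟨v, hv⟩

theorem simple (hq : SmoothPencil q) {s t : k} (hst : ¬ (s = 0 ∧ t = 0)) (h : quintic N.c s t = 0)
    (hS : quinticS N.c s t = 0) (hT : quinticT N.c s t = 0) : False := by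
  have hR : ![t, -s] ≠ 0 := by
    intro h0
    exact hst ⟨by simpa using congrFun h0 1, congrFun h0 0⟩
  obtain ⟨v, hv, -, -, -, h0, h1⟩ := N.exists_isVert hR (by simpa using h)
  obtain ⟨u, hu⟩ := hq v hv.1 (fun i => by
    fin_cases i
    · simpa [hT] using h0
    · simpa [hS] using h1) _ hR
  exact hu (hv.2.2 u)

/-- The dehomogenized quintic. -/
noncomputable def poly (N : NormalForm q Q) : Polynomial k :=
  .C (N.c 0) + .C (N.c 1) * .X + .C (N.c 2) * .X ^ 2 + .C (N.c 3) * .X ^ 3 + .C (N.c 4) * .X ^ 4 + .C (N.c 5) * .X ^ 5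

theorem poly_coeff (i : Fin 6) : N.poly.coeff i = N.c i := by
  rw [poly]
  fin_cases i <;> simp [Polynomial.coeff_X, Polynomial.coeff_C]

theorem poly_eval (T : k) : N.poly.eval T = quintic N.c 1 T := by
  simp [poly, quintic]

theorem poly_derivative (T : k) : (Polynomial.derivative N.poly).eval T = quinticT N.c 1 T := by
  simp [poly, quinticT, Polynomial.derivative_pow]
  ring

theorem poly_natDegree : N.poly.natDegree ≤ 5 := by
  rw [poly]
  compute_degree

theorem poly_ne_zero (hq : SmoothPencil q) : N.poly ≠ 0 := by
  intro h
  have hc : ∀ i, N.c i = 0 := fun i => by rw [← N.poly_coeff, h, Polynomial.coeff_zero]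
  refine N.simple hq (s := 1) (t := 0) (by simp) ?_ ?_ ?_ <;> simp [quintic, quinticS, quinticT, hc]

theorem poly_nodup (hq : SmoothPencil q) : N.poly.roots.Nodup := by
  classical
  rw [Multiset.nodup_iff_count_le_one]
  intro T
  rw [Polynomial.count_roots]
  by_contra! h
  rw [Polynomial.one_lt_rootMultiplicity_iff_isRoot (N.poly_ne_zero hq)] at h
  obtain ⟨h1, h2⟩ := h
  rw [Polynomial.IsRoot.def, N.poly_eval] at h1
  rw [Polynomial.IsRoot.def, N.poly_derivative] at h2
  refine N.simple hq (s := 1) (t := T) (by simp) h1 ?_ h2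
  rw [quintic] at h1
  rw [quinticT] at h2
  rw [quinticS]
  linear_combination 5 * h1 - T * h2

theorem coeff_four (hq : SmoothPencil q) (h : N.c 5 = 0) : N.c 4 ≠ 0 := by
  intro h4
  refine N.simple hq (s := 0) (t := 1) (by simp) ?_ ?_ ?_ <;> simp [quintic, quinticS, quinticT, h, h4]

theorem mem_roots (hq : SmoothPencil q) (T : k) : T ∈ N.poly.roots ↔ quintic N.c 1 T = 0 := by
  rw [Polynomial.mem_roots (N.poly_ne_zero hq), Polynomial.IsRoot.def, N.poly_eval]

theorem card_roots [IsAlgClosed k] : Multiset.card N.poly.roots = N.poly.natDegree :=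
  (Polynomial.splits_iff_card_roots.1 (IsAlgClosed.splits N.poly))

/-- The quintics of two pencils with the same singular members are proportional. -/
theorem exists_eq_smul [IsAlgClosed k] (hq : SmoothPencil q) (hQ : IsLine q Q)
    {V' : Type*} [AddCommGroup V'] [Module k V'] [FiniteDimensional k V'] {q' : Fin 2 → QuadraticForm k V'} {Q' : Submodule k V'}
    (N' : NormalForm q' Q') (hq' : SmoothPencil q') (hQ' : IsLine q' Q')
    (h : ∀ R : Fin 2 → k, R ≠ 0 → ((∃ v, IsVert q R v) ↔ ∃ v, IsVert q' R v)) :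
    ∃ a : k, a ≠ 0 ∧ ∀ i, N.c i = a * N'.c i := by
  have hroots : N.poly.roots = N'.poly.roots := by
    rw [Multiset.Nodup.ext (N.poly_nodup hq) (N'.poly_nodup hq')]
    intro T
    rw [N.mem_roots hq, N'.mem_roots hq']
    have h1 := h ![T, -1] (by simp)
    rw [N.isVert_iff hq hQ (by simp), N'.isVert_iff hq' hQ' (by simp)] at h1
    simpa using h1
  have e := (IsAlgClosed.splits N.poly).eq_prod_roots
  have e' := (IsAlgClosed.splits N'.poly).eq_prod_roots
  have l : N.poly.leadingCoeff ≠ 0 := Polynomial.leadingCoeff_ne_zero.2 (N.poly_ne_zero hq)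
  have l' : N'.poly.leadingCoeff ≠ 0 := Polynomial.leadingCoeff_ne_zero.2 (N'.poly_ne_zero hq')
  refine ⟨N.poly.leadingCoeff / N'.poly.leadingCoeff, div_ne_zero l l', fun i => ?_⟩
  rw [← N.poly_coeff, ← N'.poly_coeff]
  have c1 : N.poly.coeff i = N.poly.leadingCoeff * _ := (congrArg (Polynomial.coeff · i) e).trans (Polynomial.coeff_C_mul _)
  have c2 : N'.poly.coeff i = N'.poly.leadingCoeff * _ :=
    (congrArg (Polynomial.coeff · i) e').trans (Polynomial.coeff_C_mul _)
  rw [c1, c2, hroots]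
  field_simp

/-- There are five singular quadrics in the pencil. -/
theorem exists_five [IsAlgClosed k] (N : NormalForm q Q) (hq : SmoothPencil q) (hQ : IsLine q Q) :
    ∃ R : Fin 5 → Fin 2 → k, (∀ i, R i ≠ 0) ∧ (∀ i, ∃ v, IsVert q (R i) v) ∧
      (∀ i j, i ≠ j → R i 0 * R j 1 - R i 1 * R j 0 ≠ 0) ∧
      ∀ R' : Fin 2 → k, R' ≠ 0 → (∃ v, IsVert q R' v) → ∃ i, R i 0 * R' 1 - R i 1 * R' 0 = 0 := by
  classical
  have hcard : N.poly.roots.toFinset.card = N.poly.natDegree := by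
    rw [Multiset.toFinset_card_of_nodup (N.poly_nodup hq), N.card_roots]
  have hmem : ∀ T, T ∈ N.poly.roots.toFinset ↔ ∃ v, IsVert q ![T, -1] v := by
    intro T
    rw [Multiset.mem_toFinset, N.mem_roots hq, N.isVert_iff hq hQ (by simp)]
    simp
  have hfin : ∀ R' : Fin 2 → k, R' 1 ≠ 0 → (∃ v, IsVert q R' v) → -(R' 0 / R' 1) ∈ N.poly.roots.toFinset := by
    intro R' h1 ⟨v, hv⟩
    rw [hmem]
    refine ⟨v, ?_⟩
    have := hv.smul (-(R' 1)⁻¹)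
    convert this using 1
    funext i
    fin_cases i
    · simp [div_eq_inv_mul]
    · simp [h1]
  by_cases h5 : N.c 5 = 0
  · have hdeg : N.poly.natDegree = 4 := by
      apply le_antisymm
      · rw [poly, h5]
        simp only [map_zero, zero_mul, add_zero]
        compute_degree
      · apply Polynomial.le_natDegree_of_ne_zero
        have := N.poly_coeff 4
        rw [show ((4 : Fin 6) : ℕ) = 4 from rfl] at this
        rw [this]
        exact N.coeff_four hq h5
    let e := N.poly.roots.toFinset.equivFinOfCardEq (hcard.trans hdeg)
    refine ⟨Fin.cons ![1, 0] fun i => ![(e.symm i : k), -1], ?_, ?_, ?_, ?_⟩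
    · intro i
      refine Fin.cases ?_ (fun i => ?_) i <;> simp
    · intro i
      refine Fin.cases ?_ (fun i => ?_) i
      · rw [Fin.cons_zero, N.isVert_iff hq hQ (by simp)]
        simp [quintic, h5]
      · rw [Fin.cons_succ]
        exact (hmem _).1 (e.symm i).2
    · intro i
      refine Fin.cases (fun j => ?_) (fun i j => ?_) i
      · refine Fin.cases (fun h => ?_) (fun j h => ?_) j
        · exact absurd rfl h
        · simp
      · refine Fin.cases (fun h => ?_) (fun j h => ?_) j
        · simp
        · have hne : (e.symm i : k) ≠ e.symm j := by
            intro h1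
            exact h (congrArg _ (e.symm.injective (Subtype.ext h1)))
          simp only [Fin.cons_succ, cons_val_zero, cons_val_one]
          intro h0
          exact hne (by linear_combination -h0)
    · intro R' hR' hv
      by_cases h1 : R' 1 = 0
      · exact ⟨0, by simp [h1]⟩
      · refine ⟨Fin.succ (e ⟨_, hfin R' h1 hv⟩), ?_⟩
        simp only [Fin.cons_succ, cons_val_zero, cons_val_one, Equiv.symm_apply_apply]
        field_simp
        ring
  · have hdeg : N.poly.natDegree = 5 := by
      apply le_antisymm N.poly_natDegree
      apply Polynomial.le_natDegree_of_ne_zero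
      have := N.poly_coeff 5
      rw [show ((5 : Fin 6) : ℕ) = 5 from rfl] at this
      rwa [this]
    let e := N.poly.roots.toFinset.equivFinOfCardEq (hcard.trans hdeg)
    refine ⟨fun i => ![(e.symm i : k), -1], fun i => by simp, fun i => (hmem _).1 (e.symm i).2, fun i j h => ?_, ?_⟩
    · have hne : (e.symm i : k) ≠ e.symm j := by
        intro h1
        exact h (e.symm.injective (Subtype.ext h1))
      simp only [cons_val_zero, cons_val_one]
      intro h0
      exact hne (by linear_combination -h0)
    · intro R' hR' hv
      have h1 : R' 1 ≠ 0 := by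
        intro h1
        have h0 : R' 0 ≠ 0 := by
          intro h0
          apply hR'
          funext i
          fin_cases i
          exacts [h0, h1]
        rw [N.isVert_iff hq hQ hR', h1, quintic] at hv
        simp [h5, h0] at hv
      refine ⟨e ⟨_, hfin R' h1 hv⟩, ?_⟩
      simp only [cons_val_zero, cons_val_one, Equiv.symm_apply_apply]
      field_simp
      ring

/-- Pencils with proportional quintics are equivalent. -/
theorem exists_equiv {V' : Type*} [AddCommGroup V'] [Module k V'] [FiniteDimensional k V'] {q' : Fin 2 → QuadraticForm k V'} {Q' : Submodule k V'}
    (N' : NormalForm q' Q') {a : k} (ha : a ≠ 0) (h : ∀ i, N.c i = a * N'.c i) :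
    ∃ A : V →ₗ[k] V', Function.Bijective A ∧ (∀ i z, q i z = a * q' i (A z)) ∧ ∀ z, A z ∈ Q' ↔ z ∈ Q := by
  choose A hy hU hW using fun z : V => N'.surj (fun i => N.y i z) (a⁻¹ * N.U z) (a⁻¹ * N.W z)
  refine ⟨⟨⟨A, fun z z' => ?_⟩, fun b z => ?_⟩, ⟨?_, ?_⟩, ?_, ?_⟩
  · apply N'.ext_of
    · intro i; rw [hy, map_add, map_add, hy, hy]
    · rw [hU, map_add, map_add, hU, hU]; ring
    · rw [hW, map_add, map_add, hW, hW]; ring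
  · apply N'.ext_of
    · intro i; simp [hy]
    · simp [hU]; ring
    · simp [hW]; ring
  · intro z z' hz
    have hz' : A z = A z' := hz
    apply N.ext_of
    · intro i; rw [← hy, ← hy, hz']
    · apply mul_left_cancel₀ (inv_ne_zero ha); rw [← hU, ← hU, hz']
    · apply mul_left_cancel₀ (inv_ne_zero ha); rw [← hW, ← hW, hz']
  · intro w
    obtain ⟨z, h1, h2, h3⟩ := N.surj (fun i => N'.y i w) (a * N'.U w) (a * N'.W w)
    refine ⟨z, N'.ext_of (fun i => ?_) ?_ ?_⟩
    · exact (hy z i).trans (h1 i)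
    · exact (hU z).trans (by rw [h2, inv_mul_cancel_left₀ ha])
    · exact (hW z).trans (by rw [h3, inv_mul_cancel_left₀ ha])
  · intro i z
    change q i z = a * q' i (A z)
    fin_cases i
    · simp only [Fin.zero_eta]
      rw [N.form0, N'.form0, hU, hW, h, h, h, h, h]
      simp only [hy]
      field_simp
    · simp only [Fin.mk_one]
      rw [N.form1, N'.form1, hU, hW, h]
      simp only [hy]
      field_simp
  · intro z
    change A z ∈ Q' ↔ _
    rw [N'.mem, N.mem]
    simp only [hy]

end NormalForm

end Normal

section Scalar

variable {k V : Type*} [Field k] [AddCommGroup V] [Module k V] [FiniteDimensional k V]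
  {q : Fin 2 → QuadraticForm k V}

theorem exists_eigenvalue_of_two {B : V →ₗ[k] V} {W W' : Submodule k V} (hW : finrank k W = 2)
    (hW' : finrank k W' = 2) (hne : W' ≠ W) (hB : ∀ z ∈ W, B z ∈ W) (hB' : ∀ z ∈ W', B z ∈ W') {z : V}
    (hz0 : z ≠ 0) (hz : z ∈ W) (hz' : z ∈ W') : ∃ a : k, B z = a • z := by
  by_contra! hcon
  have hli := indep_of_disjoint (W := span k {z}) (mem_span_singleton_self z) hz0
    (v := B z) (fun h => by
      obtain ⟨a, ha⟩ := Submodule.mem_span_singleton.1 h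
      exact hcon a ha.symm)
  have hle : W ≤ W' := by
    intro x hx
    obtain ⟨a, b, rfl⟩ := mem_of_indep_pair hW hz (hB z hz) hli hx
    exact W'.add_mem (W'.smul_mem _ hz') (W'.smul_mem _ (hB' z hz'))
  exact hne (Submodule.eq_of_le_of_finrank_eq hle (hW.trans hW'.symm)).symm

theorem scalar_of_three {B : V →ₗ[k] V} {W : Submodule k V} (hW : finrank k W = 2) {z : Fin 3 → V}
    (hz : ∀ i, z i ∈ W) (hli : ∀ i j, i ≠ j → ∀ a b : k, a • z i + b • z j = 0 → a = 0 ∧ b = 0)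
    (hB : ∀ i, ∃ a : k, B (z i) = a • z i) : ∃ a : k, ∀ w ∈ W, B w = a • w := by
  choose c hc using hB
  have h01 := hli 0 1 (by decide)
  obtain ⟨α, β, h2⟩ := mem_of_indep_pair hW (hz 0) (hz 1) h01 (hz 2)
  have hα : α ≠ 0 := by
    rintro rfl
    have := (hli 2 1 (by decide) 1 (-β) (by rw [h2]; module)).1
    exact one_ne_zero this
  have hβ : β ≠ 0 := by
    rintro rfl
    have := (hli 2 0 (by decide) 1 (-α) (by rw [h2]; module)).1
    exact one_ne_zero this
  have h3 := hc 2
  rw [h2, map_add, map_smul, map_smul, hc, hc] at h3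
  obtain ⟨e0, e1⟩ := h01 (α * (c 0 - c 2)) (β * (c 1 - c 2)) (by
    rw [← sub_eq_zero] at h3
    rw [← h3]; module)
  have e0' : c 0 = c 2 := sub_eq_zero.1 ((mul_eq_zero.1 e0).resolve_left hα)
  have e1' : c 1 = c 2 := sub_eq_zero.1 ((mul_eq_zero.1 e1).resolve_left hβ)
  refine ⟨c 2, fun w hw => ?_⟩
  obtain ⟨a, b, rfl⟩ := mem_of_indep_pair hW (hz 0) (hz 1) h01 hw
  rw [map_add, map_smul, map_smul, hc, hc, e0', e1']
  module

theorem IsLine.exists_ne_of_refl [IsAlgClosed k] (hq : SmoothPencil q) (hV : finrank k V = 5)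
    {Q : Submodule k V} (hQ : IsLine q Q) {R R' : Fin 2 → k} (hR : R 0 * R' 1 - R 1 * R' 0 ≠ 0) {v : V}
    (hv : IsVert q R v) : ∃ z ∈ Q, polar (pencil q R') z v ≠ 0 := by
  by_contra! hcon
  apply hQ.refl_ne hq hV hR hv
  ext u
  constructor
  · rintro ⟨z, hz, rfl⟩
    rw [refl_apply, hcon z hz, zero_div, zero_smul, sub_zero]
    exact hz
  · intro hu
    exact ⟨u, hu, by rw [refl_apply, hcon u hu, zero_div, zero_smul, sub_zero]⟩

/-- Points where a line meets its reflections. -/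
theorem NormalForm.exists_meeting_point {Q : Submodule k V} (N : NormalForm q Q) (hq : SmoothPencil q)
    (hQ : IsLine q Q) {R R' : Fin 2 → k} (hR : R 0 * R' 1 - R 1 * R' 0 ≠ 0) {v : V} (hv : IsVert q R v) :
    ∃ z ∈ Q, z ≠ 0 ∧ z ∈ Q.map (refl q R' v) ∧ N.U z * R 1 = N.W z * R 0 := by
  obtain ⟨z, hz, hz0, hzv, hz2⟩ := hQ.exists_mem_refl (q := q) (R' := R') (v := v)
  refine ⟨z, hz, hz0, hz2, ?_⟩
  have hR0 : R ≠ 0 := by rintro rfl; simp at hR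
  obtain ⟨a, ha, h0, h1, h2, -⟩ := N.exists_of_isVert hq hQ hR0 hv
  have hzR := hv.2.2 z
  rw [polar_comm] at hzR
  have e : ∀ i, polar (q i) z v = 0 := by
    intro i
    rw [polar_pencil] at hzv hzR
    apply (mul_eq_zero.1 (_ : (R 0 * R' 1 - R 1 * R' 0) * _ = 0)).resolve_left hR
    fin_cases i
    · simp only [Fin.zero_eta]; linear_combination R' 1 * hzR - R 1 * hzv
    · simp only [Fin.mk_one]; linear_combination R 0 * hzv - R' 0 * hzR
  have e0 := e 0
  have e1 := e 1
  have hy := (N.mem z).1 hz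
  rw [N.polar0] at e0
  rw [N.polar1] at e1
  simp only [hy, h0, h1, h2] at e0 e1
  by_cases h : R 1 = 0
  · have hR00 : R 0 ≠ 0 := by
      intro h'
      apply hR0
      funext i
      fin_cases i
      exacts [h', h]
    rw [h] at e1 ⊢
    apply mul_left_cancel₀ (mul_ne_zero ha hR00)
    linear_combination -e1
  · apply mul_left_cancel₀ (mul_ne_zero ha h)
    linear_combination e0

variable [IsAlgClosed k]

theorem IsLine.scalar (hq : SmoothPencil q) (hV : finrank k V = 5) {B : V →ₗ[k] V}
    (hB : ∀ W, IsLine q W → ∀ z ∈ W, B z ∈ W) {Q : Submodule k V} (hQ : IsLine q Q) :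
    ∃ a : k, ∀ w ∈ Q, B w = a • w := by
  obtain ⟨N⟩ := exists_normalForm hq hV hQ
  obtain ⟨R, hR0, hRv, hRR, -⟩ := N.exists_five hq hQ
  choose v hv using hRv
  choose R' hR' using fun i => exists_independent (hR0 i)
  choose z hz hz0 hz' hzR using fun i => N.exists_meeting_point hq hQ (hR' i) (hv i)
  refine scalar_of_three hQ.1 (z := fun i => z (Fin.castLE (by norm_num) i)) (fun i => hz _) (fun i j hij => ?_) (fun i => ?_)
  · refine indep_of_disjoint (W := span k {z (Fin.castLE (by norm_num) i)}) (mem_span_singleton_self _)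
      (hz0 _) fun h => ?_
    obtain ⟨a, ha⟩ := Submodule.mem_span_singleton.1 h
    have hij' : (Fin.castLE (by norm_num) i : Fin 5) ≠ Fin.castLE (by norm_num) j := fun h => hij (Fin.castLE_injective _ h)
    have e1 := hzR (Fin.castLE (by norm_num) i)
    have e2 := hzR (Fin.castLE (by norm_num) j)
    have h3 := hRR _ _ hij'
    have h0 := hz0 (Fin.castLE (by norm_num) j)
    have h1 := (N.mem _).1 (hz (Fin.castLE (by norm_num) i))
    generalize (Fin.castLE _ i : Fin 5) = i at *
    generalize (Fin.castLE _ j : Fin 5) = j at *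
    have ha0 : a ≠ 0 := by rintro rfl; rw [zero_smul] at ha; exact h0 ha.symm
    rw [← ha, map_smul, map_smul, smul_eq_mul, smul_eq_mul, mul_assoc, mul_assoc] at e2
    have e2' := mul_left_cancel₀ ha0 e2
    apply hz0 i
    have hU : N.U (z i) = 0 := by
      apply (mul_eq_zero.1 (_ : (R i 0 * R j 1 - R i 1 * R j 0) * _ = 0)).resolve_left h3
      linear_combination R i 0 * e2' - R j 0 * e1
    have hW : N.W (z i) = 0 := by
      apply (mul_eq_zero.1 (_ : (R i 0 * R j 1 - R i 1 * R j 0) * _ = 0)).resolve_left h3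
      linear_combination R i 1 * e2' - R j 1 * e1
    exact N.inj _ h1 hU hW
  · have hn := (hv (Fin.castLE (by norm_num) i)).ne_zero hq (hR' _)
    have hL := hQ.refl (hR' _) (hv (Fin.castLE (by norm_num) i)) hn
    exact exists_eigenvalue_of_two hQ.1 hL.1 (hQ.refl_ne hq hV (hR' _) (hv _)) (hB Q hQ) (hB _ hL) (hz0 _) (hz _) (hz' _)

theorem quadratic_eq_zero {R : Fin 3 → Fin 2 → k}
    (hR : ∀ i j, i ≠ j → R i 0 * R j 1 - R i 1 * R j 0 ≠ 0) {α β γ : k}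
    (h : ∀ i, α * R i 0 ^ 2 + β * (R i 0 * R i 1) + γ * R i 1 ^ 2 = 0) : α = 0 ∧ β = 0 ∧ γ = 0 := by
  by_contra hne
  obtain ⟨s, t, m, n, hst, hmn, h1, h2, h3⟩ := exists_factor α β γ hne
  have hfac : ∀ i, s * R i 0 + t * R i 1 = 0 ∨ m * R i 0 + n * R i 1 = 0 := by
    intro i
    rw [← mul_eq_zero, ← h i, h1, h2, h3]
    ring
  have key : ∀ s t : k, ¬ (s = 0 ∧ t = 0) → ∀ i j, i ≠ j → s * R i 0 + t * R i 1 = 0 → s * R j 0 + t * R j 1 = 0 → False := by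
    intro s t hst i j hij hi hj
    apply hst
    constructor
    · apply (mul_eq_zero.1 (_ : (R i 0 * R j 1 - R i 1 * R j 0) * _ = 0)).resolve_left (hR i j hij)
      linear_combination R j 1 * hi - R i 1 * hj
    · apply (mul_eq_zero.1 (_ : (R i 0 * R j 1 - R i 1 * R j 0) * _ = 0)).resolve_left (hR i j hij)
      linear_combination R i 0 * hj - R j 0 * hi
  rcases hfac 0 with h0 | h0 <;> rcases hfac 1 with h1 | h1 <;> rcases hfac 2 with h2 | h2
  · exact key s t hst 0 1 (by decide) h0 h1
  · exact key s t hst 0 1 (by decide) h0 h1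
  · exact key s t hst 0 2 (by decide) h0 h2
  · exact key m n hmn 1 2 (by decide) h1 h2
  · exact key s t hst 1 2 (by decide) h1 h2
  · exact key m n hmn 0 2 (by decide) h0 h2
  · exact key m n hmn 0 1 (by decide) h0 h1
  · exact key m n hmn 0 1 (by decide) h0 h1

/-- A linear map that preserves all lines on a quartic del Pezzo surface is scalar. -/
theorem SmoothPencil.scalar (hq : SmoothPencil q) (hV : finrank k V = 5) {B : V →ₗ[k] V}
    (hB : ∀ W, IsLine q W → ∀ z ∈ W, B z ∈ W) {Q : Submodule k V} (hQ : IsLine q Q) :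
    ∃ a : k, ∀ w, B w = a • w := by
  obtain ⟨N⟩ := exists_normalForm hq hV hQ
  obtain ⟨R, hR0, hRv, hRR, -⟩ := N.exists_five hq hQ
  choose v hv using hRv
  obtain ⟨a, ha⟩ := hQ.scalar hq hV hB
  have hBv : ∀ i, B (v i) = a • v i := by
    intro i
    obtain ⟨R', hR'⟩ := exists_independent (hR0 i)
    have hn := (hv i).ne_zero hq hR'
    obtain ⟨b, hb⟩ := (hQ.refl hR' (hv i) hn).scalar hq hV hB
    obtain ⟨z, hz, hz0, hz', -⟩ := N.exists_meeting_point hq hQ hR' (hv i)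
    have hab : a = b := by
      have := (ha z hz).symm.trans (hb z hz')
      exact smul_left_injective k hz0 this
    obtain ⟨x, hx, hxv⟩ := hQ.exists_ne_of_refl hq hV hR' (hv i)
    have h1 := hb _ (mem_map_of_mem hx)
    rw [refl_apply, map_sub, map_smul, ha x hx, ← hab, smul_sub, sub_right_inj, smul_comm] at h1
    exact smul_right_injective V (div_ne_zero hxv hn) h1
  refine ⟨a, fun w => ?_⟩
  let D := B - a • LinearMap.id
  suffices h : LinearMap.ker D = ⊤ by
    have : D w = 0 := by rw [← LinearMap.mem_ker, h]; trivial
    simpa [D, sub_eq_zero] using this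
  by_contra hne
  obtain ⟨g, hg0, hg⟩ := Submodule.exists_le_ker_of_lt_top _ (lt_top_iff_ne_top.2 hne)
  have hgQ : ∀ z ∈ Q, g z = 0 := fun z hz => hg (by
    rw [LinearMap.mem_ker]; simp [D, ha z hz])
  have hgv : ∀ i, g (v i) = 0 := fun i => hg (by
    rw [LinearMap.mem_ker]; simp [D, hBv i])
  obtain ⟨e₀, h0, -, -⟩ := N.surj ![1, 0, 0] 0 0
  obtain ⟨e₁, h1, -, -⟩ := N.surj ![0, 1, 0] 0 0
  obtain ⟨e₂, h2, -, -⟩ := N.surj ![0, 0, 1] 0 0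
  have hgy : ∀ z, g z = N.y 0 z * g e₀ + N.y 1 z * g e₁ + N.y 2 z * g e₂ := by
    intro z
    have hz : z - (N.y 0 z • e₀ + N.y 1 z • e₁ + N.y 2 z • e₂) ∈ Q := by
      rw [N.mem]
      intro i
      simp only [map_sub, map_add, map_smul, h0, h1, h2, smul_eq_mul]
      fin_cases i <;> simp
    have := hgQ _ hz
    rw [map_sub, sub_eq_zero] at this
    rw [this]; simp
  have hq0 := quadratic_eq_zero (R := fun i : Fin 3 => R (Fin.castLE (by norm_num) i))
    (fun i j hij => hRR _ _ fun h => hij (Fin.castLE_injective _ h)) (α := g e₂) (β := -g e₁) (γ := g e₀) (fun i => by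
      obtain ⟨b, hb, y0, y1, y2, -⟩ := N.exists_of_isVert hq hQ (hR0 (Fin.castLE (by norm_num) i)) (hv _)
      have := hgv (Fin.castLE (by norm_num) i)
      rw [hgy, y0, y1, y2] at this
      apply mul_left_cancel₀ hb
      linear_combination this)
  apply hg0
  ext z
  rw [hgy, hq0.1, neg_eq_zero.1 hq0.2.1, hq0.2.2]
  simp

/-- An infinitesimal automorphism of a quartic del Pezzo surface is scalar. -/
theorem SmoothPencil.scalar_of_derivation (hq : SmoothPencil q) (hV : finrank k V = 5) {B : V →ₗ[k] V} {a : k}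
    (hB : ∀ i z, polar (q i) z (B z) = a * q i z) {Q : Submodule k V} (hQ : IsLine q Q) :
    ∃ b : k, ∀ w, B w = b • w := by
  refine hq.scalar hV (fun W hW => ?_) hQ
  obtain ⟨N⟩ := exists_normalForm hq hV hW
  obtain ⟨u, u1, u2, u3⟩ := N.surj 0 1 0
  obtain ⟨v, v1, v2, v3⟩ := N.surj 0 0 1
  have huW : u ∈ W := (N.mem u).2 u1
  have hvW : v ∈ W := (N.mem v).2 v1
  have p0u : ∀ z, polar (q 0) u z = N.y 0 z := fun z => by
    rw [N.polar0, u1, u1, u1, u2, u3]; simp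
  have p1u : ∀ z, polar (q 1) u z = N.y 1 z := fun z => by
    rw [N.polar1, u1, u1, u1, u2, u3]; simp
  have p0v : ∀ z, polar (q 0) v z = N.y 1 z := fun z => by
    rw [N.polar0, v1, v1, v1, v2, v3]; simp
  have p1v : ∀ z, polar (q 1) v z = N.y 2 z := fun z => by
    rw [N.polar1, v1, v1, v1, v2, v3]; simp
  have hBu := fun i => hB i u
  have hBv := fun i => hB i v
  have hBuv := fun i => hB i (u + v)
  simp only [hW.2 u huW, hW.2 v hvW, hW.2 _ (W.add_mem huW hvW), mul_zero, map_add, polar_add_left,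
    polar_add_right] at hBu hBv hBuv
  have a0 := hBu 0
  have a1 := hBu 1
  have b0 := hBv 0
  have b1 := hBv 1
  have c0 := hBuv 0
  have c1 := hBuv 1
  simp only [p0u, p1u, p0v, p1v] at a0 a1 b0 b1 c0 c1
  have d0 : N.y 0 (B v) = 0 := by linear_combination c0 - a0 - b0 - a1
  have d1 : N.y 2 (B u) = 0 := by linear_combination c1 - a1 - b1 - b0
  have hBuW : B u ∈ W := by
    rw [N.mem]; intro i; fin_cases i; exacts [a0, a1, d1]
  have hBvW : B v ∈ W := by
    rw [N.mem]; intro i; fin_cases i; exacts [d0, b0, b1]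
  intro z hz
  have : z = N.U z • u + N.W z • v := by
    apply N.ext_of
    · intro i
      rw [map_add, map_smul, map_smul, u1, v1, (N.mem z).1 hz i]; simp
    · rw [map_add, map_smul, map_smul, u2, v2]; simp
    · rw [map_add, map_smul, map_smul, u3, v3]; simp
  rw [this, map_add, map_smul, map_smul]
  exact W.add_mem (W.smul_mem _ hBuW) (W.smul_mem _ hBvW)

end Scalar

section XLevel

variable {K L : Type*} [Field K] [Field L] [Algebra K L] [IsAlgClosed L]
  {S : QuarticDelPezzo K L} {Y : CubicSurface K L} {B : BlowUp S Y} {φ : PSpace L 4 → PSpace L 2}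

theorem finrank_space : finrank L (Fin 5 → L) = 5 := by simp

theorem QuarticDelPezzo.isLine_iff (S : QuarticDelPezzo K L) (W : Submodule L (Fin 5 → L)) :
    W ∈ linesOn S.pts ↔ IsLine S.qf W := by
  refine and_congr_right fun _ => ⟨fun h v hv => ?_, fun h x hx => ?_⟩
  · rcases eq_or_ne v 0 with rfl | h0
    · intro i; exact QuadraticMap.map_zero _
    · exact (S.mk_mem_pts v h0).1 (h ((mem_ptsOf_mk v h0).2 hv))
  · have := (S.mk_mem_pts x.rep x.rep_nonzero).2 (h _ hx)
    rwa [x.mk_rep] at this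

namespace BlowUp.Model

variable (M : B.Model φ)

/-- The coordinates of the center. -/
abbrev pv : Fin 5 → L := baseVec L M.p

/-- The projection from the center. -/
noncomputable abbrev proj : (Fin 5 → L) →ₗ[L] (Fin 4 → L) := matLin L M.P

theorem qf_pv (i : Fin 2) : S.qf i M.pv = 0 := by
  have h := B.center_mem
  rw [M.center] at h
  exact (S.mk_mem_pts _ M.p_ne).1 h i

theorem proj_pv : M.proj M.pv = 0 := (M.ker _).2 ⟨1, (one_smul _ _).symm⟩

theorem exists_proj_eq (y : Fin 4 → L) : ∃ v, M.proj v = y :=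
  ⟨matLin L M.l y, by rw [proj, ← matLin_mul, M.Pl, matLin_one]⟩

theorem noLineThrough : NoLineThrough S.qf M.pv := by
  intro y hy hp
  by_contra hne
  have hπ : M.proj y ≠ 0 := fun h => hne ((M.ker y).1 h)
  have hy0 : y ≠ 0 := by rintro rfl; exact hπ (map_zero _)
  have h1 := (M.map y hy0 hπ hy).2
  have h2 := ((M.exc y hπ).1 hp).2
  rw [h1, M.center] at h2
  obtain ⟨a, -, ha⟩ := exists_smul_of_mk_eq_mk h2
  exact hne ⟨a, ha⟩

theorem mem_pts_iff (z : Fin 5 → L) (hz : M.proj z ≠ 0) : pmk L (M.proj z) hz ∈ Y.pts ↔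
    polar (S.qf 0) M.pv z * S.qf 1 z = polar (S.qf 1) M.pv z * S.qf 0 z := by
  have hadd : ∀ i, ∀ a : L, S.qf i (z + a • M.pv) = S.qf i z + a * polar (S.qf i) M.pv z := by
    intro i a
    rw [QuadraticMap.map_add (⇑(S.qf i)), QuadraticMap.map_smul, M.qf_pv, polar_smul_right,
      polar_comm, smul_eq_mul, smul_eq_mul, mul_zero, add_zero]
  have hpadd : ∀ i, ∀ a : L, polar (S.qf i) M.pv (z + a • M.pv) = polar (S.qf i) M.pv z := by
    intro i a
    rw [polar_add_right, polar_smul_right, polar_self, M.qf_pv]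
    simp
  have hπ : ∀ a : L, M.proj (z + a • M.pv) = M.proj z := by
    intro a
    rw [map_add, map_smul, M.proj_pv, smul_zero, add_zero]
  constructor
  · intro h
    by_cases hc : B.f (pmk L (M.proj z) hz) = B.center
    · have := (M.exc z hz).2 ⟨h, hc⟩
      rw [this, this]; ring
    · obtain ⟨v, hv, hvz⟩ := M.lift _ hz h hc
      obtain ⟨a, ha⟩ := (M.ker (z - v)).1 (by rw [map_sub, hvz, sub_self])
      have hv' : v = z + (-a) • M.pv := by rw [neg_smul, ← sub_eq_add_neg, ← ha, sub_sub_cancel]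
      have h0 := hv 0
      have h1 := hv 1
      rw [hv', hadd] at h0 h1
      linear_combination polar (S.qf 0) M.pv z * h1 - polar (S.qf 1) M.pv z * h0
  · intro h
    by_cases hx : ∀ i, polar (S.qf i) M.pv z = 0
    · exact ((M.exc z hz).1 hx).1
    · obtain ⟨a, ha⟩ : ∃ a : L, ∀ i, S.qf i (z + a • M.pv) = 0 := by
        push Not at hx
        obtain ⟨i, hi⟩ := hx
        refine ⟨-S.qf i z / polar (S.qf i) M.pv z, fun j => ?_⟩
        rw [hadd]
        fin_cases i <;> fin_cases j <;> simp only [Fin.zero_eta, Fin.mk_one] at hi ⊢ <;> field_simp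
        · ring
        · linear_combination h
        · linear_combination -h
        · ring
      have hπ' : M.proj (z + a • M.pv) ≠ 0 := by rwa [hπ]
      have hne : z + a • M.pv ≠ 0 := by intro h0; rw [h0] at hπ'; exact hπ' (map_zero _)
      have := (M.map _ hne hπ' ha).1
      simpa only [hπ] using this

variable {R : Fin 2 → L}

/-- A component of the degenerate fiber that corresponds to a singular quadric. -/
noncomputable def comp (s : Split S.qf R M.pv) : Submodule L (Fin 4 → L) :=
  (LinearMap.ker s.x ⊓ LinearMap.ker s.l).map M.proj

theorem proj_mem_comp (s : Split S.qf R M.pv) (z : Fin 5 → L) : M.proj z ∈ M.comp s ↔ s.x z = 0 ∧ s.l z = 0 := by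
  constructor
  · rintro ⟨z', ⟨h1, h2⟩, h⟩
    obtain ⟨a, ha⟩ := (M.ker (z - z')).1 (by rw [map_sub]; exact sub_eq_zero.2 h.symm)
    have hz : z = z' + a • M.pv := by rw [← ha]; abel
    have h1' : s.x z' = 0 := h1
    have h2' : s.l z' = 0 := h2
    rw [hz, map_add, map_add, map_smul, map_smul, s.xp, s.lp, h1', h2']
    simp
  · rintro ⟨h1, h2⟩
    exact ⟨z, ⟨h1, h2⟩, rfl⟩

theorem exists_comp_basis (s : Split S.qf R M.pv) : ∃ e, s.x e = 0 ∧ s.l e = 0 ∧ s.l' e = 1 ∧ s.w e = 0 ∧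
    M.comp s = span L (Set.range ![M.proj s.v, M.proj e]) ∧
    LinearIndependent L ![M.proj s.v, M.proj e] := by
  obtain ⟨e, e1, e2, e3, e4⟩ := s.surj 0 0 1 0
  refine ⟨e, e1, e2, e3, e4, ?_, ?_⟩
  · apply le_antisymm
    · rintro _ ⟨z, ⟨h1, h2⟩, rfl⟩
      have h1' : s.x z = 0 := h1
      have h2' : s.l z = 0 := h2
      obtain ⟨a, ha⟩ := s.ker (z - s.l' z • e - s.w z • M.pv) (by simp [h1', e1, s.xp]) (by simp [h2', e2, s.lp])
        (by simp [e3, s.l'p]) (by simp [e4, s.wp])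
      refine (mem_span_range_iff_exists_fun L).2 ⟨![a, s.l' z], ?_⟩
      have hz : z = a • s.v + s.l' z • e + s.w z • M.pv := by rw [← ha]; abel
      simp only [sum_univ_two, cons_val_zero, cons_val_one]
      conv_rhs => rw [hz]
      rw [map_add, map_add, map_smul, map_smul, map_smul, M.proj_pv, smul_zero, add_zero]
    · rw [Submodule.span_le]
      rintro _ ⟨i, rfl⟩
      fin_cases i
      · exact (M.proj_mem_comp s _).2 ⟨s.xv, s.lv⟩
      · exact (M.proj_mem_comp s _).2 ⟨e1, e2⟩
  · rw [LinearIndependent.pair_iff]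
    intro a b hab
    obtain ⟨c, hc⟩ := (M.ker (a • s.v + b • e)).1 (by rw [map_add, map_smul, map_smul, hab])
    have h1 := congrArg s.l' hc
    simp only [map_add, map_smul, s.l'v, e3, s.l'p, smul_eq_mul, mul_zero, mul_one, zero_add] at h1
    have h2 := congrArg s.w hc
    simp only [map_add, map_smul, s.wv, e4, s.wp, smul_eq_mul, mul_zero, mul_one, add_zero] at h2
    rw [h1, ← h2, zero_smul, zero_smul, add_zero] at hc
    exact ⟨(smul_eq_zero.1 hc).resolve_right s.vert.1, h1⟩

theorem finrank_comp (s : Split S.qf R M.pv) : finrank L (M.comp s) = 2 := by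
  obtain ⟨e, -, -, -, -, h, hli⟩ := M.exists_comp_basis s
  rw [h, finrank_span_eq_card hli]; rfl

theorem comp_not_le (s : Split S.qf R M.pv) : ¬ M.comp s ≤ M.comp s.swap := by
  intro h
  obtain ⟨e, e1, e2, e3, -⟩ := s.surj 0 0 1 0
  have := (M.proj_mem_comp s.swap e).1 (h ((M.proj_mem_comp s e).2 ⟨e1, e2⟩))
  have h2 : s.l' e = 0 := this.2
  rw [e3] at h2
  exact one_ne_zero h2

theorem comp_ne (s : Split S.qf R M.pv) : M.comp s ≠ M.comp s.swap := fun h => M.comp_not_le s h.le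

theorem N_ne_zero (hR : R ≠ 0) : matLin L M.N R ≠ 0 := by
  intro h
  apply hR
  rw [← matLin_one (K := K) R, ← M.N'N, matLin_mul, h, map_zero]

theorem fiber_eq (hR : R ≠ 0) (s : Split S.qf R M.pv) :
    {x ∈ Y.pts | φ x = pmk L (matLin L M.N R) (M.N_ne_zero hR)} =
      ptsOf (M.comp s) ∪ ptsOf (M.comp s.swap) := by
  ext x
  induction x using pmk_ind with
  | h y hy =>
    obtain ⟨z, rfl⟩ := M.exists_proj_eq y
    rw [Set.mem_union, mem_ptsOf_mk, mem_ptsOf_mk, M.proj_mem_comp, M.proj_mem_comp]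
    refine (M.fiber z hy R (M.N_ne_zero hR)).trans ?_
    rw [s.polar_p, s.form]
    change _ ↔ s.x z = 0 ∧ s.l z = 0 ∨ s.x z = 0 ∧ s.l' z = 0
    rw [← and_or_left, ← mul_eq_zero]
    refine and_congr_right fun h => ?_
    rw [h, zero_mul, zero_sub, neg_eq_zero]

theorem comp_mem_linesOn (hR : R ≠ 0) (s : Split S.qf R M.pv) : M.comp s ∈ linesOn Y.pts := by
  refine ⟨M.finrank_comp s, fun x hx => ?_⟩
  have : x ∈ ptsOf (M.comp s) ∪ ptsOf (M.comp s.swap) := Or.inl hx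
  rw [← M.fiber_eq hR s] at this
  exact this.1

theorem φ_of_mem_comp (hR : R ≠ 0) (s : Split S.qf R M.pv) {x : PSpace L 4} (hx : x ∈ ptsOf (M.comp s)) :
    φ x = pmk L (matLin L M.N R) (M.N_ne_zero hR) := by
  have : x ∈ ptsOf (M.comp s) ∪ ptsOf (M.comp s.swap) := Or.inl hx
  rw [← M.fiber_eq hR s] at this
  exact this.2

/-- A totally isotropic subspace of dimension three contains a vertex. -/
theorem _root_.DelPezzo.exists_isVert_of_isotropic {k V : Type*} [Field k] [AddCommGroup V] [Module k V] [FiniteDimensional k V]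
    {q : Fin 2 → QuadraticForm k V} (hV : finrank k V = 5) {R : Fin 2 → k} {W : Submodule k V}
    (hW : 3 ≤ finrank k W) (h : ∀ w ∈ W, pencil q R w = 0) : ∃ v, IsVert q R v := by
  obtain ⟨c, hc⟩ := exists_complement (n := 3) (m := 2) hW hV
  obtain ⟨v, hv, hv0, hvc⟩ := exists_ne_zero_mem_ker (W := W)
    (LinearMap.pi fun i : Fin 2 => polarLin (pencil q R) (c i)) (by omega)
  refine ⟨v, hv0, h v hv, fun u => ?_⟩
  obtain ⟨w, hw, a, rfl⟩ := hc u
  have hvc' : ∀ i, polar (pencil q R) v (c i) = 0 := fun i => by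
    rw [polar_comm]; exact congrFun hvc i
  rw [sum_univ_two, polar_add_right, polar_add_right, polar_smul_right,
    polar_smul_right, hvc', hvc', polar_eq_zero_of_isotropic h hv hw]
  simp

theorem isDegenerate_iff (hR : R ≠ 0) :
    Y.IsDegenerate φ (pmk L (matLin L M.N R) (M.N_ne_zero hR)) ↔ ∃ v, IsVert S.qf R v := by
  constructor
  · rintro ⟨C, hC, hCφ⟩
    have hz : ∀ z, M.proj z ∈ C → polar (pencil S.qf R) M.pv z = 0 ∧ pencil S.qf R z = 0 := by
      intro z hz
      by_cases h0 : M.proj z = 0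
      · obtain ⟨a, rfl⟩ := (M.ker z).1 h0
        have : pencil S.qf R M.pv = 0 := pencil_eq_zero M.qf_pv R
        rw [polar_smul_right, polar_self, QuadraticMap.map_smul, this]
        simp
      · refine (M.fiber z h0 R (M.N_ne_zero hR)).1 ?_
        have : pmk L (M.proj z) h0 ∈ ptsOf C := (mem_ptsOf_mk _ h0).2 hz
        exact ⟨hC.2 this, hCφ _ this⟩
    refine exists_isVert_of_isotropic finrank_space (W := C.comap M.proj) ?_ (fun w hw => (hz w hw).2)
    have hsurj : LinearMap.range M.proj = ⊤ := LinearMap.range_eq_top.2 fun y => M.exists_proj_eq y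
    obtain ⟨a, ha, b, hb, hab⟩ := exists_pair_of_finrank (show 2 ≤ finrank L C by rw [hC.1])
    obtain ⟨a', rfl⟩ := M.exists_proj_eq a
    obtain ⟨b', rfl⟩ := M.exists_proj_eq b
    have hli : LinearIndependent L ![M.pv, a', b'] := by
      rw [Fintype.linearIndependent_iff]
      intro g hg
      simp only [sum_univ_three, cons_val] at hg
      have h1 := congrArg M.proj hg
      rw [map_add, map_add, map_smul, map_smul, map_smul, M.proj_pv, smul_zero, zero_add, map_zero] at h1
      obtain ⟨g1, g2⟩ := hab _ _ h1
      rw [g1, g2, zero_smul, zero_smul, add_zero, add_zero] at hg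
      have g0 := (smul_eq_zero.1 hg).resolve_right M.p_ne
      intro i
      fin_cases i <;> assumption
    have h3 : finrank L (span L (Set.range ![M.pv, a', b'])) = 3 := by
      rw [finrank_span_eq_card hli]; rfl
    rw [← h3]
    apply Submodule.finrank_mono
    rw [Submodule.span_le]
    rintro _ ⟨i, rfl⟩
    fin_cases i
    · change M.proj M.pv ∈ C
      rw [M.proj_pv]; exact C.zero_mem
    · exact ha
    · exact hb
  · rintro ⟨v, hv⟩
    obtain ⟨s⟩ := exists_split S.smoothPencil finrank_space hR hv M.p_ne M.qf_pv
    exact ⟨M.comp s, M.comp_mem_linesOn hR s, fun x hx => M.φ_of_mem_comp hR s hx⟩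

/-- The proper transform of a line. -/
theorem proper_transform {W : Submodule L (Fin 5 → L)} (hW : IsLine S.qf W) :
    W.map M.proj ∈ linesOn Y.pts ∧ B.f '' ptsOf (W.map M.proj) = ptsOf W := by
  have hp := M.noLineThrough.not_mem hW
  have hker : ∀ w ∈ W, M.proj w = 0 → w = 0 := by
    intro w hw h0
    obtain ⟨a, rfl⟩ := (M.ker w).1 h0
    by_cases ha : a = 0
    · rw [ha, zero_smul]
    · exfalso
      apply hp
      have := W.smul_mem a⁻¹ hw
      rwa [smul_smul, inv_mul_cancel₀ ha, one_smul] at this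
  have hmk : ∀ w (hw : w ∈ W) (h0 : w ≠ 0), ∃ hπ : M.proj w ≠ 0,
      pmk L (M.proj w) hπ ∈ Y.pts ∧ B.f (pmk L (M.proj w) hπ) = pmk L w h0 :=
    fun w hw h0 => ⟨fun h => h0 (hker w hw h), M.map w h0 _ (hW.2 w hw)⟩
  refine ⟨⟨?_, fun x hx => ?_⟩, ?_⟩
  · have hinj : Function.Injective (M.proj.domRestrict W) := by
      rw [← LinearMap.ker_eq_bot, LinearMap.ker_eq_bot']
      rintro ⟨w, hw⟩ h
      exact Subtype.ext (hker w hw h)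
    have := LinearMap.finrank_range_of_inj hinj
    rwa [LinearMap.range_domRestrict, hW.1] at this
  · induction x using pmk_ind with
    | h y hy =>
      obtain ⟨w, hw, rfl⟩ := (mem_ptsOf_mk y hy).1 hx
      exact (hmk w hw (by rintro rfl; exact hy (map_zero _))).2.1
  · ext x
    induction x using pmk_ind with
    | h w h0 =>
      constructor
      · rintro ⟨x, hx, hxw⟩
        induction x using pmk_ind with
        | h y hy =>
          obtain ⟨w', hw', rfl⟩ := (mem_ptsOf_mk y hy).1 hx
          have h0' : w' ≠ 0 := by rintro rfl; exact hy (map_zero _)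
          rw [← hxw, (hmk w' hw' h0').2.2]
          exact (mem_ptsOf_mk w' h0').2 hw'
      · intro hx
        have hw := (mem_ptsOf_mk w h0).1 hx
        obtain ⟨hπ, -, h2⟩ := hmk w hw h0
        exact ⟨_, (mem_ptsOf_mk _ hπ).2 (mem_map_of_mem hw), h2⟩

theorem isThirdLine (hR : R ≠ 0) (s : Split S.qf R M.pv) {R' : Fin 2 → L} (hR' : R 0 * R' 1 - R 1 * R' 0 ≠ 0)
    {Q N : S.Line} (hN : N.1 = Q.1.map (refl S.qf R' s.v)) (hQ : s.Meets Q.1) :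
    B.IsThirdLine Q N ⟨M.comp s, M.comp_mem_linesOn hR s⟩ := by
  have hQl := (S.isLine_iff _).1 Q.2
  have hNl := (S.isLine_iff _).1 N.2
  obtain ⟨hQ1, hQ2⟩ := M.proper_transform hQl
  obtain ⟨hN1, hN2⟩ := M.proper_transform hNl
  obtain ⟨κ, hκ⟩ := s.coord hR M.noLineThrough hQl hQ
  have hv' := s.vert.ne_zero S.smoothPencil hR'
  have hvQ := s.vert.not_mem_line S.smoothPencil hR hQl
  have hpQ : ∀ z ∈ Q.1 ⊔ span L {s.v}, M.proj z = 0 → z = 0 := by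
    intro z hz h0
    obtain ⟨a, rfl⟩ := (M.ker z).1 h0
    obtain ⟨y, hy, u, hu, h⟩ := Submodule.mem_sup.1 hz
    obtain ⟨b, rfl⟩ := Submodule.mem_span_singleton.1 hu
    have h1 := congrArg s.l' h
    have h2 := congrArg s.w h
    simp only [map_add, map_smul, s.l'v, s.wv, s.l'p, s.wp, smul_eq_mul, mul_zero, add_zero, mul_one] at h1 h2
    rw [← h2, (hκ y hy).2, h1, mul_zero, zero_smul]
  refine ⟨⟨_, hQ1⟩, ⟨_, hN1⟩, (Q.1 ⊔ span L {s.v}).map M.proj, hQ2, hN2, ?_, ?_⟩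
  · have hinj : Function.Injective (M.proj.domRestrict (Q.1 ⊔ span L {s.v})) := by
      rw [← LinearMap.ker_eq_bot, LinearMap.ker_eq_bot']
      rintro ⟨w, hw⟩ h
      exact Subtype.ext (hpQ w hw h)
    have := LinearMap.finrank_range_of_inj hinj
    rwa [LinearMap.range_domRestrict, finrank_sup_span_singleton hvQ, hQl.1] at this
  · have hcub : ∀ y ∈ Q.1, ∀ a : L, ∀ h0 : M.proj (y + a • s.v) ≠ 0,
        pmk L (M.proj (y + a • s.v)) h0 ∈ Y.pts ↔
        s.x y = 0 ∨ a = 0 ∨ a = -(polar (pencil S.qf R') y s.v / pencil S.qf R' s.v) := by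
      intro y hy a h0
      rw [M.mem_pts_iff]
      have e1 : pencil S.qf R (y + a • s.v) = 0 := by
        rw [s.form]
        simp only [map_add, map_smul, s.xv, s.lv, s.l'v, s.wv, (hκ y hy).1, (hκ y hy).2]
        simp only [smul_eq_mul]; ring
      have e2 : pencil S.qf R' (y + a • s.v) = a * (polar (pencil S.qf R') y s.v + a * pencil S.qf R' s.v) := by
        have := map_comb (pencil S.qf R') 1 a y s.v
        rw [one_smul] at this
        rw [this, pencil_eq_zero (hQl.2 y hy) R']; ring
      have e3 : polar (pencil S.qf R) M.pv (y + a • s.v) = s.x y := by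
        rw [s.polar_p, map_add, map_smul, s.xv, smul_zero, add_zero]
      have e4 : polar (pencil S.qf R) M.pv (y + a • s.v) * pencil S.qf R' (y + a • s.v) -
          polar (pencil S.qf R') M.pv (y + a • s.v) * pencil S.qf R (y + a • s.v) =
          (R 0 * R' 1 - R 1 * R' 0) * (polar (S.qf 0) M.pv (y + a • s.v) * S.qf 1 (y + a • s.v) -
            polar (S.qf 1) M.pv (y + a • s.v) * S.qf 0 (y + a • s.v)) := by
        simp only [polar_pencil, pencil_apply]; ring
      rw [e1, e2, e3, mul_zero, sub_zero] at e4
      rw [← sub_eq_zero (a := _ * _), ← mul_right_inj' hR', mul_zero, ← e4, mul_eq_zero, mul_eq_zero]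
      refine or_congr_right (or_congr_right ?_)
      rw [← neg_div, eq_div_iff hv', eq_neg_iff_add_eq_zero, add_comm]
    ext x
    induction x using pmk_ind with
    | h y0 hy0 =>
      rw [Set.mem_inter_iff, Set.mem_union, Set.mem_union, mem_ptsOf_mk, mem_ptsOf_mk, mem_ptsOf_mk, mem_ptsOf_mk]
      constructor
      · rintro ⟨⟨z, hz, rfl⟩, hY⟩
        obtain ⟨y, hy, u, hu, rfl⟩ := Submodule.mem_sup.1 hz
        obtain ⟨a, rfl⟩ := Submodule.mem_span_singleton.1 hu
        rcases (hcub y hy a hy0).1 hY with h | h | h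
        · right
          rw [M.proj_mem_comp]
          simp only [map_add, map_smul, s.xv, s.lv, h, (hκ y hy).1, smul_zero, mul_zero, add_zero, and_self]
        · left; left
          rw [h, zero_smul, add_zero]
          exact mem_map_of_mem hy
        · left; right
          refine mem_map_of_mem ?_
          rw [hN]
          refine ⟨y, hy, ?_⟩
          rw [refl_apply, h, neg_smul, sub_eq_add_neg]
      · rintro ((⟨z, hz, rfl⟩ | ⟨z, hz, rfl⟩) | h)
        · refine ⟨mem_map_of_mem (Submodule.mem_sup_left hz), ?_⟩
          have h0 : M.proj (z + (0 : L) • s.v) ≠ 0 := by rwa [zero_smul, add_zero]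
          have := (hcub z hz 0 h0).2 (Or.inr (Or.inl rfl))
          simpa only [zero_smul, add_zero] using this
        · have hz' : z ∈ N.1 := hz
          rw [hN] at hz'
          obtain ⟨y, hy, rfl⟩ := hz'
          have e : refl S.qf R' s.v y = y + (-(polar (pencil S.qf R') y s.v / pencil S.qf R' s.v)) • s.v := by
            rw [refl_apply, sub_eq_add_neg, ← neg_smul]
          generalize refl S.qf R' s.v y = y' at *
          subst e
          exact ⟨mem_map_of_mem (Submodule.add_mem _ (Submodule.mem_sup_left hy)
            (Submodule.mem_sup_right (Submodule.mem_span_singleton.2 ⟨_, rfl⟩))),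
            (hcub y hy _ hy0).2 (Or.inr (Or.inr rfl))⟩
        · refine ⟨?_, (M.comp_mem_linesOn hR s).2 ((mem_ptsOf_mk y0 hy0).2 h)⟩
          refine (?_ : M.comp s ≤ _) h
          obtain ⟨e, e1, e2, e3, e4, hspan, hli⟩ := M.exists_comp_basis s
          obtain ⟨y, hyQ, hyne, hyx, hyl⟩ := hQ
          have hw := (hκ y hyQ).2
          have hl' : s.l' y ≠ 0 := by
            intro h'
            rw [h', mul_zero] at hw
            obtain ⟨a, ha⟩ := s.ker y hyx hyl h' hw
            apply hvQ
            have ha0 : a ≠ 0 := by rintro rfl; simp [ha] at hyne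
            rw [ha] at hyQ
            have := Q.1.smul_mem a⁻¹ hyQ
            rwa [smul_smul, inv_mul_cancel₀ ha0, one_smul] at this
          rw [hspan, Submodule.span_le]
          have hvm : s.v ∈ Q.1 ⊔ span L {s.v} := Submodule.mem_sup_right (mem_span_singleton_self _)
          rintro _ ⟨i, rfl⟩
          fin_cases i
          · exact mem_map_of_mem hvm
          · obtain ⟨a, ha⟩ := s.ker (y - s.l' y • e - s.w y • M.pv) (by simp [hyx, e1, s.xp]) (by simp [hyl, e2, s.lp])
              (by simp [e3, s.l'p]) (by simp [e4, s.wp])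
            refine ⟨(s.l' y)⁻¹ • (y - a • s.v), Submodule.smul_mem _ _ (Submodule.sub_mem _ (Submodule.mem_sup_left hyQ)
              (Submodule.smul_mem _ _ hvm)), ?_⟩
            have : y - a • s.v = s.l' y • e + s.w y • M.pv := by rw [← ha]; abel
            rw [this, map_smul, map_add, map_smul, map_smul, M.proj_pv, smul_zero, add_zero, smul_smul,
              inv_mul_cancel₀ hl', one_smul]
            rfl

end BlowUp.Model

end XLevel

section Curves

variable {K L : Type*} [Field K] [Field L] [Algebra K L] {n m : ℕ}

theorem eval_aeval_curve (γ : Fin n → Polynomial L) (F : MvPolynomial (Fin n) K) (t : L) :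
    (aeval γ F).eval t = aeval (fun i => (γ i).eval t) F := by
  have := comp_aeval_apply (R := K) γ ((Polynomial.aeval t : Polynomial L →ₐ[L] L).restrictScalars K) F
  simpa [Polynomial.coe_aeval_eq_eval] using this

theorem exists_functional {D : Submodule L (Fin m → L)} {x : Fin m → L} (hx : x ∉ D) :
    ∃ a : Fin m → L, (∀ y ∈ D, ∑ i, a i * y i = 0) ∧ ∑ i, a i * x i ≠ 0 := by
  obtain ⟨f, hf, hD⟩ := Submodule.exists_le_ker_of_notMem hx
  have hsum : ∀ y : Fin m → L, f y = ∑ i, f (Pi.single i 1) * y i := by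
    intro y
    conv_lhs => rw [← Finset.univ_sum_single y, map_sum]
    refine Finset.sum_congr rfl fun i _ => ?_
    have : Pi.single i (y i) = y i • (Pi.single i (1 : L) : Fin m → L) := by
      rw [← Pi.single_smul, smul_eq_mul, mul_one]
    rw [this, map_smul, smul_eq_mul, mul_comm]
  exact ⟨fun i => f (Pi.single i 1), fun y hy => by rw [← hsum]; exact hD hy, by rw [← hsum]; exact hf⟩

/-- The condition on a parameter of a curve that its image avoids a linear subspace is open. -/
theorem RegularOn.exists_poly_of_notMem {U : Set (PSpace L n)} {g : PSpace L n → PSpace L m} (hg : RegularOn K U g)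
    (γ : Fin n → Polynomial L) (hγ : ∀ t, (fun i => (γ i).eval t) ≠ 0) {D : Submodule L (Fin m → L)} {t₀ : L}
    (hU : pmk L _ (hγ t₀) ∈ U) (h : g (pmk L _ (hγ t₀)) ∉ ptsOf D) :
    ∃ f : Polynomial L, f ≠ 0 ∧ ∀ t, f.eval t ≠ 0 → pmk L _ (hγ t) ∈ U →
      g (pmk L _ (hγ t)) ∉ ptsOf D := by
  obtain ⟨d, F, hF, hF0⟩ := hg.exists_rep _ (hγ t₀) hU
  rw [hF.2 _ (hγ t₀) hF0 hU, mem_ptsOf_mk] at h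
  obtain ⟨a, haD, ha⟩ := exists_functional h
  have key : ∀ t, (∑ i, PC (a i) * aeval γ (F i)).eval t = ∑ i, a i * aeval (fun i => (γ i).eval t) (F i) := by
    intro t
    rw [Polynomial.eval_finsetSum]
    simp [eval_aeval_curve]
  refine ⟨∑ i, PC (a i) * aeval γ (F i), ?_, fun t ht htU hD => ?_⟩
  · intro h0
    apply ha
    rw [← key, h0, Polynomial.eval_zero]
  · rw [key] at ht
    have h0 : (fun j => aeval (fun i => (γ i).eval t) (F j)) ≠ 0 := by
      intro h0
      apply ht
      exact Finset.sum_eq_zero fun j _ => by rw [congrFun h0 j]; simp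
    rw [hF.2 _ (hγ t) h0 htU, mem_ptsOf_mk] at hD
    exact ht (haD _ hD)

theorem OpenIn.exists_poly {V U : Set (PSpace L n)} (hU : OpenIn K V U) (γ : Fin n → Polynomial L)
    (hγ : ∀ t, (fun i => (γ i).eval t) ≠ 0) (hV : ∀ t, pmk L _ (hγ t) ∈ V) {t₀ : L}
    (h : pmk L _ (hγ t₀) ∈ U) :
    ∃ f : Polynomial L, f ≠ 0 ∧ ∀ t, f.eval t ≠ 0 → pmk L _ (hγ t) ∈ U := by
  obtain ⟨T, hT, rfl⟩ := hU
  obtain ⟨-, F, hF, h0⟩ := h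
  obtain ⟨d, hd⟩ := hT F hF
  refine ⟨aeval γ F, ?_, fun t ht => ⟨hV t, F, hF, ?_⟩⟩
  · rintro h1
    apply h0
    rw [aeval_rep_eq_zero_iff hd, ← eval_aeval_curve, h1, Polynomial.eval_zero]
  · rw [Ne, aeval_rep_eq_zero_iff hd, ← eval_aeval_curve]
    exact ht

theorem exists_notMem_of_curve [Infinite L] {V U : Set (PSpace L n)} (hU : OpenIn K V U) {g : PSpace L n → PSpace L m} (hg : RegularOn K U g)
    (γ : Fin n → Polynomial L) (hγ : ∀ t, (fun i => (γ i).eval t) ≠ 0) (hV : ∀ t, pmk L _ (hγ t) ∈ V)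
    {D₁ D₂ : Submodule L (Fin m → L)} {t₁ t₂ : L}
    (h₁ : pmk L _ (hγ t₁) ∈ U) (h₁' : g (pmk L _ (hγ t₁)) ∉ ptsOf D₁)
    (h₂ : pmk L _ (hγ t₂) ∈ U) (h₂' : g (pmk L _ (hγ t₂)) ∉ ptsOf D₂) :
    ∃ t, pmk L _ (hγ t) ∈ U ∧ g (pmk L _ (hγ t)) ∉ ptsOf D₁ ∧
      g (pmk L _ (hγ t)) ∉ ptsOf D₂ := by
  obtain ⟨f₀, hf₀, h0⟩ := hU.exists_poly γ hγ hV h₁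
  obtain ⟨f₁, hf₁, h1⟩ := hg.exists_poly_of_notMem γ hγ h₁ h₁'
  obtain ⟨f₂, hf₂, h2⟩ := hg.exists_poly_of_notMem γ hγ h₂ h₂'
  obtain ⟨t, ht⟩ : ∃ t, (f₀ * f₁ * f₂).eval t ≠ 0 := by
    by_contra! hcon
    exact mul_ne_zero (mul_ne_zero hf₀ hf₁) hf₂ (Polynomial.funext fun t => by rw [hcon, Polynomial.eval_zero])
  rw [Polynomial.eval_mul, Polynomial.eval_mul] at ht
  have hb := left_ne_zero_of_mul ht
  have htU := h0 t (left_ne_zero_of_mul hb)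
  exact ⟨t, htU, h1 t (right_ne_zero_of_mul hb) htU, h2 t (right_ne_zero_of_mul ht) htU⟩

/-- The image of a line is not distributed between two linear subspaces. -/
theorem subset_or_of_line [Infinite L] {V U : Set (PSpace L n)} (hU : OpenIn K V U) {g : PSpace L n → PSpace L m} (hg : RegularOn K U g)
    {D : Submodule L (Fin n → L)} (hD : ptsOf D ⊆ U) {D₁ D₂ : Submodule L (Fin m → L)}
    (h : ∀ x ∈ ptsOf D, g x ∈ ptsOf D₁ ∪ ptsOf D₂) :
    (∀ x ∈ ptsOf D, g x ∈ ptsOf D₁) ∨ (∀ x ∈ ptsOf D, g x ∈ ptsOf D₂) := by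
  by_contra! hcon
  obtain ⟨⟨x₁, hx₁, h₁⟩, ⟨x₂, hx₂, h₂⟩⟩ := hcon
  have hUV : U ⊆ V := by
    obtain ⟨T, -, rfl⟩ := hU
    exact fun x hx => hx.1
  induction x₁ using pmk_ind with
  | h a ha =>
    induction x₂ using pmk_ind with
    | h b hb =>
      have haD := (mem_ptsOf_mk a ha).1 hx₁
      have hbD := (mem_ptsOf_mk b hb).1 hx₂
      by_cases hab : b ∈ span L {a}
      · obtain ⟨c, hc⟩ := Submodule.mem_span_singleton.1 hab
        have : pmk L b hb = pmk L a ha := mk_eq_mk_of_smul hb ha hc.symm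
        rw [this] at h₂
        rcases h _ hx₁ with h' | h'
        · exact h₁ h'
        · exact h₂ h'
      · have hli := indep_of_disjoint (W := span L {a}) (mem_span_singleton_self a) ha hab
        let γ : Fin n → Polynomial L := fun i => PC (a i) + PX * PC (b i - a i)
        have hev : ∀ t, (fun i => (γ i).eval t) = (1 - t) • a + t • b := by
          intro t
          funext i
          simp [γ]
          ring
        have hγ : ∀ t, (fun i => (γ i).eval t) ≠ 0 := by
          intro t h0
          rw [hev] at h0
          obtain ⟨h1, h2⟩ := hli _ _ h0
          rw [h2] at h1
          simp at h1
        have hγD : ∀ t, pmk L _ (hγ t) ∈ ptsOf D := by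
          intro t
          rw [mem_ptsOf_mk, hev]
          exact D.add_mem (D.smul_mem _ haD) (D.smul_mem _ hbD)
        have e0 : pmk L _ (hγ 0) = pmk L a ha :=
          mk_eq_mk_of_smul _ ha (a := 1) (by rw [hev]; simp)
        have e1 : pmk L _ (hγ 1) = pmk L b hb :=
          mk_eq_mk_of_smul _ hb (a := 1) (by rw [hev]; simp)
        obtain ⟨t, htU, ht1, ht2⟩ := exists_notMem_of_curve hU hg γ hγ (fun t => hUV (hD (hγD t))) (D₁ := D₁) (D₂ := D₂)
          (t₁ := 0) (t₂ := 1) (hD (hγD 0)) (by rwa [e0]) (hD (hγD 1)) (by rwa [e1])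
        rcases h _ (hγD t) with h' | h'
        · exact ht1 h'
        · exact ht2 h'

end Curves

section Transformation

variable {K L : Type*} [Field K] [Field L] [Algebra K L] [IsAlgClosed L]
  {S S' : QuarticDelPezzo K L} {Y Y' : CubicSurface K L} {B : BlowUp S Y} {B' : BlowUp S' Y'}
  {φ φ' : PSpace L 4 → PSpace L 2}

/-- The inverse transformation. -/
noncomputable def Transformation.symm (T : Transformation Y Y' φ φ') : Transformation Y' Y φ' φ where
  θ := T.θ.symm
  iso := ⟨T.iso.2, T.iso.1⟩
  source_open := T.target_open
  target_open := T.source_open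
  base := T.base.symm
  base_iso := ⟨T.base_iso.2, T.base_iso.1⟩
  comm x hx := by
    rw [Equiv.eq_symm_apply, ← T.comm _ (T.θ.map_target hx), T.θ.right_inv hx]
  source_degenerate := T.target_degenerate
  target_degenerate := T.source_degenerate

namespace BlowUp.Model

variable (M : B.Model φ)

/-- The member of the pencil that corresponds to a point of the base of the conic bundle. -/
theorem exists_mk_N (t : PSpace L 2) : ∃ R : Fin 2 → L, ∃ hR : R ≠ 0,
    t = pmk L (matLin L M.N R) (M.N_ne_zero hR) := by
  induction t using pmk_ind with
  | h r hr =>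
    have h : matLin L M.N (matLin L M.N' r) = r := by rw [← matLin_mul, M.NN', matLin_one]
    have h0 : matLin L M.N' r ≠ 0 := by
      intro h0
      rw [h0, map_zero] at h
      exact hr h.symm
    exact ⟨_, h0, mk_eq_mk_of_smul _ _ (a := 1) (by rw [h, one_smul])⟩

/-- A nondegenerate fiber is not distributed between two linear subspaces by a regular map. -/
theorem exists_notMem_of_fiber {R : Fin 2 → L} (hR : R ≠ 0) (hv : ¬ ∃ v, IsVert S.qf R v)
    {U : Set (PSpace L 4)} (hU : OpenIn K Y.pts U) {m : ℕ} {g : PSpace L 4 → PSpace L m} (hg : RegularOn K U g)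
    {D₁ D₂ : Submodule L (Fin m → L)} {x₁ x₂ : PSpace L 4} (h₁ : x₁ ∈ U) (h₂ : x₂ ∈ U)
    (hφ₁ : φ x₁ = pmk L (matLin L M.N R) (M.N_ne_zero hR))
    (hφ₂ : φ x₂ = pmk L (matLin L M.N R) (M.N_ne_zero hR))
    (hD₁ : g x₁ ∉ ptsOf D₁) (hD₂ : g x₂ ∉ ptsOf D₂) (hne : x₁ ≠ x₂) :
    ∃ x ∈ U, φ x = pmk L (matLin L M.N R) (M.N_ne_zero hR) ∧ g x ∉ ptsOf D₁ ∧ g x ∉ ptsOf D₂ := by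
  have hUV : U ⊆ Y.pts := by
    obtain ⟨T, -, rfl⟩ := hU
    exact fun x hx => hx.1
  induction x₁ using pmk_ind with
  | h y₁ hy₁ =>
  induction x₂ using pmk_ind with
  | h y₂ hy₂ =>
  obtain ⟨z₁, rfl⟩ := M.exists_proj_eq y₁
  obtain ⟨z₂, rfl⟩ := M.exists_proj_eq y₂
  obtain ⟨p1, q1⟩ := (M.fiber z₁ hy₁ R (M.N_ne_zero hR)).1 ⟨hUV h₁, hφ₁⟩
  obtain ⟨p2, q2⟩ := (M.fiber z₂ hy₂ R (M.N_ne_zero hR)).1 ⟨hUV h₂, hφ₂⟩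
  set Q := pencil S.qf R with hQ
  have hpp : Q M.pv = 0 := pencil_eq_zero M.qf_pv R
  have hppp : polar Q M.pv M.pv = 0 := by rw [polar_self, hpp, smul_zero]
  -- three isotropic independent orthogonal vectors do not exist
  have hno : ∀ z z', polar Q M.pv z = 0 → polar Q M.pv z' = 0 → Q z = 0 → Q z' = 0 →
      polar Q z z' = 0 → (∀ a b : L, a • M.proj z + b • M.proj z' = 0 → a = 0 ∧ b = 0) → False := by
    intro z z' hz hz' qz qz' hzz hli
    apply hv
    have hli3 : LinearIndependent L ![M.pv, z, z'] := by
      rw [Fintype.linearIndependent_iff]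
      intro c hc
      simp only [sum_univ_three, cons_val] at hc
      have h1 := congrArg M.proj hc
      rw [map_add, map_add, map_smul, map_smul, map_smul, M.proj_pv, smul_zero, zero_add, map_zero] at h1
      obtain ⟨c1, c2⟩ := hli _ _ h1
      rw [c1, c2, zero_smul, zero_smul, add_zero, add_zero] at hc
      have c0 := (smul_eq_zero.1 hc).resolve_right M.p_ne
      intro i
      fin_cases i <;> assumption
    refine exists_isVert_of_isotropic finrank_space (W := span L (Set.range ![M.pv, z, z'])) ?_ ?_
    · rw [finrank_span_eq_card hli3]; rfl
    · intro w hw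
      obtain ⟨c, rfl⟩ := (mem_span_range_iff_exists_fun L).1 hw
      simp only [sum_univ_three, cons_val]
      rw [map_comb_three, ← hQ, hpp, qz, qz', hz, hz', hzz]; ring
  have hli : ∀ a b : L, a • M.proj z₁ + b • M.proj z₂ = 0 → a = 0 ∧ b = 0 := by
    refine indep_of_disjoint (W := span L {M.proj z₁}) (mem_span_singleton_self _) hy₁ fun h => hne ?_
    obtain ⟨c, hc⟩ := Submodule.mem_span_singleton.1 h
    exact (mk_eq_mk_of_smul hy₂ hy₁ hc.symm).symm
  set b := polar Q z₁ z₂ with hb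
  have hb0 : b ≠ 0 := fun h => hno z₁ z₂ p1 p2 q1 q2 h hli
  have hb' : polar Q z₂ z₁ = b := polar_comm _ _ _
  -- a vector orthogonal to the two points
  obtain ⟨d, hpd, h1d, h2d, hd⟩ : ∃ d, polar Q M.pv d = 0 ∧ polar Q z₁ d = 0 ∧
      polar Q z₂ d = 0 ∧ ¬ ∃ a : L, d = a • M.pv := by
    have hf := finrank_le_finrank_inf_ker_add (k := L) (V := Fin 5 → L) ⊤
      (LinearMap.pi ![polarLin Q M.pv, polarLin Q z₁, polarLin Q z₂])
    rw [finrank_top, finrank_space] at hf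
    obtain ⟨d, hd, hdp⟩ := exists_indep_of_mem (W := ⊤ ⊓ LinearMap.ker (LinearMap.pi ![polarLin Q M.pv, polarLin Q z₁, polarLin Q z₂]))
      (by omega) M.p_ne
    refine ⟨d, congrFun hd.2 0, congrFun hd.2 1, congrFun hd.2 2, ?_⟩
    rintro ⟨a, ha⟩
    have := (hdp a (-1) (by rw [ha]; simp)).2
    simp at this
  have h1p : polar Q z₁ M.pv = 0 := by rw [polar_comm]; exact p1
  have hindep : ∀ α β ε : L, α • M.proj z₁ + β • M.proj z₂ + ε • M.proj d = 0 → α = 0 ∧ β = 0 ∧ ε = 0 := by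
    intro α β ε h
    obtain ⟨c, hc⟩ := (M.ker (α • z₁ + β • z₂ + ε • d)).1 (by simpa only [map_add, map_smul] using h)
    have e1 := congrArg (polarLin Q z₁) hc
    have e2 := congrArg (polarLin Q z₂) hc
    have p2' : polar Q z₂ M.pv = 0 := by rw [polar_comm]; exact p2
    simp [polar_self, q1, q2, ← hb, hb', hb0, h1d, h2d, h1p, p2'] at e1 e2
    rw [e1, e2, zero_smul, zero_smul, zero_add, zero_add] at hc
    refine ⟨e2, e1, ?_⟩
    by_contra hε
    exact hd ⟨ε⁻¹ * c, by rw [mul_smul, ← hc, smul_smul, inv_mul_cancel₀ hε, one_smul]⟩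
  have hqd : Q d ≠ 0 := by
    intro h0
    refine hno z₁ d p1 hpd q1 h0 h1d fun a b hab => ?_
    obtain ⟨h1, -, h3⟩ := hindep a 0 b (by rw [zero_smul, add_zero]; exact hab)
    exact ⟨h1, h3⟩
  let c₁ : Polynomial L := PC (-Q d) * (1 - PX) ^ 2
  let c₂ : Polynomial L := PC b * PX ^ 2
  let c₃ : Polynomial L := PC b * (PX * (1 - PX))
  let γ : Fin 4 → Polynomial L := fun i => c₁ * PC (M.proj z₁ i) + c₂ * PC (M.proj z₂ i) +
    c₃ * PC (M.proj d i)
  have hev : ∀ t, (fun i => (γ i).eval t) =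
      M.proj ((-Q d * (1 - t) ^ 2) • z₁ + (b * t ^ 2) • z₂ + (b * (t * (1 - t))) • d) := by
    intro t
    funext i
    simp [γ, c₁, c₂, c₃]
    ring
  have hγ : ∀ t, (fun i => (γ i).eval t) ≠ 0 := by
    intro t h0
    rw [hev, map_add, map_add, map_smul, map_smul, map_smul] at h0
    obtain ⟨h1, h2, -⟩ := hindep _ _ _ h0
    have ht : t = 0 := by simpa [hb0] using h2
    rw [ht] at h1
    simp [hqd] at h1
  have hfib : ∀ t, pmk L _ (hγ t) ∈ Y.pts ∧
      φ (pmk L _ (hγ t)) = pmk L (matLin L M.N R) (M.N_ne_zero hR) := by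
    intro t
    have hne' := hγ t
    rw [hev] at hne'
    have := (M.fiber _ hne' R (M.N_ne_zero hR)).2 ⟨by
      simp only [← hQ, polar_add_right, polar_smul_right, p1, p2, hpd]; simp, by
      rw [map_comb_three, ← hQ, q1, q2, h1d, h2d, ← hb]; ring⟩
    have e : pmk L _ (hγ t) = pmk L _ hne' :=
      mk_eq_mk_of_smul _ _ (a := 1) (by rw [hev, one_smul])
    rw [e]
    exact this
  have e0 : pmk L _ (hγ 0) = pmk L (M.proj z₁) hy₁ :=
    mk_eq_mk_of_smul _ hy₁ (a := -Q d) (by rw [hev]; simp)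
  have e1 : pmk L _ (hγ 1) = pmk L (M.proj z₂) hy₂ :=
    mk_eq_mk_of_smul _ hy₂ (a := b) (by rw [hev]; simp)
  obtain ⟨t, htU, ht1, ht2⟩ := exists_notMem_of_curve hU hg γ hγ (fun t => (hfib t).1) (D₁ := D₁) (D₂ := D₂)
    (t₁ := 0) (t₂ := 1) (by rwa [e0]) (by rwa [e0]) (by rwa [e1]) (by rwa [e1])
  exact ⟨_, htU, (hfib t).2, ht1, ht2⟩

variable {M} (M' : B'.Model φ') (T : Transformation Y Y' φ φ')

/-- A transformation takes degenerate fibers to degenerate fibers. -/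
theorem exists_isVert_of_transformation {R R' : Fin 2 → L} (hR : R ≠ 0) (s : Split S.qf R M.pv) (hR' : R' ≠ 0)
    (hb : T.base (pmk L (matLin L M.N R) (M.N_ne_zero hR)) =
      pmk L (matLin L M'.N R') (M'.N_ne_zero hR')) : ∃ v, IsVert S'.qf R' v := by
  by_contra hcon
  have hsrc : ∀ x ∈ ptsOf (M.comp s) ∪ ptsOf (M.comp s.swap), x ∈ T.θ.source ∧
      φ' (T.θ x) = pmk L (matLin L M'.N R') (M'.N_ne_zero hR') := by
    intro x hx
    rw [← M.fiber_eq hR s] at hx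
    have h1 : x ∈ T.θ.source := by
      apply T.source_degenerate x hx.1
      rw [hx.2]
      exact (M.isDegenerate_iff hR).2 ⟨s.v, s.vert⟩
    exact ⟨h1, by rw [T.comm x h1, hx.2, hb]⟩
  obtain ⟨y₁, hy₁, hy₁'⟩ := SetLike.not_le_iff_exists.1 (M.comp_not_le s)
  obtain ⟨y₂, hy₂, hy₂'⟩ := SetLike.not_le_iff_exists.1 (M.comp_not_le s.swap)
  have h1 : y₁ ≠ 0 := by rintro rfl; exact hy₁' (Submodule.zero_mem _)
  have h2 : y₂ ≠ 0 := by rintro rfl; exact hy₂' (Submodule.zero_mem _)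
  have m1 : pmk L y₁ h1 ∈ ptsOf (M.comp s) := (mem_ptsOf_mk y₁ h1).2 hy₁
  have m2 : pmk L y₂ h2 ∈ ptsOf (M.comp s.swap) := (mem_ptsOf_mk y₂ h2).2 hy₂
  have n1 : pmk L y₁ h1 ∉ ptsOf (M.comp s.swap) := fun h => hy₁' ((mem_ptsOf_mk y₁ h1).1 h)
  have n2 : pmk L y₂ h2 ∉ ptsOf (M.comp s) := fun h => hy₂' ((mem_ptsOf_mk y₂ h2).1 h)
  obtain ⟨s1, f1⟩ := hsrc _ (Or.inl m1)
  obtain ⟨s2, f2⟩ := hsrc _ (Or.inr m2)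
  obtain ⟨x, hxU, hxφ, hx1, hx2⟩ := M'.exists_notMem_of_fiber hR' hcon T.target_open T.iso.2
    (D₁ := M.comp s.swap) (D₂ := M.comp s) (T.θ.map_source s1) (T.θ.map_source s2) f1 f2
    (by rwa [T.θ.left_inv s1]) (by rwa [T.θ.left_inv s2]) (fun h => by
      have := T.θ.injOn s1 s2 h
      rw [this] at m1
      exact n2 m1)
  have hx' : T.θ.symm x ∈ {x ∈ Y.pts | φ x = pmk L (matLin L M.N R) (M.N_ne_zero hR)} := by
    have hs := T.θ.map_target hxU
    refine ⟨?_, ?_⟩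
    · obtain ⟨F, -, hF⟩ := T.source_open
      rw [hF] at hs
      exact hs.1
    · apply T.base.injective
      rw [← T.comm _ hs, T.θ.right_inv hxU, hxφ, hb]
  rw [M.fiber_eq hR s] at hx'
  rcases hx' with h | h
  · exact hx2 h
  · exact hx1 h

theorem map_comp_aux {R R' : Fin 2 → L} (hR : R ≠ 0) (s : Split S.qf R M.pv) (hR' : R' ≠ 0)
    (hb : T.base (pmk L (matLin L M.N R) (M.N_ne_zero hR)) =
      pmk L (matLin L M'.N R') (M'.N_ne_zero hR')) (s' : Split S'.qf R' M'.pv) :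
    ptsOf (M.comp s) ⊆ T.θ.source ∧
    ((∀ x ∈ ptsOf (M.comp s), T.θ x ∈ ptsOf (M'.comp s')) ∨ (∀ x ∈ ptsOf (M.comp s), T.θ x ∈ ptsOf (M'.comp s'.swap))) := by
  have hsrc : ∀ x ∈ ptsOf (M.comp s), x ∈ T.θ.source ∧ T.θ x ∈ ptsOf (M'.comp s') ∪ ptsOf (M'.comp s'.swap) := by
    intro x hx
    have hφ := M.φ_of_mem_comp hR s hx
    have h1 : x ∈ T.θ.source := by
      apply T.source_degenerate x ((M.comp_mem_linesOn hR s).2 hx)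
      rw [hφ]
      exact (M.isDegenerate_iff hR).2 ⟨s.v, s.vert⟩
    refine ⟨h1, ?_⟩
    rw [← M'.fiber_eq hR' s']
    have ht := T.θ.map_source h1
    refine ⟨?_, by rw [T.comm x h1, hφ, hb]⟩
    obtain ⟨F, -, hF⟩ := T.target_open
    rw [hF] at ht
    exact ht.1
  have : Infinite L := IsAlgClosed.instInfinite
  exact ⟨fun x hx => (hsrc x hx).1, subset_or_of_line T.source_open T.iso.1 (fun x hx => (hsrc x hx).1) fun x hx => (hsrc x hx).2⟩

theorem ptsOf_subset_iff {n : ℕ} {D D' : Submodule L (Fin n → L)} : ptsOf D ⊆ ptsOf D' ↔ D ≤ D' := by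
  constructor
  · intro h y hy
    rcases eq_or_ne y 0 with rfl | h0
    · exact D'.zero_mem
    · exact (mem_ptsOf_mk y h0).1 (h ((mem_ptsOf_mk y h0).2 hy))
  · intro h x hx
    exact h hx

theorem map_comp_of_subset {R R' : Fin 2 → L} (hR : R ≠ 0) (s : Split S.qf R M.pv) (hR' : R' ≠ 0)
    (hb : T.base (pmk L (matLin L M.N R) (M.N_ne_zero hR)) =
      pmk L (matLin L M'.N R') (M'.N_ne_zero hR')) (s' : Split S'.qf R' M'.pv)
    (h : ∀ x ∈ ptsOf (M.comp s), T.θ x ∈ ptsOf (M'.comp s')) : T.θ '' ptsOf (M.comp s) = ptsOf (M'.comp s') := by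
  have hs := (map_comp_aux M' T hR s hR' hb s').1
  have hb' : T.symm.base (pmk L (matLin L M'.N R') (M'.N_ne_zero hR')) =
      pmk L (matLin L M.N R) (M.N_ne_zero hR) := by
    change T.base.symm _ = _
    rw [← hb, Equiv.symm_apply_apply]
  obtain ⟨ht, h2⟩ := map_comp_aux M T.symm hR' s' hR hb' s
  change ptsOf (M'.comp s') ⊆ T.θ.target at ht
  have h3 : ∀ x ∈ ptsOf (M'.comp s'), T.θ.symm x ∈ ptsOf (M.comp s) := by
    refine h2.resolve_right fun h2 => M.comp_not_le s (ptsOf_subset_iff.1 fun x hx => ?_)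
    have := h2 _ (h x hx)
    change T.θ.symm _ ∈ _ at this
    rwa [T.θ.left_inv (hs hx)] at this
  apply Set.Subset.antisymm
  · rintro _ ⟨x, hx, rfl⟩
    exact h x hx
  · intro x hx
    exact ⟨_, h3 x hx, T.θ.right_inv (ht hx)⟩

/-- A transformation takes the components of the degenerate fibers to components. -/
theorem map_comp {R R' : Fin 2 → L} (hR : R ≠ 0) (s : Split S.qf R M.pv) (hR' : R' ≠ 0)
    (hb : T.base (pmk L (matLin L M.N R) (M.N_ne_zero hR)) =
      pmk L (matLin L M'.N R') (M'.N_ne_zero hR')) :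
    ∃ s' : Split S'.qf R' M'.pv, T.θ '' ptsOf (M.comp s) = ptsOf (M'.comp s') ∧
      T.θ '' ptsOf (M.comp s.swap) = ptsOf (M'.comp s'.swap) := by
  obtain ⟨v, hv⟩ := exists_isVert_of_transformation M' T hR s hR' hb
  obtain ⟨s₀⟩ := exists_split S'.smoothPencil finrank_space hR' hv M'.p_ne M'.qf_pv
  obtain ⟨s', hs'⟩ : ∃ s' : Split S'.qf R' M'.pv, ∀ x ∈ ptsOf (M.comp s), T.θ x ∈ ptsOf (M'.comp s') := by
    rcases (map_comp_aux M' T hR s hR' hb s₀).2 with h | h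
    · exact ⟨s₀, h⟩
    · exact ⟨s₀.swap, h⟩
  have h1 := map_comp_of_subset M' T hR s hR' hb s' hs'
  refine ⟨s', h1, ?_⟩
  obtain ⟨hsrc, h2⟩ := map_comp_aux M' T hR s.swap hR' hb s'
  apply map_comp_of_subset M' T hR s.swap hR' hb s'.swap
  refine h2.resolve_left fun h2 => M.comp_not_le s.swap (ptsOf_subset_iff.1 fun x hx => ?_)
  have := h2 x hx
  rw [← h1] at this
  obtain ⟨x', hx', he⟩ := this
  have := T.θ.injOn ((map_comp_aux M' T hR s hR' hb s').1 hx') (hsrc hx) he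
  rw [← this]
  exact hx'

end BlowUp.Model

end Transformation

section ProjectiveLine

variable {K L : Type*} [Field K] [Field L] [Algebra K L] {n m : ℕ}

theorem RegularOn.baseChange {U : Set (PSpace L n)} {g : PSpace L n → PSpace L m} (hg : RegularOn K U g) :
    RegularOn L U g := by
  intro x hx
  obtain ⟨d, F, hF, h0, h⟩ := hg x hx
  have e : ∀ y : Fin n → L, (fun i => aeval y (MvPolynomial.map (algebraMap K L) (F i))) = fun i => aeval y (F i) := by
    intro y
    funext i
    rw [aeval_map_algebraMap]
  refine ⟨d, fun i => MvPolynomial.map (algebraMap K L) (F i), fun i => (hF i).map _, by rw [e]; exact h0, fun y hy hne => ?_⟩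
  have hne' : (fun i => aeval y.rep (F i)) ≠ 0 := by rwa [e] at hne
  rw [h y hy hne']
  exact mk_eq_mk_of_smul _ _ (a := 1) (by rw [e, one_smul])

variable [IsAlgClosed L]

theorem squarefree_linear {a b : L} (h : ¬ (a = 0 ∧ b = 0)) :
    Squarefree (C a * X 0 + C b * X 1 : MvPolynomial (Fin 2) L) := by
  intro g hg
  by_contra hu
  obtain ⟨x, hx, h0⟩ := exists_ne_zero_aeval_eq_zero (L := L) (n := 2) le_rfl hu
  obtain ⟨f, hf⟩ := hg
  have hd : ∀ j, aeval x (pderiv j (C a * X 0 + C b * X 1 : MvPolynomial (Fin 2) L)) = 0 := by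
    intro j
    rw [hf, Derivation.leibniz, Derivation.leibniz]
    simp only [smul_eq_mul, map_add, map_mul, h0, zero_mul, mul_zero, add_zero]
  apply h
  have h0 := hd 0
  have h1 := hd 1
  simp [pderiv_X] at h0 h1
  exact ⟨h0, h1⟩

/-- A morphism from the projective line is given globally by a pair of binary forms without common zeros. -/
theorem RegularOn.exists_global {g : PSpace L 2 → PSpace L m} (hg : RegularOn L Set.univ g) :
    ∃ (d : ℕ) (F : Fin m → MvPolynomial (Fin 2) L), (∀ i, (F i).IsHomogeneous d) ∧
      ∀ (x : Fin 2 → L) (hx : x ≠ 0), ∃ h : (fun i => aeval x (F i)) ≠ 0,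
        g (pmk L x hx) = pmk L _ h := by
  classical
  let P : ℕ → Prop := fun d => ∃ F : Fin m → MvPolynomial (Fin 2) L, IsRepOf Set.univ g d F ∧
    ∃ x : Fin 2 → L, (fun i => aeval x (F i)) ≠ 0
  have hP : ∃ d, P d := by
    obtain ⟨d, F, hF, h0⟩ := hg.exists_rep ![1, 0] (by simp) trivial
    exact ⟨d, F, hF, _, h0⟩
  obtain ⟨F, hF, x₀, hx₀⟩ := Nat.find_spec hP
  set d := Nat.find hP with hd
  refine ⟨d, F, hF.hom, fun y hy => ?_⟩
  suffices h : (fun i => aeval y (F i)) ≠ 0 from ⟨h, hF.eq y hy h trivial⟩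
  intro hzero
  have hzero' : ∀ i, aeval y (F i) = 0 := fun i => congrFun hzero i
  have hd0 : d ≠ 0 := by
    intro h0
    have hFd := hF.hom
    rw [h0] at hFd
    apply hx₀
    funext i
    have h1 : F i = C (coeff 0 (F i)) := by
      have := (totalDegree_zero_iff_isHomogeneous _).2 (hFd i)
      exact totalDegree_eq_zero_iff_eq_C.1 this
    have h2 := hzero' i
    rw [h1, aeval_C] at h2 ⊢
    exact h2
  obtain ⟨d', hd'⟩ := Nat.exists_eq_succ_of_ne_zero hd0
  have hy' : ¬ (y 1 = 0 ∧ -y 0 = 0) := by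
    rintro ⟨h1, h0⟩
    apply hy
    funext i
    fin_cases i
    exacts [neg_eq_zero.1 h0, h1]
  set ℓ : MvPolynomial (Fin 2) L := C (y 1) * X 0 + C (-y 0) * X 1 with hℓ
  have hℓx : ∀ x : Fin 2 → L, aeval x ℓ = y 1 * x 0 - y 0 * x 1 := by
    intro x
    simp [hℓ]; ring
  have hℓh : ℓ.IsHomogeneous 1 := (isHomogeneous_C_mul_X _ _).add (isHomogeneous_C_mul_X _ _)
  have hdvd : ∀ i, ℓ ∣ F i := fun i => by
    refine dvd_of_vanish (L := L) (squarefree_linear hy') fun x hx => ?_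
    rw [hℓx] at hx
    obtain ⟨c, rfl⟩ := exists_smul_of_minors (x := x) hy (by
      intro i j
      fin_cases i <;> fin_cases j <;> simp only [Fin.zero_eta, Fin.mk_one]
      · linear_combination hx
      · linear_combination -hx)
    rw [aeval_smul_of_isHomogeneous (hF.hom i), hzero', mul_zero]
  choose G₀ hG₀ using hdvd
  let G : Fin m → MvPolynomial (Fin 2) L := fun i => homogeneousComponent d' (G₀ i)
  have hG : ∀ i, F i = ℓ * G i := by
    intro i
    have h1 : homogeneousComponent d (F i) = F i := by
      rw [homogeneousComponent_of_mem (hF.hom i), if_pos rfl]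
    rw [← h1, hd', Nat.succ_eq_add_one, add_comm, hG₀ i, homogeneousComponent_mul_left hℓh]
  have hGx : ∀ x : Fin 2 → L, (fun i => aeval x (F i)) = (y 1 * x 0 - y 0 * x 1) • fun i => aeval x (G i) := by
    intro x
    funext i
    rw [hG, map_mul, hℓx]; rfl
  have hℓ0 : ℓ ≠ 0 := by
    intro h0
    apply hx₀
    funext i
    rw [hG, h0, zero_mul, map_zero]; rfl
  apply Nat.find_min hP (m := d') (by omega)
  refine ⟨G, ⟨fun i => homogeneousComponent_isHomogeneous _ _, fun x hx hGne _ => ?_⟩, x₀, ?_⟩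
  · obtain ⟨d₂, F₂, hF₂, h₂⟩ := hg.exists_rep x hx trivial
    rw [hF₂.eq x hx h₂ trivial]
    have hmin : ∀ i j, F₂ i * G j - F₂ j * G i = 0 := by
      intro i j
      refine (mul_eq_zero.1 (?_ : ℓ * _ = 0)).resolve_left hℓ0
      refine eq_zero_of_vanish (L := L) fun z => ?_
      have e : aeval z (ℓ * (F₂ i * G j - F₂ j * G i)) = aeval z (F₂ i) * aeval z (F j) - aeval z (F₂ j) * aeval z (F i) := by
        rw [hG i, hG j]
        simp only [map_mul, map_sub]
        ring
      rw [e]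
      by_cases h1 : (fun i => aeval z (F i)) = 0
      · rw [show aeval z (F i) = 0 from congrFun h1 i, show aeval z (F j) = 0 from congrFun h1 j]; ring
      by_cases h2 : (fun i => aeval z (F₂ i)) = 0
      · rw [show aeval z (F₂ i) = 0 from congrFun h2 i, show aeval z (F₂ j) = 0 from congrFun h2 j]; ring
      have hz : z ≠ 0 := by
        rintro rfl
        apply h1
        rw [hGx]
        simp
      have := (hF.eq z hz h1 trivial).symm.trans (hF₂.eq z hz h2 trivial)
      obtain ⟨a, -, ha⟩ := exists_smul_of_mk_eq_mk this
      have hi := congrFun ha i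
      have hj := congrFun ha j
      simp only [Pi.smul_apply, smul_eq_mul] at hi hj
      rw [hi, hj]; ring
    obtain ⟨a, ha⟩ := exists_smul_of_minors (x := fun i => aeval x (F₂ i)) hGne (fun i j => by
      have := congrArg (aeval x) (hmin i j)
      rw [map_sub, map_mul, map_mul, map_zero, sub_eq_zero] at this
      exact this)
    exact mk_eq_mk_of_smul _ _ ha
  · intro h0
    apply hx₀
    rw [hGx, h0, smul_zero]

theorem exists_linear_of_isIsoOver {g : PSpace L 2 ≃ PSpace L 2} (hg : IsIsoOver L g.toPartialEquiv) :
    ∃ A : Matrix (Fin 2) (Fin 2) L, ∀ (x : Fin 2 → L) (hx : x ≠ 0), ∃ h : matLin L A x ≠ 0,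
      g (pmk L x hx) = pmk L _ h := by
  obtain ⟨d, F, hF, hFg⟩ := RegularOn.exists_global hg.1
  obtain ⟨e, H, hH, hHg⟩ := RegularOn.exists_global hg.2
  have hcomp : ∀ x : Fin 2 → L, x ≠ 0 → ∃ a : L, x = a • (fun i => aeval x (aeval F (H i))) ∧
      (fun i => aeval x (aeval F (H i))) ≠ 0 := by
    intro x hx
    obtain ⟨h1, e1⟩ := hFg x hx
    obtain ⟨h2, e2⟩ := hHg _ h1
    have h3 : g.symm (g (pmk L x hx)) = pmk L x hx := g.symm_apply_apply _
    have e1' : g (pmk L x hx) = _ := e1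
    have e2' : g.symm (pmk L _ h1) = _ := e2
    rw [e1', e2'] at h3
    have hc : (fun i => aeval x (aeval F (H i))) = fun i => aeval (fun i => aeval x (F i)) (H i) := by
      funext i
      exact (comp_aeval_apply (R := L) F (aeval x) (H i))
    rw [hc]
    obtain ⟨a, -, ha⟩ := exists_smul_of_mk_eq_mk h3.symm
    exact ⟨a, ha, h2⟩
  have hrel : X 1 * aeval F (H 0) = X 0 * aeval F (H 1) := by
    rw [← sub_eq_zero]
    refine eq_zero_of_vanish (L := L) fun x => ?_
    rcases eq_or_ne x 0 with rfl | hx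
    · simp
    · obtain ⟨a, ha, -⟩ := hcomp x hx
      have h0 : x 0 = a * aeval x (aeval F (H 0)) := congrFun ha 0
      have h1 : x 1 = a * aeval x (aeval F (H 1)) := congrFun ha 1
      rw [map_sub, map_mul, map_mul, aeval_X, aeval_X]
      linear_combination (aeval x (aeval F (H 0))) * h1 - (aeval x (aeval F (H 1))) * h0
  obtain ⟨E, hE⟩ : (X 0 : MvPolynomial (Fin 2) L) ∣ aeval F (H 0) := by
    have h1 : (X 0 : MvPolynomial (Fin 2) L) ∣ X 1 * aeval F (H 0) := ⟨_, hrel⟩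
    refine (dvd_X_mul_iff.1 h1).resolve_right fun h => ?_
    have := X_dvd_X.1 h.1
    simp at this
  have hE1 : aeval F (H 1) = X 1 * E := by
    rw [hE] at hrel
    have hX : (X 0 : MvPolynomial (Fin 2) L) ≠ 0 := X_ne_zero 0
    apply mul_left_cancel₀ hX
    rw [← hrel]; ring
  have hdeg := (hH 0).aeval F hF
  have hd : d * e = 1 := by
    by_contra hne
    have h0 : coeff 0 E = 0 := by
      rw [← coeff_X_mul 0 0 E, ← hE]
      exact hdeg.coeff_eq_zero (by simpa using fun h => hne h.symm)
    obtain ⟨x, hx, hxE⟩ := exists_ne_zero_of_aeval_zero (L := L) (D := E) le_rfl (by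
      rw [← constantCoeff_eq] at h0
      have : aeval (0 : Fin 2 → L) E = algebraMap L L (constantCoeff E) := by
        rw [← aeval_zero]
      rw [this, h0, map_zero])
    obtain ⟨a, -, ha⟩ := hcomp x hx
    apply ha
    funext i
    fin_cases i
    · change aeval x (aeval F (H 0)) = 0
      rw [hE, map_mul, hxE, mul_zero]
    · change aeval x (aeval F (H 1)) = 0
      rw [hE1, map_mul, hxE, mul_zero]
  have hd1 : d = 1 := Nat.eq_one_of_mul_eq_one_right hd
  subst hd1
  choose A hA using fun i => exists_coeff_of_isHomogeneous_one (hF i)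
  have hev : ∀ x : Fin 2 → L, (fun i => aeval x (F i)) = matLin L (Matrix.of A) x := by
    intro x
    funext i
    rw [hA, matLin_apply]
    simp
  refine ⟨Matrix.of A, fun x hx => ?_⟩
  obtain ⟨h, h'⟩ := hFg x hx
  have h2 : matLin L (Matrix.of A) x ≠ 0 := by rw [← hev]; exact h
  refine ⟨h2, h'.trans (mk_eq_mk_of_smul _ _ (a := 1) (by rw [hev, one_smul]))⟩

/-- An automorphism of the projective line over `K` is given by a matrix over `K`. -/
theorem exists_matrix_of_isIsoOver {g : PSpace L 2 ≃ PSpace L 2} (hg : IsIsoOver K g.toPartialEquiv) :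
    ∃ A A' : Matrix (Fin 2) (Fin 2) K, A * A' = 1 ∧ A' * A = 1 ∧ ∀ (x : Fin 2 → L) (hx : x ≠ 0),
      ∃ h : matLin L A x ≠ 0, g (pmk L x hx) = pmk L _ h := by
  obtain ⟨A, hA⟩ := exists_linear_of_isIsoOver (L := L) ⟨hg.1.baseChange, hg.2.baseChange⟩
  have hrat : ∀ v : Fin 2 → K, v ≠ 0 → ∃ w : Fin 2 → K, w ≠ 0 ∧ ∃ a : L, a ≠ 0 ∧ matLin L A (baseVec L v) = a • baseVec L w := by
    intro v hv
    have hv' := baseVec_ne_zero (L := L) hv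
    obtain ⟨d, F, hF, h0⟩ := hg.1.exists_rep _ hv' trivial
    have e : (fun i => aeval (baseVec L v) (F i)) = baseVec L fun i => aeval v (F i) := by
      funext i
      exact aeval_algebraMap_apply _ _ _
    have h1 := hF.eq _ hv' h0 trivial
    obtain ⟨h2, h3⟩ := hA _ hv'
    have h1' : g (pmk L _ hv') = _ := h1
    rw [h3] at h1'
    obtain ⟨a, ha, h⟩ := exists_smul_of_mk_eq_mk h1'
    refine ⟨fun i => aeval v (F i), ?_, a, ha, by rw [h, e]⟩
    intro h4
    apply h0
    rw [e, h4]
    funext i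
    simp [baseVec]
  obtain ⟨w₀, -, α, hα, h₀⟩ := hrat ![1, 0] (by simp)
  obtain ⟨w₁, -, β, hβ, h₁⟩ := hrat ![0, 1] (by simp)
  obtain ⟨w₂, -, γ, hγ, h₂⟩ := hrat ![1, 1] (by simp)
  have ev : ∀ a b : K, ∀ i, matLin L A (baseVec L ![a, b]) i = A i 0 * algebraMap K L a + A i 1 * algebraMap K L b := by
    intro a b i
    simp [matLin_apply, sum_univ_two, baseVec]
  have A0 : ∀ i, A i 0 = α * algebraMap K L (w₀ i) := fun i => by
    have := congrFun h₀ i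
    rw [ev, map_one, map_zero, mul_one, mul_zero, add_zero] at this
    exact this
  have A1 : ∀ i, A i 1 = β * algebraMap K L (w₁ i) := fun i => by
    have := congrFun h₁ i
    rw [ev, map_one, map_zero, mul_one, mul_zero, zero_add] at this
    exact this
  have A2 : ∀ i, A i 0 + A i 1 = γ * algebraMap K L (w₂ i) := fun i => by
    have := congrFun h₂ i
    rw [ev, map_one, mul_one, mul_one] at this
    exact this
  have hdet : A 0 0 * A 1 1 - A 0 1 * A 1 0 ≠ 0 := by
    intro h0
    have hx : ∀ x : Fin 2 → L, (∀ i, A i 0 * x 0 + A i 1 * x 1 = 0) → x = 0 := by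
      intro x hx
      by_contra hx0
      obtain ⟨h, -⟩ := hA x hx0
      apply h
      funext i
      simpa [matLin_apply, sum_univ_two] using hx i
    have hz : ∀ a b : L, ![b, -a] = 0 → a = 0 ∧ b = 0 := fun a b h => ⟨neg_eq_zero.1 (congrFun h 1), congrFun h 0⟩
    have e0 := hz _ _ (hx ![A 0 1, -A 0 0] (by
      intro i
      fin_cases i
      · simp; ring
      · simp; linear_combination -h0))
    have e1 := hz _ _ (hx ![A 1 1, -A 1 0] (by
      intro i
      fin_cases i
      · simp; linear_combination h0
      · simp; ring))
    have := hx ![1, 0] (by intro i; fin_cases i <;> simp [e0.1, e1.1])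
    simpa using congrFun this 0
  set Dw := w₀ 0 * w₁ 1 - w₁ 0 * w₀ 1 with hDw
  have hDw0 : Dw ≠ 0 := by
    intro h0
    apply hdet
    have := congrArg (algebraMap K L) h0
    rw [hDw, map_sub, map_mul, map_mul, map_zero] at this
    rw [A0, A0, A1, A1]
    linear_combination α * β * this
  set a := (w₂ 0 * w₁ 1 - w₁ 0 * w₂ 1) / Dw with ha
  set b := (w₀ 0 * w₂ 1 - w₂ 0 * w₀ 1) / Dw with hb
  have hDL : algebraMap K L Dw ≠ 0 := (map_ne_zero _).2 hDw0
  have e0 := A2 0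
  have e1 := A2 1
  rw [A0, A1] at e0 e1
  have hαa : α = γ * algebraMap K L a := by
    rw [ha, map_div₀, mul_div_assoc', eq_div_iff hDL, hDw]
    simp only [map_sub, map_mul]
    linear_combination algebraMap K L (w₁ 1) * e0 - algebraMap K L (w₁ 0) * e1
  have hβb : β = γ * algebraMap K L b := by
    rw [hb, map_div₀, mul_div_assoc', eq_div_iff hDL, hDw]
    simp only [map_sub, map_mul]
    linear_combination algebraMap K L (w₀ 0) * e1 - algebraMap K L (w₀ 1) * e0
  have hab : a * b * Dw ≠ 0 := by
    refine mul_ne_zero (mul_ne_zero ?_ ?_) hDw0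
    · intro h0; rw [h0, map_zero, mul_zero] at hαa; exact hα hαa
    · intro h0; rw [h0, map_zero, mul_zero] at hβb; exact hβ hβb
  let A' : Matrix (Fin 2) (Fin 2) K := !![a * w₀ 0, b * w₁ 0; a * w₀ 1, b * w₁ 1]
  have hA' : IsUnit A'.det := by
    rw [Matrix.det_fin_two]
    refine isUnit_iff_ne_zero.2 fun h0 => hab ?_
    simp only [A', Matrix.of_apply, Matrix.cons_val', cons_val_zero, cons_val_one, Matrix.cons_val_fin_one] at h0
    rw [hDw]
    linear_combination h0
  have hAA : ∀ x : Fin 2 → L, matLin L A x = γ • matLin L A' x := by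
    intro x
    funext i
    rw [Pi.smul_apply, matLin_apply, matLin_apply, sum_univ_two, sum_univ_two]
    simp only [Algebra.algebraMap_self, RingHom.id_apply, A0, A1, hαa, hβb]
    fin_cases i <;> simp [A'] <;> ring
  refine ⟨A', A'⁻¹, Matrix.mul_nonsing_inv _ hA', Matrix.nonsing_inv_mul _ hA', fun x hx => ?_⟩
  obtain ⟨h, h'⟩ := hA x hx
  have h2 : matLin L A' x ≠ 0 := by
    intro h0
    apply h
    rw [hAA, h0, smul_zero]
  exact ⟨h2, h'.trans (mk_eq_mk_of_smul _ _ (hAA x))⟩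

/-- The automorphism of a projective space given by an invertible matrix. -/
noncomputable def matEquiv (L : Type*) [Field L] [Algebra K L] (A A' : Matrix (Fin n) (Fin n) K) (h : A * A' = 1)
    (h' : A' * A = 1) : PSpace L n ≃ PSpace L n where
  toFun := Projectivization.map (matLin L A) (by
    refine Function.LeftInverse.injective (g := matLin L A') fun x => ?_
    rw [← matLin_mul, h', matLin_one])
  invFun := Projectivization.map (matLin L A') (by
    refine Function.LeftInverse.injective (g := matLin L A) fun x => ?_
    rw [← matLin_mul, h, matLin_one])
  left_inv x := by
    induction x using pmk_ind with
    | h v hv =>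
      rw [Projectivization.map_mk, Projectivization.map_mk]
      exact mk_eq_mk_of_smul _ _ (a := 1) (by rw [← matLin_mul, h', matLin_one, one_smul])
  right_inv x := by
    induction x using pmk_ind with
    | h v hv =>
      rw [Projectivization.map_mk, Projectivization.map_mk]
      exact mk_eq_mk_of_smul _ _ (a := 1) (by rw [← matLin_mul, h, matLin_one, one_smul])

theorem matLin_ne_zero {A A' : Matrix (Fin n) (Fin n) K} (h' : A' * A = 1) {x : Fin n → L} (hx : x ≠ 0) :
    matLin L A x ≠ 0 := by
  intro h
  apply hx
  rw [← matLin_one (K := K) x, ← h', matLin_mul, h, map_zero]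

theorem isIsoOver_matEquiv (A A' : Matrix (Fin n) (Fin n) K) (h : A * A' = 1) (h' : A' * A = 1) :
    IsIsoOver K (matEquiv L A A' h h').toPartialEquiv :=
  ⟨regularOn_of_matrix A fun _ hx _ => ⟨matLin_ne_zero h' hx, rfl⟩,
    regularOn_of_matrix A' fun _ hx _ => ⟨matLin_ne_zero h hx, rfl⟩⟩

end ProjectiveLine

section Labels

variable {K L : Type*} [Field K] [Field L] [Algebra K L] [IsAlgClosed L]
  {S : QuarticDelPezzo K L} {Y : CubicSurface K L} {B : BlowUp S Y} {φ : PSpace L 4 → PSpace L 2}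

theorem isVertex_iff (R : Fin 2 → L) (v : Fin 5 → L) : S.IsVertex R v ↔ IsVert S.qf R v := by
  rw [QuarticDelPezzo.IsVertex, S.form_eq]
  rfl

theorem mk_mem_Delta_iff {R : Fin 2 → L} (hR : R ≠ 0) :
    pmk L R hR ∈ S.Delta ↔ ∃ v, IsVert S.qf R v := by
  obtain ⟨a, ha, h⟩ := exists_rep_eq_smul R hR
  constructor
  · rintro ⟨v, hv⟩
    rw [isVertex_iff, h] at hv
    refine ⟨v, ?_⟩
    have := hv.smul a⁻¹
    rwa [smul_smul, inv_mul_cancel₀ ha, one_smul] at this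
  · rintro ⟨v, hv⟩
    refine ⟨v, ?_⟩
    rw [isVertex_iff, h]
    exact hv.smul a

theorem det_ne_zero_of_ne {R R' : PSpace L 2} (h : R ≠ R') : R.rep 0 * R'.rep 1 - R.rep 1 * R'.rep 0 ≠ 0 := by
  intro h0
  apply h
  rw [← R.mk_rep, ← R'.mk_rep, eq_mk_iff_of_two]
  linear_combination h0

theorem ne_of_det_ne_zero {R R' : Fin 2 → L} (hR : R ≠ 0) (hR' : R' ≠ 0) (h : R 0 * R' 1 - R 1 * R' 0 ≠ 0) :
    pmk L R hR ≠ pmk L R' hR' := by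
  intro h0
  rw [eq_mk_iff_of_two] at h0
  exact h (by linear_combination h0)

theorem exists_line_of_model (M : B.Model φ) : Nonempty S.Line := by
  obtain ⟨W, hW⟩ := exists_line S.smoothPencil finrank_space M.p_ne M.qf_pv
  exact ⟨⟨W, (S.isLine_iff W).2 hW⟩⟩

theorem exists_equiv_Delta (Q : S.Line) : Nonempty (Fin 5 ≃ S.Delta) := by
  have hQ := (S.isLine_iff _).1 Q.2
  obtain ⟨N⟩ := exists_normalForm S.smoothPencil finrank_space hQ
  obtain ⟨R, hR0, hRv, hRR, hall⟩ := N.exists_five S.smoothPencil hQ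
  refine ⟨Equiv.ofBijective (fun i => ⟨pmk L (R i) (hR0 i), (mk_mem_Delta_iff _).2 (hRv i)⟩) ⟨?_, ?_⟩⟩
  · intro i j hij
    by_contra hne
    exact ne_of_det_ne_zero (hR0 i) (hR0 j) (hRR i j hne) (Subtype.ext_iff.1 hij)
  · rintro ⟨R', hR'⟩
    induction R' using pmk_ind with
    | h r hr =>
      obtain ⟨i, hi⟩ := hall r hr ((mk_mem_Delta_iff hr).1 hR')
      refine ⟨i, Subtype.ext ?_⟩
      rw [eq_mk_iff_of_two]
      linear_combination hi

section Quotient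

variable (S)

open scoped Classical in
/-- The generator of the group that corresponds to a singular quadric. -/
noncomputable def QuarticDelPezzo.gen (R : S.Delta) : S.G := QuotientAddGroup.mk (Pi.single R (1 : ZMod 2))

variable {S}

theorem mk_const (c : ZMod 2) : (QuotientAddGroup.mk (fun _ => c) : S.G) = 0 :=
  (QuotientAddGroup.eq_zero_iff _).2 ⟨c, rfl⟩

theorem mk_eq_mk_iff {a b : S.GTilde} : (QuotientAddGroup.mk a : S.G) = QuotientAddGroup.mk b ↔ ∃ c, ∀ R, a R = b R + c := by
  rw [eq_comm, QuotientAddGroup.eq]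
  constructor
  · rintro ⟨c, hc⟩
    refine ⟨c, fun R => ?_⟩
    have : -b R + a R = c := congrFun hc R
    rw [← this]; ring
  · rintro ⟨c, hc⟩
    refine ⟨c, funext fun R => ?_⟩
    change -b R + a R = c
    rw [hc]; ring

open scoped Classical in
theorem gen_injective (e : Fin 5 ≃ S.Delta) : Function.Injective S.gen := by
  intro R₁ R₂ h
  by_contra hne
  obtain ⟨c, hc⟩ := mk_eq_mk_iff.1 h
  obtain ⟨R₃, h1, h2⟩ : ∃ R₃, R₃ ≠ R₁ ∧ R₃ ≠ R₂ := by
    have : ∀ i j : Fin 5, ∃ l, l ≠ i ∧ l ≠ j := by decide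
    obtain ⟨l, h1, h2⟩ := this (e.symm R₁) (e.symm R₂)
    exact ⟨e l, fun h => h1 (by rw [← h, e.symm_apply_apply]), fun h => h2 (by rw [← h, e.symm_apply_apply])⟩
  have h3 := hc R₃
  rw [Pi.single_eq_of_ne h1, Pi.single_eq_of_ne h2, zero_add] at h3
  have h4 := hc R₁
  rw [Pi.single_eq_same, Pi.single_eq_of_ne hne, ← h3] at h4
  simp at h4

open scoped Classical in
theorem gen_ne_zero (e : Fin 5 ≃ S.Delta) (R : S.Delta) : S.gen R ≠ 0 := by
  intro h
  rw [← mk_const (S := S) 0] at h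
  obtain ⟨c, hc⟩ := mk_eq_mk_iff.1 h
  obtain ⟨R₃, h1⟩ : ∃ R₃, R₃ ≠ R := by
    have : ∀ i : Fin 5, ∃ l, l ≠ i := by decide
    obtain ⟨l, h1⟩ := this (e.symm R)
    exact ⟨e l, fun h => h1 (by rw [← h, e.symm_apply_apply])⟩
  have h3 := hc R₃
  rw [Pi.single_eq_of_ne h1, zero_add] at h3
  have h4 := hc R
  rw [Pi.single_eq_same, ← h3] at h4
  simp at h4

theorem G_induction (e : Fin 5 ≃ S.Delta) {p : S.G → Prop} (h0 : p 0) (hadd : ∀ a R, p a → p (a + S.gen R)) (a : S.G) : p a := by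
  classical
  have : Fintype S.Delta := Fintype.ofEquiv _ e
  obtain ⟨f, rfl⟩ := QuotientAddGroup.mk_surjective a
  have key : ∀ s : Finset S.Delta, p (QuotientAddGroup.mk (∑ R ∈ s, Pi.single R (f R))) := by
    intro s
    induction s using Finset.induction_on with
    | empty => exact h0
    | insert R s hR ih =>
      rw [Finset.sum_insert hR, add_comm, QuotientAddGroup.mk_add]
      have h2 : f R = 0 ∨ f R = 1 := by
        generalize f R = x
        revert x
        decide
      rcases h2 with h2 | h2
      · rw [h2, Pi.single_zero, QuotientAddGroup.mk_zero, add_zero]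
        exact ih
      · rw [h2]
        have := hadd _ R ih
        rw [QuarticDelPezzo.gen] at this
        convert this using 4
  have := key Finset.univ
  rwa [Finset.univ_sum_single] at this

end Quotient

/-- A choice of splittings of the singular quadrics. -/
abbrev BlowUp.Model.Splits (M : B.Model φ) := ∀ R : S.Delta, Split S.qf R.1.rep M.pv

theorem BlowUp.Model.exists_splits (M : B.Model φ) : Nonempty M.Splits := by
  have : ∀ R : S.Delta, Nonempty (Split S.qf R.1.rep M.pv) := by
    rintro ⟨R, v, hv⟩
    exact exists_split S.smoothPencil finrank_space R.rep_nonzero ((isVertex_iff _ _).1 hv) M.p_ne M.qf_pv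
  exact ⟨fun R => (this R).some⟩

section Involution

/-- A member of the pencil different from the given one. -/
noncomputable def other (R : PSpace L 2) : Fin 2 → L := (exists_independent R.rep_nonzero).choose

theorem other_spec (R : PSpace L 2) : R.rep 0 * other R 1 - R.rep 1 * other R 0 ≠ 0 :=
  (exists_independent R.rep_nonzero).choose_spec

variable (S) in
/-- A vertex of a singular quadric. -/
noncomputable def QuarticDelPezzo.vert (R : S.Delta) : Fin 5 → L := R.2.choose

theorem vert_spec (R : S.Delta) : IsVert S.qf R.1.rep (S.vert R) := (isVertex_iff _ _).1 R.2.choose_spec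

/-- The action of the involution of a singular quadric on the lines. -/
noncomputable def QuarticDelPezzo.iota (R : S.Delta) (W : S.Line) : S.Line :=
  ⟨W.1.map (refl S.qf (other R.1) (S.vert R)), (S.isLine_iff _).2 (((S.isLine_iff _).1 W.2).refl (other_spec R.1) (vert_spec R)
    ((vert_spec R).ne_zero S.smoothPencil (other_spec R.1)))⟩

theorem refl_smul {k V : Type*} [Field k] [AddCommGroup V] [Module k V] [FiniteDimensional k V] {q : Fin 2 → QuadraticForm k V} (R' : Fin 2 → k)
    (v : V) {a : k} (ha : a ≠ 0) : refl q R' (a • v) = refl q R' v := by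
  ext x
  rw [refl_apply, refl_apply, polar_smul_right, QuadraticMap.map_smul, smul_smul, smul_eq_mul, smul_eq_mul]
  congr 2
  by_cases h : pencil q R' v = 0
  · rw [h]; simp
  · field_simp

theorem iota_eq {R : S.Delta} {v : Fin 5 → L} (hv : IsVert S.qf R.1.rep v) {R' : Fin 2 → L}
    (hR' : R.1.rep 0 * R' 1 - R.1.rep 1 * R' 0 ≠ 0) (W : S.Line) : (S.iota R W).1 = W.1.map (refl S.qf R' v) := by
  obtain ⟨a, ha⟩ := IsVert.unique S.smoothPencil R.1.rep_nonzero hv (vert_spec R)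
  have ha0 : a ≠ 0 := by
    rintro rfl
    rw [zero_smul] at ha
    exact (vert_spec R).1 ha
  change W.1.map (refl S.qf (other R.1) (S.vert R)) = _
  rw [ha, refl_smul _ _ ha0, refl_eq (other_spec R.1) hv (hv.ne_zero S.smoothPencil (other_spec R.1))
    (hv.ne_zero S.smoothPencil hR')]

theorem iota_iota (R : S.Delta) (W : S.Line) : S.iota R (S.iota R W) = W :=
  Subtype.ext (refl_map_map ((vert_spec R).ne_zero S.smoothPencil (other_spec R.1)) W.1)

theorem iota_ne (R : S.Delta) (W : S.Line) : S.iota R W ≠ W := fun h =>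
  ((S.isLine_iff _).1 W.2).refl_ne S.smoothPencil finrank_space (other_spec R.1) (vert_spec R) (Subtype.ext_iff.1 h)

theorem meet_iota (R : S.Delta) (W : S.Line) : S.Meet W (S.iota R W) := by
  obtain ⟨y, hy, hy0, -, hy2⟩ := ((S.isLine_iff _).1 W.2).exists_mem_refl (R' := other R.1) (v := S.vert R)
  intro h
  apply hy0
  have : y ∈ W.1 ⊓ (S.iota R W).1 := ⟨hy, hy2⟩
  rwa [h, Submodule.mem_bot] at this

theorem meet_self (W : S.Line) : S.Meet W W := by
  intro h
  rw [inf_idem] at h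
  have := W.2.1
  rw [h] at this
  simp at this

theorem exists_iota_of_meet {W W' : S.Line} (hne : W ≠ W') (h : S.Meet W W') : ∃ R, W' = S.iota R W := by
  obtain ⟨R, v, hR, hv, hall⟩ := IsLine.exists_vert_of_meet S.smoothPencil finrank_space ((S.isLine_iff _).1 W.2)
    ((S.isLine_iff _).1 W'.2) (fun h => hne (Subtype.ext h)) h
  refine ⟨⟨pmk L R hR, (mk_mem_Delta_iff hR).2 ⟨v, hv⟩⟩, Subtype.ext ?_⟩
  obtain ⟨a, ha, hrep⟩ := exists_rep_eq_smul R hR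
  have h1 := other_spec (pmk L R hR)
  rw [iota_eq (v := v) (R' := other (pmk L R hR)) (by rw [hrep]; exact hv.smul a) h1]
  apply hall
  rw [hrep] at h1
  intro h0
  apply h1
  simp only [Pi.smul_apply, smul_eq_mul]
  linear_combination a * h0

theorem involutionMaps_iota (R : S.Delta) (W : S.Line) : S.InvolutionMaps R W (S.iota R W) := by
  have h0 : other R.1 ≠ 0 := by
    intro h
    apply other_spec R.1
    rw [h]; simp
  obtain ⟨a, ha, hrep⟩ := exists_rep_eq_smul (other R.1) h0
  have hdet : R.1.rep 0 * (pmk L _ h0).rep 1 - R.1.rep 1 * (pmk L _ h0).rep 0 ≠ 0 := by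
    rw [hrep]
    intro h
    apply mul_ne_zero ha (other_spec R.1)
    simp only [Pi.smul_apply, smul_eq_mul] at h
    linear_combination h
  refine ⟨S.vert R, pmk L _ h0, (isVertex_iff _ _).2 (vert_spec R), ?_, ?_⟩
  · intro h
    rw [h] at hdet
    exact hdet (by ring)
  · rw [iota_eq (vert_spec R) hdet, Submodule.map_coe]
    congr 1
    funext x
    rw [QuarticDelPezzo.involution, S.form_eq]
    rfl

end Involution

namespace BlowUp.Model

variable {M : B.Model φ} (s : M.Splits)

open scoped Classical in
/-- The label of a line: the component of each degenerate fiber that it meets. -/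
noncomputable def label (W : S.Line) : S.GTilde := fun R => if (s R).Meets W.1 then 0 else 1

/-- The class of the label of a line. -/
noncomputable def cls (W : S.Line) : S.G := QuotientAddGroup.mk (label s W)

theorem swap_meets_iff (R : S.Delta) (W : S.Line) : (s R).swap.Meets W.1 ↔ ¬ (s R).Meets W.1 := by
  have hW := (S.isLine_iff _).1 W.2
  constructor
  · exact fun h => (s R).swap.not_meets_both S.smoothPencil R.1.rep_nonzero M.noLineThrough hW h
  · exact fun h => ((s R).meets_or hW).resolve_left h

theorem meets_iota_self (R : S.Delta) (W : S.Line) : (s R).Meets (S.iota R W).1 ↔ (s R).Meets W.1 := by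
  have key : ∀ W : S.Line, (s R).Meets W.1 → (s R).Meets (S.iota R W).1 := fun W h => by
    rw [iota_eq (s R).vert (other_spec R.1)]
    exact (s R).meets_refl ((s R).vert.ne_zero S.smoothPencil (other_spec R.1)) h
  refine ⟨fun h => ?_, key W⟩
  have := key _ h
  rwa [iota_iota] at this

theorem meets_iota_of_ne {R R₂ : S.Delta} (hne : R₂ ≠ R) (W : S.Line) :
    (s R).Meets (S.iota R₂ W).1 ↔ ¬ (s R).Meets W.1 := by
  have hdet := det_ne_zero_of_ne (fun h => hne (Subtype.ext h))
  have hW := (S.isLine_iff _).1 W.2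
  have h1 : (s R).Meets W.1 → ¬ (s R).Meets (S.iota R₂ W).1 := fun h =>
    (s R).not_meets_refl S.smoothPencil finrank_space M.noLineThrough hdet (vert_spec R₂) (other_spec R₂.1) hW h
  have h2 : (s R).swap.Meets W.1 → ¬ (s R).swap.Meets (S.iota R₂ W).1 := fun h =>
    (s R).swap.not_meets_refl S.smoothPencil finrank_space M.noLineThrough hdet (vert_spec R₂) (other_spec R₂.1) hW h
  rw [swap_meets_iff, swap_meets_iff, not_not] at h2
  exact ⟨fun h h' => h1 h' h, h2⟩

open scoped Classical in
theorem cls_iota (R : S.Delta) (W : S.Line) : cls s (S.iota R W) = cls s W + S.gen R := by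
  rw [cls, cls, QuarticDelPezzo.gen, ← QuotientAddGroup.mk_add, mk_eq_mk_iff]
  refine ⟨1, fun R₂ => ?_⟩
  rw [Pi.add_apply, label, label]
  by_cases h : R = R₂
  · subst h
    rw [Pi.single_eq_same, meets_iota_self]
    by_cases hm : (s R).Meets W.1
    · rw [if_pos hm]; rfl
    · rw [if_neg hm]; rfl
  · rw [Pi.single_eq_of_ne (fun h' => h h'.symm), meets_iota_of_ne s h]
    by_cases hm : (s R₂).Meets W.1
    · rw [if_pos hm, if_neg (not_not.2 hm)]; rfl
    · rw [if_neg hm, if_pos hm]; rfl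

theorem cls_injective : Function.Injective (cls s) := by
  intro W W' h
  obtain ⟨e⟩ := exists_equiv_Delta W
  by_contra hne
  by_cases hm : S.Meet W W'
  · obtain ⟨R, rfl⟩ := exists_iota_of_meet hne hm
    rw [cls_iota, left_eq_add] at h
    exact gen_ne_zero e R h
  · obtain ⟨U, hU⟩ : ∃ U : S.Line, ∃ R₁ R₂, W = S.iota R₁ U ∧ W' = S.iota R₂ U := by
      have hbot : W.1 ⊓ W'.1 = ⊥ := not_not.1 hm
      obtain ⟨N, hN, hne1, hne2, h1, h2⟩ := IsLine.exists_common_neighbour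
        ((S.isLine_iff _).1 W.2) ((S.isLine_iff _).1 W'.2) hbot
      let U : S.Line := ⟨N, (S.isLine_iff _).2 hN⟩
      obtain ⟨R₁, hR₁⟩ := exists_iota_of_meet (W := U) (W' := W) (fun h => hne1 (Subtype.ext_iff.1 h))
        (by rw [QuarticDelPezzo.Meet, inf_comm]; exact h1)
      obtain ⟨R₂, hR₂⟩ := exists_iota_of_meet (W := U) (W' := W') (fun h => hne2 (Subtype.ext_iff.1 h)) h2
      exact ⟨U, R₁, R₂, hR₁, hR₂⟩
    obtain ⟨R₁, R₂, rfl, rfl⟩ := hU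
    rw [cls_iota, cls_iota, add_right_inj] at h
    rw [gen_injective e h] at hne
    exact hne rfl

theorem cls_surjective : Function.Surjective (cls s) := by
  obtain ⟨W₀⟩ := exists_line_of_model M
  obtain ⟨e⟩ := exists_equiv_Delta W₀
  have key : ∀ a, ∃ W, cls s W = cls s W₀ + a := by
    refine G_induction e ⟨W₀, (add_zero _).symm⟩ fun a R ⟨W, hW⟩ => ⟨S.iota R W, ?_⟩
    rw [cls_iota, hW, add_assoc]
  intro a
  obtain ⟨W, hW⟩ := key (a - cls s W₀)
  exact ⟨W, by rw [hW]; abel⟩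

/-- The lines form a torsor. -/
noncomputable def clsEquiv : S.Line ≃ S.G := Equiv.ofBijective (cls s) ⟨cls_injective s, cls_surjective s⟩

theorem meet_iff (W W' : S.Line) : S.Meet W W' ↔ cls s W' = cls s W ∨ ∃ R, cls s W' = cls s W + S.gen R := by
  constructor
  · intro h
    by_cases hne : W = W'
    · exact Or.inl (by rw [hne])
    · obtain ⟨R, rfl⟩ := exists_iota_of_meet hne h
      exact Or.inr ⟨R, cls_iota s R W⟩
  · rintro (h | ⟨R, h⟩)
    · rw [cls_injective s h]
      exact meet_self W
    · rw [← cls_iota] at h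
      rw [cls_injective s h]
      exact meet_iota R W

end BlowUp.Model

end Labels

section Conjugation

variable {K L : Type*} [Field K] [Field L] [Algebra K L] [IsAlgClosed L]
  {S : QuarticDelPezzo K L} {Y : CubicSurface K L} {B : BlowUp S Y} {φ : PSpace L 4 → PSpace L 2}

theorem galPt_mem_ptsOf_iff {n : ℕ} (σ : L ≃ₐ[K] L) (D : Submodule L (Fin n → L)) (x : Fin n → L) (hx : x ≠ 0) :
    galPt σ (pmk L x hx) ∈ ptsOf D ↔ (fun i => σ (x i)) ∈ D := by
  rw [galPt_mk, mem_ptsOf_mk]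

theorem CubicSurface.galPt_mem (σ : L ≃ₐ[K] L) {x : PSpace L 4} (hx : x ∈ Y.pts) : galPt σ x ∈ Y.pts := by
  induction x using pmk_ind with
  | h y hy => rw [galPt_mk, Y.mk_mem_pts, aeval_gal, (Y.mk_mem_pts y hy).1 hx, map_zero]

theorem galDelta_symm_apply (σ : L ≃ₐ[K] L) (R : S.Delta) : S.galDelta σ (S.galDelta σ.symm R) = R :=
  Subtype.ext (galPt_galPt_symm σ R.1)

theorem galDelta_apply_symm (σ : L ≃ₐ[K] L) (R : S.Delta) : S.galDelta σ.symm (S.galDelta σ R) = R :=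
  Subtype.ext (galPt_symm_galPt σ R.1)

theorem finrank_galSub {n : ℕ} (σ : L ≃ₐ[K] L) (D : Submodule L (Fin n → L)) :
    finrank L (galSub σ D) = finrank L D := by
  let j : D ≃+ galSub σ D :=
    { toFun := fun y => ⟨fun i => σ (y.1 i), by
        change (fun i => σ.symm (σ (y.1 i))) ∈ D
        simp⟩
      invFun := fun y => ⟨fun i => σ.symm (y.1 i), y.2⟩
      left_inv := fun y => by ext i; simp
      right_inv := fun y => by ext i; simp
      map_add' := fun y z => by ext i; simp }
  have := rank_eq_of_equiv_equiv σ j σ.bijective (fun r m => by ext i; simp [j])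
  rw [finrank, finrank, this]

theorem QuarticDelPezzo.qf_gal (σ : L ≃ₐ[K] L) (i : Fin 2) (v : Fin 5 → L) : S.qf i (fun j => σ (v j)) = σ (S.qf i v) := by
  rw [S.qf_apply, S.qf_apply, aeval_gal]

theorem galSub_mem_linesOn (σ : L ≃ₐ[K] L) (W : S.Line) : galSub σ W.1 ∈ linesOn S.pts := by
  rw [S.isLine_iff]
  refine ⟨(finrank_galSub σ _).trans W.2.1, fun y hy i => σ.symm.injective ?_⟩
  rw [← S.qf_gal, map_zero]
  exact ((S.isLine_iff _).1 W.2).2 _ hy i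

namespace BlowUp.Model

variable {M : B.Model φ} (hφ : B.IsConicBundle φ) (s : M.Splits)

theorem mk_N_rep {r : Fin 2 → L} (hr : r ≠ 0) : pmk L (matLin L M.N (pmk L r hr).rep)
    (M.N_ne_zero (rep_nonzero _)) = pmk L (matLin L M.N r) (M.N_ne_zero hr) := by
  obtain ⟨a, ha, h⟩ := exists_rep_eq_smul r hr
  exact mk_eq_mk_of_smul _ _ (a := a) (by rw [h, map_smul])

include hφ in
theorem gal_mem_fiber (σ : L ≃ₐ[K] L) {R R' : S.Delta} (h : R'.1 = galPt σ R.1) {x : PSpace L 4}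
    (hx : x ∈ ptsOf (M.comp (s R)) ∪ ptsOf (M.comp (s R).swap)) :
    galPt σ x ∈ ptsOf (M.comp (s R')) ∪ ptsOf (M.comp (s R').swap) := by
  rw [← M.fiber_eq (rep_nonzero _)] at hx ⊢
  refine ⟨CubicSurface.galPt_mem σ hx.1, ?_⟩
  rw [hφ.regular.galPt σ hx.1 (CubicSurface.galPt_mem σ hx.1), hx.2, galPt_mk]
  have : (fun i => σ (matLin L M.N R.1.rep i)) = matLin L M.N (fun i => σ (R.1.rep i)) := (matLin_gal σ _ _).symm
  simp only [this, h]
  exact (mk_N_rep _).symm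

/-- Conjugation takes the chosen components of the fiber over `R` to that of the conjugate fiber. -/
def Preserves (σ : L ≃ₐ[K] L) (R : S.Delta) : Prop :=
  ∀ x ∈ ptsOf (M.comp (s R)), galPt σ x ∈ ptsOf (M.comp (s (S.galDelta σ R)))

theorem submodule_le_or_le {V : Type*} [AddCommGroup V] [Module L V] {D D₁ D₂ : Submodule L V}
    (h : ∀ x ∈ D, x ∈ D₁ ∨ x ∈ D₂) : D ≤ D₁ ∨ D ≤ D₂ := by
  by_contra! hcon
  obtain ⟨⟨a, ha, ha1⟩, ⟨b, hb, hb2⟩⟩ := And.imp SetLike.not_le_iff_exists.1 SetLike.not_le_iff_exists.1 hcon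
  have ha2 := (h a ha).resolve_left ha1
  have hb1 := (h b hb).resolve_right hb2
  rcases h _ (D.add_mem ha hb) with h' | h'
  · exact ha1 ((D₁.add_mem_iff_left hb1).1 h')
  · exact hb2 ((D₂.add_mem_iff_right ha2).1 h')

theorem galPt_mem_iff_galSub {n : ℕ} (σ : L ≃ₐ[K] L) (D D' : Submodule L (Fin n → L)) :
    (∀ x ∈ ptsOf D, galPt σ x ∈ ptsOf D') ↔ galSub σ D ≤ D' := by
  constructor
  · intro h y hy
    have hy' : (fun i => σ.symm (y i)) ∈ D := hy
    rcases eq_or_ne y 0 with rfl | h0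
    · exact D'.zero_mem
    · have := h _ ((mem_ptsOf_mk _ (gal_ne_zero σ.symm h0)).2 hy')
      rw [galPt_mem_ptsOf_iff] at this
      simpa using this
  · intro h x hx
    induction x using pmk_ind with
    | h y hy =>
      rw [galPt_mem_ptsOf_iff]
      apply h
      change (fun i => σ.symm (σ (y i))) ∈ D
      simpa using (mem_ptsOf_mk y hy).1 hx

include hφ in
theorem preserves_or (σ : L ≃ₐ[K] L) (R : S.Delta) (c : Split S.qf R.1.rep M.pv) (hc : c = s R ∨ c = (s R).swap) :
    galSub σ (M.comp c) ≤ M.comp (s (S.galDelta σ R)) ∨ galSub σ (M.comp c) ≤ M.comp (s (S.galDelta σ R)).swap := by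
  apply submodule_le_or_le
  intro y hy
  rcases eq_or_ne y 0 with rfl | h0
  · exact Or.inl (Submodule.zero_mem _)
  have h1 := (mem_ptsOf_mk (M := M.comp c) _ (gal_ne_zero σ.symm h0)).2 hy
  have h2 := gal_mem_fiber hφ s σ (R := R) (R' := S.galDelta σ R) rfl
    (x := pmk L _ (gal_ne_zero σ.symm h0)) (by
    rcases hc with rfl | rfl
    · exact Or.inl h1
    · exact Or.inr h1)
  rw [galPt_mk] at h2
  simpa [mem_ptsOf_mk] using h2

include hφ in
theorem galSub_swap (σ : L ≃ₐ[K] L) (R : S.Delta) : (Preserves s σ R →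
      galSub σ (M.comp (s R).swap) ≤ M.comp (s (S.galDelta σ R)).swap) ∧
    (¬ Preserves s σ R → galSub σ (M.comp (s R)) ≤ M.comp (s (S.galDelta σ R)).swap ∧
      galSub σ (M.comp (s R).swap) ≤ M.comp (s (S.galDelta σ R))) := by
  have key : ∀ D, galSub σ (M.comp (s R)) ≤ D → galSub σ (M.comp (s R).swap) ≤ D →
      M.comp (s (S.galDelta σ R)) ≤ D ∧ M.comp (s (S.galDelta σ R)).swap ≤ D := by
    intro D h1 h2
    have h3 : ∀ y, (y ∈ M.comp (s (S.galDelta σ R)) ∨ y ∈ M.comp (s (S.galDelta σ R)).swap) → y ∈ D := by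
      intro y hy
      rcases eq_or_ne y 0 with rfl | h0
      · exact D.zero_mem
      have := gal_mem_fiber hφ s σ.symm (R := S.galDelta σ R) (R' := R) (galPt_symm_galPt σ R.1).symm
        (x := pmk L y h0) (hy.imp (mem_ptsOf_mk y h0).2 (mem_ptsOf_mk y h0).2)
      rw [galPt_mk] at this
      exact this.elim (fun h => h1 ((mem_ptsOf_mk (M := M.comp (s R)) _ _).1 h))
        (fun h => h2 ((mem_ptsOf_mk (M := M.comp (s R).swap) _ _).1 h))
    exact ⟨fun y hy => h3 y (Or.inl hy), fun y hy => h3 y (Or.inr hy)⟩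
  rw [Preserves, galPt_mem_iff_galSub]
  constructor
  · intro h
    refine (preserves_or hφ s σ R _ (Or.inr rfl)).resolve_left fun h' => ?_
    exact M.comp_not_le (s (S.galDelta σ R)).swap (key _ h h').2
  · intro h
    have h1 := (preserves_or hφ s σ R _ (Or.inl rfl)).resolve_left h
    refine ⟨h1, (preserves_or hφ s σ R _ (Or.inr rfl)).resolve_right fun h' => ?_⟩
    exact M.comp_not_le (s (S.galDelta σ R)) (key _ h1 h').1

theorem meets_of_galSub_le (σ : L ≃ₐ[K] L) {R R' : Fin 2 → L} {c : Split S.qf R M.pv} {c' : Split S.qf R' M.pv}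
    (h : galSub σ (M.comp c) ≤ M.comp c') {W W' : Submodule L (Fin 5 → L)} (hW : W' = galSub σ W) (hm : c.Meets W) :
    c'.Meets W' := by
  obtain ⟨y, hy, hy0, h1, h2⟩ := hm
  have e : (fun i => σ.symm (σ (y i))) = y := by simp
  refine ⟨fun i => σ (y i), ?_, gal_ne_zero σ hy0, ?_⟩
  · rw [hW]
    change (fun i => σ.symm (σ (y i))) ∈ W
    rwa [e]
  · rw [← M.proj_mem_comp]
    apply h
    change (fun i => σ.symm (M.proj (fun i => σ (y i)) i)) ∈ M.comp c
    rw [proj, matLin_gal]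
    simp only [AlgEquiv.symm_apply_apply]
    exact (M.proj_mem_comp c y).2 ⟨h1, h2⟩

open scoped Classical in
/-- The function that records which of the chosen components are not preserved by conjugation. -/
noncomputable def twist (σ : L ≃ₐ[K] L) : S.GTilde := fun R => if Preserves s σ (S.galDelta σ.symm R) then 0 else 1

include hφ in
theorem label_galDelta (σ : L ≃ₐ[K] L) {W N : S.Line} (h : N.1 = galSub σ W.1) (R : S.Delta) :
    label s N (S.galDelta σ R) = label s W R + twist s σ (S.galDelta σ R) := by
  obtain ⟨h1, h2⟩ := galSub_swap hφ s σ R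
  rw [label, label, twist, galDelta_apply_symm]
  have hsw := swap_meets_iff s R W
  have hsw' := swap_meets_iff s (S.galDelta σ R) N
  by_cases hp : Preserves s σ R
  · rw [if_pos hp, add_zero]
    by_cases hm : (s R).Meets W.1
    · rw [if_pos hm, if_pos (meets_of_galSub_le σ ((galPt_mem_iff_galSub _ _ _).1 hp) h hm)]
    · rw [if_neg hm, if_neg (hsw'.1 (meets_of_galSub_le σ (h1 hp) h (hsw.2 hm)))]
  · obtain ⟨h3, h4⟩ := h2 hp
    rw [if_neg hp]
    by_cases hm : (s R).Meets W.1
    · rw [if_pos hm, if_neg (hsw'.1 (meets_of_galSub_le σ h3 h hm))]; rfl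
    · rw [if_neg hm, if_pos (meets_of_galSub_le σ h4 h (hsw.2 hm))]; rfl

include hφ in
theorem cls_galSub (σ : L ≃ₐ[K] L) {W N : S.Line} (h : N.1 = galSub σ W.1) :
    cls s N = S.galG σ (cls s W) + QuotientAddGroup.mk (twist s σ) := by
  change (QuotientAddGroup.mk (label s N) : S.G) = QuotientAddGroup.mk (S.galGTilde σ (label s W)) + QuotientAddGroup.mk (twist s σ)
  rw [← QuotientAddGroup.mk_add]
  congr 1
  funext R
  rw [← galDelta_symm_apply σ R, label_galDelta hφ s σ h]
  change _ = label s W (S.galDelta σ.symm (S.galDelta σ _)) + _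
  rw [galDelta_apply_symm]

/-- The torsor structure on the lines. -/
noncomputable def action : Multiplicative S.G →* Equiv.Perm S.Line where
  toFun a := ((clsEquiv s).trans (Equiv.addRight a.toAdd)).trans (clsEquiv s).symm
  map_one' := by ext1 W; simp
  map_mul' a b := by
    ext1 W
    simp only [Equiv.trans_apply, Equiv.Perm.mul_apply, Equiv.apply_symm_apply, Equiv.coe_addRight, toAdd_mul]
    congr 1
    abel

theorem cls_action (a : S.G) (W : S.Line) : cls s (action s (Multiplicative.ofAdd a) W) = cls s W + a :=
  (clsEquiv s).apply_symm_apply _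

include hφ in
theorem isTorsorAction_action : S.IsTorsorAction (action s) where
  generator R W := by
    have : action s (Multiplicative.ofAdd (S.gen R)) W = S.iota R W := by
      apply cls_injective s
      rw [cls_action, cls_iota]
    change S.InvolutionMaps R W (action s (Multiplicative.ofAdd (S.gen R)) W)
    rw [this]
    exact involutionMaps_iota R W
  simply_transitive W W' := by
    refine ⟨cls s W' - cls s W, cls_injective s ?_, fun a ha => ?_⟩
    · rw [cls_action]; abel
    · have ha' : action s (Multiplicative.ofAdd a) W = W' := ha
      rw [← ha', cls_action]; abel
  galois σ a W N h := by
    have hU : (⟨_, galSub_mem_linesOn σ (action s (Multiplicative.ofAdd a) W)⟩ : S.Line) =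
        action s (Multiplicative.ofAdd (S.galG σ a)) N := by
      apply cls_injective s
      rw [cls_action, cls_galSub hφ s σ rfl, cls_galSub hφ s σ h, cls_action, map_add]
      abel
    rw [← hU]

end BlowUp.Model

section Pencils

variable (M : B.Model φ)

theorem isPencilIso_matEquiv : B.IsPencilIso φ (matEquiv L M.N M.N' M.NN' M.N'N) where
  iso := isIsoOver_matEquiv _ _ _ _
  fiber R x hx hf := by
    induction x using pmk_ind with
    | h y hy =>
      obtain ⟨v, hv, rfl⟩ := M.lift y hy hx hf
      have hv0 : v ≠ 0 := by rintro rfl; exact hy (map_zero _)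
      have h1 := (M.map v hv0 hy hv).2
      have h2 := M.fiber v hy R.rep (M.N_ne_zero R.rep_nonzero)
      have h3 : matEquiv L M.N M.N' M.NN' M.N'N R = pmk L (matLin L M.N R.rep) (M.N_ne_zero R.rep_nonzero) := by
        conv_lhs => rw [← R.mk_rep]
        rfl
      obtain ⟨a, ha, hra⟩ := exists_rep_eq_smul _ M.p_ne
      obtain ⟨b, hb, hrb⟩ := exists_rep_eq_smul _ hv0
      rw [h3, BlowUp.OnTangentSection]
      have h4 : polar (S.form R.rep) B.center.rep (B.f (pmk L (matLin L M.P v) hy)).rep = 0 ↔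
          polar (pencil S.qf R.rep) (baseVec L M.p) v = 0 := by
        rw [h1, M.center, hra, hrb, S.form_eq, polar_smul_left, polar_smul_right, smul_eq_mul, smul_eq_mul]
        simp [ha, hb]
      rw [h4]
      constructor
      · exact fun h => ⟨hx, hf, (h2.1 ⟨hx, h⟩).1⟩
      · exact fun h => (h2.2 ⟨h.2.2, pencil_eq_zero hv _⟩).2

end Pencils

end Conjugation

section Transfer

variable {K L : Type*} [Field K] [Field L] [Algebra K L] [IsAlgClosed L]
  {S S' : QuarticDelPezzo K L} {Y Y' : CubicSurface K L} {B : BlowUp S Y} {B' : BlowUp S' Y'}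
  {φ φ' : PSpace L 4 → PSpace L 2}

/-- A matrix of the isomorphism of pencils that is induced by a transformation. -/
structure PencilMap (M : B.Model φ) (M' : B'.Model φ') (T : Transformation Y Y' φ φ') where
  G : Matrix (Fin 2) (Fin 2) K
  G' : Matrix (Fin 2) (Fin 2) K
  GG' : G * G' = 1
  G'G : G' * G = 1
  base : ∀ (R : Fin 2 → L) (hR : R ≠ 0), T.base (pmk L (matLin L M.N R) (M.N_ne_zero hR)) =
    pmk L (matLin L M'.N (matLin L G R)) (M'.N_ne_zero (matLin_ne_zero G'G hR))

variable {M : B.Model φ} {M' : B'.Model φ'} {T : Transformation Y Y' φ φ'}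

variable (M M' T) in
theorem PencilMap.exists_pencilMap : Nonempty (PencilMap M M' T) := by
  obtain ⟨A, A', h, h', hA⟩ := exists_matrix_of_isIsoOver T.base_iso
  refine ⟨⟨M'.N' * (A * M.N), M.N' * (A' * M'.N), ?_, ?_, fun R hR => ?_⟩⟩
  · calc _ = M'.N' * (A * (M.N * M.N') * A') * M'.N := by simp only [Matrix.mul_assoc]
      _ = 1 := by rw [M.NN', Matrix.mul_one, h, Matrix.mul_one, M'.N'N]
  · calc _ = M.N' * (A' * (M'.N * M'.N') * A) * M.N := by simp only [Matrix.mul_assoc]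
      _ = 1 := by rw [M'.NN', Matrix.mul_one, h', Matrix.mul_one, M.N'N]
  · obtain ⟨h1, h2⟩ := hA _ (M.N_ne_zero hR)
    rw [h2]
    congr 1
    rw [← matLin_mul, ← matLin_mul, ← Matrix.mul_assoc M'.N, M'.NN', Matrix.one_mul]

namespace PencilMap

variable (p : PencilMap M M' T)

/-- The isomorphism of pencils. -/
noncomputable def equiv : PSpace L 2 ≃ PSpace L 2 := matEquiv L p.G p.G' p.GG' p.G'G

theorem equiv_mk (R : Fin 2 → L) (hR : R ≠ 0) :
    p.equiv (pmk L R hR) = pmk L (matLin L p.G R) (matLin_ne_zero p.G'G hR) := rfl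

theorem base_mk_rep (R : PSpace L 2) : T.base (pmk L (matLin L M.N R.rep) (M.N_ne_zero R.rep_nonzero)) =
    pmk L (matLin L M'.N (p.equiv R).rep) (M'.N_ne_zero (rep_nonzero _)) := by
  have h : p.equiv R = pmk L _ (matLin_ne_zero p.G'G R.rep_nonzero) := by
    rw [← p.equiv_mk _ R.rep_nonzero, R.mk_rep]
  rw [p.base _ R.rep_nonzero, ← BlowUp.Model.mk_N_rep (M := M') (matLin_ne_zero p.G'G R.rep_nonzero)]
  simp only [h]

theorem mem_Delta_iff (R : PSpace L 2) : R ∈ S.Delta ↔ p.equiv R ∈ S'.Delta := by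
  have h := p.base_mk_rep R
  constructor
  · rintro ⟨v, hv⟩
    obtain ⟨s⟩ := exists_split S.smoothPencil finrank_space R.rep_nonzero ((isVertex_iff _ _).1 hv) M.p_ne M.qf_pv
    obtain ⟨v, hv⟩ := BlowUp.Model.exists_isVert_of_transformation M' T R.rep_nonzero s (rep_nonzero _) h
    exact ⟨v, (isVertex_iff _ _).2 hv⟩
  · rintro ⟨v, hv⟩
    obtain ⟨s⟩ := exists_split S'.smoothPencil finrank_space (rep_nonzero _) ((isVertex_iff _ _).1 hv) M'.p_ne M'.qf_pv
    obtain ⟨v, hv⟩ := BlowUp.Model.exists_isVert_of_transformation M T.symm (rep_nonzero _) s R.rep_nonzero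
      ((Equiv.symm_apply_eq _).2 h.symm)
    exact ⟨v, (isVertex_iff _ _).2 hv⟩

/-- The isomorphism of the schemes of singular quadrics. -/
noncomputable def delta : S.Delta ≃ S'.Delta := p.equiv.subtypeEquiv p.mem_Delta_iff

theorem delta_gal (σ : L ≃ₐ[K] L) (R : S.Delta) : p.delta (S.galDelta σ R) = S'.galDelta σ (p.delta R) :=
  Subtype.ext ((isIsoOver_matEquiv p.G p.G' p.GG' p.G'G).1.galPt σ (Set.mem_univ _) (Set.mem_univ _))

theorem delta_symm_gal (σ : L ≃ₐ[K] L) (R : S'.Delta) : p.delta.symm (S'.galDelta σ R) = S.galDelta σ (p.delta.symm R) := by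
  rw [Equiv.symm_apply_eq, p.delta_gal, Equiv.apply_symm_apply]

/-- The isomorphism of the group schemes. -/
noncomputable def gamma : S.G ≃+ S'.G :=
  QuotientAddGroup.congr S.constants S'.constants
    { toFun := fun a => a ∘ p.delta.symm
      invFun := fun a => a ∘ p.delta
      left_inv := fun a => by funext R; simp
      right_inv := fun a => by funext R; simp
      map_add' := fun _ _ => rfl } (by
    ext a
    constructor
    · rintro ⟨_, ⟨c, rfl⟩, rfl⟩
      exact ⟨c, rfl⟩
    · rintro ⟨c, rfl⟩
      exact ⟨fun _ => c, ⟨c, rfl⟩, rfl⟩)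

theorem gamma_mk (a : S.GTilde) : p.gamma (QuotientAddGroup.mk a) = QuotientAddGroup.mk (a ∘ p.delta.symm) := rfl

theorem gamma_gal (σ : L ≃ₐ[K] L) (a : S.G) : p.gamma (S.galG σ a) = S'.galG σ (p.gamma a) := by
  obtain ⟨f, rfl⟩ := QuotientAddGroup.mk_surjective a
  change (QuotientAddGroup.mk (S.galGTilde σ f ∘ p.delta.symm) : S'.G) = QuotientAddGroup.mk (S'.galGTilde σ (f ∘ p.delta.symm))
  congr 1
  funext R
  exact congrArg f (p.delta_symm_gal σ.symm R).symm

theorem gamma_gen (R : S.Delta) : p.gamma (S.gen R) = S'.gen (p.delta R) := by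
  classical
  rw [QuarticDelPezzo.gen, QuarticDelPezzo.gen, p.gamma_mk]
  congr 1
  funext R'
  rw [Function.comp_apply, Pi.single_apply, Pi.single_apply]
  simp only [Equiv.symm_apply_eq]

/-- Splittings of the singular quadrics that correspond under the transformation. -/
def Compatible (s : M.Splits) (s' : M'.Splits) : Prop :=
  ∀ R, T.θ '' ptsOf (M.comp (s R)) = ptsOf (M'.comp (s' (p.delta R))) ∧
    T.θ '' ptsOf (M.comp (s R).swap) = ptsOf (M'.comp (s' (p.delta R)).swap)

theorem exists_compatible (s : M.Splits) : ∃ s', p.Compatible s s' := by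
  have : ∀ R' : S'.Delta, ∃ c : Split S'.qf R'.1.rep M'.pv, ∀ R, p.delta R = R' →
      T.θ '' ptsOf (M.comp (s R)) = ptsOf (M'.comp c) ∧ T.θ '' ptsOf (M.comp (s R).swap) = ptsOf (M'.comp c.swap) := by
    intro R'
    obtain ⟨R, rfl⟩ := p.delta.surjective R'
    obtain ⟨c, hc⟩ := BlowUp.Model.map_comp M' T R.1.rep_nonzero (s R) (rep_nonzero _) (p.base_mk_rep R.1)
    refine ⟨c, fun R₂ h => ?_⟩
    rw [p.delta.injective h]
    exact hc
  choose s' hs' using this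
  exact ⟨s', fun R => hs' _ R rfl⟩

variable {p} {s : M.Splits} {s' : M'.Splits} (hs : p.Compatible s s') (hφ : B.IsConicBundle φ) (hφ' : B'.IsConicBundle φ')

open BlowUp.Model

include hφ in
theorem mem_source (R : S.Delta) {x : PSpace L 4}
    (hx : x ∈ ptsOf (M.comp (s R)) ∪ ptsOf (M.comp (s R).swap)) : x ∈ T.θ.source := by
  rw [← M.fiber_eq R.1.rep_nonzero] at hx
  refine T.source_degenerate x hx.1 ?_
  rw [hx.2]
  exact (M.isDegenerate_iff R.1.rep_nonzero).2 ⟨_, (s R).vert⟩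

include hs hφ in
theorem preserves_iff (σ : L ≃ₐ[K] L) (R : S.Delta) : Preserves s' σ (p.delta R) ↔ Preserves s σ R := by
  rw [Preserves, ← p.delta_gal, ← (hs _).1, ← (hs _).1]
  have hsrc : ∀ x ∈ ptsOf (M.comp (s R)), galPt σ x ∈ T.θ.source ∧ T.θ (galPt σ x) = galPt σ (T.θ x) := by
    intro x hx
    have h1 := mem_source (T := T) hφ _ (gal_mem_fiber hφ s σ (R' := S.galDelta σ R) rfl (Or.inl hx))
    exact ⟨h1, T.iso.1.galPt σ (mem_source (T := T) hφ _ (Or.inl hx)) h1⟩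
  constructor
  · intro h x hx
    obtain ⟨y, hy, hyx⟩ := h _ ⟨x, hx, rfl⟩
    rw [← (hsrc x hx).2] at hyx
    rwa [← T.θ.injOn (mem_source (T := T) hφ _ (Or.inl hy)) (hsrc x hx).1 hyx]
  · rintro h _ ⟨x, hx, rfl⟩
    exact ⟨_, h x hx, (hsrc x hx).2⟩

include hs hφ in
theorem gamma_twist (σ : L ≃ₐ[K] L) : p.gamma (QuotientAddGroup.mk (twist s σ)) = QuotientAddGroup.mk (twist s' σ) := by
  rw [p.gamma_mk]
  congr 1
  funext R'
  obtain ⟨R, rfl⟩ := p.delta.surjective R'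
  rw [Function.comp_apply, Equiv.symm_apply_apply, twist, twist, ← p.delta_gal]
  have h := preserves_iff hs hφ σ (S.galDelta σ.symm R)
  by_cases h' : Preserves s σ (S.galDelta σ.symm R)
  · rw [if_pos h', if_pos (h.2 h')]
  · rw [if_neg h', if_neg fun h₂ => h' (h.1 h₂)]

variable (p s s') in
/-- The map of the schemes of lines that is induced by the transformation. -/
noncomputable def nu : S.Line ≃ S'.Line := (clsEquiv s).trans (p.gamma.toEquiv.trans (clsEquiv s').symm)

theorem cls_nu (W : S.Line) : cls s' (nu p s s' W) = p.gamma (cls s W) := (clsEquiv s').apply_symm_apply _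

theorem nu_iota (R : S.Delta) (W : S.Line) : nu p s s' (S.iota R W) = S'.iota (p.delta R) (nu p s s' W) := by
  apply cls_injective s'
  rw [cls_nu, cls_iota, cls_iota, cls_nu, map_add, gamma_gen]

theorem nu_action (a : S.G) (W : S.Line) : nu p s s' (action s (Multiplicative.ofAdd a) W) =
    action s' (Multiplicative.ofAdd (p.gamma a)) (nu p s s' W) := by
  apply cls_injective s'
  rw [cls_nu, cls_action, cls_action, cls_nu, map_add]

include hs hφ hφ' in
theorem nu_galSub (σ : L ≃ₐ[K] L) (W N : S.Line) (h : N.1 = galSub σ W.1) :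
    (nu p s s' N).1 = galSub σ (nu p s s' W).1 := by
  have : nu p s s' N = ⟨_, galSub_mem_linesOn σ (nu p s s' W)⟩ := by
    apply cls_injective s'
    rw [cls_nu, cls_galSub hφ s σ h, map_add, gamma_gal, gamma_twist hs hφ, ← cls_nu (s := s) (s' := s')]
    exact (cls_galSub hφ' s' σ rfl).symm
  rw [this]

theorem exists_label_nu (W : S.Line) : ∃ c, ∀ R, label s' (nu p s s' W) (p.delta R) = label s W R + c := by
  have h : (QuotientAddGroup.mk (label s' (nu p s s' W)) : S'.G) = QuotientAddGroup.mk (label s W ∘ p.delta.symm) := cls_nu W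
  obtain ⟨c, hc⟩ := mk_eq_mk_iff.1 h
  exact ⟨c, fun R => by rw [hc, Function.comp_apply, Equiv.symm_apply_apply]⟩

end PencilMap

end Transfer

section Markings

variable {K L : Type*} [Field K] [Field L] [Algebra K L] [IsAlgClosed L]
  {S S' : QuarticDelPezzo K L} {Y Y' : CubicSurface K L} {B : BlowUp S Y} {B' : BlowUp S' Y'}
  {φ φ' : PSpace L 4 → PSpace L 2}

theorem QuarticDelPezzo.Marking.exists_equiv (μ : S.Marking) : ∃ e : Fin 5 ≃ S.Delta, ∀ i, μ.line i = S.iota (e i) μ.Q := by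
  have : ∀ i, ∃ R, μ.line i = S.iota R μ.Q := fun i => exists_iota_of_meet (μ.ne i).symm (by
    rw [QuarticDelPezzo.Meet, inf_comm]
    exact μ.meet i)
  choose f hf using this
  have hinj : Function.Injective f := fun i j h => μ.injective (by rw [hf, hf, h])
  obtain ⟨e⟩ := exists_equiv_Delta μ.Q
  exact ⟨Equiv.ofBijective f ⟨hinj, (Finite.injective_iff_surjective_of_equiv e).1 hinj⟩, hf⟩

/-- The marking that is given by a line and an enumeration of the singular quadrics. -/
noncomputable def markingOf {M : B.Model φ} (s : M.Splits) (Q : S.Line) (e : Fin 5 ≃ S.Delta) : S.Marking where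
  Q := Q
  line i := S.iota (e i) Q
  injective i j h := e.injective (gen_injective e (by
    have := congrArg (BlowUp.Model.cls s) h
    rwa [BlowUp.Model.cls_iota, BlowUp.Model.cls_iota, add_right_inj] at this))
  ne i := iota_ne _ _
  meet i := by
    rw [QuarticDelPezzo.Meet, inf_comm]
    exact meet_iota _ _

section Signs

variable (e : Fin 5 ≃ S.Delta)

/-- The class of a sign change. -/
noncomputable def signCls (a : evenSigns) : S.G := QuotientAddGroup.mk fun R => if a.1 (e.symm R) = 1 then 0 else 1

/-- The action of permutations on the group. -/
noncomputable def permCls (σ : Equiv.Perm (Fin 5)) : S.G →+ S.G :=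
  QuotientAddGroup.map _ _
    { toFun := fun a R => a (e (σ⁻¹ (e.symm R)))
      map_zero' := rfl
      map_add' := fun _ _ => rfl } (by
    rintro _ ⟨c, rfl⟩
    exact ⟨c, rfl⟩)

theorem permCls_mk (σ : Equiv.Perm (Fin 5)) (a : S.GTilde) :
    permCls e σ (QuotientAddGroup.mk a) = QuotientAddGroup.mk fun R => a (e (σ⁻¹ (e.symm R))) := rfl

theorem signCls_one : signCls e 1 = 0 := by
  rw [← mk_const (S := S) 0]; rfl

theorem signCls_mul (a b : evenSigns) : signCls e (a * b) = signCls e a + signCls e b := by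
  have : ∀ u v : ℤˣ, (if u * v = 1 then (0 : ZMod 2) else 1) = (if u = 1 then 0 else 1) + if v = 1 then 0 else 1 := by decide
  rw [signCls, signCls, signCls, ← QuotientAddGroup.mk_add]
  congr 1
  funext R
  exact this _ _

theorem permCls_one (x : S.G) : permCls e 1 x = x := by
  obtain ⟨f, rfl⟩ := QuotientAddGroup.mk_surjective x
  rw [permCls_mk]
  simp

theorem permCls_mul (σ τ : Equiv.Perm (Fin 5)) (x : S.G) : permCls e (σ * τ) x = permCls e σ (permCls e τ x) := by
  obtain ⟨f, rfl⟩ := QuotientAddGroup.mk_surjective x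
  simp [permCls_mk]

theorem permCls_signCls (σ : Equiv.Perm (Fin 5)) (a : evenSigns) : permCls e σ (signCls e a) = signCls e (permSigns σ a) := by
  rw [signCls, permCls_mk]
  simp only [Equiv.symm_apply_apply]
  rfl

theorem permCls_gen (σ : Equiv.Perm (Fin 5)) (i : Fin 5) : permCls e σ (S.gen (e i)) = S.gen (e (σ i)) := by
  classical
  rw [QuarticDelPezzo.gen, QuarticDelPezzo.gen, permCls_mk]
  congr 1
  funext R
  rw [Pi.single_apply, Pi.single_apply]
  have : e (σ⁻¹ (e.symm R)) = e i ↔ R = e (σ i) := by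
    rw [e.apply_eq_iff_eq, Equiv.Perm.inv_eq_iff_eq, Equiv.symm_apply_eq]
  by_cases h : R = e (σ i)
  · rw [if_pos h, if_pos (this.2 h)]
  · rw [if_neg h, if_neg fun h' => h (this.1 h')]

theorem signCls_signsExcept (i : Fin 5) : signCls e (signsExcept i) = S.gen (e i) := by
  classical
  rw [signCls, QuarticDelPezzo.gen, mk_eq_mk_iff]
  refine ⟨1, fun R => ?_⟩
  rw [Pi.single_apply]
  change (if (if e.symm R = i then (1 : ℤˣ) else -1) = 1 then (0 : ZMod 2) else 1) = _
  have := e.symm_apply_eq (x := R) (y := i)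
  by_cases h : R = e i
  · rw [if_pos h, if_pos (this.2 h), if_pos rfl]; rfl
  · rw [if_neg h, if_neg fun h' => h (this.1 h'), if_neg (by decide)]; rfl

variable {M : B.Model φ} (s : M.Splits) (Q : S.Line)

open BlowUp.Model

/-- The image of a line under an element of the Weyl group. -/
noncomputable def weylMap (w : WeylD5) (W : S.Line) : S.Line :=
  (clsEquiv s).symm (cls s Q + (signCls e w.left + permCls e w.right (cls s W - cls s Q)))

theorem cls_weylMap (w : WeylD5) (W : S.Line) :
    cls s (weylMap e s Q w W) = cls s Q + (signCls e w.left + permCls e w.right (cls s W - cls s Q)) :=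
  (clsEquiv s).apply_symm_apply _

/-- The action of the Weyl group on the lines. -/
noncomputable def weylAct : WeylD5 →* Equiv.Perm S.Line :=
  @MulAction.toPermHom WeylD5 S.Line _
    { smul := weylMap e s Q
      one_smul := fun W => cls_injective s (by
        refine (cls_weylMap e s Q 1 W).trans ?_
        rw [SemidirectProduct.one_left, SemidirectProduct.one_right, signCls_one, permCls_one]
        abel)
      mul_smul := fun w w' W => cls_injective s (by
        refine (cls_weylMap e s Q _ W).trans (Eq.trans ?_ (cls_weylMap e s Q w (weylMap e s Q w' W)).symm)
        rw [cls_weylMap, SemidirectProduct.mul_left, SemidirectProduct.mul_right, signCls_mul, permCls_mul, add_sub_cancel_left,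
          map_add, permCls_signCls]
        abel) }

theorem cls_weylAct (w : WeylD5) (W : S.Line) :
    cls s (weylAct e s Q w W) = cls s Q + (signCls e w.left + permCls e w.right (cls s W - cls s Q)) :=
  cls_weylMap e s Q w W

theorem isMarkingAction_weylAct (μ : S.Marking) (he : ∀ i, μ.line i = S.iota (e i) μ.Q) :
    S.IsMarkingAction μ (weylAct e s μ.Q) := by
  have key : ∀ (w : WeylD5) (W W' : S.Line), S.Meet W W' → S.Meet (weylAct e s μ.Q w W) (weylAct e s μ.Q w W') := by
    intro w W W' h
    rw [meet_iff s] at h ⊢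
    rw [cls_weylAct, cls_weylAct]
    rcases h with h | ⟨R, h⟩
    · exact Or.inl (by rw [h])
    · obtain ⟨i, rfl⟩ := e.surjective R
      refine Or.inr ⟨e (w.right i), ?_⟩
      rw [h, add_sub_right_comm, map_add, permCls_gen]
      abel
  refine ⟨fun w W W' => ⟨fun h => ?_, key w W W'⟩, fun σ => cls_injective s ?_, fun σ i => cls_injective s ?_,
    fun i => cls_injective s ?_⟩
  · have := key w⁻¹ _ _ h
    rwa [← Equiv.Perm.mul_apply, ← Equiv.Perm.mul_apply, ← map_mul, inv_mul_cancel, map_one] at this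
  · rw [cls_weylAct, SemidirectProduct.left_inr, signCls_one, sub_self, map_zero]
    abel
  · rw [cls_weylAct, SemidirectProduct.left_inr, SemidirectProduct.right_inr, signCls_one, he, he, cls_iota, cls_iota,
      add_sub_cancel_left, permCls_gen, zero_add]
  · rw [cls_weylAct, SemidirectProduct.left_inl, SemidirectProduct.right_inl, signCls_signsExcept, sub_self, map_zero, he,
      cls_iota, add_zero]

theorem PencilMap.nu_weylAct {M' : B'.Model φ'} {T : Transformation Y Y' φ φ'} (p : PencilMap M M' T) (s' : M'.Splits)
    (w : WeylD5) (W : S.Line) : p.nu s s' (weylAct e s Q w W) = weylAct (e.trans p.delta) s' (p.nu s s' Q) w (p.nu s s' W) := by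
  apply cls_injective s'
  have h1 : p.gamma (signCls e w.left) = signCls (e.trans p.delta) w.left := rfl
  have h2 : ∀ x, p.gamma (permCls e w.right x) = permCls (e.trans p.delta) w.right (p.gamma x) := by
    intro x
    obtain ⟨f, rfl⟩ := QuotientAddGroup.mk_surjective x
    rw [permCls_mk, p.gamma_mk, p.gamma_mk, permCls_mk]
    congr 1
    funext R
    simp
  rw [cls_nu, cls_weylAct, cls_weylAct, cls_nu, cls_nu, map_add, map_add, h1, h2, map_sub]

end Signs

namespace BlowUp.Model

variable {M : B.Model φ} (s : M.Splits)

/-- Splittings with the planes interchanged where the given function does not vanish. -/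
noncomputable def pick (b : S.GTilde) : M.Splits := fun R => if b R = 0 then s R else (s R).swap

theorem pick_of_eq_zero {b : S.GTilde} {R : S.Delta} (h : b R = 0) : pick s b R = s R := if_pos h

theorem pick_of_ne_zero {b : S.GTilde} {R : S.Delta} (h : b R ≠ 0) : pick s b R = (s R).swap := if_neg h

theorem pick_meets (b : S.GTilde) (R : S.Delta) (W : S.Line) : (pick s b R).Meets W.1 ↔ label s W R = b R := by
  have h01 : ∀ x : ZMod 2, x ≠ 0 → x = 1 := by decide
  have := swap_meets_iff s R W
  rw [label]
  by_cases hb : b R = 0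
  · rw [pick_of_eq_zero s hb, hb]
    by_cases h : (s R).Meets W.1
    · rw [if_pos h]; exact iff_of_true h rfl
    · rw [if_neg h]; exact iff_of_false h (by decide)
  · rw [pick_of_ne_zero s hb, h01 _ hb, this]
    by_cases h : (s R).Meets W.1
    · rw [if_pos h]; exact iff_of_false (not_not.2 h) (by decide)
    · rw [if_neg h]; exact iff_of_true h rfl

theorem matEquiv_N (R : PSpace L 2) : matEquiv L M.N M.N' M.NN' M.N'N R =
    pmk L (matLin L M.N R.rep) (M.N_ne_zero R.rep_nonzero) := by
  conv_lhs => rw [← R.mk_rep]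
  rfl

/-- The marking of the conic bundle that is given by splittings of the singular quadrics. -/
noncomputable def marking (e : Fin 5 ≃ S.Delta) : Y.Marking φ where
  E i := ⟨M.comp (s (e i)), M.comp_mem_linesOn (e i).1.rep_nonzero _⟩
  F i := ⟨M.comp (s (e i)).swap, M.comp_mem_linesOn (e i).1.rep_nonzero _⟩
  ne i h := M.comp_ne (s (e i)) (Subtype.ext_iff.1 h)
  t i := matEquiv L M.N M.N' M.NN' M.N'N (e i).1
  injective := (Equiv.injective _).comp (Subtype.val_injective.comp e.injective)
  fiber i := by
    rw [matEquiv_N]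
    exact M.fiber_eq (e i).1.rep_nonzero _
  exhaust t ht := by
    obtain ⟨R, hR, rfl⟩ := M.exists_mk_N t
    obtain ⟨i, hi⟩ := e.surjective ⟨_, (mk_mem_Delta_iff hR).2 ((M.isDegenerate_iff hR).1 ht)⟩
    refine ⟨i, ?_⟩
    rw [hi]
    rfl

theorem isThirdLine_iota (c : M.Splits) (R : S.Delta) {Q : S.Line} (h : (c R).Meets Q.1) :
    B.IsThirdLine Q (S.iota R Q) ⟨M.comp (c R), M.comp_mem_linesOn R.1.rep_nonzero _⟩ :=
  M.isThirdLine R.1.rep_nonzero (c R) (other_spec R.1) (iota_eq (c R).vert (other_spec R.1) Q) h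

theorem corresponds (e : Fin 5 ≃ S.Delta) (μ : S.Marking) (he : ∀ i, μ.line i = S.iota (e i) μ.Q)
    (h : ∃ c, ∀ R, (if c = (0 : ZMod 2) then s R else (s R).swap).Meets μ.Q.1) : B.Corresponds μ (marking s e) := by
  obtain ⟨c, hc⟩ := h
  by_cases h0 : c = 0
  · left
    intro i
    have := hc (e i)
    rw [if_pos h0] at this
    rw [he]
    exact isThirdLine_iota s (e i) this
  · right
    intro i
    have := hc (e i)
    rw [if_neg h0] at this
    rw [he]
    exact isThirdLine_iota (fun R => (s R).swap) (e i) this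

end BlowUp.Model

open BlowUp.Model

theorem PencilMap.isTransfer {M : B.Model φ} {M' : B'.Model φ'} {T : Transformation Y Y' φ φ'} (p : PencilMap M M' T)
    {s : M.Splits} {s' : M'.Splits} (hs : p.Compatible s s') (hφ : B.IsConicBundle φ) (hφ' : B'.IsConicBundle φ') :
    IsTransfer B B' T (p.nu s s') where
  galois := nu_galSub hs hφ hφ'
  exists_marking := by
    obtain ⟨W⟩ := exists_line_of_model M
    obtain ⟨e⟩ := exists_equiv_Delta W
    exact ⟨markingOf s W e⟩
  marking μ := by
    obtain ⟨e, he⟩ := μ.exists_equiv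
    let b : S.GTilde := label s μ.Q
    let μ' := markingOf s' (p.nu s s' μ.Q) (e.trans p.delta)
    have he' : ∀ i, μ'.line i = S'.iota (e.trans p.delta i) μ'.Q := fun _ => rfl
    refine ⟨marking (pick s b) e, marking (pick s' (b ∘ p.delta.symm)) (e.trans p.delta), μ', ?_, ?_, ?_, rfl, ?_,
      weylAct e s μ.Q, weylAct (e.trans p.delta) s' μ'.Q, isMarkingAction_weylAct e s μ he,
      isMarkingAction_weylAct _ s' μ' he', p.nu_weylAct e s μ.Q s'⟩
    · exact corresponds _ e μ he ⟨0, fun R => by rw [if_pos rfl, pick_meets]⟩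
    · intro i
      have h := hs (e i)
      have hd : (b ∘ p.delta.symm) (p.delta (e i)) = b (e i) := congrArg b (p.delta.symm_apply_apply _)
      change ptsOf (M'.comp (pick s' _ (p.delta (e i)))) = T.θ '' ptsOf (M.comp (pick s b (e i))) ∧
        ptsOf (M'.comp (pick s' _ (p.delta (e i))).swap) = T.θ '' ptsOf (M.comp (pick s b (e i)).swap)
      by_cases h0 : b (e i) = 0
      · rw [pick_of_eq_zero s h0, pick_of_eq_zero s' (hd.trans h0)]
        exact ⟨h.1.symm, h.2.symm⟩
      · rw [pick_of_ne_zero s h0, pick_of_ne_zero s' (by rwa [hd])]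
        exact ⟨h.2.symm, h.1.symm⟩
    · obtain ⟨c, hc⟩ := exists_label_nu (p := p) (s := s) (s' := s') μ.Q
      refine corresponds _ _ μ' he' ⟨c, fun R' => ?_⟩
      obtain ⟨R, rfl⟩ := p.delta.surjective R'
      have hd : (b ∘ p.delta.symm) (p.delta R) = b R := congrArg b (p.delta.symm_apply_apply _)
      have h1 := pick_meets s' (b ∘ p.delta.symm) (p.delta R) μ'.Q
      have h2 := swap_meets_iff (pick s' (b ∘ p.delta.symm)) (p.delta R) μ'.Q
      have h3 : label s' μ'.Q (p.delta R) = b R + c := hc R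
      rw [hd, h3, add_eq_left] at h1
      by_cases h0 : c = 0
      · rw [if_pos h0]; exact h1.2 h0
      · rw [if_neg h0]; exact h2.2 fun h => h0 (h1.1 h)
    · intro i
      rw [he, nu_iota]
      rfl

end Markings

section Equivalence

variable {K L : Type*} [Field K] [Field L] [Algebra K L] [IsAlgClosed L]
  {S S' : QuarticDelPezzo K L} {Y Y' : CubicSurface K L} {B : BlowUp S Y} {B' : BlowUp S' Y'}
  {φ φ' : PSpace L 4 → PSpace L 2} {M : B.Model φ} {M' : B'.Model φ'} {T : Transformation Y Y' φ φ'}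

theorem mem_map_refl {k V : Type*} [Field k] [AddCommGroup V] [Module k V] [FiniteDimensional k V]
    {q : Fin 2 → QuadraticForm k V} {R' : Fin 2 → k} {v : V} (h : pencil q R' v ≠ 0) (W : Submodule k V) (z : V) :
    z ∈ W.map (refl q R' v) ↔ refl q R' v z ∈ W := by
  constructor
  · rintro ⟨y, hy, rfl⟩
    rwa [refl_refl h]
  · exact fun hz => ⟨_, hz, refl_refl h z⟩

namespace PencilMap

variable (p : PencilMap M M' T)

/-- The generators of the second pencil that correspond to those of the first one. -/
noncomputable def form (i : Fin 2) : QuadraticForm L (Fin 5 → L) := pencil S'.qf fun j => algebraMap K L (p.G j i)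

theorem form_apply (i : Fin 2) (z : Fin 5 → L) :
    p.form i z = algebraMap K L (p.G 0 i) * S'.qf 0 z + algebraMap K L (p.G 1 i) * S'.qf 1 z := rfl

theorem pencil_form (R : Fin 2 → L) : pencil p.form R = pencil S'.qf (matLin L p.G R) := by
  ext z
  simp only [pencil_apply, form_apply, matLin_apply, sum_univ_two]
  ring

theorem form_eq_zero_iff (z : Fin 5 → L) : (∀ i, p.form i z = 0) ↔ ∀ i, S'.qf i z = 0 := by
  constructor
  · intro h i
    have h1 : ∀ R, pencil S'.qf R z = 0 := fun R => by
      have := pencil_eq_zero h (matLin L p.G' R)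
      rwa [p.pencil_form, ← matLin_mul, p.GG', matLin_one] at this
    have h2 := h1 (Pi.single i 1)
    fin_cases i <;> simpa [pencil_apply] using h2
  · exact fun h i => pencil_eq_zero h _

theorem smoothPencil : SmoothPencil p.form := by
  intro v hv h R hR
  rw [p.pencil_form]
  exact S'.smoothPencil v hv ((p.form_eq_zero_iff v).1 h) _ (matLin_ne_zero p.G'G hR)

theorem isLine_iff (W : Submodule L (Fin 5 → L)) : IsLine p.form W ↔ IsLine S'.qf W :=
  and_congr_right fun _ => forall₂_congr fun v _ => p.form_eq_zero_iff v

theorem isVert_iff (R : Fin 2 → L) (v : Fin 5 → L) : IsVert p.form R v ↔ IsVert S'.qf (matLin L p.G R) v := by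
  rw [IsVert, p.pencil_form]; rfl

/-- A linear map that takes the first pencil to the second one. -/
structure Similitude (s : M.Splits) (s' : M'.Splits) where
  A : (Fin 5 → L) →ₗ[L] (Fin 5 → L)
  a : L
  bijective : Function.Bijective A
  ne_zero : a ≠ 0
  eq : ∀ i z, S.qf i z = a * p.form i (A z)
  mem : ∀ W z, A z ∈ (p.nu s s' W).1 ↔ z ∈ W.1

open BlowUp.Model

theorem mem_nu_iota {s : M.Splits} {s' : M'.Splits} {A : (Fin 5 → L) →ₗ[L] (Fin 5 → L)} {a : L} (hA : Function.Bijective A)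
    (ha : a ≠ 0) (h : ∀ i z, S.qf i z = a * p.form i (A z)) (R : S.Delta) {W : S.Line}
    (hW : ∀ z, A z ∈ (p.nu s s' W).1 ↔ z ∈ W.1) (z : Fin 5 → L) :
    A z ∈ (p.nu s s' (S.iota R W)).1 ↔ z ∈ (S.iota R W).1 := by
  have hpen : ∀ r z, pencil S.qf r z = a * pencil p.form r (A z) := fun r z => by
    rw [pencil_apply, pencil_apply, h, h]; ring
  have hpol : ∀ r x y, polar (pencil S.qf r) x y = a * polar (pencil p.form r) (A x) (A y) := by
    intro r x y
    simp only [polar, hpen, map_add]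
    ring
  have hv := vert_spec R
  have hR := other_spec R.1
  set v := S.vert R
  set R' := other R.1
  have hv' : IsVert S'.qf (matLin L p.G R.1.rep) (A v) := by
    rw [← p.isVert_iff]
    refine ⟨fun h0 => hv.1 (hA.1 (h0.trans (map_zero A).symm)), ?_, fun u => ?_⟩
    · have := hv.2.1
      rw [hpen] at this
      exact (mul_eq_zero.1 this).resolve_left ha
    · obtain ⟨u, rfl⟩ := hA.2 u
      have := hv.2.2 u
      rw [hpol] at this
      exact (mul_eq_zero.1 this).resolve_left ha
  have h0 := hv.ne_zero S.smoothPencil hR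
  have h0' : pencil S'.qf (matLin L p.G R') (A v) ≠ 0 := by
    rw [hpen, p.pencil_form] at h0
    exact (mul_ne_zero_iff.1 h0).2
  obtain ⟨b, hb, hrep⟩ := exists_rep_eq_smul (matLin L p.G R.1.rep) (matLin_ne_zero p.G'G R.1.rep_nonzero)
  have hrep' : (p.delta R).1.rep = b • matLin L p.G R.1.rep := by
    rw [← hrep, ← p.equiv_mk _ R.1.rep_nonzero]
    simp only [R.1.mk_rep]
    rfl
  have hdet : (p.delta R).1.rep 0 * matLin L p.G R' 1 - (p.delta R).1.rep 1 * matLin L p.G R' 0 ≠ 0 := by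
    intro hd
    apply h0'
    have h1 : pmk L (matLin L p.G R.1.rep) (matLin_ne_zero p.G'G R.1.rep_nonzero) =
        pmk L (matLin L p.G R') (matLin_ne_zero p.G'G (by
          rintro h0; apply hR; rw [h0]; simp)) := by
      rw [eq_mk_iff_of_two]
      apply mul_left_cancel₀ hb
      rw [hrep'] at hd
      simp only [Pi.smul_apply, smul_eq_mul] at hd
      linear_combination hd
    obtain ⟨c, -, hc⟩ := exists_smul_of_mk_eq_mk h1.symm
    rw [hc]
    exact (hv'.smul c).2.1
  rw [nu_iota, iota_eq (v := A v) (by rw [hrep']; exact hv'.smul b) hdet, mem_map_refl h0', iota_eq hv hR, mem_map_refl h0,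
    ← hW]
  have : refl S'.qf (matLin L p.G R') (A v) (A z) = A (refl S.qf R' v z) := by
    rw [refl_apply, refl_apply, map_sub, map_smul, hpen, hpol, p.pencil_form, mul_div_mul_left _ _ ha]
  rw [this]

theorem exists_similitude (s : M.Splits) (s' : M'.Splits) : Nonempty (p.Similitude s s') := by
  obtain ⟨Q⟩ := exists_line_of_model M
  have hQ := (S.isLine_iff _).1 Q.2
  have hQ' := (p.isLine_iff _).2 ((S'.isLine_iff _).1 (p.nu s s' Q).2)
  obtain ⟨N⟩ := exists_normalForm S.smoothPencil finrank_space hQ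
  obtain ⟨N'⟩ := exists_normalForm p.smoothPencil finrank_space hQ'
  obtain ⟨b, hb, hbN⟩ := N.exists_eq_smul S.smoothPencil hQ N' p.smoothPencil hQ' fun R hR => by
    simp only [p.isVert_iff]
    rw [← mk_mem_Delta_iff hR, ← mk_mem_Delta_iff (matLin_ne_zero p.G'G hR)]
    exact p.mem_Delta_iff _
  obtain ⟨A, hA, hAq, hAQ⟩ := N.exists_equiv N' hb hbN
  refine ⟨⟨A, b, hA, hb, hAq, ?_⟩⟩
  obtain ⟨e⟩ := exists_equiv_Delta Q
  have key : ∀ x, ∀ W, cls s W = cls s Q + x → ∀ z, A z ∈ (p.nu s s' W).1 ↔ z ∈ W.1 := by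
    refine G_induction e (fun W h => ?_) fun x R ih W h => ?_
    · rw [cls_injective s (h.trans (add_zero _))]
      exact hAQ
    · obtain ⟨W₀, hW₀⟩ := cls_surjective s (cls s Q + x)
      have : W = S.iota R W₀ := cls_injective s (by rw [cls_iota, hW₀, h, add_assoc])
      rw [this]
      exact p.mem_nu_iota hA hb hAq R (ih W₀ hW₀)
  exact fun W => key (cls s W - cls s Q) W (by abel)

namespace Similitude

variable {p} {s : M.Splits} {s' : M'.Splits} (A : p.Similitude s s')

/-- Rescaling of a similitude. -/
noncomputable def scale (c : L) (hc : c ≠ 0) : p.Similitude s s' where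
  A := c • A.A
  a := A.a / c ^ 2
  bijective := by
    refine ⟨fun x y h => A.bijective.1 (smul_right_injective _ hc h), fun y => ?_⟩
    obtain ⟨x, hx⟩ := A.bijective.2 (c⁻¹ • y)
    exact ⟨x, by rw [LinearMap.smul_apply, hx, smul_smul, mul_inv_cancel₀ hc, one_smul]⟩
  ne_zero := div_ne_zero A.ne_zero (pow_ne_zero 2 hc)
  eq i z := by
    rw [LinearMap.smul_apply, QuadraticMap.map_smul, A.eq, smul_eq_mul]
    field_simp
  mem W z := by
    rw [LinearMap.smul_apply, Submodule.smul_mem_iff _ hc, A.mem]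

/-- The entries of the matrix of a similitude. -/
noncomputable def entry (i j : Fin 5) : L := A.A (Pi.single j 1) i

theorem apply_eq (z : Fin 5 → L) (i : Fin 5) : A.A z i = ∑ j, A.entry i j * z j := by
  conv_lhs => rw [← Finset.univ_sum_single z, map_sum, Finset.sum_apply]
  refine Finset.sum_congr rfl fun j _ => ?_
  have : (Pi.single j (z j) : Fin 5 → L) = z j • Pi.single j 1 := by
    rw [← Pi.single_smul, smul_eq_mul, mul_one]
  rw [this, map_smul, entry, Pi.smul_apply, smul_eq_mul, mul_comm]

theorem exists_entry_ne_zero : ∃ i j, A.entry i j ≠ 0 := by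
  by_contra! h
  have : A.A (Pi.single 0 1) = A.A 0 := by
    rw [map_zero]
    funext i
    exact h i 0
  have := congrFun (A.bijective.1 this) 0
  simp at this

variable (hs : p.Compatible s s') (hφ : B.IsConicBundle φ) (hφ' : B'.IsConicBundle φ')

include hs hφ hφ' in
theorem exists_gal_entry (σ : L ≃ₐ[K] L) : ∃ c, ∀ i j, σ (A.entry i j) = c * A.entry i j := by
  let Aσ : (Fin 5 → L) →ₗ[L] (Fin 5 → L) := Matrix.mulVecLin (Matrix.of fun i j => σ (A.entry i j))
  have hAσ : ∀ z, Aσ z = fun i => σ (A.A (fun j => σ.symm (z j)) i) := by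
    intro z
    funext i
    rw [A.apply_eq, map_sum]
    simp [Aσ, Matrix.mulVec, dotProduct]
  let E := LinearEquiv.ofBijective A.A A.bijective
  have hE : ∀ z, A.A (E.symm z) = z := fun z => E.apply_symm_apply z
  obtain ⟨Q⟩ := exists_line_of_model M
  obtain ⟨c, hc⟩ := S.smoothPencil.scalar finrank_space (B := E.symm.toLinearMap.comp Aσ) (fun W hW z hz => by
    let W₁ : S.Line := ⟨W, (S.isLine_iff W).2 hW⟩
    let U : S.Line := ⟨_, galSub_mem_linesOn σ.symm W₁⟩
    have hU : W₁.1 = galSub σ U.1 := by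
      ext y
      change y ∈ W ↔ (fun i => σ.symm.symm (σ.symm (y i))) ∈ W
      simp
    change E.symm (Aσ z) ∈ W₁.1
    rw [← A.mem, hE, nu_galSub hs hφ hφ' σ U W₁ hU, hAσ]
    change (fun i => σ.symm (σ (A.A (fun j => σ.symm (z j)) i))) ∈ (p.nu s s' U).1
    simp only [AlgEquiv.symm_apply_apply]
    rw [A.mem]
    change (fun i => σ.symm.symm (σ.symm (z i))) ∈ W
    simpa using hz) ((S.isLine_iff _).1 Q.2)
  refine ⟨c, fun i j => ?_⟩
  have h1 := congrArg A.A (hc (Pi.single j 1))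
  rw [LinearMap.comp_apply, LinearEquiv.coe_coe, hE, map_smul] at h1
  have h2 := congrFun h1 i
  simpa [Aσ, entry] using h2

end Similitude

end PencilMap

end Equivalence

universe u

section Separability

variable {K L : Type*} [Field K] [Field L] [Algebra K L]

open KaehlerDifferential in
theorem isSeparable_of_derivation_eq_zero {k F : Type u} [Field k] [Field F] [Algebra k F] [FiniteDimensional k F]
    (h0 : ∀ D : Derivation k F F, D = 0) : Algebra.IsSeparable k F := by
  have hsub : Subsingleton (Ω[F⁄k]) := by
    refine subsingleton_of_forall_eq 0 fun ω => ?_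
    rw [← Module.forall_dual_apply_eq_zero_iff F]
    intro g
    have : g = 0 := (linearMapEquivDerivation k F).injective ((h0 _).trans (map_zero _).symm)
    rw [this]; rfl
  exact (Algebra.FormallyUnramified.iff_isSeparable k F).1 ⟨hsub⟩

theorem isSeparable_of_derivation_of_univ {K L : Type u} [Field K] [Field L] [Algebra K L] [Algebra.IsAlgebraic K L] {ι : Type*}
    [Finite ι] (m : ι → L) (hD : ∀ (F : IntermediateField K L) (D : Derivation K F L) (f : ι → F),
      (∀ i, (f i : L) = m i) → ∀ i, D (f i) = 0) (i : ι) : IsSeparable K (m i) := by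
  obtain ⟨F, hF⟩ : ∃ F, F = IntermediateField.adjoin K (Set.range m) := ⟨_, rfl⟩
  have : FiniteDimensional K F := by
    rw [hF]
    exact IntermediateField.finiteDimensional_adjoin fun x _ => Algebra.IsIntegral.isIntegral x
  have hm : ∀ i, m i ∈ F := fun i => by rw [hF]; exact IntermediateField.subset_adjoin _ _ ⟨i, rfl⟩
  have h0 : ∀ D : Derivation K F F, D = 0 := by
    intro D
    have hgen : ∀ i, D ⟨m i, hm i⟩ = 0 := fun i =>
      Subtype.ext (hD F ((IsScalarTower.toAlgHom F F L).toLinearMap.compDer D) (fun i => ⟨m i, hm i⟩) (fun _ => rfl) i)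
    let E : IntermediateField K L :=
      { carrier := {x | ∃ h : x ∈ F, D ⟨x, h⟩ = 0}
        mul_mem' := fun ⟨h1, h1'⟩ ⟨h2, h2'⟩ => ⟨F.mul_mem h1 h2, (D.leibniz ⟨_, h1⟩ ⟨_, h2⟩).trans (by
          rw [h1', h2', smul_zero, smul_zero, add_zero])⟩
        add_mem' := fun ⟨h1, h1'⟩ ⟨h2, h2'⟩ => ⟨F.add_mem h1 h2, (D.map_add ⟨_, h1⟩ ⟨_, h2⟩).trans (by rw [h1', h2', add_zero])⟩
        algebraMap_mem' := fun c => ⟨F.algebraMap_mem c, D.map_algebraMap c⟩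
        inv_mem' := fun x ⟨h, h'⟩ => ⟨F.inv_mem h, (D.leibniz_inv ⟨x, h⟩).trans (by rw [h', smul_zero])⟩ }
    have hE : F ≤ E := by
      conv_lhs => rw [hF]
      rw [IntermediateField.adjoin_le_iff]
      rintro _ ⟨i, rfl⟩
      exact ⟨hm i, hgen i⟩
    ext ⟨x, hx⟩
    exact congrArg Subtype.val (hE hx).2
  have hsep := isSeparable_of_derivation_eq_zero h0
  have h2 : IsSeparable K (⟨m i, hm i⟩ : F) := hsep.isSeparable' _
  rw [IsSeparable, ← minpoly.algebraMap_eq (algebraMap F L).injective] at h2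
  exact h2

theorem isSeparable_of_derivation [Algebra.IsAlgebraic K L] {ι : Type*} [Finite ι] (m : ι → L)
    (hD : ∀ (F : IntermediateField K L) (D : Derivation K F L) (f : ι → F),
      (∀ i, (f i : L) = m i) → ∀ i, D (f i) = 0) (i : ι) : IsSeparable K (m i) := by
  have : Algebra.IsAlgebraic (⊥ : IntermediateField K L) L := Algebra.IsAlgebraic.tower_top (K := K) _
  have h1 : IsSeparable (⊥ : IntermediateField K L) (m i) := isSeparable_of_derivation_of_univ m (fun F D f hf =>
    hD (F.restrictScalars K) (Derivation.mk'
      { toFun := fun x => D x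
        map_add' := D.map_add
        map_smul' := fun c x => by
          have h : (c • x : F.restrictScalars K) = (algebraMap K (⊥ : IntermediateField K L) c • (show F from x) : F) :=
            Subtype.ext (algebra_compatible_smul (⊥ : IntermediateField K L) c (x : L))
          rw [h]
          exact (D.map_smul _ _).trans (algebra_compatible_smul (⊥ : IntermediateField K L) c _).symm } D.leibniz) f hf) i
  have := IntermediateField.isSeparable_bot (F := K) (E := L)
  exact h1.of_algebra_isSeparable_of_isSeparable K

theorem mem_range_of_fixed [IsAlgClosure K L] {x : L} (hx : IsSeparable K x) (h : ∀ σ : L ≃ₐ[K] L, σ x = x) :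
    ∃ y, algebraMap K L y = x := by
  have := IsAlgClosure.isAlgebraic (R := K) (K := L)
  have := IsAlgClosure.isAlgClosed K (K := L)
  by_contra hcon
  obtain ⟨y, hne, hy⟩ := (notMem_iff_exists_ne_and_isConjRoot hx (IsAlgClosed.splits _)).1 (fun h => hcon (Algebra.mem_bot.1 h))
  obtain ⟨σ, rfl⟩ := isConjRoot_iff_exists_algEquiv.1 hy.symm
  exact hne (h σ).symm

theorem derivation_aeval {F : Type*} [Field F] [Algebra K F] [Algebra F L] [IsScalarTower K F L] (D : Derivation K F L) {n : ℕ}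
    (w : Fin n → F) (P : MvPolynomial (Fin n) K) :
    D (aeval w P) = diff P (fun i => algebraMap F L (w i)) fun i => D (w i) := by
  induction P using MvPolynomial.induction_on with
  | C a => simp
  | add p q hp hq => simp [hp, hq]
  | mul_X p i hp =>
    have : algebraMap F L (aeval w p) = aeval (fun i => algebraMap F L (w i)) p := by
      rw [← aeval_algebraMap_apply]; rfl
    simp [hp, Algebra.smul_def, this]

theorem quadraticForm_eq_zero {n : ℕ} (Ψ : QuadraticForm L (Fin n → L)) (h : ∀ v : Fin n → K, Ψ (fun i => algebraMap K L (v i)) = 0)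
    (z : Fin n → L) : Ψ z = 0 := by
  classical
  have hs : ∀ i, (fun j => algebraMap K L ((Pi.single i 1 : Fin n → K) j)) = (Pi.single i 1 : Fin n → L) := by
    intro i
    funext j
    rw [Pi.single_apply, Pi.single_apply]
    split_ifs <;> simp
  have h1 : ∀ i, Ψ (Pi.single i 1) = 0 := fun i => by rw [← hs]; exact h _
  have h2 : ∀ i j, polar Ψ (Pi.single i 1) (Pi.single j 1) = 0 := by
    intro i j
    rw [polar, h1, h1, ← hs, ← hs]
    have := h (Pi.single i 1 + Pi.single j 1)
    simp only [Pi.add_apply, map_add] at this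
    rw [sub_zero, sub_zero]
    exact this
  have hz : ∀ z : Fin n → L, z = ∑ i, z i • Pi.single i (1 : L) := fun z => pi_eq_sum_univ' z
  have h3 : ∀ x y, polar Ψ x y = 0 := by
    intro x y
    change polarBilin Ψ x y = 0
    rw [hz x, hz y, LinearMap.map_sum₂]
    refine Finset.sum_eq_zero fun i _ => ?_
    rw [map_sum]
    refine Finset.sum_eq_zero fun j _ => ?_
    rw [map_smul, LinearMap.map_smul₂, polarBilin_apply_apply, h2, smul_zero, smul_zero]
  rw [hz z]
  have : ∀ s : Finset (Fin n), Ψ (∑ i ∈ s, z i • Pi.single i (1 : L)) = 0 := by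
    intro s
    induction s using Finset.induction_on with
    | empty => simp
    | insert i s hi ih =>
      rw [Finset.sum_insert hi, QuadraticMap.map_add (⇑Ψ), h3, ih, QuadraticMap.map_smul, h1]
      simp
  exact this _

end Separability

section Descent

variable {K L : Type*} [Field K] [Field L] [Algebra K L] [IsAlgClosed L]
  {S S' : QuarticDelPezzo K L} {Y Y' : CubicSurface K L} {B : BlowUp S Y} {B' : BlowUp S' Y'}
  {φ φ' : PSpace L 4 → PSpace L 2} {M : B.Model φ} {M' : B'.Model φ'} {T : Transformation Y Y' φ φ'}
  {p : PencilMap M M' T} {s : M.Splits} {s' : M'.Splits}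

theorem BlowUp.Model.exists_qf_ne_zero (M : B.Model φ) : ∃ i z, S.qf i z ≠ 0 := by
  by_contra! h
  obtain ⟨u, hu⟩ := S.smoothPencil M.pv M.p_ne M.qf_pv (Pi.single 0 1) (by simp)
  apply hu
  simp [polar, pencil_apply, h]

namespace PencilMap.Similitude

variable (A : p.Similitude s s')

theorem derivation_eq_zero {i₀ j₀ : Fin 5} (h1 : A.entry i₀ j₀ = 1) {F : Type*} [Field F] [Algebra K F] [Algebra F L]
    [IsScalarTower K F L] (D : Derivation K F L) (f : Fin 5 → Fin 5 → F) (a : F) (hf : ∀ i j, algebraMap F L (f i j) = A.entry i j)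
    (ha : algebraMap F L a = A.a) : D a = 0 ∧ ∀ i j, D (f i j) = 0 := by
  let Z : (Fin 5 → L) →ₗ[L] (Fin 5 → L) := Matrix.mulVecLin (Matrix.of fun i j => D (f i j))
  have hZ : ∀ z i, Z z i = ∑ j, D (f i j) * z j := fun z i => by simp [Z, Matrix.mulVec, dotProduct]
  let Ψ : Fin 2 → QuadraticForm L (Fin 5 → L) := fun i => D a • (p.form i).comp A.A +
    A.a • LinearMap.BilinMap.toQuadraticMap ((polarBilin (p.form i)).compl₁₂ A.A Z)
  have hΨ : ∀ i z, Ψ i z = D a * p.form i (A.A z) + A.a * polar (p.form i) (A.A z) (Z z) := fun i z => rfl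
  have hΨ0 : ∀ i z, Ψ i z = 0 := by
    intro i
    refine quadraticForm_eq_zero (K := K) _ fun v => ?_
    let w : Fin 5 → F := fun i => ∑ j, f i j * algebraMap K F (v j)
    have hw : (fun i => algebraMap F L (w i)) = A.A (fun i => algebraMap K L (v i)) := by
      funext i
      simp [w, A.apply_eq, hf, ← IsScalarTower.algebraMap_apply]
    have hDw : (fun i => D (w i)) = Z (fun i => algebraMap K L (v i)) := by
      funext i
      simp [w, hZ, Algebra.smul_def, ← IsScalarTower.algebraMap_apply, mul_comm]
    have hq : ∀ k, algebraMap F L (aeval w (S'.q k)) = S'.qf k (A.A (fun i => algebraMap K L (v i))) := by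
      intro k
      rw [S'.qf_apply, ← hw, ← aeval_algebraMap_apply]
      rfl
    have hDq : ∀ k, D (aeval w (S'.q k)) = polar (S'.qf k) (A.A (fun i => algebraMap K L (v i)))
        (Z (fun i => algebraMap K L (v i))) := by
      intro k
      rw [S'.polar_qf, derivation_aeval, hw, hDw]
    have hK : algebraMap K F (aeval v (S.q i)) = a * (algebraMap K F (p.G 0 i) * aeval w (S'.q 0) +
        algebraMap K F (p.G 1 i) * aeval w (S'.q 1)) := by
      apply (algebraMap F L).injective
      rw [map_mul, map_add, map_mul, map_mul, hq, hq, ha, ← IsScalarTower.algebraMap_apply, ← IsScalarTower.algebraMap_apply,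
        ← IsScalarTower.algebraMap_apply, ← p.form_apply, ← A.eq, S.qf_apply, ← aeval_algebraMap_apply]
      rfl
    have hD := congrArg D hK
    rw [D.map_algebraMap, D.leibniz, D.map_add, D.leibniz, D.leibniz, D.map_algebraMap, D.map_algebraMap, hDq, hDq] at hD
    simp only [Algebra.smul_def, map_add, map_mul, hq, ha, ← IsScalarTower.algebraMap_apply] at hD
    rw [hΨ, form, polar_pencil, pencil_apply]
    linear_combination -hD
  let E := LinearEquiv.ofBijective A.A A.bijective
  have hE : ∀ z, A.A (E.symm z) = z := fun z => E.apply_symm_apply z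
  obtain ⟨Q⟩ := exists_line_of_model M
  obtain ⟨b, hb⟩ := S.smoothPencil.scalar_of_derivation finrank_space (B := E.symm.toLinearMap.comp Z) (a := -(D a / A.a))
    (fun i z => by
      have h2 := hΨ0 i z
      rw [hΨ] at h2
      have h3 : polar (S.qf i) z (E.symm (Z z)) = A.a * polar (p.form i) (A.A z) (Z z) := by
        simp only [polar, A.eq, map_add, hE]
        ring
      have := A.ne_zero
      refine h3.trans ?_
      rw [A.eq]
      field_simp
      linear_combination h2) ((S.isLine_iff _).1 Q.2)
  have hZA : ∀ i j, D (f i j) = b * A.entry i j := by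
    intro i j
    have h2 := congrArg A.A (hb (Pi.single j 1))
    rw [LinearMap.comp_apply, LinearEquiv.coe_coe, hE, map_smul] at h2
    have h3 := congrFun h2 i
    simpa [hZ, entry, Pi.single_apply] using h3
  have hb0 : b = 0 := by
    have h2 := hZA i₀ j₀
    have h3 : f i₀ j₀ = 1 := (algebraMap F L).injective (by rw [hf, h1, map_one])
    rw [h3, D.map_one_eq_zero, h1, mul_one] at h2
    exact h2.symm
  have hall : ∀ i j, D (f i j) = 0 := fun i j => by rw [hZA, hb0, zero_mul]
  refine ⟨?_, hall⟩
  obtain ⟨i, z, hz⟩ := M.exists_qf_ne_zero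
  rw [A.eq] at hz
  have hZ0 : Z z = 0 := by
    funext i
    simp [hZ, hall]
  have h2 := hΨ0 i z
  rw [hΨ, hZ0, polar_zero_right, mul_zero, add_zero] at h2
  exact (mul_eq_zero.1 h2).resolve_right (mul_ne_zero_iff.1 hz).2

end PencilMap.Similitude

theorem PencilMap.exists_iso [IsAlgClosure K L] (hs : p.Compatible s s') (hφ : B.IsConicBundle φ) (hφ' : B'.IsConicBundle φ') :
    ∃ ψ : PartialEquiv (PSpace L 5) (PSpace L 5), ψ.source = S.pts ∧ ψ.target = S'.pts ∧ IsIsoOver K ψ ∧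
      ∀ W : S.Line, ψ '' ptsOf W.1 = ptsOf (p.nu s s' W).1 := by
  have := IsAlgClosure.isAlgebraic (R := K) (K := L)
  obtain ⟨A₀⟩ := p.exists_similitude s s'
  obtain ⟨i₀, j₀, h0⟩ := A₀.exists_entry_ne_zero
  let A := A₀.scale _ (inv_ne_zero h0)
  have h1 : A.entry i₀ j₀ = 1 := inv_mul_cancel₀ h0
  have hfix : ∀ i j, ∀ σ : L ≃ₐ[K] L, σ (A.entry i j) = A.entry i j := by
    intro i j σ
    obtain ⟨c, hc⟩ := A.exists_gal_entry hs hφ hφ' σ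
    have h2 := hc i₀ j₀
    rw [h1, map_one, mul_one] at h2
    rw [hc, ← h2, one_mul]
  have hsep : ∀ i j, IsSeparable K (A.entry i j) := fun i j =>
    isSeparable_of_derivation (fun o : Option (Fin 5 × Fin 5) => o.elim A.a fun x => A.entry x.1 x.2) (fun F D f hf => by
      have := A.derivation_eq_zero h1 D (fun i j => f (some (i, j))) (f none) (fun i j => hf (some (i, j))) (hf none)
      rintro (_ | ⟨i, j⟩)
      · exact this.1
      · exact this.2 i j) (some (i, j))
  choose C hC using fun i j => mem_range_of_fixed (hsep i j) (hfix i j)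
  let C' : Matrix (Fin 5) (Fin 5) K := Matrix.of C
  have hCA : ∀ z, matLin L C' z = A.A z := by
    intro z
    funext i
    rw [A.apply_eq, matLin_apply]
    exact Finset.sum_congr rfl fun j _ => by rw [← hC]; rfl
  have hdet : IsUnit C'.det := by
    rw [← Matrix.isUnit_iff_isUnit_det, ← Matrix.mulVec_injective_iff_isUnit]
    intro v w h
    have h2 : baseVec L v = baseVec L w := A.bijective.1 (by
      rw [← hCA, ← hCA, matLin_baseVec, matLin_baseVec, h])
    funext i
    exact (algebraMap K L).injective (congrFun h2 i)
  let e := matEquiv L C' C'⁻¹ (Matrix.mul_nonsing_inv _ hdet) (Matrix.nonsing_inv_mul _ hdet)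
  have he : ∀ z (hz : z ≠ 0), ∃ h : A.A z ≠ 0, e (pmk L z hz) = pmk L (A.A z) h := by
    intro z hz
    have h2 := matLin_ne_zero (L := L) (Matrix.nonsing_inv_mul C' hdet) hz
    exact ⟨by rwa [← hCA], mk_eq_mk_of_smul _ _ (a := 1) (by rw [one_smul, hCA])⟩
  have himage : ∀ U V : Set (PSpace L 5), (∀ x, e x ∈ V ↔ x ∈ U) → e '' U = V := by
    intro U V h
    ext y
    obtain ⟨x, rfl⟩ := e.surjective y
    rw [e.injective.mem_set_image, h]
  have hpts : e '' S.pts = S'.pts := by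
    refine himage _ _ fun x => ?_
    induction x using pmk_ind with
    | h z hz =>
      obtain ⟨h2, h3⟩ := he z hz
      rw [h3, S'.mk_mem_pts, S.mk_mem_pts, ← p.form_eq_zero_iff]
      refine forall_congr' fun i => ?_
      rw [A.eq, mul_eq_zero, or_iff_right A.ne_zero]
  refine ⟨e.toPartialEquivOfImageEq _ _ hpts, rfl, rfl, ?_, fun W => himage _ _ fun x => ?_⟩
  · exact ⟨regularOn_of_matrix C' fun x hx _ => ⟨matLin_ne_zero (Matrix.nonsing_inv_mul C' hdet) hx, rfl⟩,
      regularOn_of_matrix C'⁻¹ fun x hx _ => ⟨matLin_ne_zero (Matrix.mul_nonsing_inv C' hdet) hx, rfl⟩⟩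
  · induction x using pmk_ind with
    | h z hz =>
      obtain ⟨h2, h3⟩ := he z hz
      rw [h3, mem_ptsOf_mk, mem_ptsOf_mk, A.mem]

end Descent

end DelPezzo

theorem corollary6p8 {K L : Type*} [Field K] [Field L] [Algebra K L] [IsAlgClosure K L]
    (S S' : QuarticDelPezzo K L) (X X' : CubicSurface K L)
    (B : BlowUp S X) (B' : BlowUp S' X')
    (φ φ' : PSpace L 4 → PSpace L 2) (hφ : B.IsConicBundle φ) (hφ' : B'.IsConicBundle φ')
    (T : Transformation X X' φ φ') :
    -- the natural isomorphism of the pencils, which identifies `Δ(S)` and `Δ(S')`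
    ∃ (δ δ' g : PSpace L 2 ≃ PSpace L 2) (gΔ : S.Delta ≃ S'.Delta),
      B.IsPencilIso φ δ ∧ B'.IsPencilIso φ' δ' ∧
      IsIsoOver K g.toPartialEquiv ∧ (∀ R, δ' (g R) = T.base (δ R)) ∧
      (∀ R : S.Delta, (gΔ R : PSpace L 2) = g R) ∧
      -- the induced isomorphism of the group schemes
      ∃ γ : S.G ≃+ S'.G,
        (∀ a : S.GTilde, γ (QuotientAddGroup.mk a) = QuotientAddGroup.mk (a ∘ gΔ.symm)) ∧
        (∀ (σ : L ≃ₐ[K] L) (a : S.G), γ (S.galG σ a) = S'.galG σ (γ a)) ∧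
        -- the isomorphism of the schemes of lines is an isomorphism of torsors
        ∃ ν : S.Line ≃ S'.Line, IsTransfer B B' T ν ∧
          (∃ (ρ : Multiplicative S.G →* Equiv.Perm S.Line)
             (ρ' : Multiplicative S'.G →* Equiv.Perm S'.Line),
            S.IsTorsorAction ρ ∧ S'.IsTorsorAction ρ' ∧
            ∀ (a : S.G) (M : S.Line),
              ν (ρ (Multiplicative.ofAdd a) M) = ρ' (Multiplicative.ofAdd (γ a)) (ν M)) ∧
          -- the isomorphism of the surfaces that induces it
          ∃ ψ : PartialEquiv (PSpace L 5) (PSpace L 5),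
            ψ.source = S.pts ∧ ψ.target = S'.pts ∧ IsIsoOver K ψ ∧
            ∀ M : S.Line, ψ '' ptsOf M.1 = ptsOf (ν M).1 := by
  have := IsAlgClosure.isAlgClosed K (K := L)
  obtain ⟨M⟩ := BlowUp.exists_model B hφ
  obtain ⟨M'⟩ := BlowUp.exists_model B' hφ'
  obtain ⟨p⟩ := PencilMap.exists_pencilMap M M' T
  obtain ⟨s⟩ := M.exists_splits
  obtain ⟨s', hs⟩ := p.exists_compatible s
  refine ⟨_, _, p.equiv, p.delta, isPencilIso_matEquiv M, isPencilIso_matEquiv M', isIsoOver_matEquiv _ _ _ _, fun R => ?_,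
    fun _ => rfl, p.gamma, p.gamma_mk, p.gamma_gal, p.nu s s', p.isTransfer hs hφ hφ', ⟨BlowUp.Model.action s, BlowUp.Model.action s',
    BlowUp.Model.isTorsorAction_action hφ s, BlowUp.Model.isTorsorAction_action hφ' s', PencilMap.nu_action⟩, p.exists_iso hs hφ hφ'⟩
  rw [BlowUp.Model.matEquiv_N, BlowUp.Model.matEquiv_N]
  exact (p.base_mk_rep R).symm
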